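/- **Setting.** Let $\Omega,\nu,\Gamma>0$, $\Delta,\gamma\in\mathbb R$, and let $f(t,\tau)$ be either $a_1\sin\nu t+a_2\sin(\nu t+\Gamma\tau)$ with $a_1,a_2>0$, $a_1\neq a_2$, or $A\sin(\nu t+\theta)+B\sin\Gamma\tau$ with $A,B,\theta\in\mathbb R$. For $J>0$ put $$\omega_0(J)=\frac{\pi\Omega}{\pi-\arctan\frac{J}{2\Omega\Delta}}\ (\Delta>0),\qquad \omega_0(J)=-\frac{\pi\Omega}{\arctan\frac{J}{2\Omega\Delta}}\ (\Delta<0),\qquad \omega_0(J)=2\Omega\ (\Delta=0),$$ and let $\kappa(\psi,J)$ be the $2\pi$-periodic function of $\psi$ equal to $\dfrac{\cos(\Omega_0(\psi-\pi))}{2\Omega\sin\pi\Omega_0}$ for $0\le\psi<2\pi$, where $\Omega_0=\Omega/\omega_0(J)$. Let $p,q$ be coprime positive integers and $J_{pq}>0$ a resonance point, $\omega_0(J_{pq})=\frac qp\nu$. With $\psi=\varphi+\frac qp\nu t$ put $$F(t,\tau,\varphi,J)=-4\omega_0(J)\,[f(t,\tau)+\gamma J\omega_0(J)\kappa_\psi(\psi,J)]\,\kappa_\psi(\psi,J),$$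 $$G(t,\tau,\varphi,J)=-4\omega_0(J)J^{-1}[f(t,\tau)+\gamma J\omega_0(J)\kappa_\psi(\psi,J)]\,(-J\kappa(\psi,J))_J .$$ For $\varepsilon>0$, $\mu=\sqrt\varepsilon$, $J=J_{pq}+\mu z$, consider the impulse-phase equations of the impact oscillator $$\frac{dz}{dt}=\mu F(t,\varepsilon t,\varphi,J_{pq}+\mu z),\qquad \frac{d\varphi}{dt}=\omega_0(J_{pq}+\mu z)-\frac qp\nu+\varepsilon G(t,\varepsilon t,\varphi,J_{pq}+\mu z),\tag{14}$$ whose right-hand sides jump at $\psi\in2\pi\mathbb Z$; solutions are absolutely continuous functions satisfying (14) almost everywhere. Let $f_0(\eta,\tau)$, $f_1(\eta,\tau)$, $g_0(\eta,\tau)$ be the mean values over $t\in[0,2\pi p/\nu]$ of $F(t,\tau,\eta,J_{pq})$, $F_J(t,\tau,\eta,J_{pq})$, $G(t,\tau,\eta,J_{pq})$. **Theorem 2.** Assume that $\omega_0'(J_{pq})\neq0$ and that $\eta_0$ is a continuous $2\pi/\Gamma$-periodic function with $0<\eta_0(\tau)<2\pi$ and $f_0(\eta_0(\tau),\tau)=0$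 for all $\tau$. Put $a(\tau)=f_{0\eta}(\eta_0(\tau),\tau)$, $b(\tau)=f_1(\eta_0(\tau),\tau)$, $d=\omega_0'(J_{pq})$, $e(\tau)=g_{0\eta}(\eta_0(\tau),\tau)$. Assume that, for a constant $\sigma_1$, $a(\tau)d<\sigma_1<0$ for all $\tau\in\mathbb R$, and that the mean value $\langle b+e\rangle$ over a period $2\pi/\Gamma$ is nonzero. Then there are constants $\delta,K_0>0$ such that for every $K\ge K_0$ there is $\varepsilon_0>0$ such that for all $0<\varepsilon<\varepsilon_0$: 1. system (14) has a (Bohr) almost periodic solution with $|J(t)-J_{pq}|\le K_0\varepsilon$ and $|\varphi(t)-\eta_0(\varepsilon t)|\le K_0\sqrt\varepsilon\le\delta$ for all $t\in\mathbb R$; 2. it is the only almost periodic solution of (14) with $|J(t)-J_{pq}|\le K\varepsilon$ and $|\varphi(t)-\eta_0(\varepsilon t)|\le\delta$ for all $t\in\mathbb R$; 3. it is asymptotically stable if $\langle b+e\rangle<0$ and unstable (not Lyapunov stable) if $\langle b+e\rangle>0$. -/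

import Mathlib

open Real MeasureTheory Filter Topology

noncomputable section

/-- Data of the perturbed impact oscillator
`x'' + Ω² x + Φ₀(x, x') = ε (f(t, ε t) - γ x')` with a limiter at `x = Δ`, together with a
resonance `ω₀(Jr) = (q / p) ν`. -/
structure ImpactOscillator where
  Ω : ℝ
  Δ : ℝ
  γ : ℝ
  ν : ℝ
  p : ℕ
  q : ℕ
  Jr : ℝ
  f : ℝ → ℝ → ℝ

/-- The two kinds of biharmonic forces `f(t, τ)`: close frequencies, and very different
frequencies (`τ = ε t`). -/
inductive IsBiharmonic (ν Γ : ℝ) : (ℝ → ℝ → ℝ) → Prop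
  | close (a₁ a₂ : ℝ) (h₁ : 0 < a₁) (h₂ : 0 < a₂) (hne : a₁ ≠ a₂) :
      IsBiharmonic ν Γ (fun t τ => a₁ * sin (ν * t) + a₂ * sin (ν * t + Γ * τ))
  | distant (A B θ : ℝ) :
      IsBiharmonic ν Γ (fun t τ => A * sin (ν * t + θ) + B * sin (Γ * τ))

namespace ImpactOscillator

variable (S : ImpactOscillator)

/-- Frequency `ω₀(J)` of the conservative impact oscillator as a function of the impulse. -/
def omega (J : ℝ) : ℝ :=
  if 0 < S.Δ then π * S.Ω / (π - arctan (J / (2 * S.Ω * S.Δ)))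
  else if S.Δ < 0 then -(π * S.Ω) / arctan (J / (2 * S.Ω * S.Δ))
  else 2 * S.Ω

/-- The `2π`-periodic Green function `κ(ψ, J)`: on `0 ≤ ψ < 2π` it equals
`cos (Ω₀ (ψ - π)) / (2 Ω sin (π Ω₀))` with `Ω₀ = Ω / ω₀(J)`. Its Fourier series is
`ω₀⁻¹ [1 / (2 π Ω₀²) + π⁻¹ ∑_{k ≥ 1} cos (k ψ) / (Ω₀² - k²)]`. -/
def kappa (ψ J : ℝ) : ℝ :=
  cos (S.Ω / S.omega J * (toIcoMod two_pi_pos 0 ψ - π)) /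
    (2 * S.Ω * sin (π * (S.Ω / S.omega J)))

/-- `κ_ψ`. It jumps at `ψ ∈ 2πℤ`, where `deriv` (and the Fourier series) gives the value `0`. -/
def kappaPsi (ψ J : ℝ) : ℝ := deriv (fun s => S.kappa s J) ψ

/-- The phase `ψ = φ + (q / p) ν t`. -/
def phase (t φ : ℝ) : ℝ := φ + (S.q : ℝ) / (S.p : ℝ) * S.ν * t

/-- The bracket `f(t, τ) + γ J ω₀(J) κ_ψ(ψ, J)`. -/
def force (t τ φ J : ℝ) : ℝ :=
  S.f t τ + S.γ * J * S.omega J * S.kappaPsi (S.phase t φ) J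

/-- `dJ/dt = ε F(t, τ, φ, J)`. -/
def F (t τ φ J : ℝ) : ℝ :=
  -4 * S.omega J * S.force t τ φ J * S.kappaPsi (S.phase t φ) J

/-- `dφ/dt = ω₀(J) - (q / p) ν + ε G(t, τ, φ, J)`. -/
def G (t τ φ J : ℝ) : ℝ :=
  -4 * S.omega J * J⁻¹ * S.force t τ φ J * deriv (fun I => -I * S.kappa (S.phase t φ) I) J

def F₀ (t τ φ : ℝ) : ℝ := S.F t τ φ S.Jr

def F₁ (t τ φ : ℝ) : ℝ := deriv (fun J => S.F t τ φ J) S.Jr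

def G₀ (t τ φ : ℝ) : ℝ := S.G t τ φ S.Jr

/-- Right-hand side of the system for `(z, φ)`, where `J = Jr + μ z` and `μ = √ε`. This is the
full right-hand side; its expansion in `μ` is
`z' = μ F₀ + μ² F₁ z + O(μ³)`, `φ' = μ ω₀'(Jr) z + μ² ω₀''(Jr) z² / 2 + μ² G₀ + O(μ³)`. -/
def field (ε t : ℝ) (w : ℝ × ℝ) : ℝ × ℝ :=
  (√ε * S.F t (ε * t) w.2 (S.Jr + √ε * w.1),
    S.omega (S.Jr + √ε * w.1) - (S.q : ℝ) / (S.p : ℝ) * S.ν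
      + ε * S.G t (ε * t) w.2 (S.Jr + √ε * w.1))

/-- Mean value in `t`; for fixed `τ`, `φ` the functions above have period `2πp / ν` in `t`. -/
def meanT (h : ℝ → ℝ) : ℝ :=
  S.ν / (2 * π * S.p) * ∫ t in (0 : ℝ)..(2 * π * S.p / S.ν), h t

def f₀ (η τ : ℝ) : ℝ := S.meanT (fun t => S.F₀ t τ η)

def f₁ (η τ : ℝ) : ℝ := S.meanT (fun t => S.F₁ t τ η)

def g₀ (η τ : ℝ) : ℝ := S.meanT (fun t => S.G₀ t τ η)

/-- `a(τ) = f₀_η(η₀(τ), τ)`. -/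
def a (η₀ : ℝ → ℝ) (τ : ℝ) : ℝ := deriv (fun η => S.f₀ η τ) (η₀ τ)

/-- `b(τ) = f₁(η₀(τ), τ)`. -/
def b (η₀ : ℝ → ℝ) (τ : ℝ) : ℝ := S.f₁ (η₀ τ) τ

/-- `d = ω₀'(Jr)`. -/
def d : ℝ := deriv S.omega S.Jr

/-- `e(τ) = g₀_η(η₀(τ), τ)`. -/
def e (η₀ : ℝ → ℝ) (τ : ℝ) : ℝ := deriv (fun η => S.g₀ η τ) (η₀ τ)

end ImpactOscillator

/-- Mean value of a function of period `2π / Γ`. -/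
def periodMean (Γ : ℝ) (h : ℝ → ℝ) : ℝ :=
  Γ / (2 * π) * ∫ τ in (0 : ℝ)..(2 * π / Γ), h τ

/-- Carathéodory solution of `w' = V(t, w)` on an interval `I` (absolutely continuous, equation
satisfied almost everywhere), in integral form. The right-hand side may be discontinuous. -/
def IsSolutionOn (V : ℝ → ℝ × ℝ → ℝ × ℝ) (w : ℝ → ℝ × ℝ) (I : Set ℝ) : Prop :=
  ∀ s ∈ I, ∀ t ∈ I, IntervalIntegrable (fun r => V r (w r)) volume s t ∧
    w t - w s = ∫ r in s..t, V r (w r)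

/-- Almost periodicity in the sense of Bohr. -/
def IsAlmostPeriodic (w : ℝ → ℝ × ℝ) : Prop :=
  Continuous w ∧ ∀ δ > 0, ∃ L > 0, ∀ c : ℝ, ∃ T ∈ Set.Icc c (c + L),
    ∀ t, dist (w (t + T)) (w t) < δ

/-- Lyapunov stability (for increasing time) of the solution `w`. -/
def IsLyapunovStable (V : ℝ → ℝ × ℝ → ℝ × ℝ) (w : ℝ → ℝ × ℝ) : Prop :=
  ∀ t₀ : ℝ, ∀ r > 0, ∃ δ > 0, ∀ t₁ ≥ t₀, ∀ y : ℝ → ℝ × ℝ,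
    IsSolutionOn V y (Set.Icc t₀ t₁) → dist (y t₀) (w t₀) < δ →
      ∀ t ∈ Set.Icc t₀ t₁, dist (y t) (w t) < r

/-- Asymptotic stability: Lyapunov stability, and all solutions that start near `w` exist for
all later times and converge to `w`. -/
def IsAsymptoticallyStable (V : ℝ → ℝ × ℝ → ℝ × ℝ) (w : ℝ → ℝ × ℝ) : Prop :=
  IsLyapunovStable V w ∧ ∀ t₀ : ℝ, ∃ δ > 0, ∀ v : ℝ × ℝ, dist v (w t₀) < δ →
    (∃ y : ℝ → ℝ × ℝ, IsSolutionOn V y (Set.Ici t₀) ∧ y t₀ = v) ∧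
    ∀ y : ℝ → ℝ × ℝ, IsSolutionOn V y (Set.Ici t₀) → y t₀ = v →
      Tendsto (fun t => dist (y t) (w t)) atTop (𝓝 0)

/-- The solution `w = (z, φ)` stays where `|J - Jr| = |μ z| ≤ ρ` and `|φ - η₀(ε t)| ≤ δ`. -/
def StaysNear (η₀ : ℝ → ℝ) (ε ρ δ : ℝ) (w : ℝ → ℝ × ℝ) : Prop :=
  ∀ t, |√ε * (w t).1| ≤ ρ ∧ |(w t).2 - η₀ (ε * t)| ≤ δ

end

/-! ### The jump set and monotonicity across it -/

noncomputable section

open scoped ContDiff BoundedContinuousFunction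

/-! The right-hand sides jump when the phase ψ = φ + (q/p)νt meets 2πℤ, so in the variable t the
jump times depend on the solution. But ψ increases along solutions, so s = ψ can be the independent
variable (`PhaseSystem`). Then the jumps sit on a fixed discrete set, and y = (z, φ) solves y' =
V(s, y) with V Lipschitz in y on the tubes used. Time becomes t = c(s − φ), where c is the inverse
of the resonant frequency, and the slow time is μ²cs up to O(μ²).

Put x = φ − η(μ²cs). On tubes |z|, |x| ≤ Kμ, `LO.V_fst` and `LO.V_snd` give z' = μ(A₀ + A'x +
A''x²/2 + μBz), φ' = μdz + μ²(G₀ + Ex), with errors that are O(μ³) and have Lipschitz constants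
O(μ³). The mean of A₀ over s vanishes because η is a root of f₀. After averaging, the difference (ζ,
ξ) of two solutions obeys ζ' = −μαdξ, ξ' = μdζ at leading order, with α > 0. This is a center, so
stability is decided at order μ² only, and every effect of that order has to be controlled.

The core is a quadratic form ρ(ζ² + αξ²) plus corrections of orders μ and μ², whose derivative is
μ²·`rate` times the form, up to O(μ³) (`energy_rate_bound`, `energy_deriv`). Correctors, that is,
primitives in the fast phase, absorb the oscillating coefficients. The nonlinearity contributes
A''Xξ, where X is the rescaled midpoint of the two solutions; it has the same order as the damping
and is cancelled by the terms with k, because the midpoint (W, X) rotates like (ζ, ξ). The weights ρ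
and p make the rate constant. It is the mean of B + E, that is, ⟨b + e⟩ divided by the resonant
frequency (`ImpactOscillator.IsForce.rate_eq`). Hence differences of solutions contract like
exp(−lμ²|s|), forward if the rate is negative and backward if it is positive, and a defect G between
two approximate solutions costs only C·G/μ² (`norm_contraction`).

The rest follows from this contraction. An explicit approximate solution has defect O(μ³)
(`exists_center`). Exact solutions that start on it further and further upstream stay within O(μ) of
it and converge to a solution in a tube over the whole line (`exists_tubeSolution`). Two such
solutions coincide, being contracted from infinity (`tubeSolution_unique`). A translate by j fast
periods which is almost a multiple of the slow period is an approximate solution with small defect,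
which gives almost periodicity (`tubeSolution_almost_periodic`). Uniqueness in a neighbourhood of
fixed size δ reduces to uniqueness in tubes by `localization`: a phase deviation much larger than μ
would make the averaged force drive z out of its bound. Forward contraction gives asymptotic
stability. With backward contraction, a nearby solution that stayed close for all later times would
coincide with the given one, which excludes Lyapunov stability.

Finally, all this is carried between time and phase (`ClampedSolution.exists_time_solution`,
`exists_phase_parametrization`), and the oscillator is written as a phase system
(`ImpactOscillator.system`, `ImpactOscillator.IsForce.exists_timeField`). -/

/-- The phases at which the right-hand sides jump. -/
def jumpSet : Set ℝ := Set.range fun k : ℤ => 2 * π * (k : ℝ)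

theorem countable_jumpSet : jumpSet.Countable := Set.countable_range _

theorem isClosed_jumpSet : IsClosed jumpSet := by
  have h : jumpSet = (fun x : ℝ => 2 * π * x) '' Set.range (fun k : ℤ => (k : ℝ)) := by
    rw [← Set.range_comp]; rfl
  rw [h]
  exact (Homeomorph.mulLeft₀ (2 * π) two_pi_pos.ne').isClosedMap _
    Int.isClosedEmbedding_coe_real.isClosed_range

theorem isOpen_compl_jumpSet : IsOpen jumpSetᶜ := isClosed_jumpSet.isOpen_compl

theorem ae_notMem_jumpSet : ∀ᵐ s : ℝ, s ∉ jumpSet := by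
  have := countable_jumpSet.measure_zero volume
  exact measure_eq_zero_iff_ae_notMem.mp this

theorem floor_le_two_pi (s : ℝ) : 2 * π * ⌊s / (2 * π)⌋ ≤ s := by
  have := Int.floor_le (s / (2 * π))
  rwa [le_div_iff₀ two_pi_pos, mul_comm] at this

theorem lt_floor_two_pi (s : ℝ) : s < 2 * π * (⌊s / (2 * π)⌋ + 1) := by
  have := Int.lt_floor_add_one (s / (2 * π))
  rwa [div_lt_iff₀ two_pi_pos, mul_comm] at this

theorem notMem_jumpSet_of_mem_Ioo {s : ℝ} {k : ℤ} (h1 : 2 * π * k < s) (h2 : s < 2 * π * (k + 1)) :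
    s ∉ jumpSet := by
  rintro ⟨m, rfl⟩
  have h1' := lt_of_mul_lt_mul_left h1 two_pi_pos.le
  have h2' := lt_of_mul_lt_mul_left h2 two_pi_pos.le
  have h1'' : k < m := by exact_mod_cast h1'
  have h2'' : m < k + 1 := by exact_mod_cast h2'
  omega

theorem mem_Ioo_floor_of_notMem_jumpSet {s : ℝ} (h : s ∉ jumpSet) :
    s ∈ Set.Ioo (2 * π * (⌊s / (2 * π)⌋ : ℝ)) (2 * π * (⌊s / (2 * π)⌋ + 1)) := by
  refine ⟨lt_of_le_of_ne (floor_le_two_pi s) ?_, lt_floor_two_pi s⟩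
  intro h'
  exact h ⟨_, h'⟩

theorem add_period_notMem_jumpSet {s : ℝ} (k : ℤ) (h : s ∉ jumpSet) : s + 2 * π * k ∉ jumpSet := by
  rintro ⟨m, hm⟩
  exact h ⟨m - k, by push_cast; simp only at hm; linarith⟩

/-- Between consecutive points of 2πℤ this is the usual monotonicity criterion; continuity glues the
pieces together. It replaces the mean value theorem throughout, since solutions have corners at the
jumps. -/
theorem le_of_hasDerivAt_nonpos_off_jumpSet {f f' : ℝ → ℝ} {a b : ℝ} (hab : a ≤ b)
    (hc : ContinuousOn f (Set.Icc a b))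
    (hd : ∀ s ∈ Set.Ioo a b, s ∉ jumpSet → HasDerivAt f (f' s) s)
    (hn : ∀ s ∈ Set.Ioo a b, s ∉ jumpSet → f' s ≤ 0) : f b ≤ f a := by
  have base : ∀ a b : ℝ, a ≤ b → ContinuousOn f (Set.Icc a b) →
      (∀ s ∈ Set.Ioo a b, s ∉ jumpSet → HasDerivAt f (f' s) s) →
      (∀ s ∈ Set.Ioo a b, s ∉ jumpSet → f' s ≤ 0) →
      b ≤ 2 * π * (⌊a / (2 * π)⌋ + 1) → f b ≤ f a := by
    intro a b hab hc hd hn hb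
    have hnj : ∀ s ∈ Set.Ioo a b, s ∉ jumpSet := fun s hs =>
      notMem_jumpSet_of_mem_Ioo (k := ⌊a / (2 * π)⌋)
        ((floor_le_two_pi a).trans_lt hs.1) (hs.2.trans_le hb)
    have hanti : AntitoneOn f (Set.Icc a b) := by
      refine antitoneOn_of_deriv_nonpos (convex_Icc a b) hc ?_ ?_
      · rw [interior_Icc]
        exact fun s hs => (hd s hs (hnj s hs)).differentiableAt.differentiableWithinAt
      · rw [interior_Icc]
        intro s hs
        rw [(hd s hs (hnj s hs)).deriv]
        exact hn s hs (hnj s hs)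
    exact hanti (Set.left_mem_Icc.2 hab) (Set.right_mem_Icc.2 hab) hab
  -- Induction on the number of jump points to be crossed: cut at the first jump point m to the
  -- right of a.
  have key : ∀ n : ℕ, ∀ a b : ℝ, a ≤ b → ContinuousOn f (Set.Icc a b) →
      (∀ s ∈ Set.Ioo a b, s ∉ jumpSet → HasDerivAt f (f' s) s) →
      (∀ s ∈ Set.Ioo a b, s ∉ jumpSet → f' s ≤ 0) →
      b ≤ 2 * π * (⌊a / (2 * π)⌋ + 1 + n) → f b ≤ f a := by
    intro n
    induction n with
    | zero =>
      intro a b hab hc hd hn hb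
      exact base a b hab hc hd hn (by simpa using hb)
    | succ n ih =>
      intro a b hab hc hd hn hb
      set m := 2 * π * ((⌊a / (2 * π)⌋ : ℝ) + 1) with hm
      have ham : a < m := lt_floor_two_pi a
      rcases le_total b m with h | h
      · exact base a b hab hc hd hn h
      · have h1 : f m ≤ f a := base a m ham.le (hc.mono (Set.Icc_subset_Icc_right h))
          (fun s hs => hd s ⟨hs.1, hs.2.trans_le h⟩) (fun s hs => hn s ⟨hs.1, hs.2.trans_le h⟩) le_rfl
        have hfl : ⌊m / (2 * π)⌋ = ⌊a / (2 * π)⌋ + 1 := by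
          rw [hm, mul_div_cancel_left₀ _ two_pi_pos.ne']
          exact_mod_cast Int.floor_intCast (R := ℝ) (⌊a / (2 * π)⌋ + 1)
        have h2 : f b ≤ f m := by
          refine ih m b h (hc.mono (Set.Icc_subset_Icc_left ham.le))
            (fun s hs => hd s ⟨ham.trans hs.1, hs.2⟩) (fun s hs => hn s ⟨ham.trans hs.1, hs.2⟩) ?_
          rw [hfl]; push_cast at hb ⊢; linarith
        exact h2.trans h1
  obtain ⟨n, hn'⟩ := exists_nat_ge (b / (2 * π) - (⌊a / (2 * π)⌋ + 1))
  refine key n a b hab hc hd hn ?_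
  have : b / (2 * π) ≤ ⌊a / (2 * π)⌋ + 1 + n := by linarith
  rwa [div_le_iff₀ two_pi_pos, mul_comm] at this

/-! ### Fast, slow and separated functions, and their correctors -/

/-- Piecewise continuous periodic functions of the fast phase. -/
structure IsFast (T : ℝ) (e : ℝ → ℝ) : Prop where
  periodic : Function.Periodic e T
  bounded : ∃ C, ∀ s, |e s| ≤ C
  cont : ContinuousOn e jumpSetᶜ

def fastMean (T : ℝ) (e : ℝ → ℝ) : ℝ := T⁻¹ * ∫ s in (0 : ℝ)..T, e s

theorem intervalIntegrable_of_bounded_off_jumpSet {e : ℝ → ℝ} (hc : ContinuousOn e jumpSetᶜ)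
    {C : ℝ} (hC : ∀ s, |e s| ≤ C) (a b : ℝ) : IntervalIntegrable e volume a b := by
  have hm : AEStronglyMeasurable e volume := by
    have h1 := hc.aestronglyMeasurable (μ := volume) isOpen_compl_jumpSet.measurableSet
    have h2 : (volume : Measure ℝ).restrict jumpSetᶜ = volume := by
      rw [Measure.restrict_eq_self_of_ae_mem]
      exact ae_notMem_jumpSet
    rwa [h2] at h1
  refine (intervalIntegrable_const (c := C)).mono_fun hm.restrict ?_
  filter_upwards with s
  exact (hC s).trans (le_abs_self C)

namespace IsFast

variable {T : ℝ} {e e₁ e₂ : ℝ → ℝ}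

theorem intervalIntegrable (h : IsFast T e) (a b : ℝ) : IntervalIntegrable e volume a b :=
  intervalIntegrable_of_bounded_off_jumpSet h.cont h.bounded.choose_spec a b

theorem const (c : ℝ) : IsFast T fun _ => c :=
  ⟨fun _ => rfl, ⟨|c|, fun _ => le_rfl⟩, continuousOn_const⟩

theorem add (h₁ : IsFast T e₁) (h₂ : IsFast T e₂) : IsFast T fun s => e₁ s + e₂ s := by
  obtain ⟨C₁, hC₁⟩ := h₁.bounded
  obtain ⟨C₂, hC₂⟩ := h₂.bounded
  exact ⟨fun s => by simp only [h₁.periodic s, h₂.periodic s],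
    ⟨C₁ + C₂, fun s => (abs_add_le _ _).trans (add_le_add (hC₁ s) (hC₂ s))⟩, h₁.cont.add h₂.cont⟩

theorem mul (h₁ : IsFast T e₁) (h₂ : IsFast T e₂) : IsFast T fun s => e₁ s * e₂ s := by
  obtain ⟨C₁, hC₁⟩ := h₁.bounded
  obtain ⟨C₂, hC₂⟩ := h₂.bounded
  refine ⟨fun s => by simp only [h₁.periodic s, h₂.periodic s], ⟨C₁ * C₂, fun s => ?_⟩,
    h₁.cont.mul h₂.cont⟩
  rw [abs_mul]
  exact mul_le_mul (hC₁ s) (hC₂ s) (abs_nonneg _) ((abs_nonneg _).trans (hC₁ s))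

theorem of_continuous (hT : 0 < T) (hp : Function.Periodic e T) (hc : Continuous e) : IsFast T e := by
  refine ⟨hp, ?_, hc.continuousOn⟩
  obtain ⟨C, hC⟩ := isCompact_Icc.exists_bound_of_continuousOn (s := Set.Icc 0 (0 + T))
    hc.continuousOn
  refine ⟨C, fun s => ?_⟩
  obtain ⟨s', hs', h⟩ := hp.exists_mem_Ico₀ hT s
  rw [h]
  exact hC s' ⟨hs'.1, by simpa using hs'.2.le⟩

/-- Subtracting the mean of e makes the primitive periodic. Normalizing the primitive to mean zero
allows it to be integrated a second time, as is done for the corrector V of U. -/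
theorem exists_primitive (hT : 0 < T) (h : IsFast T e) :
    ∃ E : ℝ → ℝ, Continuous E ∧ IsFast T E ∧ fastMean T E = 0 ∧
      ∀ s ∉ jumpSet, HasDerivAt E (e s - fastMean T e) s := by
  set m := fastMean T e with hm
  have hem : IsFast T fun s => e s + -m := h.add (const (-m))
  have hcont : Continuous fun s => ∫ r in (0 : ℝ)..s, (e r + -m) :=
    intervalIntegral.continuous_primitive (fun a b => hem.intervalIntegrable a b) 0
  have hzero : ∫ r in (0 : ℝ)..T, (e r + -m) = 0 := by
    rw [intervalIntegral.integral_add (h.intervalIntegrable _ _) intervalIntegrable_const,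
      intervalIntegral.integral_const, hm, fastMean]
    simp only [sub_zero, smul_eq_mul]
    field_simp
    ring
  have hper : Function.Periodic (fun s => ∫ r in (0 : ℝ)..s, (e r + -m)) T := by
    intro s
    have h1 := intervalIntegral.integral_add_adjacent_intervals
      (hem.intervalIntegrable 0 s) (hem.intervalIntegrable s (s + T))
    have h2 : ∫ r in s..(s + T), (e r + -m) = 0 := by
      rw [hem.periodic.intervalIntegral_add_eq s 0, zero_add, hzero]
    simp only
    rw [← h1, h2, add_zero]
  have hder : ∀ s ∉ jumpSet, HasDerivAt (fun s => ∫ r in (0 : ℝ)..s, (e r + -m)) (e s + -m) s := by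
    intro s hs
    have hmem : jumpSetᶜ ∈ 𝓝 s := isOpen_compl_jumpSet.mem_nhds hs
    refine intervalIntegral.integral_hasDerivAt_right (hem.intervalIntegrable 0 s) ?_
      (hem.cont.continuousAt hmem)
    exact hem.cont.stronglyMeasurableAtFilter isOpen_compl_jumpSet s hs
  have hF := of_continuous hT hper hcont
  set E₀ := fun s => ∫ r in (0 : ℝ)..s, (e r + -m) with hE₀
  refine ⟨fun s => E₀ s + -fastMean T E₀, by fun_prop, hF.add (const _), ?_, ?_⟩
  · have : fastMean T (fun s => E₀ s + -fastMean T E₀)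
        = fastMean T E₀ + -fastMean T E₀ := by
      conv_lhs => rw [fastMean]
      rw [intervalIntegral.integral_add (hF.intervalIntegrable _ _) intervalIntegrable_const,
        intervalIntegral.integral_const, mul_add]
      congr 1
      simp only [sub_zero, smul_eq_mul]
      field_simp
    rw [this, add_neg_cancel]
  · intro s hs
    simpa [sub_eq_add_neg] using (hder s hs).add_const (-fastMean T E₀)

end IsFast

/-- Smooth periodic functions of the slow time. -/
structure IsSlow (T : ℝ) (α : ℝ → ℝ) : Prop where
  smooth : ContDiff ℝ ∞ α
  periodic : Function.Periodic α T

namespace IsSlow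

variable {T : ℝ} {α α₁ α₂ : ℝ → ℝ}

theorem const (c : ℝ) : IsSlow T fun _ => c := ⟨contDiff_const, fun _ => rfl⟩

theorem add (h₁ : IsSlow T α₁) (h₂ : IsSlow T α₂) : IsSlow T fun σ => α₁ σ + α₂ σ :=
  ⟨h₁.smooth.add h₂.smooth, fun σ => by simp only [h₁.periodic σ, h₂.periodic σ]⟩

theorem mul (h₁ : IsSlow T α₁) (h₂ : IsSlow T α₂) : IsSlow T fun σ => α₁ σ * α₂ σ :=
  ⟨h₁.smooth.mul h₂.smooth, fun σ => by simp only [h₁.periodic σ, h₂.periodic σ]⟩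

theorem neg (h : IsSlow T α) : IsSlow T fun σ => -α σ :=
  ⟨h.smooth.neg, fun σ => by simp only [h.periodic σ]⟩

theorem sub (h₁ : IsSlow T α₁) (h₂ : IsSlow T α₂) : IsSlow T fun σ => α₁ σ - α₂ σ :=
  ⟨h₁.smooth.sub h₂.smooth, fun σ => by simp only [h₁.periodic σ, h₂.periodic σ]⟩

theorem inv (h : IsSlow T α) (h0 : ∀ σ, α σ ≠ 0) : IsSlow T fun σ => (α σ)⁻¹ :=
  ⟨h.smooth.inv h0, fun σ => by simp only [h.periodic σ]⟩

theorem comp (h : IsSlow T α) {f : ℝ → ℝ} (hf : ContDiff ℝ ∞ f) : IsSlow T fun σ => f (α σ) :=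
  ⟨hf.comp h.smooth, fun σ => by simp only [h.periodic σ]⟩

theorem deriv (h : IsSlow T α) : IsSlow T (deriv α) := by
  refine ⟨(contDiff_infty_iff_deriv.1 h.smooth).2, fun σ => ?_⟩
  rw [← deriv_comp_add_const]
  congr 1
  exact funext h.periodic

theorem hasDerivAt (h : IsSlow T α) (σ : ℝ) : HasDerivAt α (_root_.deriv α σ) σ :=
  (h.smooth.differentiable (by simp) σ).hasDerivAt

theorem hasDerivAt_scaled (h : IsSlow T α) (κ s : ℝ) :
    HasDerivAt (fun s => α (κ * s)) (κ * _root_.deriv α (κ * s)) s := by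
  have h1 : HasDerivAt (fun s : ℝ => κ * s) κ s := by simpa using (hasDerivAt_id s).const_mul κ
  simpa [mul_comm, Function.comp_def] using (h.hasDerivAt (κ * s)).comp s h1

theorem bounded (h : IsSlow T α) (hT : 0 < T) : ∃ C, ∀ σ, |α σ| ≤ C :=
  (IsFast.of_continuous hT h.periodic h.smooth.continuous).bounded

/-- The reciprocal is again slow, hence bounded. -/
theorem exists_lower_bound (h : IsSlow T α) (hT : 0 < T) (hpos : ∀ σ, 0 < α σ) :
    ∃ m > 0, ∀ σ, m ≤ α σ := by
  obtain ⟨C, hC⟩ := (h.inv fun σ => (hpos σ).ne').bounded hT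
  have hC0 : 0 < C := lt_of_lt_of_le (abs_pos.2 (inv_ne_zero (hpos 0).ne')) (hC 0)
  refine ⟨C⁻¹, inv_pos.2 hC0, fun σ => ?_⟩
  have := (le_abs_self _).trans (hC σ)
  exact (inv_le_comm₀ hC0 (hpos σ)).2 this

end IsSlow

/-- Finite sums of products of a slow and a fast function. -/
def IsSep (Tf Ts : ℝ) (g : ℝ → ℝ → ℝ) : Prop :=
  ∃ (ι : Type) (_ : Fintype ι) (α e : ι → ℝ → ℝ), (∀ i, IsSlow Ts (α i)) ∧ (∀ i, IsFast Tf (e i)) ∧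
    ∀ s σ, g s σ = ∑ i, α i σ * e i s

namespace IsSep

variable {Tf Ts : ℝ} {g g₁ g₂ : ℝ → ℝ → ℝ}

theorem of_slow {α : ℝ → ℝ} (h : IsSlow Ts α) : IsSep Tf Ts fun _ σ => α σ :=
  ⟨Unit, inferInstance, fun _ => α, fun _ _ => 1, fun _ => h, fun _ => IsFast.const 1, by simp⟩

theorem of_fast {e : ℝ → ℝ} (h : IsFast Tf e) : IsSep Tf Ts fun s _ => e s :=
  ⟨Unit, inferInstance, fun _ _ => 1, fun _ => e, fun _ => IsSlow.const 1, fun _ => h, by simp⟩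

theorem add (h₁ : IsSep Tf Ts g₁) (h₂ : IsSep Tf Ts g₂) :
    IsSep Tf Ts fun s σ => g₁ s σ + g₂ s σ := by
  obtain ⟨ι₁, _, α₁, e₁, hα₁, he₁, hg₁⟩ := h₁
  obtain ⟨ι₂, _, α₂, e₂, hα₂, he₂, hg₂⟩ := h₂
  refine ⟨ι₁ ⊕ ι₂, inferInstance, Sum.elim α₁ α₂, Sum.elim e₁ e₂, ?_, ?_, ?_⟩
  · rintro (i | i)
    · exact hα₁ i
    · exact hα₂ i
  · rintro (i | i)
    · exact he₁ i
    · exact he₂ i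
  · intro s σ
    simp [hg₁, hg₂]

theorem mul (h₁ : IsSep Tf Ts g₁) (h₂ : IsSep Tf Ts g₂) :
    IsSep Tf Ts fun s σ => g₁ s σ * g₂ s σ := by
  obtain ⟨ι₁, _, α₁, e₁, hα₁, he₁, hg₁⟩ := h₁
  obtain ⟨ι₂, _, α₂, e₂, hα₂, he₂, hg₂⟩ := h₂
  refine ⟨ι₁ × ι₂, inferInstance, fun i σ => α₁ i.1 σ * α₂ i.2 σ, fun i s => e₁ i.1 s * e₂ i.2 s,
    fun i => (hα₁ i.1).mul (hα₂ i.2), fun i => (he₁ i.1).mul (he₂ i.2), ?_⟩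
  intro s σ
  simp only
  rw [hg₁, hg₂, Finset.sum_mul_sum, Fintype.sum_prod_type]
  refine Finset.sum_congr rfl fun i _ => Finset.sum_congr rfl fun j _ => ?_
  ring

theorem bounded (hTs : 0 < Ts) (h : IsSep Tf Ts g) : ∃ C, ∀ s σ, |g s σ| ≤ C := by
  obtain ⟨ι, _, α, e, hα, he, hg⟩ := h
  choose A hA using fun i => (hα i).bounded hTs
  choose B hB using fun i => (he i).bounded
  refine ⟨∑ i, A i * B i, fun s σ => ?_⟩
  rw [hg]
  refine (Finset.abs_sum_le_sum_abs _ _).trans (Finset.sum_le_sum fun i _ => ?_)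
  rw [abs_mul]
  exact mul_le_mul (hA i σ) (hB i s) (abs_nonneg _) ((abs_nonneg _).trans (hA i σ))

theorem fastMean_sum {ι : Type} [Fintype ι] {α : ι → ℝ} {e : ι → ℝ → ℝ}
    (he : ∀ i, IsFast Tf (e i)) :
    fastMean Tf (fun s => ∑ i, α i * e i s) = ∑ i, α i * fastMean Tf (e i) := by
  simp only [fastMean]
  rw [intervalIntegral.integral_finsetSum
    (fun i _ => ((he i).intervalIntegrable 0 Tf).const_mul (α i)), Finset.mul_sum]
  refine Finset.sum_congr rfl fun i _ => ?_
  rw [intervalIntegral.integral_const_mul]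
  ring

theorem fastMean_isSlow (h : IsSep Tf Ts g) : IsSlow Ts fun σ => fastMean Tf fun s => g s σ := by
  obtain ⟨ι, _, α, e, hα, he, hg⟩ := h
  have : (fun σ => fastMean Tf fun s => g s σ) = fun σ => ∑ i, α i σ * fastMean Tf (e i) := by
    funext σ
    simp only [hg]
    exact fastMean_sum he
  rw [this]
  refine ⟨ContDiff.sum fun i _ => (hα i).smooth.mul contDiff_const, fun σ => ?_⟩
  exact Finset.sum_congr rfl fun i _ => by rw [(hα i).periodic σ]

theorem isFast (h : IsSep Tf Ts g) (σ : ℝ) : IsFast Tf fun s => g s σ := by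
  obtain ⟨ι, _, α, e, hα, he, hg⟩ := h
  simp only [hg]
  refine ⟨fun s => Finset.sum_congr rfl fun i _ => by rw [(he i).periodic s], ?_,
    continuousOn_finsetSum _ fun i _ => continuousOn_const.mul (he i).cont⟩
  choose B hB using fun i => (he i).bounded
  refine ⟨∑ i, |α i σ| * B i, fun s => (Finset.abs_sum_le_sum_abs _ _).trans
    (Finset.sum_le_sum fun i _ => ?_)⟩
  rw [abs_mul]
  exact mul_le_mul_of_nonneg_left (hB i s) (abs_nonneg _)

/-- Integrate each fast factor. Along the line σ = κs, differentiating the slow factors costs only a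
factor κ, which will be of order μ². -/
theorem exists_corrector (hTf : 0 < Tf) (h : IsSep Tf Ts g) :
    ∃ U V : ℝ → ℝ → ℝ, IsSep Tf Ts U ∧ IsSep Tf Ts V ∧ (∀ σ, fastMean Tf (fun s => U s σ) = 0) ∧
      (∀ κ, Continuous fun s => U s (κ * s)) ∧
      ∀ κ, ∀ s ∉ jumpSet, HasDerivAt (fun s => U s (κ * s))
        (g s (κ * s) - fastMean Tf (fun r => g r (κ * s)) + κ * V s (κ * s)) s := by
  obtain ⟨ι, _, α, e, hα, he, hg⟩ := h
  choose E hEc hE hE0 hEd using fun i => (he i).exists_primitive hTf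
  refine ⟨fun s σ => ∑ i, α i σ * E i s, fun s σ => ∑ i, deriv (α i) σ * E i s,
    ⟨ι, inferInstance, α, E, hα, hE, fun _ _ => rfl⟩,
    ⟨ι, inferInstance, fun i => deriv (α i), E, fun i => (hα i).deriv, hE, fun _ _ => rfl⟩, ?_, ?_, ?_⟩
  · intro σ
    rw [fastMean_sum hE]
    simp [hE0]
  · intro κ
    refine continuous_finsetSum _ fun i _ => ?_
    exact ((hα i).smooth.continuous.comp (continuous_const.mul continuous_id)).mul (hEc i)
  · intro κ s hs
    have h1 : HasDerivAt (fun s => ∑ i, α i (κ * s) * E i s)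
        (∑ i, (κ * deriv (α i) (κ * s) * E i s + α i (κ * s) * (e i s - fastMean Tf (e i)))) s := by
      apply HasDerivAt.fun_sum
      intro i _
      exact ((hα i).hasDerivAt_scaled κ s).mul (hEd i s hs)
    convert h1 using 1
    simp only [hg]
    rw [fastMean_sum he, Finset.mul_sum, ← Finset.sum_sub_distrib, ← Finset.sum_add_distrib]
    refine Finset.sum_congr rfl fun i _ => ?_
    ring

end IsSep

/-! ### Uniform bounds and the algebra of the energy form -/

/-- Uniform boundedness of a family of reals. -/
def Bdd {ι : Type*} (f : ι → ℝ) : Prop := ∃ C, ∀ i, |f i| ≤ C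

namespace Bdd

variable {ι : Type*} {f g : ι → ℝ}

theorem const (c : ℝ) : Bdd fun _ : ι => c := ⟨|c|, fun _ => le_rfl⟩

theorem add (hf : Bdd f) (hg : Bdd g) : Bdd fun i => f i + g i := by
  obtain ⟨C, hC⟩ := hf
  obtain ⟨D, hD⟩ := hg
  exact ⟨C + D, fun i => (abs_add_le _ _).trans (add_le_add (hC i) (hD i))⟩

theorem sub (hf : Bdd f) (hg : Bdd g) : Bdd fun i => f i - g i := by
  obtain ⟨C, hC⟩ := hf
  obtain ⟨D, hD⟩ := hg
  exact ⟨C + D, fun i => (abs_sub _ _).trans (add_le_add (hC i) (hD i))⟩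

theorem neg (hf : Bdd f) : Bdd fun i => -f i := by
  obtain ⟨C, hC⟩ := hf
  exact ⟨C, fun i => by rw [abs_neg]; exact hC i⟩

theorem mul (hf : Bdd f) (hg : Bdd g) : Bdd fun i => f i * g i := by
  obtain ⟨C, hC⟩ := hf
  obtain ⟨D, hD⟩ := hg
  refine ⟨C * D, fun i => ?_⟩
  rw [abs_mul]
  exact mul_le_mul (hC i) (hD i) (abs_nonneg _) ((abs_nonneg _).trans (hC i))

theorem pow (hf : Bdd f) (n : ℕ) : Bdd fun i => f i ^ n := by
  obtain ⟨C, hC⟩ := hf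
  refine ⟨C ^ n, fun i => ?_⟩
  rw [abs_pow]
  exact pow_le_pow_left₀ (abs_nonneg _) (hC i) n

theorem exists_pos (hf : Bdd f) : ∃ C > 0, ∀ i, |f i| ≤ C := by
  obtain ⟨C, hC⟩ := hf
  exact ⟨|C| + 1, by positivity, fun i => (hC i).trans ((le_abs_self C).trans (by linarith))⟩

end Bdd

theorem abs_quadratic_le {a b c C x y : ℝ} (ha : |a| ≤ C) (hb : |b| ≤ C) (hc : |c| ≤ C) :
    |a * x ^ 2 + b * (x * y) + c * y ^ 2| ≤ 2 * C * (x ^ 2 + y ^ 2) := by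
  have hC : 0 ≤ C := (abs_nonneg a).trans ha
  have h1 : |a * x ^ 2| ≤ C * x ^ 2 := by
    rw [abs_mul, abs_of_nonneg (sq_nonneg x)]; exact mul_le_mul_of_nonneg_right ha (sq_nonneg x)
  have h2 : |c * y ^ 2| ≤ C * y ^ 2 := by
    rw [abs_mul, abs_of_nonneg (sq_nonneg y)]; exact mul_le_mul_of_nonneg_right hc (sq_nonneg y)
  have h3 : |b * (x * y)| ≤ C * (x ^ 2 + y ^ 2) := by
    rw [abs_mul]
    have h4 : |x * y| ≤ x ^ 2 + y ^ 2 := by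
      rw [abs_le]; constructor <;> nlinarith [sq_nonneg (x + y), sq_nonneg (x - y)]
    exact mul_le_mul hb h4 (abs_nonneg _) hC
  have h5 := abs_add_le (a * x ^ 2 + b * (x * y)) (c * y ^ 2)
  have h6 := abs_add_le (a * x ^ 2) (b * (x * y))
  nlinarith

/-- Rate of change, in slow and fast variables, of the coefficients of the energy form. -/
theorem energy_rate_bound {ι : Type*}
    {μ A A₂ B E X W x₁ w₁ U u₁ V v₁ UB ub₁ U₂ u₂ UE ue₁ ρ ρ₁ α α₁ k k₁ p p₁ a₂ b e : ι → ℝ}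
    (d β : ℝ) (hμ : Bdd μ) (hA : Bdd A) (hA₂ : Bdd A₂) (hB : Bdd B) (hE : Bdd E) (hX : Bdd X)
    (hW : Bdd W) (hx₁ : Bdd x₁) (hw₁ : Bdd w₁) (hU : Bdd U) (hu₁ : Bdd u₁) (hV : Bdd V)
    (hv₁ : Bdd v₁) (hUB : Bdd UB) (hub₁ : Bdd ub₁) (hU₂ : Bdd U₂) (hu₂ : Bdd u₂) (hUE : Bdd UE)
    (hue₁ : Bdd ue₁) (hρ : Bdd ρ) (hρ₁ : Bdd ρ₁) (hα : Bdd α) (hα₁ : Bdd α₁) (hk : Bdd k)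
    (hk₁ : Bdd k₁) (hp : Bdd p) (hp₁ : Bdd p₁)
    (h₁ : ∀ i, 3 * k i * (-(α i * d)) = ρ i * a₂ i)
    (h₂ : ∀ i, ρ₁ i + 2 * ρ i * b i + 2 * d * p i = β * ρ i)
    (h₃ : ∀ i, ρ₁ i * α i + ρ i * α₁ i + 2 * ρ i * α i * e i + 2 * p i * (-(α i * d))
      = β * ρ i * α i) :
    ∃ C > 0, ∀ i, 0 ≤ μ i → ∀ ζ ξ : ℝ,
      |(μ i ^ 2 * ρ₁ i - 2 * μ i * (μ i ^ 2 * k₁ i * X i + k i * (μ i * d * W i + μ i ^ 2 * x₁ i))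
          + μ i ^ 2 * (-2 * (μ i ^ 2 * ρ₁ i * UB i + ρ i * (B i - b i + μ i ^ 2 * ub₁ i))
            + 2 * d * (μ i ^ 2 * ρ₁ i * V i + ρ i * (U i + μ i ^ 2 * v₁ i)))) * ζ ^ 2
        + 2 * (μ i * (-(μ i ^ 2 * ρ₁ i * U i + ρ i * (A i + α i * d + μ i ^ 2 * u₁ i))
              + (μ i ^ 2 * k₁ i * W i + k i * (μ i * A i * X i + μ i ^ 2 * w₁ i))
              + μ i ^ 2 * p₁ i)
            + μ i ^ 2 * ((μ i * d * W i + μ i ^ 2 * x₁ i) * (k i * U i - ρ i * U₂ i)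
              + X i * ((μ i ^ 2 * k₁ i * U i + k i * (A i + α i * d + μ i ^ 2 * u₁ i))
                - (μ i ^ 2 * ρ₁ i * U₂ i + ρ i * (A₂ i - a₂ i + μ i ^ 2 * u₂ i))))) * (ζ * ξ)
        + (μ i ^ 2 * ρ₁ i * α i + ρ i * (μ i ^ 2 * α₁ i)
            + 2 * μ i * ((μ i ^ 2 * k₁ i * α i + k i * (μ i ^ 2 * α₁ i)) * X i
              + k i * α i * (μ i * d * W i + μ i ^ 2 * x₁ i))
            + μ i ^ 2 * (μ i ^ 2 * ρ₁ i * U i ^ 2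
              + ρ i * (2 * U i * (A i + α i * d + μ i ^ 2 * u₁ i))
              - 2 * d * ((μ i ^ 2 * ρ₁ i * α i + ρ i * (μ i ^ 2 * α₁ i)) * V i
                + ρ i * α i * (U i + μ i ^ 2 * v₁ i))
              - 2 * ((μ i ^ 2 * ρ₁ i * α i + ρ i * (μ i ^ 2 * α₁ i)) * UE i
                + ρ i * α i * (E i - e i + μ i ^ 2 * ue₁ i))
              - 2 * ((μ i ^ 2 * k₁ i * W i + k i * (μ i * A i * X i + μ i ^ 2 * w₁ i)) * U i
                + k i * W i * (A i + α i * d + μ i ^ 2 * u₁ i))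
              - 2 * (μ i ^ 2 * p₁ i * U i + p i * (A i + α i * d + μ i ^ 2 * u₁ i)))) * ξ ^ 2
        + 2 * ((ρ i - 2 * μ i * (k i * X i)
              + μ i ^ 2 * (-2 * (ρ i * UB i) + 2 * d * (ρ i * V i))) * ζ
            + (μ i * (-(ρ i * U i) + k i * W i + p i)
              + μ i ^ 2 * (X i * (k i * U i - ρ i * U₂ i))) * ξ)
          * (μ i * A i * ξ + μ i ^ 2 * (A₂ i * X i * ξ + B i * ζ))
        + 2 * ((μ i * (-(ρ i * U i) + k i * W i + p i)
              + μ i ^ 2 * (X i * (k i * U i - ρ i * U₂ i))) * ζ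
            + (ρ i * α i + 2 * μ i * (k i * α i * X i)
              + μ i ^ 2 * (ρ i * U i ^ 2 - 2 * d * (ρ i * α i * V i) - 2 * (ρ i * α i * UE i)
                - 2 * (k i * W i * U i) - 2 * (p i * U i))) * ξ)
          * (μ i * d * ζ + μ i ^ 2 * (E i * ξ))
        - μ i ^ 2 * β * (ρ i * ζ ^ 2 + ρ i * α i * ξ ^ 2)|
      ≤ C * μ i ^ 3 * (ζ ^ 2 + ξ ^ 2) := by
  have hd : Bdd fun _ : ι => d := Bdd.const d
  have hn : Bdd fun _ : ι => (2 : ℝ) := Bdd.const 2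
  have hr11 : Bdd fun i => -2 * (ρ i * UB i) + 2 * d * (ρ i * V i) :=
    ((Bdd.const (-2)).mul (hρ.mul hUB)).add ((hn.mul hd).mul (hρ.mul hV))
  have hr12 : Bdd fun i => X i * (k i * U i - ρ i * U₂ i) :=
    hX.mul ((hk.mul hU).sub (hρ.mul hU₂))
  have hr22 : Bdd fun i => ρ i * U i ^ 2 - 2 * d * (ρ i * α i * V i) - 2 * (ρ i * α i * UE i)
      - 2 * (k i * W i * U i) - 2 * (p i * U i) :=
    ((((hρ.mul (hU.pow 2)).sub ((hn.mul hd).mul ((hρ.mul hα).mul hV))).sub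
      (hn.mul ((hρ.mul hα).mul hUE))).sub (hn.mul ((hk.mul hW).mul hU))).sub (hn.mul (hp.mul hU))
  have hp12 : Bdd fun i => -(ρ i * U i) + k i * W i + p i :=
    ((hρ.mul hU).neg.add (hk.mul hW)).add hp
  set r11 : ι → ℝ := fun i => -2 * (ρ i * UB i) + 2 * d * (ρ i * V i) with er11
  set r12 : ι → ℝ := fun i => X i * (k i * U i - ρ i * U₂ i) with er12
  set r22 : ι → ℝ := fun i => ρ i * U i ^ 2 - 2 * d * (ρ i * α i * V i) - 2 * (ρ i * α i * UE i)
      - 2 * (k i * W i * U i) - 2 * (p i * U i) with er22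
  set p12 : ι → ℝ := fun i => -(ρ i * U i) + k i * W i + p i with ep12
  -- `hT11`, `hT12` and `hT22` bound what remains of the coefficients of ζ², ζξ and ξ² after the
  -- lower orders have cancelled and μ³ has been factored out.
  have hT11 : Bdd fun i => -2 * (k₁ i * X i + k i * x₁ i)
      + μ i * (-2 * (ρ₁ i * UB i + ρ i * ub₁ i) + 2 * d * (ρ₁ i * V i + ρ i * v₁ i))
      + 2 * (B i * (-2 * (k i * X i) + μ i * r11 i)) + 2 * d * r12 i :=
    ((((Bdd.const (-2)).mul ((hk₁.mul hX).add (hk.mul hx₁))).add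
      (hμ.mul (((Bdd.const (-2)).mul ((hρ₁.mul hUB).add (hρ.mul hub₁))).add
        ((hn.mul hd).mul ((hρ₁.mul hV).add (hρ.mul hv₁)))))).add
      (hn.mul (hB.mul (((Bdd.const (-2)).mul (hk.mul hX)).add (hμ.mul hr11))))).add
      ((hn.mul hd).mul hr12)
  have hT12 : Bdd fun i => 2 * (-(ρ₁ i * U i) - ρ i * u₁ i + k₁ i * W i + k i * w₁ i + p₁ i
        + d * W i * (k i * U i - ρ i * U₂ i)
        + μ i * (x₁ i * (k i * U i - ρ i * U₂ i)
          + X i * (k₁ i * U i + k i * u₁ i - ρ₁ i * U₂ i - ρ i * u₂ i)))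
      + 2 * (r11 i * A i + (-2 * (k i * X i) + μ i * r11 i) * (A₂ i * X i))
      + 2 * ((p12 i + μ i * r12 i) * (B i + E i)) + 2 * (r22 i * d) := by
    have hkU := (hk.mul hU).sub (hρ.mul hU₂)
    exact (((hn.mul ((((((((hρ₁.mul hU).neg.sub (hρ.mul hu₁)).add (hk₁.mul hW)).add
      (hk.mul hw₁)).add hp₁).add ((hd.mul hW).mul hkU)).add
      (hμ.mul ((hx₁.mul hkU).add (hX.mul ((((hk₁.mul hU).add (hk.mul hu₁)).sub
        (hρ₁.mul hU₂)).sub (hρ.mul hu₂)))))))).add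
      (hn.mul ((hr11.mul hA).add ((((Bdd.const (-2)).mul (hk.mul hX)).add (hμ.mul hr11)).mul
        (hA₂.mul hX))))).add (hn.mul ((hp12.add (hμ.mul hr12)).mul (hB.add hE)))).add
      (hn.mul (hr22.mul hd))
  have hT22 : Bdd fun i => 2 * (k₁ i * α i * X i + k i * α₁ i * X i + k i * α i * x₁ i)
      + -2 * (k i * A i * X i * U i)
      + μ i * (ρ₁ i * U i ^ 2 + 2 * (ρ i * U i * u₁ i)
        - 2 * d * ((ρ₁ i * α i + ρ i * α₁ i) * V i + ρ i * α i * v₁ i)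
        - 2 * ((ρ₁ i * α i + ρ i * α₁ i) * UE i + ρ i * α i * ue₁ i)
        - 2 * (k₁ i * W i * U i + k i * w₁ i * U i + k i * W i * u₁ i)
        - 2 * (p₁ i * U i + p i * u₁ i))
      + 2 * (r12 i * A i) + 2 * ((p12 i + μ i * r12 i) * (A₂ i * X i))
      + 2 * ((2 * (k i * α i * X i) + μ i * r22 i) * E i) := by
    have hρα := (hρ₁.mul hα).add (hρ.mul hα₁)
    exact (((((hn.mul ((((hk₁.mul hα).mul hX).add ((hk.mul hα₁).mul hX)).add
      ((hk.mul hα).mul hx₁))).add ((Bdd.const (-2)).mul (((hk.mul hA).mul hX).mul hU))).add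
      (hμ.mul ((((((hρ₁.mul (hU.pow 2)).add (hn.mul ((hρ.mul hU).mul hu₁))).sub
        ((hn.mul hd).mul ((hρα.mul hV).add ((hρ.mul hα).mul hv₁)))).sub
        (hn.mul ((hρα.mul hUE).add ((hρ.mul hα).mul hue₁)))).sub
        (hn.mul ((((hk₁.mul hW).mul hU).add ((hk.mul hw₁).mul hU)).add
          ((hk.mul hW).mul hu₁)))).sub (hn.mul ((hp₁.mul hU).add (hp.mul hu₁)))))).add
      (hn.mul (hr12.mul hA))).add (hn.mul ((hp12.add (hμ.mul hr12)).mul (hA₂.mul hX)))).add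
      (hn.mul (((hn.mul ((hk.mul hα).mul hX)).add (hμ.mul hr22)).mul hE))
  obtain ⟨C₁, hC₁, hT11⟩ := hT11.exists_pos
  obtain ⟨C₂, hC₂, hT12⟩ := hT12.exists_pos
  obtain ⟨C₃, hC₃, hT22⟩ := hT22.exists_pos
  refine ⟨2 * (C₁ + C₂ + C₃), by positivity, fun i hμi ζ ξ => ?_⟩
  have key := abs_quadratic_le (x := ζ) (y := ξ) (C := C₁ + C₂ + C₃)
    ((hT11 i).trans (by linarith)) ((hT12 i).trans (by linarith)) ((hT22 i).trans (by linarith))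
  have hμ3 : 0 ≤ μ i ^ 3 := pow_nonneg hμi 3
  have key2 := mul_le_mul_of_nonneg_left key hμ3
  rw [← abs_of_nonneg hμ3, ← abs_mul, abs_of_nonneg hμ3] at key2
  refine le_of_eq_of_le (congrArg abs ?_) (key2.trans_eq (by ring))
  simp only [er11, er12, er22, ep12]
  -- Order μ cancels identically. At order μ², `h₂` and `h₃` turn the diagonal terms into β times
  -- the form, and `h₁` cancels the term Xζξ that comes from the second derivative a₂.
  linear_combination (μ i ^ 2 * ζ ^ 2) * h₂ i + (μ i ^ 2 * ξ ^ 2) * h₃ i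
    - 2 * μ i ^ 2 * X i * (ζ * ξ) * h₁ i

/-! ### Coefficients that are smooth on the period cell, and their expansion in the impulse -/

/-- The representative of the phase in `[0, 2 π)`. -/
def saw (s : ℝ) : ℝ := toIcoMod two_pi_pos 0 s

theorem saw_mem (s : ℝ) : saw s ∈ Set.Icc 0 (2 * π) := by
  have h := toIcoMod_mem_Ico two_pi_pos 0 s
  rw [zero_add] at h
  exact ⟨h.1, h.2.le⟩

theorem saw_add_period (s : ℝ) (k : ℤ) : saw (s + 2 * π * k) = saw s := by
  have := toIcoMod_add_zsmul two_pi_pos 0 s k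
  rwa [zsmul_eq_mul, mul_comm (k : ℝ)] at this

theorem saw_eq_of_mem {s : ℝ} {k : ℤ} (h : s ∈ Set.Ico (2 * π * (k : ℝ)) (2 * π * (k + 1))) :
    saw s = s - 2 * π * k := by
  unfold saw
  rw [toIcoMod_eq_iff]
  refine ⟨⟨by linarith [h.1], by linarith [h.2]⟩, k, ?_⟩
  rw [zsmul_eq_mul]; ring

theorem continuousOn_saw : ContinuousOn saw jumpSetᶜ := by
  intro s hs
  have h := mem_Ioo_floor_of_notMem_jumpSet hs
  refine ContinuousAt.continuousWithinAt ?_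
  have he : (fun r => r - 2 * π * (⌊s / (2 * π)⌋ : ℝ)) =ᶠ[𝓝 s] saw := by
    filter_upwards [Ioo_mem_nhds h.1 h.2] with r hr
    exact (saw_eq_of_mem ⟨hr.1.le, hr.2⟩).symm
  exact ContinuousAt.congr (by fun_prop) he

/-- Partial derivative in the second variable. -/
def partialJ (H : ℝ → ℝ → ℝ) (x J : ℝ) : ℝ := fderiv ℝ (Function.uncurry H) (x, J) (0, 1)

abbrev impulseDomain : Set (ℝ × ℝ) := Set.univ ×ˢ Set.Ioi 0

theorem isOpen_impulseDomain : IsOpen impulseDomain := isOpen_univ.prod isOpen_Ioi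

theorem contDiffOn_partialJ {H : ℝ → ℝ → ℝ}
    (h : ContDiffOn ℝ ∞ (Function.uncurry H) impulseDomain) :
    ContDiffOn ℝ ∞ (Function.uncurry (partialJ H)) impulseDomain :=
  (h.fderiv_of_isOpen isOpen_impulseDomain (m := ∞) (by simp)).clm_apply contDiffOn_const

theorem hasDerivAt_partialJ {H : ℝ → ℝ → ℝ}
    (h : ContDiffOn ℝ ∞ (Function.uncurry H) impulseDomain) (x : ℝ) {J : ℝ} (hJ : 0 < J) :
    HasDerivAt (H x) (partialJ H x J) J := by
  have hmem : (x, J) ∈ impulseDomain := ⟨Set.mem_univ _, hJ⟩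
  have h1 : DifferentiableAt ℝ (Function.uncurry H) (x, J) :=
    (h.differentiableOn (by simp)).differentiableAt (isOpen_impulseDomain.mem_nhds hmem)
  have h2 : HasDerivAt (fun I : ℝ => (x, I)) ((0 : ℝ), (1 : ℝ)) J :=
    (hasDerivAt_const J x).prodMk (hasDerivAt_id J)
  exact h1.hasFDerivAt.comp_hasDerivAt J h2

theorem bounded_on_strip {H : ℝ → ℝ → ℝ} {Jr : ℝ} (hJr : 0 < Jr)
    (h : ContDiffOn ℝ ∞ (Function.uncurry H) impulseDomain) :
    ∃ C > 0, ∀ x ∈ Set.Icc 0 (2 * π), ∀ J, |J - Jr| ≤ Jr / 2 → |H x J| ≤ C := by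
  have hK : IsCompact (Set.Icc 0 (2 * π) ×ˢ Set.Icc (Jr / 2) (3 * Jr / 2)) :=
    isCompact_Icc.prod isCompact_Icc
  obtain ⟨C, hC⟩ := hK.exists_bound_of_continuousOn (f := Function.uncurry H)
    (h.continuousOn.mono fun z hz => ⟨Set.mem_univ _, by
      have := hz.2.1; exact lt_of_lt_of_le (by linarith) this⟩)
  refine ⟨|C| + 1, by positivity, fun x hx J hJ => ?_⟩
  have hJ' := abs_le.1 hJ
  have := hC (x, J) ⟨hx, by constructor <;> simp only <;> linarith [hJ'.1, hJ'.2]⟩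
  exact this.trans ((le_abs_self C).trans (by linarith))

/-- Bounds, uniform in the phase, for a coefficient and its first order expansion at `Jr`. -/
structure HasExpansion (Jr : ℝ) (h : ℝ → ℝ → ℝ) (h' : ℝ → ℝ) (C : ℝ) : Prop where
  pos : 0 < C
  bound : ∀ s J, |J - Jr| ≤ Jr / 2 → |h s J| ≤ C
  bound' : ∀ s, |h' s| ≤ C
  lip : ∀ s J₁ J₂, |J₁ - Jr| ≤ Jr / 2 → |J₂ - Jr| ≤ Jr / 2 → |h s J₁ - h s J₂| ≤ C * |J₁ - J₂|
  exp : ∀ s J₁ J₂, |J₁ - Jr| ≤ Jr / 2 → |J₂ - Jr| ≤ Jr / 2 →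
    |h s J₁ - h s J₂ - h' s * (J₁ - J₂)| ≤ C * (|J₁ - Jr| + |J₂ - Jr|) * |J₁ - J₂|

theorem abs_sub_le_of_mem_uIcc {J₁ J₂ Jr r : ℝ} (h₁ : |J₁ - Jr| ≤ r) (h₂ : |J₂ - Jr| ≤ r) {J : ℝ}
    (hJ : J ∈ Set.uIcc J₁ J₂) : |J - Jr| ≤ r := by
  have h1 := abs_le.1 h₁
  have h2 := abs_le.1 h₂
  rw [abs_le]
  rcases Set.mem_uIcc.1 hJ with h | h <;> constructor <;> linarith [h.1, h.2]

theorem abs_image_sub_le_of_deriv {f f' : ℝ → ℝ} {C x y : ℝ}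
    (hf : ∀ z ∈ Set.uIcc x y, HasDerivAt f (f' z) z) (hC : ∀ z ∈ Set.uIcc x y, |f' z| ≤ C) :
    |f x - f y| ≤ C * |x - y| := by
  have := (convex_uIcc x y).norm_image_sub_le_of_norm_hasDerivWithin_le
    (fun z hz => (hf z hz).hasDerivWithinAt) hC Set.right_mem_uIcc Set.left_mem_uIcc
  simpa using this

/-- H is smooth for all real x, and the jumps enter only through `saw`, whose values lie in a
compact interval. The mean value inequality on [0, 2π] × [Jr/2, 3Jr/2] is therefore uniform in the
phase. -/
theorem hasExpansion_of_contDiffOn {H : ℝ → ℝ → ℝ} {Jr : ℝ} (hJr : 0 < Jr)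
    (h : ContDiffOn ℝ ∞ (Function.uncurry H) impulseDomain) :
    ∃ C, HasExpansion Jr (fun s J => H (saw s) J) (fun s => partialJ H (saw s) Jr) C := by
  have h' := contDiffOn_partialJ h
  obtain ⟨C₀, hC₀, hb₀⟩ := bounded_on_strip hJr h
  obtain ⟨C₁, hC₁, hb₁⟩ := bounded_on_strip hJr h'
  obtain ⟨C₂, hC₂, hb₂⟩ := bounded_on_strip hJr (contDiffOn_partialJ h')
  have hpos : ∀ {J : ℝ}, |J - Jr| ≤ Jr / 2 → 0 < J := fun {J} hJ => by
    have := (abs_le.1 hJ).1; linarith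
  have hself : |Jr - Jr| ≤ Jr / 2 := by simp; linarith
  refine ⟨C₀ + C₁ + C₂, by positivity, fun s J hJ => (hb₀ _ (saw_mem s) J hJ).trans (by linarith),
    fun s => (hb₁ _ (saw_mem s) Jr hself).trans (by linarith), fun s J₁ J₂ h₁ h₂ => ?_,
    fun s J₁ J₂ h₁ h₂ => ?_⟩
  · refine (abs_image_sub_le_of_deriv (f := H (saw s)) (f' := partialJ H (saw s)) (C := C₁)
      (fun J hJ => hasDerivAt_partialJ h _ (hpos (abs_sub_le_of_mem_uIcc h₁ h₂ hJ)))
      (fun J hJ => hb₁ _ (saw_mem s) J (abs_sub_le_of_mem_uIcc h₁ h₂ hJ))).trans ?_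
    exact mul_le_mul_of_nonneg_right (by linarith) (abs_nonneg _)
  -- With the linear part at Jr removed, the derivative is controlled by the distance to Jr, and a
  -- second mean value estimate applies.
  · have key := abs_image_sub_le_of_deriv (x := J₁) (y := J₂)
      (f := fun J => H (saw s) J - partialJ H (saw s) Jr * J)
      (f' := fun J => partialJ H (saw s) J - partialJ H (saw s) Jr)
      (C := C₂ * (|J₁ - Jr| + |J₂ - Jr|))
      (fun J hJ => by
        have := (hasDerivAt_partialJ h (saw s)
          (hpos (abs_sub_le_of_mem_uIcc h₁ h₂ hJ))).fun_sub
          ((hasDerivAt_id J).const_mul (partialJ H (saw s) Jr))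
        simpa using this)
      (fun J hJ => by
        have hJJ := abs_sub_le_of_mem_uIcc h₁ h₂ hJ
        have h3 := abs_image_sub_le_of_deriv (x := J) (y := Jr) (f := partialJ H (saw s))
          (f' := partialJ (partialJ H) (saw s)) (C := C₂)
          (fun I hI => hasDerivAt_partialJ h' _ (hpos (abs_sub_le_of_mem_uIcc hJJ hself hI)))
          (fun I hI => hb₂ _ (saw_mem s) I (abs_sub_le_of_mem_uIcc hJJ hself hI))
        refine h3.trans (mul_le_mul_of_nonneg_left ?_ hC₂.le)
        exact abs_sub_le_of_mem_uIcc (by linarith [abs_nonneg (J₂ - Jr)])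
          (by linarith [abs_nonneg (J₁ - Jr)]) hJ)
    have e : H (saw s) J₁ - H (saw s) J₂ - partialJ H (saw s) Jr * (J₁ - J₂)
        = (H (saw s) J₁ - partialJ H (saw s) Jr * J₁)
          - (H (saw s) J₂ - partialJ H (saw s) Jr * J₂) := by ring
    rw [e]
    refine key.trans (mul_le_mul_of_nonneg_right (mul_le_mul_of_nonneg_right (by linarith) ?_)
      (abs_nonneg _))
    positivity

theorem isFast_saw {H : ℝ → ℝ} {Tf : ℝ} {n : ℤ} (hTf : Tf = 2 * π * n) (h : Continuous H) :
    IsFast Tf fun s => H (saw s) := by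
  refine ⟨fun s => by simp only [hTf, saw_add_period], ?_, h.comp_continuousOn continuousOn_saw⟩
  obtain ⟨C, hC⟩ := isCompact_Icc.exists_bound_of_continuousOn (s := Set.Icc 0 (2 * π))
    h.continuousOn
  exact ⟨C, fun s => hC _ (saw_mem s)⟩

theorem continuous_slice {H : ℝ → ℝ → ℝ}
    (h : ContDiffOn ℝ ∞ (Function.uncurry H) impulseDomain) {J : ℝ} (hJ : 0 < J) :
    Continuous fun x => H x J := by
  have : Continuous (Function.uncurry H ∘ fun x : ℝ => (x, J)) :=
    h.continuousOn.comp_continuous (by fun_prop) fun x => ⟨Set.mem_univ _, hJ⟩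
  exact this

/-! ### The phase system and the calculus of orders on tubes -/

/-- The system with the phase `s = ψ` as independent variable. The fast coefficients are given by
functions of the phase in `[0, 2 π)` and of the impulse. -/
structure PhaseSystem where
  c : ℝ
  lam : ℝ
  Jr : ℝ
  Tf : ℝ
  Ts : ℝ
  P : ℝ → ℝ
  Q : ℝ → ℝ
  R : ℝ → ℝ
  η : ℝ → ℝ
  H₁ : ℝ → ℝ → ℝ
  H₀ : ℝ → ℝ → ℝ
  M₁ : ℝ → ℝ → ℝ
  M₀ : ℝ → ℝ → ℝ
  Θ : ℝ → ℝ

namespace PhaseSystem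

variable (S : PhaseSystem)

/-- `fast` makes Tf a common period of `saw` and of the harmonics of frequency `lam`. Smoothness of
Θ is stated with a dummy phase argument so that the lemmas about fast coefficients apply to it. -/
structure Regular : Prop where
  c_pos : 0 < S.c
  Jr_pos : 0 < S.Jr
  Ts_pos : 0 < S.Ts
  fast : ∃ n m : ℤ, 0 < n ∧ S.Tf = 2 * π * n ∧ S.lam * S.Tf = 2 * π * m
  hP : IsSlow S.Ts S.P
  hQ : IsSlow S.Ts S.Q
  hR : IsSlow S.Ts S.R
  hη : IsSlow S.Ts S.η
  hH₁ : ContDiffOn ℝ ∞ (Function.uncurry S.H₁) impulseDomain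
  hH₀ : ContDiffOn ℝ ∞ (Function.uncurry S.H₀) impulseDomain
  hM₁ : ContDiffOn ℝ ∞ (Function.uncurry S.M₁) impulseDomain
  hM₀ : ContDiffOn ℝ ∞ (Function.uncurry S.M₀) impulseDomain
  hΘ : ContDiffOn ℝ ∞ (Function.uncurry fun _ : ℝ => S.Θ) impulseDomain
  Θ_Jr : S.Θ S.Jr = 0

/-- The external force in terms of the phase. -/
def force (s τ φ : ℝ) : ℝ :=
  S.P τ * sin (S.lam * (s - φ)) + S.Q τ * cos (S.lam * (s - φ)) + S.R τ

/-- Time is c(s − φ) in terms of the phase, so the slow time εt also depends on the state. -/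
def u (μ s : ℝ) (y : ℝ × ℝ) : ℝ := S.force s (μ ^ 2 * S.c * (s - y.2)) y.2

def A (μ s : ℝ) (y : ℝ × ℝ) : ℝ :=
  S.H₁ (saw s) (S.Jr + μ * y.1) * S.u μ s y + S.H₀ (saw s) (S.Jr + μ * y.1)

def G (μ s : ℝ) (y : ℝ × ℝ) : ℝ :=
  S.M₁ (saw s) (S.Jr + μ * y.1) * S.u μ s y + S.M₀ (saw s) (S.Jr + μ * y.1)

/-- The right-hand side of the system in the phase variable. -/
def V (μ s : ℝ) (y : ℝ × ℝ) : ℝ × ℝ :=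
  (μ * (S.A μ s y / (1 + μ ^ 2 * S.G μ s y)),
    1 - (1 - S.Θ (S.Jr + μ * y.1)) / (1 + μ ^ 2 * S.G μ s y))

/-- A prime on `u₀` and on `A` means a derivative in φ at φ = η(σ), with the slow time frozen. `B`
is the derivative of the first coefficient in J, and `E` that of the second one in φ. -/
def u₀ (s σ : ℝ) : ℝ := S.force s σ (S.η σ)

def u₀' (s σ : ℝ) : ℝ :=
  S.lam * (S.Q σ * sin (S.lam * (s - S.η σ)) - S.P σ * cos (S.lam * (s - S.η σ)))

def u₀'' (s σ : ℝ) : ℝ :=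
  -S.lam ^ 2 * (S.P σ * sin (S.lam * (s - S.η σ)) + S.Q σ * cos (S.lam * (s - S.η σ)))

def A₀ (s σ : ℝ) : ℝ := S.H₁ (saw s) S.Jr * S.u₀ s σ + S.H₀ (saw s) S.Jr

def A' (s σ : ℝ) : ℝ := S.H₁ (saw s) S.Jr * S.u₀' s σ

def A'' (s σ : ℝ) : ℝ := S.H₁ (saw s) S.Jr * S.u₀'' s σ

def B (s σ : ℝ) : ℝ := partialJ S.H₁ (saw s) S.Jr * S.u₀ s σ + partialJ S.H₀ (saw s) S.Jr

def G₀ (s σ : ℝ) : ℝ := S.M₁ (saw s) S.Jr * S.u₀ s σ + S.M₀ (saw s) S.Jr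

def E (s σ : ℝ) : ℝ := S.M₁ (saw s) S.Jr * S.u₀' s σ

def d : ℝ := partialJ (fun _ => S.Θ) 0 S.Jr

/-- The slow time. -/
def slow (μ s : ℝ) : ℝ := μ ^ 2 * S.c * s

/-- Since J = Jr + μz, the impulse varies by O(μ²) only. -/
def tube (K μ s : ℝ) : Set (ℝ × ℝ) := {y | |y.1| ≤ K * μ ∧ |y.2 - S.η (S.slow μ s)| ≤ K * μ}

/-- On tubes of radius `K μ`, the function is `O(μ ^ m)` and Lipschitz with constant `O(μ ^ n)`. -/
def LO (K : ℝ) (m n : ℕ) (h : ℝ → ℝ → ℝ × ℝ → ℝ) : Prop :=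
  ∃ C > 0, ∃ μ₀ > 0, μ₀ ≤ 1 ∧ ∀ μ s, 0 < μ → μ < μ₀ →
    (∀ y ∈ S.tube K μ s, |h μ s y| ≤ C * μ ^ m) ∧
    ∀ y₁ ∈ S.tube K μ s, ∀ y₂ ∈ S.tube K μ s, |h μ s y₁ - h μ s y₂| ≤ C * μ ^ n * ‖y₁ - y₂‖

namespace LO

variable {S} {K : ℝ} {m n m₁ n₁ m₂ n₂ : ℕ} {h h₁ h₂ : ℝ → ℝ → ℝ × ℝ → ℝ}

theorem mono (H : S.LO K m₁ n₁ h) (hm : m ≤ m₁) (hn : n ≤ n₁) : S.LO K m n h := by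
  obtain ⟨C, hC, μ₀, hμ₀, hμ₁, H⟩ := H
  refine ⟨C, hC, μ₀, hμ₀, hμ₁, fun μ s hμ hμ' => ⟨fun y hy => ?_, fun y₁ hy₁ y₂ hy₂ => ?_⟩⟩
  · refine ((H μ s hμ hμ').1 y hy).trans (mul_le_mul_of_nonneg_left ?_ hC.le)
    exact pow_le_pow_of_le_one hμ.le (hμ'.le.trans hμ₁) hm
  · refine ((H μ s hμ hμ').2 y₁ hy₁ y₂ hy₂).trans (mul_le_mul_of_nonneg_right
      (mul_le_mul_of_nonneg_left ?_ hC.le) (norm_nonneg _))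
    exact pow_le_pow_of_le_one hμ.le (hμ'.le.trans hμ₁) hn

theorem add (H₁ : S.LO K m n h₁) (H₂ : S.LO K m n h₂) :
    S.LO K m n fun μ s y => h₁ μ s y + h₂ μ s y := by
  obtain ⟨C₁, hC₁, μ₁, hμ₁, hμ₁', H₁⟩ := H₁
  obtain ⟨C₂, hC₂, μ₂, hμ₂, hμ₂', H₂⟩ := H₂
  refine ⟨C₁ + C₂, by positivity, min μ₁ μ₂, lt_min hμ₁ hμ₂, (min_le_left _ _).trans hμ₁',
    fun μ s hμ hμ' => ?_⟩
  obtain ⟨a₁, b₁⟩ := H₁ μ s hμ (hμ'.trans_le (min_le_left _ _))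
  obtain ⟨a₂, b₂⟩ := H₂ μ s hμ (hμ'.trans_le (min_le_right _ _))
  refine ⟨fun y hy => ?_, fun y₁ hy₁ y₂ hy₂ => ?_⟩
  · refine (abs_add_le _ _).trans ((add_le_add (a₁ y hy) (a₂ y hy)).trans_eq (by ring))
  · have e : h₁ μ s y₁ + h₂ μ s y₁ - (h₁ μ s y₂ + h₂ μ s y₂)
        = (h₁ μ s y₁ - h₁ μ s y₂) + (h₂ μ s y₁ - h₂ μ s y₂) := by ring
    rw [e]
    exact (abs_add_le _ _).trans ((add_le_add (b₁ y₁ hy₁ y₂ hy₂) (b₂ y₁ hy₁ y₂ hy₂)).trans_eq (by ring))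

/-- Leibniz rule: the Lipschitz order of one factor is paired with the size order of the other. -/
theorem mul (H₁ : S.LO K m₁ n₁ h₁) (H₂ : S.LO K m₂ n₂ h₂) (hm : m ≤ m₁ + m₂) (hn : n ≤ n₁ + m₂)
    (hn' : n ≤ m₁ + n₂) : S.LO K m n fun μ s y => h₁ μ s y * h₂ μ s y := by
  obtain ⟨C₁, hC₁, μ₁, hμ₁, hμ₁', H₁⟩ := H₁
  obtain ⟨C₂, hC₂, μ₂, hμ₂, hμ₂', H₂⟩ := H₂
  refine ⟨2 * C₁ * C₂, by positivity, min μ₁ μ₂, lt_min hμ₁ hμ₂, (min_le_left _ _).trans hμ₁',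
    fun μ s hμ hμ' => ?_⟩
  have hle : μ ≤ 1 := hμ'.le.trans ((min_le_left _ _).trans hμ₁')
  obtain ⟨a₁, b₁⟩ := H₁ μ s hμ (hμ'.trans_le (min_le_left _ _))
  obtain ⟨a₂, b₂⟩ := H₂ μ s hμ (hμ'.trans_le (min_le_right _ _))
  refine ⟨fun y hy => ?_, fun y₁ hy₁ y₂ hy₂ => ?_⟩
  · rw [abs_mul]
    have h1 := mul_le_mul (a₁ y hy) (a₂ y hy) (abs_nonneg _) (by positivity)
    have h2 : μ ^ (m₁ + m₂) ≤ μ ^ m := pow_le_pow_of_le_one hμ.le hle hm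
    calc _ ≤ C₁ * μ ^ m₁ * (C₂ * μ ^ m₂) := h1
      _ = C₁ * C₂ * μ ^ (m₁ + m₂) := by rw [pow_add]; ring
      _ ≤ 2 * C₁ * C₂ * μ ^ m := by
        have := mul_le_mul_of_nonneg_left h2 (by positivity : 0 ≤ C₁ * C₂)
        nlinarith [(by positivity : 0 ≤ C₁ * C₂ * μ ^ m)]
  · have e : h₁ μ s y₁ * h₂ μ s y₁ - h₁ μ s y₂ * h₂ μ s y₂
        = (h₁ μ s y₁ - h₁ μ s y₂) * h₂ μ s y₁ + h₁ μ s y₂ * (h₂ μ s y₁ - h₂ μ s y₂) := by ring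
    rw [e]
    refine (abs_add_le _ _).trans ?_
    rw [abs_mul, abs_mul]
    have h1 := mul_le_mul (b₁ y₁ hy₁ y₂ hy₂) (a₂ y₁ hy₁) (abs_nonneg _) (by positivity)
    have h2 := mul_le_mul (a₁ y₂ hy₂) (b₂ y₁ hy₁ y₂ hy₂) (abs_nonneg _) (by positivity)
    have h3 : μ ^ (n₁ + m₂) ≤ μ ^ n := pow_le_pow_of_le_one hμ.le hle hn
    have h4 : μ ^ (m₁ + n₂) ≤ μ ^ n := pow_le_pow_of_le_one hμ.le hle hn'
    have hN := norm_nonneg (y₁ - y₂)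
    calc _ ≤ C₁ * μ ^ n₁ * ‖y₁ - y₂‖ * (C₂ * μ ^ m₂) + C₁ * μ ^ m₁ * (C₂ * μ ^ n₂ * ‖y₁ - y₂‖) :=
          add_le_add h1 h2
      _ = C₁ * C₂ * ‖y₁ - y₂‖ * (μ ^ (n₁ + m₂) + μ ^ (m₁ + n₂)) := by rw [pow_add, pow_add]; ring
      _ ≤ C₁ * C₂ * ‖y₁ - y₂‖ * (μ ^ n + μ ^ n) :=
          mul_le_mul_of_nonneg_left (add_le_add h3 h4) (by positivity)
      _ = 2 * C₁ * C₂ * μ ^ n * ‖y₁ - y₂‖ := by ring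

theorem of_bound {f : ℝ → ℝ → ℝ} {C : ℝ} (n : ℕ)
    (hf : ∀ μ s, 0 < μ → |f μ s| ≤ C * μ ^ m) : S.LO K m n fun μ s _ => f μ s := by
  refine ⟨|C| + 1, by positivity, 1, one_pos, le_rfl, fun μ s hμ _ => ⟨fun y _ => ?_, ?_⟩⟩
  · refine (hf μ s hμ).trans (mul_le_mul_of_nonneg_right ?_ (by positivity))
    linarith [le_abs_self C]
  · intro y₁ _ y₂ _
    simp only [sub_self, abs_zero]
    positivity

theorem const (c : ℝ) (n : ℕ) : S.LO K 0 n fun _ _ _ => c :=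
  of_bound (C := |c|) n fun μ s _ => by simp

theorem mu (n : ℕ) : S.LO K 1 n fun μ _ _ => μ :=
  of_bound (C := 1) n fun μ s h => by simp [abs_of_pos h]

theorem neg (H : S.LO K m n h) : S.LO K m n fun μ s y => -h μ s y := by
  obtain ⟨C, hC, μ₀, hμ₀, hμ₁, H⟩ := H
  refine ⟨C, hC, μ₀, hμ₀, hμ₁, fun μ s hμ hμ' => ⟨fun y hy => ?_, fun y₁ hy₁ y₂ hy₂ => ?_⟩⟩
  · rw [abs_neg]; exact (H μ s hμ hμ').1 y hy
  · rw [neg_sub_neg, abs_sub_comm]; exact (H μ s hμ hμ').2 y₁ hy₁ y₂ hy₂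

theorem congr (H : S.LO K m n h₁) (h : ∀ μ s y, h₂ μ s y = h₁ μ s y) : S.LO K m n h₂ := by
  have : h₂ = h₁ := by funext μ s y; exact h μ s y
  rwa [this]

theorem fst (hK : 0 ≤ K) : S.LO K 1 0 fun _ _ y => y.1 := by
  refine ⟨K + 1, by positivity, 1, one_pos, le_rfl, fun μ s hμ _ => ⟨fun y hy => ?_, ?_⟩⟩
  · rw [pow_one]; exact hy.1.trans (by nlinarith)
  · intro y₁ _ y₂ _
    have : |y₁.1 - y₂.1| ≤ ‖y₁ - y₂‖ := norm_fst_le (y₁ - y₂)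
    rw [pow_zero, mul_one]
    nlinarith [norm_nonneg (y₁ - y₂)]

theorem dev (hK : 0 ≤ K) : S.LO K 1 0 fun μ s y => y.2 - S.η (S.slow μ s) := by
  refine ⟨K + 1, by positivity, 1, one_pos, le_rfl, fun μ s hμ _ => ⟨fun y hy => ?_, ?_⟩⟩
  · rw [pow_one]; exact hy.2.trans (by nlinarith)
  · intro y₁ _ y₂ _
    have : |y₁.2 - y₂.2| ≤ ‖y₁ - y₂‖ := norm_snd_le (y₁ - y₂)
    rw [pow_zero, mul_one, sub_sub_sub_cancel_right]
    nlinarith [norm_nonneg (y₁ - y₂)]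

theorem exists_half {g : ℝ → ℝ → ℝ × ℝ → ℝ} (H : S.LO K 0 0 g) :
    ∃ μ₀ > 0, μ₀ ≤ 1 ∧ ∀ μ s, 0 < μ → μ < μ₀ → ∀ y ∈ S.tube K μ s,
      1 / 2 ≤ 1 + μ ^ 2 * g μ s y := by
  obtain ⟨C, hC, μ₀, hμ₀, hμ₁, H⟩ := H
  refine ⟨min μ₀ (1 / (2 * C)), lt_min hμ₀ (by positivity), (min_le_left _ _).trans hμ₁,
    fun μ s hμ hμ' y hy => ?_⟩
  have h1 := (H μ s hμ (hμ'.trans_le (min_le_left _ _))).1 y hy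
  rw [pow_zero, mul_one] at h1
  have h2 : μ < 1 / (2 * C) := hμ'.trans_le (min_le_right _ _)
  have h3 : μ ≤ 1 := hμ'.le.trans ((min_le_left _ _).trans hμ₁)
  rw [lt_div_iff₀ (by positivity)] at h2
  have h4 := (abs_le.1 h1).1
  nlinarith [mul_le_mul_of_nonneg_left h4 (sq_nonneg μ), mul_pos hμ hC]

theorem inv_one_add {g : ℝ → ℝ → ℝ × ℝ → ℝ} (H : S.LO K 0 0 g) :
    S.LO K 0 0 fun μ s y => (1 + μ ^ 2 * g μ s y)⁻¹ := by
  obtain ⟨μ₁, hμ₁, hμ₁', hh⟩ := exists_half H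
  obtain ⟨C, hC, μ₀, hμ₀, hμ₀', H⟩ := H
  refine ⟨2 + 4 * C, by positivity, min μ₀ μ₁, lt_min hμ₀ hμ₁, (min_le_left _ _).trans hμ₀',
    fun μ s hμ hμ' => ?_⟩
  have hle : μ ≤ 1 := hμ'.le.trans ((min_le_left _ _).trans hμ₀')
  have hh' := hh μ s hμ (hμ'.trans_le (min_le_right _ _))
  have H' := H μ s hμ (hμ'.trans_le (min_le_left _ _))
  have hpos : ∀ y ∈ S.tube K μ s, 0 < 1 + μ ^ 2 * g μ s y := fun y hy => by linarith [hh' y hy]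
  have hinv : ∀ y ∈ S.tube K μ s, |(1 + μ ^ 2 * g μ s y)⁻¹| ≤ 2 := fun y hy => by
    rw [abs_of_pos (inv_pos.2 (hpos y hy)), inv_le_comm₀ (hpos y hy) two_pos]
    linarith [hh' y hy]
  refine ⟨fun y hy => (hinv y hy).trans (by rw [pow_zero]; linarith), fun y₁ h₁ y₂ h₂ => ?_⟩
  have e : (1 + μ ^ 2 * g μ s y₁)⁻¹ - (1 + μ ^ 2 * g μ s y₂)⁻¹
      = (1 + μ ^ 2 * g μ s y₁)⁻¹ * (1 + μ ^ 2 * g μ s y₂)⁻¹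
        * (-(μ ^ 2) * (g μ s y₁ - g μ s y₂)) := by
    have := (hpos y₁ h₁).ne'
    have := (hpos y₂ h₂).ne'
    field_simp
    ring
  rw [e, abs_mul, abs_mul, abs_mul, abs_neg, abs_of_nonneg (sq_nonneg μ)]
  have h3 := H'.2 y₁ h₁ y₂ h₂
  have h4 := mul_le_mul (hinv y₁ h₁) (hinv y₂ h₂) (abs_nonneg _) two_pos.le
  have h5 : μ ^ 2 * |g μ s y₁ - g μ s y₂| ≤ C * ‖y₁ - y₂‖ := by
    have : μ ^ 2 ≤ 1 := pow_le_one₀ hμ.le hle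
    calc _ ≤ 1 * |g μ s y₁ - g μ s y₂| := mul_le_mul_of_nonneg_right this (abs_nonneg _)
      _ ≤ _ := by rw [one_mul]; simpa using h3
  calc _ ≤ 2 * 2 * (C * ‖y₁ - y₂‖) := mul_le_mul h4 h5 (by positivity) (by norm_num)
    _ ≤ _ := by rw [pow_zero]; nlinarith [norm_nonneg (y₁ - y₂)]

theorem mu_sq (n : ℕ) : S.LO K 2 n fun μ _ _ => μ ^ 2 :=
  of_bound (C := 1) n fun μ s h => by rw [one_mul, abs_of_pos (by positivity)]

theorem eventually_congr {μ₁ : ℝ} (hμ₁ : 0 < μ₁) (H : S.LO K m n h₁)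
    (h : ∀ μ s, 0 < μ → μ < μ₁ → ∀ y ∈ S.tube K μ s, h₂ μ s y = h₁ μ s y) : S.LO K m n h₂ := by
  obtain ⟨C, hC, μ₀, hμ₀, hμ₀', H⟩ := H
  refine ⟨C, hC, min μ₀ μ₁, lt_min hμ₀ hμ₁, (min_le_left _ _).trans hμ₀', fun μ s hμ hμ' => ?_⟩
  have h' := h μ s hμ (hμ'.trans_le (min_le_right _ _))
  have H' := H μ s hμ (hμ'.trans_le (min_le_left _ _))
  refine ⟨fun y hy => ?_, fun y₁ hy₁ y₂ hy₂ => ?_⟩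
  · rw [h' y hy]; exact H'.1 y hy
  · rw [h' y₁ hy₁, h' y₂ hy₂]; exact H'.2 y₁ hy₁ y₂ hy₂

theorem div_sub {a g : ℝ → ℝ → ℝ × ℝ → ℝ} (Ha : S.LO K 0 0 a) (Hg : S.LO K 0 0 g) :
    S.LO K 2 2 fun μ s y => a μ s y / (1 + μ ^ 2 * g μ s y) - a μ s y := by
  obtain ⟨μ₁, hμ₁, -, hh⟩ := exists_half Hg
  have h1 : S.LO K 2 2 fun μ s y =>
      μ ^ 2 * (-(a μ s y * g μ s y * (1 + μ ^ 2 * g μ s y)⁻¹)) :=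
    (mu_sq 2).mul (m₂ := 0) (n₂ := 0) (((Ha.mul (m := 0) (n := 0) Hg (by simp) (by simp)
      (by simp)).mul (inv_one_add Hg) (by simp) (by simp) (by simp)).neg) (by simp) (by simp) (by simp)
  refine eventually_congr hμ₁ h1 fun μ s hμ hμ' y hy => ?_
  have : 1 + μ ^ 2 * g μ s y ≠ 0 := by linarith [hh μ s hμ hμ' y hy]
  field_simp
  ring

/-- Two terms of the geometric series of 1/(1 + μ²g). The remainder has order μ⁴; order 3 is all
that is needed. -/
theorem div_sub_add {a g : ℝ → ℝ → ℝ × ℝ → ℝ} (Ha : S.LO K 0 0 a) (Hg : S.LO K 0 0 g) :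
    S.LO K 3 3 fun μ s y =>
      a μ s y / (1 + μ ^ 2 * g μ s y) - a μ s y + μ ^ 2 * (a μ s y * g μ s y) := by
  obtain ⟨μ₁, hμ₁, -, hh⟩ := exists_half Hg
  have h0 : S.LO K 0 0 fun μ s y => a μ s y * g μ s y * g μ s y * (1 + μ ^ 2 * g μ s y)⁻¹ :=
    ((Ha.mul (m := 0) (n := 0) Hg (by simp) (by simp) (by simp)).mul (m := 0) (n := 0) Hg
      (by simp) (by simp) (by simp)).mul (inv_one_add Hg) (by simp) (by simp) (by simp)
  have h1 : S.LO K 3 3 fun μ s y => μ ^ 2 * (μ ^ 2 *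
      (a μ s y * g μ s y * g μ s y * (1 + μ ^ 2 * g μ s y)⁻¹)) :=
    (mu_sq 3).mul (m₂ := 2) (n₂ := 2) ((mu_sq 2).mul h0 (by simp) (by simp) (by simp))
      (by simp) (by simp) (by simp)
  refine eventually_congr hμ₁ h1 fun μ s hμ hμ' y hy => ?_
  have : 1 + μ ^ 2 * g μ s y ≠ 0 := by linarith [hh μ s hμ hμ' y hy]
  field_simp
  ring

end LO

end PhaseSystem

/-! ### Expansion of the right-hand side on tubes -/

/-- The derivative of the second order remainder of the sine is −l times the first order remainder
of the cosine, which is O(r²). This gives the Lipschitz constant as well as the size. -/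
theorem sin_taylor_remainder (θ l : ℝ) {r x₁ x₂ : ℝ} (h₁ : |x₁| ≤ r) (h₂ : |x₂| ≤ r) :
    |(sin (θ - l * x₁) - sin θ + l * x₁ * cos θ + l ^ 2 * x₁ ^ 2 / 2 * sin θ)
      - (sin (θ - l * x₂) - sin θ + l * x₂ * cos θ + l ^ 2 * x₂ ^ 2 / 2 * sin θ)|
      ≤ |l| ^ 3 * r ^ 2 * |x₁ - x₂| := by
  have hr : 0 ≤ r := (abs_nonneg _).trans h₁
  have hlin : ∀ x : ℝ, HasDerivAt (fun x => θ - l * x) (-l) x := fun x => by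
    simpa using ((hasDerivAt_id x).const_mul l).const_sub θ
  have hcos : ∀ x, |x| ≤ r → |cos (θ - l * x) - cos θ - l * x * sin θ| ≤ |l| ^ 2 * r ^ 2 := by
    intro x hx
    have h0r : ∀ z ∈ Set.uIcc x 0, |z| ≤ r := fun z hz => by
      have := abs_sub_le_of_mem_uIcc (Jr := 0) (r := r) (by simpa using hx) (by simpa using hr) hz
      simpa using this
    have h := abs_image_sub_le_of_deriv (x := x) (y := 0) (C := |l| ^ 2 * r)
      (f := fun x => cos (θ - l * x) - l * x * sin θ)
      (f' := fun x => -sin (θ - l * x) * (-l) - l * sin θ)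
      (fun z _ => by
        have h1 := (hlin z).cos
        have h2 := ((hasDerivAt_id z).const_mul l).mul_const (sin θ)
        simpa using h1.fun_sub h2)
      (fun z hz => by
        have e : -sin (θ - l * z) * (-l) - l * sin θ = l * (sin (θ - l * z) - sin θ) := by ring
        rw [e, abs_mul]
        have h3 := abs_sin_sub_sin_le (θ - l * z) θ
        have e2 : θ - l * z - θ = -(l * z) := by ring
        rw [e2, abs_neg, abs_mul] at h3
        have h4 := mul_le_mul_of_nonneg_left (h0r z hz) (abs_nonneg l)
        have h5 := mul_le_mul_of_nonneg_left (h3.trans h4) (abs_nonneg l)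
        exact h5.trans_eq (by ring))
    have e3 : cos (θ - l * x) - cos θ - l * x * sin θ
        = (cos (θ - l * x) - l * x * sin θ) - (cos (θ - l * 0) - l * 0 * sin θ) := by simp; ring
    rw [e3]
    refine h.trans ?_
    rw [sub_zero]
    have := mul_le_mul_of_nonneg_left hx (by positivity : 0 ≤ |l| ^ 2 * r)
    exact this.trans_eq (by ring)
  refine abs_image_sub_le_of_deriv (x := x₁) (y := x₂)
    (f := fun x => sin (θ - l * x) - sin θ + l * x * cos θ + l ^ 2 * x ^ 2 / 2 * sin θ)
    (f' := fun x => -l * (cos (θ - l * x) - cos θ - l * x * sin θ)) (fun z _ => ?_) (fun z hz => ?_)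
  · have h1 := (hlin z).sin
    have h2 := ((hasDerivAt_id z).const_mul l).mul_const (cos θ)
    have h3 := (((hasDerivAt_pow 2 z).const_mul (l ^ 2)).div_const 2).mul_const (sin θ)
    have h4 := ((h1.sub_const (sin θ)).fun_add h2).fun_add h3
    refine h4.congr_deriv ?_
    push_cast
    ring
  · have hz' : |z| ≤ r := by
      have := abs_sub_le_of_mem_uIcc (Jr := 0) (r := r) (by simpa using h₁) (by simpa using h₂) hz
      simpa using this
    rw [abs_mul, abs_neg]
    exact (mul_le_mul_of_nonneg_left (hcos z hz') (abs_nonneg l)).trans_eq (by ring)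

theorem IsSlow.lipschitz {T : ℝ} {α : ℝ → ℝ} (h : IsSlow T α) (hT : 0 < T) :
    ∃ L > 0, ∀ x y, |α x - α y| ≤ L * |x - y| := by
  obtain ⟨C, hC⟩ := h.deriv.bounded hT
  refine ⟨|C| + 1, by positivity, fun x y => ?_⟩
  exact abs_image_sub_le_of_deriv (fun z _ => h.hasDerivAt z)
    fun z _ => (hC z).trans ((le_abs_self C).trans (by linarith))

namespace PhaseSystem

variable {S : PhaseSystem} {K : ℝ}

/-- The two slow times differ by μ²cφ, and φ is bounded on a tube. -/
theorem LO.slow_shift (hS : S.Regular) (hK : 0 ≤ K) {α : ℝ → ℝ} (hα : IsSlow S.Ts α) :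
    S.LO K 2 2 fun μ s y => α (μ ^ 2 * S.c * (s - y.2)) - α (S.slow μ s) := by
  obtain ⟨L, hL, hlip⟩ := hα.lipschitz hS.Ts_pos
  obtain ⟨C, hC⟩ := hS.hη.bounded hS.Ts_pos
  have hC0 : 0 ≤ C := (abs_nonneg _).trans (hC 0)
  have hc := hS.c_pos
  refine ⟨L * S.c * (C + K + 1), by positivity, 1, one_pos, le_rfl, fun μ s hμ hμ' =>
    ⟨fun y hy => ?_, fun y₁ hy₁ y₂ hy₂ => ?_⟩⟩
  · have hy2 : |y.2| ≤ C + K + 1 := by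
      have h1 : |y.2| ≤ |y.2 - S.η (S.slow μ s)| + |S.η (S.slow μ s)| := by
        simpa using abs_add_le (y.2 - S.η (S.slow μ s)) (S.η (S.slow μ s))
      have h2 := hy.2
      have h3 := hC (S.slow μ s)
      nlinarith
    refine (hlip _ _).trans ?_
    have e : μ ^ 2 * S.c * (s - y.2) - S.slow μ s = -(μ ^ 2 * S.c * y.2) := by
      unfold slow; ring
    rw [e, abs_neg, abs_mul, abs_of_nonneg (by positivity : 0 ≤ μ ^ 2 * S.c)]
    calc _ ≤ L * (μ ^ 2 * S.c * (C + K + 1)) := by gcongr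
      _ = _ := by ring
  · rw [sub_sub_sub_cancel_right]
    refine (hlip _ _).trans ?_
    have e : μ ^ 2 * S.c * (s - y₁.2) - μ ^ 2 * S.c * (s - y₂.2)
        = -(μ ^ 2 * S.c * (y₁.2 - y₂.2)) := by ring
    rw [e, abs_neg, abs_mul, abs_of_nonneg (by positivity : 0 ≤ μ ^ 2 * S.c)]
    have h1 : |y₁.2 - y₂.2| ≤ ‖y₁ - y₂‖ := norm_snd_le (y₁ - y₂)
    calc _ ≤ L * (μ ^ 2 * S.c * ‖y₁ - y₂‖) := by gcongr
      _ = L * S.c * 1 * μ ^ 2 * ‖y₁ - y₂‖ := by ring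
      _ ≤ _ := by gcongr; linarith

theorem LO.sin_remainder (hK : 0 ≤ K) (θ : ℝ → ℝ → ℝ) (l : ℝ) :
    S.LO K 2 2 fun μ s y => sin (θ μ s - l * (y.2 - S.η (S.slow μ s))) - sin (θ μ s)
      + l * (y.2 - S.η (S.slow μ s)) * cos (θ μ s)
      + l ^ 2 * (y.2 - S.η (S.slow μ s)) ^ 2 / 2 * sin (θ μ s) := by
  refine ⟨|l| ^ 3 * K ^ 2 * (K + 1) + 1, by positivity, 1, one_pos, le_rfl, fun μ s hμ hμ' =>
    ⟨fun y hy => ?_, fun y₁ hy₁ y₂ hy₂ => ?_⟩⟩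
  · have h := sin_taylor_remainder (θ μ s) l (r := K * μ) hy.2 (x₂ := 0)
      (by simp; positivity)
    simp only [mul_zero, sub_zero, sub_self, zero_mul, add_zero, ne_eq, OfNat.ofNat_ne_zero,
      not_false_eq_true, zero_pow, zero_div] at h
    refine h.trans ?_
    have h2 := mul_le_mul_of_nonneg_left hy.2 (by positivity : 0 ≤ |l| ^ 3 * (K * μ) ^ 2)
    refine h2.trans ?_
    calc |l| ^ 3 * (K * μ) ^ 2 * (K * μ) = |l| ^ 3 * K ^ 2 * K * μ * μ ^ 2 := by ring
      _ ≤ |l| ^ 3 * K ^ 2 * K * 1 * μ ^ 2 := by gcongr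
      _ ≤ (|l| ^ 3 * K ^ 2 * (K + 1) + 1) * μ ^ 2 := by
        gcongr
        nlinarith [(by positivity : 0 ≤ |l| ^ 3 * K ^ 2)]
  · have h := sin_taylor_remainder (θ μ s) l (r := K * μ) hy₁.2 hy₂.2
    refine h.trans ?_
    have h1 : |y₁.2 - y₂.2| ≤ ‖y₁ - y₂‖ := norm_snd_le (y₁ - y₂)
    rw [sub_sub_sub_cancel_right]
    calc _ ≤ |l| ^ 3 * (K * μ) ^ 2 * ‖y₁ - y₂‖ := by gcongr
      _ = |l| ^ 3 * K ^ 2 * μ ^ 2 * ‖y₁ - y₂‖ := by ring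
      _ ≤ _ := by
        gcongr
        nlinarith [(by positivity : 0 ≤ |l| ^ 3 * K ^ 2), (by positivity : 0 ≤ |l| ^ 3 * K ^ 2 * K)]

theorem LO.of_slow {α : ℝ → ℝ} (hS : S.Regular) (hα : IsSlow S.Ts α) (n : ℕ) :
    S.LO K 0 n fun μ s _ => α (S.slow μ s) := by
  obtain ⟨C, hC⟩ := hα.bounded hS.Ts_pos
  exact LO.of_bound (C := C) n fun μ s _ => by simpa using hC _

/-- Expansion of the force on tubes. -/
theorem LO.u_sub (hS : S.Regular) (hK : 0 ≤ K) :
    S.LO K 2 2 fun μ s y => S.u μ s y - S.u₀ s (S.slow μ s)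
      - S.u₀' s (S.slow μ s) * (y.2 - S.η (S.slow μ s))
      - S.u₀'' s (S.slow μ s) / 2 * (y.2 - S.η (S.slow μ s)) ^ 2 := by
  have hsin : S.LO K 0 0 fun μ s y => sin (S.lam * (s - y.2)) := by
    refine ⟨|S.lam| + 1, by positivity, 1, one_pos, le_rfl, fun μ s hμ hμ' =>
      ⟨fun y _ => ?_, fun y₁ _ y₂ _ => ?_⟩⟩
    · rw [pow_zero, mul_one]; exact (abs_sin_le_one _).trans (by linarith [abs_nonneg S.lam])
    · refine (abs_sin_sub_sin_le _ _).trans ?_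
      have e : S.lam * (s - y₁.2) - S.lam * (s - y₂.2) = -(S.lam * (y₁.2 - y₂.2)) := by ring
      have h1 : |y₁.2 - y₂.2| ≤ ‖y₁ - y₂‖ := norm_snd_le (y₁ - y₂)
      rw [e, abs_neg, abs_mul, pow_zero, mul_one]
      exact mul_le_mul (by linarith) h1 (abs_nonneg _) (by positivity)
  have hcos : S.LO K 0 0 fun μ s y => cos (S.lam * (s - y.2)) := by
    refine ⟨|S.lam| + 1, by positivity, 1, one_pos, le_rfl, fun μ s hμ hμ' =>
      ⟨fun y _ => ?_, fun y₁ _ y₂ _ => ?_⟩⟩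
    · rw [pow_zero, mul_one]; exact (abs_cos_le_one _).trans (by linarith [abs_nonneg S.lam])
    · simp only [← sin_add_pi_div_two]
      refine (abs_sin_sub_sin_le _ _).trans ?_
      have e : S.lam * (s - y₁.2) + π / 2 - (S.lam * (s - y₂.2) + π / 2)
          = -(S.lam * (y₁.2 - y₂.2)) := by ring
      have h1 : |y₁.2 - y₂.2| ≤ ‖y₁ - y₂‖ := norm_snd_le (y₁ - y₂)
      rw [e, abs_neg, abs_mul, pow_zero, mul_one]
      exact mul_le_mul (by linarith) h1 (abs_nonneg _) (by positivity)
  have r1 := LO.sin_remainder (S := S) hK (fun μ s => S.lam * (s - S.η (S.slow μ s))) S.lam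
  -- The cosine is treated as a sine shifted by π/2.
  have r2 := LO.sin_remainder (S := S) hK
    (fun μ s => S.lam * (s - S.η (S.slow μ s)) + π / 2) S.lam
  have t1 := (LO.slow_shift hS hK hS.hP).mul (m := 2) (n := 2) hsin (by simp) (by simp) (by simp)
  have t2 := (LO.slow_shift hS hK hS.hQ).mul (m := 2) (n := 2) hcos (by simp) (by simp) (by simp)
  have t3 := LO.slow_shift hS hK hS.hR
  have t4 := (LO.of_slow (K := K) hS hS.hP 2).mul (m := 2) (n := 2) r1 (by simp) (by simp) (by simp)
  have t5 := (LO.of_slow (K := K) hS hS.hQ 2).mul (m := 2) (n := 2) r2 (by simp) (by simp) (by simp)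
  refine ((((t1.add t2).add t3).add t4).add t5).congr fun μ s y => ?_
  have e1 : S.lam * (s - S.η (S.slow μ s)) - S.lam * (y.2 - S.η (S.slow μ s))
      = S.lam * (s - y.2) := by ring
  have e2 : S.lam * (s - S.η (S.slow μ s)) + π / 2 - S.lam * (y.2 - S.η (S.slow μ s))
      = S.lam * (s - y.2) + π / 2 := by ring
  simp only [e1, e2, sin_add_pi_div_two, cos_add_pi_div_two, u, u₀, u₀', u₀'', force]
  ring

/-- Dependence of the coefficients on the impulse. -/
theorem LO.coeff_sub (hK : 0 ≤ K) (hJ : 0 < S.Jr) {h : ℝ → ℝ → ℝ} {h' : ℝ → ℝ} {C : ℝ}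
    (H : HasExpansion S.Jr h h' C) :
    S.LO K 3 3 fun μ s y => h s (S.Jr + μ * y.1) - h s S.Jr - h' s * (μ * y.1) := by
  have hC := H.pos
  refine ⟨2 * C * (K + 1) ^ 2, by positivity, min 1 (S.Jr / (2 * (K + 1))), by positivity,
    min_le_left _ _, fun μ s hμ hμ' => ?_⟩
  have hμ1 : μ ≤ 1 := hμ'.le.trans (min_le_left _ _)
  have hμ2 : μ * (2 * (K + 1)) < S.Jr := by
    have := hμ'.trans_le (min_le_right _ _)
    rwa [lt_div_iff₀ (by positivity)] at this
  have hz : ∀ y ∈ S.tube K μ s, |S.Jr + μ * y.1 - S.Jr| ≤ (K + 1) * μ ^ 2 := fun y hy => by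
    rw [add_sub_cancel_left, abs_mul, abs_of_pos hμ]
    have := mul_le_mul_of_nonneg_left hy.1 hμ.le
    nlinarith [sq_nonneg μ]
  have hz' : ∀ y ∈ S.tube K μ s, |S.Jr + μ * y.1 - S.Jr| ≤ S.Jr / 2 := fun y hy => by
    refine (hz y hy).trans ?_
    have : (K + 1) * μ ^ 2 ≤ (K + 1) * (μ * 1) := by rw [sq]; gcongr
    linarith
  have hself : |S.Jr - S.Jr| ≤ S.Jr / 2 := by simp; linarith
  refine ⟨fun y hy => ?_, fun y₁ hy₁ y₂ hy₂ => ?_⟩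
  · have h1 := H.exp s _ _ (hz' y hy) hself
    rw [sub_self, abs_zero, add_zero] at h1
    have e : h' s * (S.Jr + μ * y.1 - S.Jr) = h' s * (μ * y.1) := by ring
    rw [e] at h1
    refine h1.trans ?_
    have h2 := hz y hy
    calc _ ≤ C * ((K + 1) * μ ^ 2) * ((K + 1) * μ ^ 2) := by gcongr
      _ = C * (K + 1) ^ 2 * μ * μ ^ 3 := by ring
      _ ≤ C * (K + 1) ^ 2 * 1 * μ ^ 3 := by gcongr
      _ ≤ _ := by nlinarith [(by positivity : 0 ≤ C * (K + 1) ^ 2 * μ ^ 3)]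
  · have h1 := H.exp s _ _ (hz' y₁ hy₁) (hz' y₂ hy₂)
    have e : h s (S.Jr + μ * y₁.1) - h s S.Jr - h' s * (μ * y₁.1)
        - (h s (S.Jr + μ * y₂.1) - h s S.Jr - h' s * (μ * y₂.1))
        = h s (S.Jr + μ * y₁.1) - h s (S.Jr + μ * y₂.1)
          - h' s * (S.Jr + μ * y₁.1 - (S.Jr + μ * y₂.1)) := by ring
    rw [e]
    refine h1.trans ?_
    have e2 : S.Jr + μ * y₁.1 - (S.Jr + μ * y₂.1) = μ * (y₁.1 - y₂.1) := by ring
    rw [e2, abs_mul, abs_of_pos hμ]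
    have h3 : |y₁.1 - y₂.1| ≤ ‖y₁ - y₂‖ := norm_fst_le (y₁ - y₂)
    have h4 := hz y₁ hy₁
    have h5 := hz y₂ hy₂
    calc _ ≤ C * ((K + 1) * μ ^ 2 + (K + 1) * μ ^ 2) * (μ * ‖y₁ - y₂‖) := by gcongr
      _ = 2 * C * (K + 1) * μ ^ 3 * ‖y₁ - y₂‖ := by ring
      _ ≤ _ := by
        gcongr
        nlinarith

theorem LO.of_bounded {e : ℝ → ℝ → ℝ} {C : ℝ} (he : ∀ s σ, |e s σ| ≤ C) (n : ℕ) :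
    S.LO K 0 n fun μ s _ => e s (S.slow μ s) :=
  LO.of_bound (C := C) n fun μ s _ => by simpa using he _ _

theorem LO.coeff_sub' (hK : 0 ≤ K) (hJ : 0 < S.Jr) {h : ℝ → ℝ → ℝ} {h' : ℝ → ℝ} {C : ℝ}
    (H : HasExpansion S.Jr h h' C) :
    S.LO K 2 1 fun μ s y => h s (S.Jr + μ * y.1) - h s S.Jr := by
  have h1 := (LO.coeff_sub hK hJ H).mono (m := 2) (n := 1) (by simp) (by simp)
  have h2 : S.LO K 2 1 fun μ s y => h' s * (μ * y.1) :=
    (LO.of_bounded (e := fun s _ => h' s) (fun s _ => H.bound' s) 1).mul (m₂ := 2) (n₂ := 1)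
      ((LO.mu 2).mul (LO.fst hK) (by simp) (by simp) (by simp)) (by simp) (by simp) (by simp)
  exact (h1.add h2).congr fun μ s y => by ring

theorem LO.coeff (hK : 0 ≤ K) (hJ : 0 < S.Jr) {h : ℝ → ℝ → ℝ} {h' : ℝ → ℝ} {C : ℝ}
    (H : HasExpansion S.Jr h h' C) : S.LO K 0 0 fun μ s y => h s (S.Jr + μ * y.1) := by
  have h1 := (LO.coeff_sub' hK hJ H).mono (m := 0) (n := 0) (by simp) (by simp)
  have h2 := LO.of_bounded (S := S) (K := K) (e := fun s _ => h s S.Jr) (C := C)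
    (fun s _ => H.bound s _ (by simp; linarith)) 0
  exact (h1.add h2).congr fun μ s y => by ring

theorem Regular.isFast (hS : S.Regular) {H : ℝ → ℝ → ℝ}
    (h : ContDiffOn ℝ ∞ (Function.uncurry H) impulseDomain) :
    IsFast S.Tf fun s => H (saw s) S.Jr := by
  obtain ⟨n, m, hn, hTf, -⟩ := hS.fast
  exact isFast_saw hTf (continuous_slice h hS.Jr_pos)

theorem Regular.Tf_pos (hS : S.Regular) : 0 < S.Tf := by
  obtain ⟨n, m, hn, hTf, -⟩ := hS.fast
  rw [hTf]
  have : (0 : ℝ) < n := by exact_mod_cast hn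
  positivity

theorem Regular.isFast_sin (hS : S.Regular) : IsFast S.Tf fun s => sin (S.lam * s) := by
  obtain ⟨n, m, hn, hTf, hm⟩ := hS.fast
  refine IsFast.of_continuous hS.Tf_pos (fun s => ?_) (by fun_prop)
  rw [mul_add, hm, mul_comm (2 * π) (m : ℝ)]
  exact sin_add_int_mul_two_pi _ m

theorem Regular.isFast_cos (hS : S.Regular) : IsFast S.Tf fun s => cos (S.lam * s) := by
  obtain ⟨n, m, hn, hTf, hm⟩ := hS.fast
  refine IsFast.of_continuous hS.Tf_pos (fun s => ?_) (by fun_prop)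
  rw [mul_add, hm, mul_comm (2 * π) (m : ℝ)]
  exact cos_add_int_mul_two_pi _ m

theorem Regular.isSep_sin (hS : S.Regular) : IsSep S.Tf S.Ts fun s σ => sin (S.lam * (s - S.η σ)) := by
  have h1 := (IsSep.of_fast (Ts := S.Ts) hS.isFast_sin).mul
    (IsSep.of_slow (Tf := S.Tf) (hS.hη.comp (f := fun x => cos (S.lam * x)) (by fun_prop)))
  have h2 := (IsSep.of_fast (Ts := S.Ts) hS.isFast_cos).mul
    (IsSep.of_slow (Tf := S.Tf) (hS.hη.comp (f := fun x => -sin (S.lam * x)) (by fun_prop)))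
  have h3 := h1.add h2
  convert h3 using 3 with s σ
  rw [mul_sub, sin_sub]; ring

theorem Regular.isSep_cos (hS : S.Regular) : IsSep S.Tf S.Ts fun s σ => cos (S.lam * (s - S.η σ)) := by
  have h1 := (IsSep.of_fast (Ts := S.Ts) hS.isFast_cos).mul
    (IsSep.of_slow (Tf := S.Tf) (hS.hη.comp (f := fun x => cos (S.lam * x)) (by fun_prop)))
  have h2 := (IsSep.of_fast (Ts := S.Ts) hS.isFast_sin).mul
    (IsSep.of_slow (Tf := S.Tf) (hS.hη.comp (f := fun x => sin (S.lam * x)) (by fun_prop)))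
  have h3 := h1.add h2
  convert h3 using 3 with s σ
  rw [mul_sub, cos_sub]

theorem Regular.isSep_u₀ (hS : S.Regular) : IsSep S.Tf S.Ts S.u₀ :=
  (((IsSep.of_slow hS.hP).mul hS.isSep_sin).add ((IsSep.of_slow hS.hQ).mul hS.isSep_cos)).add
    (IsSep.of_slow hS.hR)

theorem Regular.isSep_u₀' (hS : S.Regular) : IsSep S.Tf S.Ts S.u₀' := by
  have h := (IsSep.of_slow (Tf := S.Tf) (IsSlow.const (T := S.Ts) S.lam)).mul
    (((IsSep.of_slow hS.hQ).mul hS.isSep_sin).add ((IsSep.of_slow hS.hP.neg).mul hS.isSep_cos))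
  convert h using 3 with s σ
  rw [u₀']; ring

theorem Regular.isSep_u₀'' (hS : S.Regular) : IsSep S.Tf S.Ts S.u₀'' :=
  (IsSep.of_slow (Tf := S.Tf) (IsSlow.const (T := S.Ts) (-S.lam ^ 2))).mul
    (((IsSep.of_slow hS.hP).mul hS.isSep_sin).add ((IsSep.of_slow hS.hQ).mul hS.isSep_cos))

theorem Regular.isSep_A₀ (hS : S.Regular) : IsSep S.Tf S.Ts S.A₀ :=
  ((IsSep.of_fast (hS.isFast hS.hH₁)).mul hS.isSep_u₀).add (IsSep.of_fast (hS.isFast hS.hH₀))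

theorem Regular.isSep_A' (hS : S.Regular) : IsSep S.Tf S.Ts S.A' :=
  (IsSep.of_fast (hS.isFast hS.hH₁)).mul hS.isSep_u₀'

theorem Regular.isSep_A'' (hS : S.Regular) : IsSep S.Tf S.Ts S.A'' :=
  (IsSep.of_fast (hS.isFast hS.hH₁)).mul hS.isSep_u₀''

theorem Regular.isSep_B (hS : S.Regular) : IsSep S.Tf S.Ts S.B :=
  ((IsSep.of_fast (hS.isFast (contDiffOn_partialJ hS.hH₁))).mul hS.isSep_u₀).add
    (IsSep.of_fast (hS.isFast (contDiffOn_partialJ hS.hH₀)))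

theorem Regular.isSep_G₀ (hS : S.Regular) : IsSep S.Tf S.Ts S.G₀ :=
  ((IsSep.of_fast (hS.isFast hS.hM₁)).mul hS.isSep_u₀).add (IsSep.of_fast (hS.isFast hS.hM₀))

theorem Regular.isSep_E (hS : S.Regular) : IsSep S.Tf S.Ts S.E :=
  (IsSep.of_fast (hS.isFast hS.hM₁)).mul hS.isSep_u₀'

theorem LO.of_isSep (hS : S.Regular) {g : ℝ → ℝ → ℝ} (hg : IsSep S.Tf S.Ts g) (n : ℕ) :
    S.LO K 0 n fun μ s _ => g s (S.slow μ s) := by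
  obtain ⟨C, hC⟩ := hg.bounded hS.Ts_pos
  exact LO.of_bounded hC n

theorem LO.u_sub' (hS : S.Regular) (hK : 0 ≤ K) :
    S.LO K 2 1 fun μ s y => S.u μ s y - S.u₀ s (S.slow μ s)
      - S.u₀' s (S.slow μ s) * (y.2 - S.η (S.slow μ s)) := by
  have h1 := (LO.u_sub hS hK).mono (m := 2) (n := 1) (by simp) (by simp)
  have h2 : S.LO K 2 1 fun μ s y => (y.2 - S.η (S.slow μ s)) * (y.2 - S.η (S.slow μ s)) :=
    (LO.dev hK).mul (LO.dev hK) (by simp) (by simp) (by simp)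
  have h3 := ((LO.of_isSep hS hS.isSep_u₀'' 1).mul (m := 2) (n := 1) h2 (by simp) (by simp)
    (by simp)).mul (m := 2) (n := 1) (LO.const (1 / 2) 1) (by simp) (by simp) (by simp)
  exact (h1.add h3).congr fun μ s y => by ring

theorem LO.u_sub_zero (hS : S.Regular) (hK : 0 ≤ K) : S.LO K 1 0 fun μ s y => S.u μ s y - S.u₀ s (S.slow μ s) := by
  have h1 := (LO.u_sub' hS hK).mono (m := 1) (n := 0) (by simp) (by simp)
  have h2 := (LO.of_isSep hS hS.isSep_u₀' 0).mul (m := 1) (n := 0) (LO.dev hK) (by simp) (by simp)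
    (by simp)
  exact (h1.add h2).congr fun μ s y => by ring

theorem LO.u_bounded (hS : S.Regular) (hK : 0 ≤ K) : S.LO K 0 0 (S.u) := by
  have h1 := (LO.u_sub_zero hS hK).mono (m := 0) (n := 0) (by simp) (by simp)
  exact (h1.add (LO.of_isSep hS hS.isSep_u₀ 0)).congr fun μ s y => by ring

theorem LO.A_bounded (hS : S.Regular) (hK : 0 ≤ K) : S.LO K 0 0 S.A := by
  obtain ⟨C₁, h₁⟩ := hasExpansion_of_contDiffOn hS.Jr_pos hS.hH₁
  obtain ⟨C₀, h₀⟩ := hasExpansion_of_contDiffOn hS.Jr_pos hS.hH₀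
  exact ((LO.coeff hK hS.Jr_pos h₁).mul (LO.u_bounded hS hK) (by simp) (by simp) (by simp)).add
    (LO.coeff hK hS.Jr_pos h₀)

theorem LO.G_bounded (hS : S.Regular) (hK : 0 ≤ K) : S.LO K 0 0 S.G := by
  obtain ⟨C₁, h₁⟩ := hasExpansion_of_contDiffOn hS.Jr_pos hS.hM₁
  obtain ⟨C₀, h₀⟩ := hasExpansion_of_contDiffOn hS.Jr_pos hS.hM₀
  exact ((LO.coeff hK hS.Jr_pos h₁).mul (LO.u_bounded hS hK) (by simp) (by simp) (by simp)).add
    (LO.coeff hK hS.Jr_pos h₀)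

/-- Expansion of the first component of the right-hand side. -/
theorem LO.V_fst (hS : S.Regular) (hK : 0 ≤ K) :
    S.LO K 3 3 fun μ s y => (S.V μ s y).1 - μ * (S.A₀ s (S.slow μ s)
      + S.A' s (S.slow μ s) * (y.2 - S.η (S.slow μ s))
      + S.A'' s (S.slow μ s) / 2 * (y.2 - S.η (S.slow μ s)) ^ 2
      + μ * S.B s (S.slow μ s) * y.1) := by
  obtain ⟨C₁, h₁⟩ := hasExpansion_of_contDiffOn hS.Jr_pos hS.hH₁
  obtain ⟨C₀, h₀⟩ := hasExpansion_of_contDiffOn hS.Jr_pos hS.hH₀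
  have d1 := LO.div_sub (LO.A_bounded hS hK) (LO.G_bounded hS hK)
  have t1 : S.LO K 2 2 fun μ s y => S.H₁ (saw s) S.Jr * (S.u μ s y - S.u₀ s (S.slow μ s)
      - S.u₀' s (S.slow μ s) * (y.2 - S.η (S.slow μ s))
      - S.u₀'' s (S.slow μ s) / 2 * (y.2 - S.η (S.slow μ s)) ^ 2) :=
    (LO.of_isSep hS (IsSep.of_fast (Ts := S.Ts) (hS.isFast hS.hH₁)) 2).mul (LO.u_sub hS hK)
      (by simp) (by simp) (by simp)
  have t2 := (LO.coeff_sub hK hS.Jr_pos h₁).mul (m := 2) (n := 2) (LO.u_bounded hS hK)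
    (by simp) (by simp) (by simp)
  have t3 : S.LO K 2 2 fun μ s y => partialJ S.H₁ (saw s) S.Jr * (μ * y.1
      * (S.u μ s y - S.u₀ s (S.slow μ s))) :=
    (LO.of_isSep hS (IsSep.of_fast (Ts := S.Ts)
      (hS.isFast (contDiffOn_partialJ hS.hH₁))) 2).mul (m₂ := 3) (n₂ := 2)
      (((LO.mu 2).mul (m := 2) (n := 1) (LO.fst hK) (by simp) (by simp) (by simp)).mul
        (LO.u_sub_zero hS hK) (by simp) (by simp) (by simp)) (by simp) (by simp) (by simp)
  have t4 := (LO.coeff_sub hK hS.Jr_pos h₀).mono (m := 2) (n := 2) (by simp) (by simp)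
  -- All error terms in the bracket have order 2; the prefactor μ of the first equation supplies the
  -- third power.
  have t := (LO.mu (S := S) (K := K) 3).mul (m := 3) (n := 3)
    ((((d1.add t1).add t2).add t3).add t4) (by simp) (by simp) (by simp)
  refine t.congr fun μ s y => ?_
  simp only [V, A, A₀, A', A'', B]
  ring

/-- Expansion of the second component of the right-hand side. -/
theorem LO.V_snd (hS : S.Regular) (hK : 0 ≤ K) :
    S.LO K 3 3 fun μ s y => (S.V μ s y).2 - (S.d * μ * y.1 + μ ^ 2 * (S.G₀ s (S.slow μ s)
      + S.E s (S.slow μ s) * (y.2 - S.η (S.slow μ s)))) := by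
  obtain ⟨C₁, h₁⟩ := hasExpansion_of_contDiffOn hS.Jr_pos hS.hM₁
  obtain ⟨C₀, h₀⟩ := hasExpansion_of_contDiffOn hS.Jr_pos hS.hM₀
  obtain ⟨C₂, h₂⟩ := hasExpansion_of_contDiffOn hS.Jr_pos hS.hΘ
  -- The phase argument of Θ is a dummy, so its derivative in J does not depend on it.
  have hd : ∀ s, partialJ (fun _ => S.Θ) (saw s) S.Jr = S.d := by
    intro s
    have e1 := (hasDerivAt_partialJ hS.hΘ (saw s) hS.Jr_pos).deriv
    have e2 := (hasDerivAt_partialJ hS.hΘ 0 hS.Jr_pos).deriv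
    rw [d, ← e1, ← e2]
  have hΘ := LO.coeff hK hS.Jr_pos h₂
  have hΘ' := LO.coeff_sub' hK hS.Jr_pos h₂
  have h1Θ : S.LO K 0 0 fun μ s y => 1 + -S.Θ (S.Jr + μ * y.1) := (LO.const 1 0).add hΘ.neg
  have d1 := (LO.div_sub_add h1Θ (LO.G_bounded hS hK)).neg
  have d2 := LO.coeff_sub hK hS.Jr_pos h₂
  have g1 : S.LO K 2 1 fun μ s y => S.M₁ (saw s) S.Jr * (S.u μ s y - S.u₀ s (S.slow μ s)
      - S.u₀' s (S.slow μ s) * (y.2 - S.η (S.slow μ s))) :=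
    (LO.of_isSep hS (IsSep.of_fast (Ts := S.Ts) (hS.isFast hS.hM₁)) 1).mul (LO.u_sub' hS hK)
      (by simp) (by simp) (by simp)
  have g2 := (LO.coeff_sub' hK hS.Jr_pos h₁).mul (m := 2) (n := 1) (LO.u_bounded hS hK)
    (by simp) (by simp) (by simp)
  have g3 := LO.coeff_sub' hK hS.Jr_pos h₀
  have g4 := (hΘ'.mul (m := 2) (n := 1) (LO.G_bounded hS hK) (by simp) (by simp) (by simp)).neg
  have g5 := (LO.mu_sq (S := S) (K := K) 3).mul (m := 3) (n := 3) (((g1.add g2).add g3).add g4)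
    (by simp) (by simp) (by simp)
  refine ((d1.add d2).add g5).congr fun μ s y => ?_
  simp only [hd, hS.Θ_Jr, V, G, G₀, E]
  ring

end PhaseSystem

/-! ### Weights and correctors -/

theorem IsSlow.exists_primitive {T : ℝ} {α : ℝ → ℝ} (h : IsSlow T α) (hT : 0 < T)
    (h0 : fastMean T α = 0) : ∃ F, IsSlow T F ∧ ∀ σ, HasDerivAt F (α σ) σ := by
  have hc := h.smooth.continuous
  have hd : ∀ σ, HasDerivAt (fun σ => ∫ r in (0 : ℝ)..σ, α r) (α σ) σ := fun σ =>
    intervalIntegral.integral_hasDerivAt_right (hc.intervalIntegrable _ _)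
      hc.aestronglyMeasurable.stronglyMeasurableAtFilter hc.continuousAt
  have hzero : ∫ r in (0 : ℝ)..T, α r = 0 := by
    have := h0
    rw [fastMean, mul_eq_zero] at this
    exact this.resolve_left (inv_ne_zero hT.ne')
  refine ⟨fun σ => ∫ r in (0 : ℝ)..σ, α r, ⟨?_, fun σ => ?_⟩, hd⟩
  · rw [contDiff_infty_iff_deriv]
    refine ⟨fun σ => (hd σ).differentiableAt, ?_⟩
    have : _root_.deriv (fun σ => ∫ r in (0 : ℝ)..σ, α r) = α := funext fun σ => (hd σ).deriv
    rw [this]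
    exact h.smooth
  · have h1 := intervalIntegral.integral_add_adjacent_intervals
      (hc.intervalIntegrable (μ := volume) 0 σ) (hc.intervalIntegrable σ (σ + T))
    rw [← h1, h.periodic.intervalIntegral_add_eq σ 0, zero_add, hzero, add_zero]

theorem fastMean_const {T : ℝ} (hT : T ≠ 0) (c : ℝ) : fastMean T (fun _ => c) = c := by
  simp [fastMean, hT]

theorem fastMean_add {T : ℝ} {e₁ e₂ : ℝ → ℝ} (h₁ : IsFast T e₁) (h₂ : IsFast T e₂) :
    fastMean T (fun s => e₁ s + e₂ s) = fastMean T e₁ + fastMean T e₂ := by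
  simp only [fastMean]
  rw [intervalIntegral.integral_add (h₁.intervalIntegrable _ _) (h₂.intervalIntegrable _ _), mul_add]

theorem fastMean_const_mul {T : ℝ} (c : ℝ) (e : ℝ → ℝ) :
    fastMean T (fun s => c * e s) = c * fastMean T e := by
  simp only [fastMean]
  rw [intervalIntegral.integral_const_mul]
  ring

theorem IsSlow.isFast {T : ℝ} {α : ℝ → ℝ} (h : IsSlow T α) (hT : 0 < T) : IsFast T α :=
  IsFast.of_continuous hT h.periodic h.smooth.continuous

namespace PhaseSystem

variable (S : PhaseSystem)

/-- Mean over the fast phase. -/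
def mean (g : ℝ → ℝ → ℝ) (σ : ℝ) : ℝ := fastMean S.Tf fun s => g s σ

/-- The mean damping rate. -/
def rate : ℝ := fastMean S.Ts fun σ => S.mean S.B σ + S.mean S.E σ

/-- `mean_A₀` says that η solves the averaged phase equation; `ell` makes the averaged linear system
at order μ a center rather than a saddle. -/
structure Elliptic : Prop extends S.Regular where
  mean_A₀ : ∀ σ, S.mean S.A₀ σ = 0
  ell : ∀ σ, S.mean S.A' σ * S.d < 0

/-- Slowly varying coefficients of the energy form. -/
structure IsWeight (ρ α k p : ℝ → ℝ) : Prop where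
  hρ : IsSlow S.Ts ρ
  hα : IsSlow S.Ts α
  hk : IsSlow S.Ts k
  hp : IsSlow S.Ts p
  ρ_pos : ∀ σ, 0 < ρ σ
  α_pos : ∀ σ, 0 < α σ
  mean_A' : ∀ σ, S.mean S.A' σ = -(α σ * S.d)
  k_eq : ∀ σ, 3 * k σ * (-(α σ * S.d)) = ρ σ * S.mean S.A'' σ
  p_eq : ∀ σ, S.c * deriv ρ σ + 2 * ρ σ * S.mean S.B σ + 2 * S.d * p σ = S.rate * ρ σ
  ρα_eq : ∀ σ, S.c * deriv ρ σ * α σ + ρ σ * (S.c * deriv α σ) + 2 * ρ σ * α σ * S.mean S.E σ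
    + 2 * p σ * (-(α σ * S.d)) = S.rate * ρ σ * α σ

variable {S}

theorem Elliptic.d_ne (hS : S.Elliptic) : S.d ≠ 0 := by
  intro h
  have := hS.ell 0
  rw [h, mul_zero] at this
  exact lt_irrefl 0 this

/-- α is dictated by conservation of ζ² + αξ² in the averaged system. Adding `p_eq` times α to
`ρα_eq` eliminates p and leaves cρ'/ρ = rate − (mean B + mean E) − cα'/(2α). A periodic solution
exists exactly because `rate` is the mean of B + E. Then p and k are read off from their own
equations. -/
theorem Elliptic.exists_weight (hS : S.Elliptic) : ∃ ρ α k p, S.IsWeight ρ α k p := by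
  have hd := hS.d_ne
  have hc := hS.c_pos.ne'
  have mA' : IsSlow S.Ts (S.mean S.A') := hS.isSep_A'.fastMean_isSlow
  have mA'' : IsSlow S.Ts (S.mean S.A'') := hS.isSep_A''.fastMean_isSlow
  have mB : IsSlow S.Ts (S.mean S.B) := hS.isSep_B.fastMean_isSlow
  have mE : IsSlow S.Ts (S.mean S.E) := hS.isSep_E.fastMean_isSlow
  have mA'_ne : ∀ σ, S.mean S.A' σ ≠ 0 := fun σ h => by
    have := hS.ell σ
    rw [h, zero_mul] at this
    exact lt_irrefl 0 this
  set α : ℝ → ℝ := fun σ => S.mean S.A' σ * (-S.d⁻¹) with hαdef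
  have hα : IsSlow S.Ts α := mA'.mul (IsSlow.const _)
  have hαA : ∀ σ, S.mean S.A' σ = -(α σ * S.d) := fun σ => by
    simp only [hαdef]; field_simp
  have α_pos : ∀ σ, 0 < α σ := fun σ => by
    have h1 := hS.ell σ
    rw [hαA σ] at h1
    have h2 : 0 < S.d ^ 2 := by positivity
    nlinarith
  have hdiff : IsSlow S.Ts fun σ => S.c⁻¹ * (S.rate + -1 * (S.mean S.B σ + S.mean S.E σ)) :=
    (IsSlow.const _).mul ((IsSlow.const _).add ((IsSlow.const _).mul (mB.add mE)))
  -- The only place where the value of `rate` matters: it makes the integrand have mean zero, so Λ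
  -- is periodic.
  obtain ⟨Λ, hΛ, hΛ'⟩ := hdiff.exists_primitive hS.Ts_pos (by
    rw [fastMean_const_mul, fastMean_add (IsFast.const _)
      (((IsSlow.const _).mul (mB.add mE)).isFast hS.Ts_pos), fastMean_const hS.Ts_pos.ne',
      fastMean_const_mul, rate]
    ring)
  have hlog : IsSlow S.Ts fun σ => log (α σ) :=
    ⟨hα.smooth.log fun σ => (α_pos σ).ne', fun σ => by simp only [hα.periodic σ]⟩
  set ρ : ℝ → ℝ := fun σ => exp (Λ σ + (-(1 / 2)) * log (α σ)) with hρdef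
  have hρ : IsSlow S.Ts ρ := (hΛ.add ((IsSlow.const _).mul hlog)).comp contDiff_exp
  have ρ_pos : ∀ σ, 0 < ρ σ := fun σ => exp_pos _
  have hρ' : ∀ σ, deriv ρ σ = ρ σ * (S.c⁻¹ * (S.rate + -1 * (S.mean S.B σ + S.mean S.E σ))
      + (-(1 / 2)) * (deriv α σ / α σ)) := fun σ => by
    have h1 : HasDerivAt (fun σ => log (α σ)) (deriv α σ / α σ) σ :=
      (hα.hasDerivAt σ).log (α_pos σ).ne'
    exact (((hΛ' σ).fun_add (h1.const_mul (-(1 / 2)))).exp).deriv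
  refine ⟨ρ, α, fun σ => ρ σ * S.mean S.A'' σ * (3 * S.mean S.A' σ)⁻¹,
    fun σ => (S.rate * ρ σ - S.c * deriv ρ σ - 2 * (ρ σ * S.mean S.B σ)) * (2 * S.d)⁻¹,
    hρ, hα, (hρ.mul mA'').mul (((IsSlow.const 3).mul mA').inv fun σ =>
      mul_ne_zero three_ne_zero (mA'_ne σ)),
    ((((IsSlow.const _).mul hρ).sub ((IsSlow.const _).mul hρ.deriv)).sub
      ((IsSlow.const _).mul (hρ.mul mB))).mul (IsSlow.const _), ρ_pos, α_pos, hαA, ?_, ?_, ?_⟩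
  · intro σ
    rw [← hαA σ]
    have := mA'_ne σ
    field_simp
  · intro σ
    field_simp
    ring
  · intro σ
    have h1 := (α_pos σ).ne'
    rw [hρ' σ]
    field_simp
    ring

/-- A bounded function whose derivative along the slow time is `g` minus its mean, up to a term
proportional to the slow rate. -/
structure IsCorrector (S : PhaseSystem) (g : ℝ → ℝ → ℝ) (m : ℝ → ℝ) (U U' : ℝ → ℝ → ℝ) : Prop where
  bdd : ∃ C, ∀ s σ, |U s σ| ≤ C
  bdd' : ∃ C, ∀ s σ, |U' s σ| ≤ C
  cont : ∀ μ, Continuous fun s => U s (S.slow μ s)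
  hasDerivAt : ∀ μ, ∀ s ∉ jumpSet, HasDerivAt (fun s => U s (S.slow μ s))
    (g s (S.slow μ s) - m (S.slow μ s) + μ ^ 2 * U' s (S.slow μ s)) s

theorem Regular.exists_isCorrector (hS : S.Regular) {g : ℝ → ℝ → ℝ} (hg : IsSep S.Tf S.Ts g) :
    ∃ U U', IsSep S.Tf S.Ts U ∧ (∀ σ, S.mean U σ = 0) ∧ S.IsCorrector g (S.mean g) U U' := by
  obtain ⟨U, V, hU, hV, hU0, hUc, hUd⟩ := hg.exists_corrector hS.Tf_pos
  refine ⟨U, fun s σ => S.c * V s σ, hU, hU0, hU.bounded hS.Ts_pos,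
    ((IsSep.of_slow (Tf := S.Tf) (IsSlow.const (T := S.Ts) S.c)).mul hV).bounded hS.Ts_pos,
    fun μ => hUc _, fun μ s hs => ?_⟩
  refine (hUd (μ ^ 2 * S.c) s hs).congr_deriv ?_
  simp only [slow, mean]
  ring

/-- Correctors for the averaging of the linearized system, and the approximate solution given by
`u` and `v`. -/
structure IsFrame (S : PhaseSystem) (u u' v v' U U' V V' UB UB' U₂ U₂' UE UE' : ℝ → ℝ → ℝ) :
    Prop where
  hu : S.IsCorrector S.A₀ (fun _ => 0) u u'
  hv : S.IsCorrector (fun s σ => S.d * u s σ + S.G₀ s σ - S.c * deriv S.η σ) (fun _ => 0) v v'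
  hU : S.IsCorrector S.A' (S.mean S.A') U U'
  hV : S.IsCorrector U (fun _ => 0) V V'
  hUB : S.IsCorrector S.B (S.mean S.B) UB UB'
  hU₂ : S.IsCorrector S.A'' (S.mean S.A'') U₂ U₂'
  hUE : S.IsCorrector S.E (S.mean S.E) UE UE'

/-- The corrector u is determined up to a function of the slow time. This freedom is used to make
the order μ² part of the phase equation, d·u + G₀ − cη', average to zero, so that v exists. -/
theorem Elliptic.exists_frame (hS : S.Elliptic) :
    ∃ u u' v v' U U' V V' UB UB' U₂ U₂' UE UE',
      S.IsFrame u u' v v' U U' V V' UB UB' U₂ U₂' UE UE' := by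
  have hd := hS.d_ne
  obtain ⟨w, w', hw, hw0, hwc⟩ := hS.exists_isCorrector hS.isSep_A₀
  obtain ⟨U, U', hU, hU0, hUc⟩ := hS.exists_isCorrector hS.isSep_A'
  obtain ⟨V, V', -, -, hVc⟩ := hS.exists_isCorrector hU
  obtain ⟨UB, UB', -, -, hUBc⟩ := hS.exists_isCorrector hS.isSep_B
  obtain ⟨U₂, U₂', -, -, hU₂c⟩ := hS.exists_isCorrector hS.isSep_A''
  obtain ⟨UE, UE', -, -, hUEc⟩ := hS.exists_isCorrector hS.isSep_E
  have mG : IsSlow S.Ts (S.mean S.G₀) := hS.isSep_G₀.fastMean_isSlow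
  -- The mean value which u must have for d·u + G₀ − cη' to have mean zero.
  set ζ : ℝ → ℝ := fun σ => (S.c * deriv S.η σ - S.mean S.G₀ σ) * S.d⁻¹ with hζdef
  have hcη : IsSlow S.Ts fun σ => S.c * deriv S.η σ := (IsSlow.const _).mul hS.hη.deriv
  have hζ : IsSlow S.Ts ζ := (hcη.sub mG).mul (IsSlow.const _)
  have hu : IsSep S.Tf S.Ts fun s σ => w s σ + ζ σ := hw.add (IsSep.of_slow hζ)
  have hg : IsSep S.Tf S.Ts fun s σ => S.d * (w s σ + ζ σ) + S.G₀ s σ + -(S.c * deriv S.η σ) :=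
    (((IsSep.of_slow (IsSlow.const _)).mul hu).add hS.isSep_G₀).add (IsSep.of_slow hcη.neg)
  have hg0 : ∀ σ, S.mean (fun s σ => S.d * (w s σ + ζ σ) + S.G₀ s σ + -(S.c * deriv S.η σ)) σ = 0 := by
    intro σ
    have f1 := hu.isFast σ
    have f2 : IsFast S.Tf fun s => S.d * (w s σ + ζ σ) := (IsFast.const _).mul f1
    have f3 := hS.isSep_G₀.isFast σ
    unfold mean
    rw [fastMean_add (f2.add f3) (IsFast.const _), fastMean_add f2 f3, fastMean_const_mul,
      fastMean_add (hw.isFast σ) (IsFast.const _), fastMean_const hS.Tf_pos.ne',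
      fastMean_const hS.Tf_pos.ne']
    have h1 : fastMean S.Tf (fun s => w s σ) = 0 := hw0 σ
    have h2 : fastMean S.Tf (fun s => S.G₀ s σ) = S.mean S.G₀ σ := rfl
    rw [h1, h2, hζdef]
    field_simp
    ring
  obtain ⟨v, v', -, -, hvc⟩ := hS.exists_isCorrector hg
  refine ⟨fun s σ => w s σ + ζ σ, fun s σ => w' s σ + S.c * deriv ζ σ, v, v', U, U', V, V', UB, UB',
    U₂, U₂', UE, UE', ⟨hu.bounded hS.Ts_pos, ?_, ?_, ?_⟩, ⟨hvc.bdd, hvc.bdd', hvc.cont, ?_⟩, hUc,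
    ⟨hVc.bdd, hVc.bdd', hVc.cont, ?_⟩, hUBc, hU₂c, hUEc⟩
  · obtain ⟨C₁, h₁⟩ := hwc.bdd'
    obtain ⟨C₂, h₂⟩ := ((IsSlow.const (T := S.Ts) S.c).mul hζ.deriv).bounded hS.Ts_pos
    exact ⟨C₁ + C₂, fun s σ => (abs_add_le _ _).trans (add_le_add (h₁ s σ) (h₂ σ))⟩
  · intro μ
    refine (hwc.cont μ).add (hζ.smooth.continuous.comp ?_)
    unfold slow
    fun_prop
  · intro μ s hs
    refine ((hwc.hasDerivAt μ s hs).fun_add (hζ.hasDerivAt_scaled (μ ^ 2 * S.c) s)).congr_deriv ?_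
    rw [hS.mean_A₀]
    unfold slow
    ring
  · intro μ s hs
    refine (hvc.hasDerivAt μ s hs).congr_deriv ?_
    rw [hg0]
    ring
  · intro μ s hs
    refine (hVc.hasDerivAt μ s hs).congr_deriv ?_
    rw [hU0]

end PhaseSystem

/-! ### The energy form and its derivative -/

/-- Functions entering the energy form and the approximate solution. -/
structure EnergyData where
  ρ : ℝ → ℝ
  α : ℝ → ℝ
  k : ℝ → ℝ
  p : ℝ → ℝ
  u : ℝ → ℝ → ℝ
  u' : ℝ → ℝ → ℝ
  v : ℝ → ℝ → ℝ
  v' : ℝ → ℝ → ℝ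
  U : ℝ → ℝ → ℝ
  U' : ℝ → ℝ → ℝ
  V : ℝ → ℝ → ℝ
  V' : ℝ → ℝ → ℝ
  UB : ℝ → ℝ → ℝ
  UB' : ℝ → ℝ → ℝ
  U₂ : ℝ → ℝ → ℝ
  U₂' : ℝ → ℝ → ℝ
  UE : ℝ → ℝ → ℝ
  UE' : ℝ → ℝ → ℝ

namespace PhaseSystem

variable (S : PhaseSystem) (D : EnergyData)

structure ValidData : Prop where
  weight : S.IsWeight D.ρ D.α D.k D.p
  frame : S.IsFrame D.u D.u' D.v D.v' D.U D.U' D.V D.V' D.UB D.UB' D.U₂ D.U₂' D.UE D.UE'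

def q₁₁ (μ s X : ℝ) : ℝ :=
  D.ρ (S.slow μ s) - 2 * μ * (D.k (S.slow μ s) * X)
    + μ ^ 2 * (-2 * (D.ρ (S.slow μ s) * D.UB s (S.slow μ s))
      + 2 * S.d * (D.ρ (S.slow μ s) * D.V s (S.slow μ s)))

def q₁₂ (μ s X W : ℝ) : ℝ :=
  μ * (-(D.ρ (S.slow μ s) * D.U s (S.slow μ s)) + D.k (S.slow μ s) * W + D.p (S.slow μ s))
    + μ ^ 2 * (X * (D.k (S.slow μ s) * D.U s (S.slow μ s)
      - D.ρ (S.slow μ s) * D.U₂ s (S.slow μ s)))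

def q₂₂ (μ s X W : ℝ) : ℝ :=
  D.ρ (S.slow μ s) * D.α (S.slow μ s) + 2 * μ * (D.k (S.slow μ s) * D.α (S.slow μ s) * X)
    + μ ^ 2 * (D.ρ (S.slow μ s) * D.U s (S.slow μ s) ^ 2
      - 2 * S.d * (D.ρ (S.slow μ s) * D.α (S.slow μ s) * D.V s (S.slow μ s))
      - 2 * (D.ρ (S.slow μ s) * D.α (S.slow μ s) * D.UE s (S.slow μ s))
      - 2 * (D.k (S.slow μ s) * W * D.U s (S.slow μ s))
      - 2 * (D.p (S.slow μ s) * D.U s (S.slow μ s)))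

/-- The energy form in the difference `(ζ, ξ)` of two solutions with rescaled midpoint `(W, X)`. -/
def energy (μ s X W ζ ξ : ℝ) : ℝ :=
  S.q₁₁ D μ s X * ζ ^ 2 + 2 * S.q₁₂ D μ s X W * (ζ * ξ) + S.q₂₂ D μ s X W * ξ ^ 2

variable {S D}

theorem Elliptic.exists_validData (hS : S.Elliptic) : ∃ D, S.ValidData D := by
  obtain ⟨ρ, α, k, p, h⟩ := hS.exists_weight
  obtain ⟨u, u', v, v', U, U', V, V', UB, UB', U₂, U₂', UE, UE', hf⟩ := hS.exists_frame
  exact ⟨⟨ρ, α, k, p, u, u', v, v', U, U', V, V', UB, UB', U₂, U₂', UE, UE'⟩, h, hf⟩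

theorem bdd_slow {ι : Type*} {μ s : ι → ℝ} {f : ℝ → ℝ} (hT : 0 < S.Ts) (h : IsSlow S.Ts f) :
    Bdd fun i => f (S.slow (μ i) (s i)) := by
  obtain ⟨C, hC⟩ := h.bounded hT
  exact ⟨C, fun i => hC _⟩

theorem bdd_fast {ι : Type*} {μ s : ι → ℝ} {f : ℝ → ℝ → ℝ} (h : ∃ C, ∀ s σ, |f s σ| ≤ C) :
    Bdd fun i => f (s i) (S.slow (μ i) (s i)) := by
  obtain ⟨C, hC⟩ := h
  exact ⟨C, fun i => hC _ _⟩

theorem hasDerivAt_slow {f : ℝ → ℝ} (h : IsSlow S.Ts f) (μ s : ℝ) :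
    HasDerivAt (fun s => f (S.slow μ s)) (μ ^ 2 * (S.c * deriv f (S.slow μ s))) s :=
  (h.hasDerivAt_scaled (μ ^ 2 * S.c) s).congr_deriv (by unfold slow; ring)

/-- Combines the chain rule with `energy_rate_bound`. The errors e₁, e₂ of the linear equations are
kept as an explicit work term, because they contain the defects, whose size is prescribed later. -/
theorem energy_deriv (hS : S.Elliptic) (hD : S.ValidData D) (M : ℝ) :
    ∃ C > 0, ∀ μ, 0 < μ → μ ≤ 1 → ∀ s ∉ jumpSet, ∀ (ζ ξ X W : ℝ → ℝ) (e₁ e₂ x₁ w₁ : ℝ),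
      |X s| ≤ M → |W s| ≤ M → |x₁| ≤ M → |w₁| ≤ M →
      HasDerivAt ζ (μ * S.A' s (S.slow μ s) * ξ s
        + μ ^ 2 * (S.A'' s (S.slow μ s) * X s * ξ s + S.B s (S.slow μ s) * ζ s) + e₁) s →
      HasDerivAt ξ (μ * S.d * ζ s + μ ^ 2 * (S.E s (S.slow μ s) * ξ s) + e₂) s →
      HasDerivAt X (μ * S.d * W s + μ ^ 2 * x₁) s →
      HasDerivAt W (μ * S.A' s (S.slow μ s) * X s + μ ^ 2 * w₁) s →
      ∃ r, HasDerivAt (fun s => S.energy D μ s (X s) (W s) (ζ s) (ξ s)) r s ∧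
        |r - μ ^ 2 * S.rate * (D.ρ (S.slow μ s) * ζ s ^ 2
          + D.ρ (S.slow μ s) * D.α (S.slow μ s) * ξ s ^ 2)|
        ≤ C * μ ^ 3 * (ζ s ^ 2 + ξ s ^ 2)
          + |2 * (S.q₁₁ D μ s (X s) * ζ s + S.q₁₂ D μ s (X s) (W s) * ξ s) * e₁
            + 2 * (S.q₁₂ D μ s (X s) (W s) * ζ s + S.q₂₂ D μ s (X s) (W s) * ξ s) * e₂| := by
  have hw := hD.weight
  have hf := hD.frame
  have hT := hS.Ts_pos
  -- One index runs over all admissible (μ, s, X, W, x₁, w₁), so a single constant serves all of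
  -- them.
  let ι := {t : ℝ × ℝ × ℝ × ℝ × ℝ × ℝ // |t.1| ≤ 1 ∧ |t.2.2.1| ≤ M ∧ |t.2.2.2.1| ≤ M ∧
    |t.2.2.2.2.1| ≤ M ∧ |t.2.2.2.2.2| ≤ M}
  let μ' : ι → ℝ := fun i => i.1.1
  let s' : ι → ℝ := fun i => i.1.2.1
  have sl : ∀ {f : ℝ → ℝ}, IsSlow S.Ts f → Bdd fun i : ι => f (S.slow (μ' i) (s' i)) :=
    fun h => bdd_slow hT h
  have fa : ∀ {f : ℝ → ℝ → ℝ}, (∃ C, ∀ s σ, |f s σ| ≤ C) →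
      Bdd fun i : ι => f (s' i) (S.slow (μ' i) (s' i)) := fun h => bdd_fast h
  have cd : ∀ {f : ℝ → ℝ}, IsSlow S.Ts f → IsSlow S.Ts fun σ => S.c * deriv f σ :=
    fun h => (IsSlow.const _).mul h.deriv
  obtain ⟨C, hC, hb⟩ := energy_rate_bound (ι := ι) (μ := μ')
    (X := fun i => i.1.2.2.1) (W := fun i => i.1.2.2.2.1) (x₁ := fun i => i.1.2.2.2.2.1)
    (w₁ := fun i => i.1.2.2.2.2.2) S.d S.rate ⟨1, fun i => i.2.1⟩
    (fa (hS.isSep_A'.bounded hT)) (fa (hS.isSep_A''.bounded hT)) (fa (hS.isSep_B.bounded hT))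
    (fa (hS.isSep_E.bounded hT)) ⟨M, fun i => i.2.2.1⟩ ⟨M, fun i => i.2.2.2.1⟩
    ⟨M, fun i => i.2.2.2.2.1⟩ ⟨M, fun i => i.2.2.2.2.2⟩
    (fa hf.hU.bdd) (fa hf.hU.bdd') (fa hf.hV.bdd) (fa hf.hV.bdd') (fa hf.hUB.bdd) (fa hf.hUB.bdd')
    (fa hf.hU₂.bdd) (fa hf.hU₂.bdd') (fa hf.hUE.bdd) (fa hf.hUE.bdd')
    (sl hw.hρ) (sl (cd hw.hρ)) (sl hw.hα) (sl (cd hw.hα)) (sl hw.hk) (sl (cd hw.hk))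
    (sl hw.hp) (sl (cd hw.hp)) (fun i => hw.k_eq _) (fun i => hw.p_eq _) (fun i => hw.ρα_eq _)
  refine ⟨C, hC, fun μ hμ hμ1 s hs ζ ξ X W e₁ e₂ x₁ w₁ hX hW hx₁ hw₁ dζ dξ dX dW => ?_⟩
  have hb' := hb ⟨(μ, s, X s, W s, x₁, w₁), by rwa [abs_of_pos hμ], hX, hW, hx₁, hw₁⟩ hμ.le (ζ s) (ξ s)
  simp only [μ', s'] at hb'
  have dρ := hasDerivAt_slow hw.hρ μ s
  have dα := hasDerivAt_slow hw.hα μ s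
  have dk := hasDerivAt_slow hw.hk μ s
  have dp := hasDerivAt_slow hw.hp μ s
  have dU := hf.hU.hasDerivAt μ s hs
  have dV := hf.hV.hasDerivAt μ s hs
  have dUB := hf.hUB.hasDerivAt μ s hs
  have dU₂ := hf.hU₂.hasDerivAt μ s hs
  have dUE := hf.hUE.hasDerivAt μ s hs
  have d11 : HasDerivAt (fun s => S.q₁₁ D μ s (X s)) _ s :=
    (dρ.fun_sub ((dk.fun_mul dX).const_mul (2 * μ))).fun_add
      ((((dρ.fun_mul dUB).const_mul (-2)).fun_add ((dρ.fun_mul dV).const_mul (2 * S.d))).const_mul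
        (μ ^ 2))
  have d12 : HasDerivAt (fun s => S.q₁₂ D μ s (X s) (W s)) _ s :=
    ((((dρ.fun_mul dU).fun_neg.fun_add (dk.fun_mul dW)).fun_add dp).const_mul μ).fun_add
      ((dX.fun_mul ((dk.fun_mul dU).fun_sub (dρ.fun_mul dU₂))).const_mul (μ ^ 2))
  have d22 : HasDerivAt (fun s => S.q₂₂ D μ s (X s) (W s)) _ s :=
    ((dρ.fun_mul dα).fun_add (((dk.fun_mul dα).fun_mul dX).const_mul (2 * μ))).fun_add
      ((((((dρ.fun_mul (dU.fun_pow 2)).fun_sub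
        (((dρ.fun_mul dα).fun_mul dV).const_mul (2 * S.d))).fun_sub
        (((dρ.fun_mul dα).fun_mul dUE).const_mul 2)).fun_sub
        (((dk.fun_mul dW).fun_mul dU).const_mul 2)).fun_sub ((dp.fun_mul dU).const_mul 2)).const_mul
        (μ ^ 2))
  have dQ : HasDerivAt (fun s => S.energy D μ s (X s) (W s) (ζ s) (ξ s)) _ s :=
    ((d11.fun_mul (dζ.fun_pow 2)).fun_add ((d12.const_mul 2).fun_mul (dζ.fun_mul dξ))).fun_add
      (d22.fun_mul (dξ.fun_pow 2))
  refine ⟨_, dQ, ?_⟩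
  have h3 := (abs_add_le _ (2 * (S.q₁₁ D μ s (X s) * ζ s + S.q₁₂ D μ s (X s) (W s) * ξ s) * e₁
    + 2 * (S.q₁₂ D μ s (X s) (W s) * ζ s + S.q₂₂ D μ s (X s) (W s) * ξ s) * e₂)).trans
    (add_le_add hb' le_rfl)
  refine le_of_eq_of_le (congrArg abs ?_) h3
  rw [hw.mean_A']
  simp only [q₁₁, q₁₂, q₂₂]
  norm_num
  ring

end PhaseSystem

/-! ### Equations for differences and midpoints -/

theorem hasDerivAt_fst {y : ℝ → ℝ × ℝ} {y' : ℝ × ℝ} {s : ℝ} (h : HasDerivAt y y' s) :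
    HasDerivAt (fun s => (y s).1) y'.1 s :=
  (ContinuousLinearMap.fst ℝ ℝ ℝ).hasFDerivAt.comp_hasDerivAt s h

theorem hasDerivAt_snd {y : ℝ → ℝ × ℝ} {y' : ℝ × ℝ} {s : ℝ} (h : HasDerivAt y y' s) :
    HasDerivAt (fun s => (y s).2) y'.2 s :=
  (ContinuousLinearMap.snd ℝ ℝ ℝ).hasFDerivAt.comp_hasDerivAt s h

theorem sq_norm_le_add (y : ℝ × ℝ) : ‖y‖ ^ 2 ≤ y.1 ^ 2 + y.2 ^ 2 := by
  rw [Prod.norm_def]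
  rcases max_choice ‖y.1‖ ‖y.2‖ with h | h <;> rw [h, norm_eq_abs, sq_abs] <;>
    nlinarith [sq_nonneg y.1, sq_nonneg y.2]

theorem add_le_two_sq_norm (y : ℝ × ℝ) : y.1 ^ 2 + y.2 ^ 2 ≤ 2 * ‖y‖ ^ 2 := by
  have h1 : |y.1| ≤ ‖y‖ := norm_fst_le y
  have h2 : |y.2| ≤ ‖y‖ := norm_snd_le y
  have := sq_le_sq' (by linarith [abs_nonneg y.1, neg_abs_le y.1, norm_nonneg y]) h1
  have := sq_le_sq' (by linarith [abs_nonneg y.2, norm_nonneg y]) h2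
  rw [sq_abs] at *
  linarith

namespace PhaseSystem

variable (S : PhaseSystem) {D : EnergyData}

def err₁ (μ s : ℝ) (y : ℝ × ℝ) : ℝ :=
  (S.V μ s y).1 - μ * (S.A₀ s (S.slow μ s)
      + S.A' s (S.slow μ s) * (y.2 - S.η (S.slow μ s))
      + S.A'' s (S.slow μ s) / 2 * (y.2 - S.η (S.slow μ s)) ^ 2
      + μ * S.B s (S.slow μ s) * y.1)

def err₂ (μ s : ℝ) (y : ℝ × ℝ) : ℝ :=
  (S.V μ s y).2 - (S.d * μ * y.1 + μ ^ 2 * (S.G₀ s (S.slow μ s)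
      + S.E s (S.slow μ s) * (y.2 - S.η (S.slow μ s))))

/-- The rescaled midpoint of two curves relative to the approximate solution. -/
def midX (D : EnergyData) (μ : ℝ) (y₁ y₂ : ℝ → ℝ × ℝ) (s : ℝ) : ℝ :=
  (((y₁ s).2 + (y₂ s).2) / 2 - S.η (S.slow μ s) - μ ^ 2 * D.v s (S.slow μ s)) / μ

def midW (D : EnergyData) (μ : ℝ) (y₁ y₂ : ℝ → ℝ × ℝ) (s : ℝ) : ℝ :=
  ((y₁ s).1 + (y₂ s).1) / (2 * μ) - D.u s (S.slow μ s)

variable {S}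

theorem exists_common_bound (hS : S.Elliptic) (hD : S.ValidData D) :
    ∃ C ≥ 0, ∀ s σ, |S.A' s σ| ≤ C ∧ |S.A'' s σ| ≤ C ∧ |S.B s σ| ≤ C ∧ |S.E s σ| ≤ C ∧
      |D.u s σ| ≤ C ∧ |D.u' s σ| ≤ C ∧ |D.v s σ| ≤ C ∧ |D.v' s σ| ≤ C := by
  have hT := hS.Ts_pos
  have hf := hD.frame
  obtain ⟨C₁, h₁⟩ := hS.isSep_A'.bounded hT
  obtain ⟨C₂, h₂⟩ := hS.isSep_A''.bounded hT
  obtain ⟨C₃, h₃⟩ := hS.isSep_B.bounded hT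
  obtain ⟨C₄, h₄⟩ := hS.isSep_E.bounded hT
  obtain ⟨C₅, h₅⟩ := hf.hu.bdd
  obtain ⟨C₆, h₆⟩ := hf.hu.bdd'
  obtain ⟨C₇, h₇⟩ := hf.hv.bdd
  obtain ⟨C₈, h₈⟩ := hf.hv.bdd'
  have p₁ := (abs_nonneg _).trans (h₁ 0 0)
  have p₂ := (abs_nonneg _).trans (h₂ 0 0)
  have p₃ := (abs_nonneg _).trans (h₃ 0 0)
  have p₄ := (abs_nonneg _).trans (h₄ 0 0)
  have p₅ := (abs_nonneg _).trans (h₅ 0 0)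
  have p₆ := (abs_nonneg _).trans (h₆ 0 0)
  have p₇ := (abs_nonneg _).trans (h₇ 0 0)
  have p₈ := (abs_nonneg _).trans (h₈ 0 0)
  refine ⟨C₁ + C₂ + C₃ + C₄ + C₅ + C₆ + C₇ + C₈, by positivity, fun s σ => ?_⟩
  refine ⟨(h₁ s σ).trans ?_, (h₂ s σ).trans ?_, (h₃ s σ).trans ?_, (h₄ s σ).trans ?_,
    (h₅ s σ).trans ?_, (h₆ s σ).trans ?_, (h₇ s σ).trans ?_, (h₈ s σ).trans ?_⟩ <;> linarith

theorem abs_midpoint_le {a b c K : ℝ} (ha : |a - c| ≤ K) (hb : |b - c| ≤ K) :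
    |(a + b) / 2 - c| ≤ K := by
  rw [abs_le] at *
  constructor <;> linarith [ha.1, ha.2, hb.1, hb.2]

set_option maxHeartbeats 1000000 in
/-- The differential equations for the difference and the midpoint of two approximate solutions. -/
theorem difference_equations (hS : S.Elliptic) (hD : S.ValidData D) {K : ℝ} (hK : 0 ≤ K) :
    ∃ M ≥ 0, ∃ μ₀ > 0, μ₀ ≤ 1 ∧ ∀ μ, 0 < μ → μ < μ₀ → ∀ s ∉ jumpSet,
      ∀ (y₁ y₂ : ℝ → ℝ × ℝ) (g₁ g₂ : ℝ × ℝ),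
      y₁ s ∈ S.tube K μ s → y₂ s ∈ S.tube K μ s → ‖g₁‖ ≤ K * μ ^ 3 → ‖g₂‖ ≤ K * μ ^ 3 →
      HasDerivAt y₁ (S.V μ s (y₁ s) + g₁) s → HasDerivAt y₂ (S.V μ s (y₂ s) + g₂) s →
      ∃ e₁ e₂ x₁ w₁ : ℝ, |S.midX D μ y₁ y₂ s| ≤ M ∧ |S.midW D μ y₁ y₂ s| ≤ M ∧ |x₁| ≤ M ∧
        |w₁| ≤ M ∧ |e₁| ≤ M * μ ^ 3 * ‖y₁ s - y₂ s‖ + ‖g₁ - g₂‖ ∧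
        |e₂| ≤ M * μ ^ 3 * ‖y₁ s - y₂ s‖ + ‖g₁ - g₂‖ ∧
        HasDerivAt (fun s => (y₁ s).1 - (y₂ s).1)
          (μ * S.A' s (S.slow μ s) * ((y₁ s).2 - (y₂ s).2)
          + μ ^ 2 * (S.A'' s (S.slow μ s) * S.midX D μ y₁ y₂ s * ((y₁ s).2 - (y₂ s).2)
            + S.B s (S.slow μ s) * ((y₁ s).1 - (y₂ s).1)) + e₁) s ∧
        HasDerivAt (fun s => (y₁ s).2 - (y₂ s).2) (μ * S.d * ((y₁ s).1 - (y₂ s).1)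
          + μ ^ 2 * (S.E s (S.slow μ s) * ((y₁ s).2 - (y₂ s).2)) + e₂) s ∧
        HasDerivAt (S.midX D μ y₁ y₂) (μ * S.d * S.midW D μ y₁ y₂ s + μ ^ 2 * x₁) s ∧
        HasDerivAt (S.midW D μ y₁ y₂)
          (μ * S.A' s (S.slow μ s) * S.midX D μ y₁ y₂ s + μ ^ 2 * w₁) s := by
  obtain ⟨Cb, hCb, hb⟩ := exists_common_bound hS hD
  have hL₁ : S.LO K 3 3 S.err₁ := LO.V_fst hS.toRegular hK
  have hL₂ : S.LO K 3 3 S.err₂ := LO.V_snd hS.toRegular hK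
  obtain ⟨C₁, hC₁, μ₁, hμ₁, hμ₁', H₁⟩ := hL₁
  obtain ⟨C₂, hC₂, μ₂, hμ₂, hμ₂', H₂⟩ := hL₂
  have hf := hD.frame
  refine ⟨K + Cb + Cb * K + C₁ + C₂ + Cb ^ 2 + Cb * K ^ 2, by positivity, min μ₁ μ₂, lt_min hμ₁ hμ₂,
    (min_le_left _ _).trans hμ₁', ?_⟩
  intro μ hμ hμ' s hs y₁ y₂ g₁ g₂ ht₁ ht₂ hg₁ hg₂ d₁ d₂
  have hμ1 : μ ≤ 1 := hμ'.le.trans ((min_le_left _ _).trans hμ₁')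
  obtain ⟨v₁, l₁⟩ := H₁ μ s hμ (hμ'.trans_le (min_le_left _ _))
  obtain ⟨v₂, l₂⟩ := H₂ μ s hμ (hμ'.trans_le (min_le_right _ _))
  obtain ⟨bA', bA'', bB, bE, bu, bu', bv, bv'⟩ := hb s (S.slow μ s)
  have dη := hasDerivAt_slow hS.hη μ s
  have du := hf.hu.hasDerivAt μ s hs
  have dv := hf.hv.hasDerivAt μ s hs
  have dz₁ := hasDerivAt_fst d₁
  have dz₂ := hasDerivAt_fst d₂
  have dφ₁ := hasDerivAt_snd d₁
  have dφ₂ := hasDerivAt_snd d₂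
  simp only [Prod.fst_add, Prod.snd_add] at dz₁ dz₂ dφ₁ dφ₂
  set σ := S.slow μ s with hσ
  set x : ℝ := ((y₁ s).2 + (y₂ s).2) / 2 - S.η σ with hx
  have hxK : |x| ≤ K * μ := abs_midpoint_le ht₁.2 ht₂.2
  have hzK : |((y₁ s).1 + (y₂ s).1) / 2| ≤ K * μ := by
    have := abs_midpoint_le (c := 0) (by simpa using ht₁.1) (by simpa using ht₂.1)
    simpa using this
  have hX : S.midX D μ y₁ y₂ s = (x - μ ^ 2 * D.v s σ) / μ := rfl
  have hW : S.midW D μ y₁ y₂ s = ((y₁ s).1 + (y₂ s).1) / 2 / μ - D.u s σ := by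
    simp only [midW]; rw [div_div]
  have hμX : μ * S.midX D μ y₁ y₂ s = x - μ ^ 2 * D.v s σ := by
    rw [hX]; field_simp
  have hμW : μ * S.midW D μ y₁ y₂ s = ((y₁ s).1 + (y₂ s).1) / 2 - μ * D.u s σ := by
    rw [hW]; field_simp
  have hg₁' : |g₁.1| ≤ K * μ ^ 3 := (norm_fst_le g₁).trans hg₁
  have hg₁'' : |g₁.2| ≤ K * μ ^ 3 := (norm_snd_le g₁).trans hg₁
  have hg₂' : |g₂.1| ≤ K * μ ^ 3 := (norm_fst_le g₂).trans hg₂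
  have hg₂'' : |g₂.2| ≤ K * μ ^ 3 := (norm_snd_le g₂).trans hg₂
  have hd1 : |g₁.1 - g₂.1| ≤ ‖g₁ - g₂‖ := norm_fst_le (g₁ - g₂)
  have hd2 : |g₁.2 - g₂.2| ≤ ‖g₁ - g₂‖ := norm_snd_le (g₁ - g₂)
  have hξ : |(y₁ s).2 - (y₂ s).2| ≤ ‖y₁ s - y₂ s‖ := norm_snd_le (y₁ s - y₂ s)
  have E₁ : ∀ y, (S.V μ s y).1 = μ * (S.A₀ s σ + S.A' s σ * (y.2 - S.η σ)
      + S.A'' s σ / 2 * (y.2 - S.η σ) ^ 2 + μ * S.B s σ * y.1) + S.err₁ μ s y := fun y => by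
    simp only [err₁, ← hσ]; ring
  have E₂ : ∀ y, (S.V μ s y).2 = S.d * μ * y.1 + μ ^ 2 * (S.G₀ s σ + S.E s σ * (y.2 - S.η σ))
      + S.err₂ μ s y := fun y => by
    simp only [err₂, ← hσ]; ring
  have hμn := hμ.ne'
  refine ⟨μ ^ 3 * S.A'' s σ * D.v s σ * ((y₁ s).2 - (y₂ s).2)
      + (S.err₁ μ s (y₁ s) - S.err₁ μ s (y₂ s)) + (g₁.1 - g₂.1),
    (S.err₂ μ s (y₁ s) - S.err₂ μ s (y₂ s)) + (g₁.2 - g₂.2),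
    (μ ^ 2 * (S.E s σ * x) + (S.err₂ μ s (y₁ s) + S.err₂ μ s (y₂ s) + g₁.2 + g₂.2) / 2
      - μ ^ 4 * D.v' s σ) / μ ^ 3,
    (μ ^ 3 * (S.A' s σ * D.v s σ)
      + μ * (S.A'' s σ / 4) * (((y₁ s).2 - S.η σ) ^ 2 + ((y₂ s).2 - S.η σ) ^ 2)
      + μ ^ 2 * (S.B s σ * (((y₁ s).1 + (y₂ s).1) / 2))
      + (S.err₁ μ s (y₁ s) + S.err₁ μ s (y₂ s) + g₁.1 + g₂.1) / 2 - μ ^ 3 * D.u' s σ) / μ ^ 3,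
    ?_, ?_, ?_, ?_, ?_, ?_, ?_, ?_, ?_, ?_⟩
  · rw [hX, abs_div, abs_of_pos hμ, div_le_iff₀ hμ]
    have h1 := abs_sub x (μ ^ 2 * D.v s σ)
    rw [abs_mul, abs_of_nonneg (sq_nonneg μ)] at h1
    have h2 : μ ^ 2 * |D.v s σ| ≤ μ * 1 * Cb := by rw [sq]; gcongr
    have h3 : (0 : ℝ) ≤ (Cb * K + C₁ + C₂ + Cb ^ 2 + Cb * K ^ 2) * μ := by positivity
    nlinarith
  · rw [hW]
    have h1 : |((y₁ s).1 + (y₂ s).1) / 2 / μ| ≤ K := by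
      rw [abs_div, abs_of_pos hμ, div_le_iff₀ hμ]; exact hzK
    have h2 := abs_sub (((y₁ s).1 + (y₂ s).1) / 2 / μ) (D.u s σ)
    have h3 : (0 : ℝ) ≤ Cb * K + C₁ + C₂ + Cb ^ 2 + Cb * K ^ 2 := by positivity
    linarith
  · rw [abs_div, abs_of_pos (by positivity : 0 < μ ^ 3), div_le_iff₀ (by positivity)]
    have t1 : |μ ^ 2 * (S.E s σ * x)| ≤ Cb * K * μ ^ 3 := by
      rw [abs_mul, abs_mul, abs_of_nonneg (sq_nonneg μ)]
      calc _ ≤ μ ^ 2 * (Cb * (K * μ)) := by gcongr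
        _ = _ := by ring
    have t2 := v₂ (y₁ s) ht₁
    have t3 := v₂ (y₂ s) ht₂
    have t4 : |μ ^ 4 * D.v' s σ| ≤ Cb * μ ^ 3 := by
      rw [abs_mul, abs_of_nonneg (by positivity)]
      calc _ ≤ μ ^ 4 * Cb := by gcongr
        _ = μ * (Cb * μ ^ 3) := by ring
        _ ≤ 1 * (Cb * μ ^ 3) := by gcongr
        _ = _ := by ring
    have h3 : (0 : ℝ) ≤ (C₁ + Cb ^ 2 + Cb * K ^ 2) * μ ^ 3 := by positivity
    have h4 : (0 : ℝ) ≤ K * μ ^ 3 := by positivity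
    have t5 := hg₁''
    have t6 := hg₂''
    rw [abs_le] at t1 t2 t3 t4 t5 t6
    exact abs_le.2 ⟨by linarith only [h3, h4, t1.1, t2.1, t3.1, t4.2, t5.1, t6.1],
      by linarith only [h3, h4, t1.2, t2.2, t3.2, t4.1, t5.2, t6.2]⟩
  · rw [abs_div, abs_of_pos (by positivity : 0 < μ ^ 3), div_le_iff₀ (by positivity)]
    have t1 : |μ ^ 3 * (S.A' s σ * D.v s σ)| ≤ Cb ^ 2 * μ ^ 3 := by
      rw [abs_mul, abs_mul, abs_of_nonneg (by positivity)]
      calc _ ≤ μ ^ 3 * (Cb * Cb) := by gcongr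
        _ = _ := by ring
    have t2 : |μ * (S.A'' s σ / 4) * (((y₁ s).2 - S.η σ) ^ 2 + ((y₂ s).2 - S.η σ) ^ 2)|
        ≤ Cb * K ^ 2 * μ ^ 3 := by
      have q1 : ((y₁ s).2 - S.η σ) ^ 2 ≤ (K * μ) ^ 2 := by
        rw [← sq_abs]; exact pow_le_pow_left₀ (abs_nonneg _) ht₁.2 2
      have q2 : ((y₂ s).2 - S.η σ) ^ 2 ≤ (K * μ) ^ 2 := by
        rw [← sq_abs]; exact pow_le_pow_left₀ (abs_nonneg _) ht₂.2 2
      rw [abs_mul, abs_mul, abs_div, abs_of_pos hμ,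
        abs_of_nonneg (by positivity : 0 ≤ ((y₁ s).2 - S.η σ) ^ 2 + ((y₂ s).2 - S.η σ) ^ 2),
        abs_of_pos (by norm_num : (0 : ℝ) < 4)]
      calc _ ≤ μ * (Cb / 4) * ((K * μ) ^ 2 + (K * μ) ^ 2) := by gcongr
        _ ≤ _ := by nlinarith [(by positivity : 0 ≤ Cb * K ^ 2 * μ ^ 3)]
    have t3 : |μ ^ 2 * (S.B s σ * (((y₁ s).1 + (y₂ s).1) / 2))| ≤ Cb * K * μ ^ 3 := by
      rw [abs_mul, abs_mul, abs_of_nonneg (sq_nonneg μ)]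
      calc _ ≤ μ ^ 2 * (Cb * (K * μ)) := by gcongr
        _ = _ := by ring
    have t4 := v₁ (y₁ s) ht₁
    have t5 := v₁ (y₂ s) ht₂
    have t6 : |μ ^ 3 * D.u' s σ| ≤ Cb * μ ^ 3 := by
      rw [abs_mul, abs_of_nonneg (by positivity), mul_comm]; gcongr
    have h3 : (0 : ℝ) ≤ C₂ * μ ^ 3 := by positivity
    have h4 : (0 : ℝ) ≤ K * μ ^ 3 := by positivity
    have t7 := hg₁'
    have t8 := hg₂'
    rw [abs_le] at t1 t2 t3 t4 t5 t6 t7 t8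
    exact abs_le.2 ⟨by linarith only [h3, h4, t1.1, t2.1, t3.1, t4.1, t5.1, t6.2, t7.1, t8.1],
      by linarith only [h3, h4, t1.2, t2.2, t3.2, t4.2, t5.2, t6.1, t7.2, t8.2]⟩
  · have t1 : |μ ^ 3 * S.A'' s σ * D.v s σ * ((y₁ s).2 - (y₂ s).2)|
        ≤ Cb ^ 2 * μ ^ 3 * ‖y₁ s - y₂ s‖ := by
      rw [abs_mul, abs_mul, abs_mul, abs_of_nonneg (by positivity : 0 ≤ μ ^ 3)]
      calc _ ≤ μ ^ 3 * Cb * Cb * ‖y₁ s - y₂ s‖ := by gcongr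
        _ = _ := by ring
    have t2 := l₁ (y₁ s) ht₁ (y₂ s) ht₂
    have h3 : (0 : ℝ) ≤ (K + Cb + Cb * K + C₂ + Cb * K ^ 2) * μ ^ 3 * ‖y₁ s - y₂ s‖ := by positivity
    refine (abs_add_three _ _ _).trans ?_
    linarith
  · have t2 := l₂ (y₁ s) ht₁ (y₂ s) ht₂
    have h3 : (0 : ℝ) ≤ (K + Cb + Cb * K + C₁ + Cb ^ 2 + Cb * K ^ 2) * μ ^ 3 * ‖y₁ s - y₂ s‖ := by
      positivity
    refine (abs_add_le _ _).trans ?_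
    linarith
  · refine (dz₁.fun_sub dz₂).congr_deriv ?_
    rw [E₁, E₁]
    -- A difference of squares is the difference times twice the midpoint, so the quadratic term
    -- becomes exactly linear in the difference. The part with v is of third order and belongs to
    -- the first error.
    have : (y₁ s).2 - S.η σ + ((y₂ s).2 - S.η σ) = 2 * (μ * S.midX D μ y₁ y₂ s + μ ^ 2 * D.v s σ) := by
      rw [hμX, hx]; ring
    linear_combination (μ * S.A'' s σ / 2 * ((y₁ s).2 - (y₂ s).2)) * this
  · refine (dφ₁.fun_sub dφ₂).congr_deriv ?_
    rw [E₂, E₂]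
    ring
  · have h := ((((dφ₁.fun_add dφ₂).div_const 2).fun_sub dη).fun_sub (dv.const_mul (μ ^ 2))).div_const μ
    refine HasDerivAt.congr_deriv (f := S.midX D μ y₁ y₂) h ?_
    rw [E₂, E₂, mul_right_comm μ S.d, hμW]
    field_simp
    rw [hx]
    ring
  · have h := ((dz₁.fun_add dz₂).div_const (2 * μ)).fun_sub du
    refine HasDerivAt.congr_deriv (f := S.midW D μ y₁ y₂) h ?_
    rw [E₁, E₁, mul_right_comm μ (S.A' s σ), hμX]
    field_simp
    rw [hx]
    ring

end PhaseSystem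

/-! ### The Lyapunov function, contraction and the approximate solution -/

namespace PhaseSystem

variable {S : PhaseSystem} {D : EnergyData}

/-- All corrections carry a factor μ, so for small μ the form is comparable with ρζ² + ραξ², hence
with the squared norm. -/
theorem energy_coeff_bound (hS : S.Elliptic) (hD : S.ValidData D) (M : ℝ) :
    ∃ C > 0, ∀ μ, 0 < μ → μ ≤ 1 → ∀ s X W, |X| ≤ M → |W| ≤ M →
      |S.q₁₁ D μ s X - D.ρ (S.slow μ s)| ≤ C * μ ∧ |S.q₁₂ D μ s X W| ≤ C * μ ∧
      |S.q₂₂ D μ s X W - D.ρ (S.slow μ s) * D.α (S.slow μ s)| ≤ C * μ := by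
  have hw := hD.weight
  have hf := hD.frame
  have hT := hS.Ts_pos
  let ι := {t : ℝ × ℝ × ℝ × ℝ // |t.1| ≤ 1 ∧ |t.2.2.1| ≤ M ∧ |t.2.2.2| ≤ M}
  let μ' : ι → ℝ := fun i => i.1.1
  let s' : ι → ℝ := fun i => i.1.2.1
  let X' : ι → ℝ := fun i => i.1.2.2.1
  let W' : ι → ℝ := fun i => i.1.2.2.2
  have sl : ∀ {f : ℝ → ℝ}, IsSlow S.Ts f → Bdd fun i : ι => f (S.slow (μ' i) (s' i)) :=
    fun h => bdd_slow hT h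
  have fa : ∀ {f : ℝ → ℝ → ℝ}, (∃ C, ∀ s σ, |f s σ| ≤ C) →
      Bdd fun i : ι => f (s' i) (S.slow (μ' i) (s' i)) := fun h => bdd_fast h
  have bμ : Bdd μ' := ⟨1, fun i => i.2.1⟩
  have bX : Bdd X' := ⟨M, fun i => i.2.2.1⟩
  have bW : Bdd W' := ⟨M, fun i => i.2.2.2⟩
  have two : Bdd fun _ : ι => (2 : ℝ) := Bdd.const 2
  have twod : Bdd fun _ : ι => 2 * S.d := Bdd.const _
  obtain ⟨C₁, hC₁, h₁⟩ := ((two.mul ((sl hw.hk).mul bX)).neg.add (bμ.mul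
    (((Bdd.const (-2)).mul ((sl hw.hρ).mul (fa hf.hUB.bdd))).add
      (twod.mul ((sl hw.hρ).mul (fa hf.hV.bdd)))))).exists_pos
  obtain ⟨C₂, hC₂, h₂⟩ := ((((sl hw.hρ).mul (fa hf.hU.bdd)).neg.add ((sl hw.hk).mul bW)).add
    (sl hw.hp) |>.add (bμ.mul (bX.mul (((sl hw.hk).mul (fa hf.hU.bdd)).sub
      ((sl hw.hρ).mul (fa hf.hU₂.bdd)))))).exists_pos
  obtain ⟨C₃, hC₃, h₃⟩ := ((two.mul (((sl hw.hk).mul (sl hw.hα)).mul bX)).add (bμ.mul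
    ((((((sl hw.hρ).mul ((fa hf.hU.bdd).pow 2)).sub
      (twod.mul (((sl hw.hρ).mul (sl hw.hα)).mul (fa hf.hV.bdd)))).sub
      (two.mul (((sl hw.hρ).mul (sl hw.hα)).mul (fa hf.hUE.bdd)))).sub
      (two.mul (((sl hw.hk).mul bW).mul (fa hf.hU.bdd)))).sub
      (two.mul ((sl hw.hp).mul (fa hf.hU.bdd)))))).exists_pos
  refine ⟨C₁ + C₂ + C₃, by positivity, fun μ hμ hμ1 s X W hX hW => ?_⟩
  have key : ∀ {x C : ℝ}, |x| ≤ C → C ≤ C₁ + C₂ + C₃ → |μ * x| ≤ (C₁ + C₂ + C₃) * μ := by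
    intro x C h h'
    rw [abs_mul, abs_of_pos hμ, mul_comm]
    exact mul_le_mul_of_nonneg_right (h.trans h') hμ.le
  have k₁ := key (h₁ ⟨(μ, s, X, W), by rwa [abs_of_pos hμ], hX, hW⟩) (by linarith)
  have k₂ := key (h₂ ⟨(μ, s, X, W), by rwa [abs_of_pos hμ], hX, hW⟩) (by linarith)
  have k₃ := key (h₃ ⟨(μ, s, X, W), by rwa [abs_of_pos hμ], hX, hW⟩) (by linarith)
  refine ⟨le_of_eq_of_le (congrArg abs ?_) k₁, le_of_eq_of_le (congrArg abs ?_) k₂,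
    le_of_eq_of_le (congrArg abs ?_) k₃⟩
  · simp only [q₁₁, μ', s', X']; ring
  · simp only [q₁₂, μ', s', X', W']; ring
  · simp only [q₂₂, μ', s', X', W']; ring

theorem quadratic_sub_bound {q₁₁ q₁₂ q₂₂ a b δ ζ ξ : ℝ} (h₁ : |q₁₁ - a| ≤ δ) (h₂ : |q₁₂| ≤ δ)
    (h₃ : |q₂₂ - b| ≤ δ) :
    |q₁₁ * ζ ^ 2 + 2 * q₁₂ * (ζ * ξ) + q₂₂ * ξ ^ 2 - (a * ζ ^ 2 + b * ξ ^ 2)|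
      ≤ 2 * δ * (ζ ^ 2 + ξ ^ 2) := by
  have hδ : 0 ≤ δ := (abs_nonneg _).trans h₂
  have e : q₁₁ * ζ ^ 2 + 2 * q₁₂ * (ζ * ξ) + q₂₂ * ξ ^ 2 - (a * ζ ^ 2 + b * ξ ^ 2)
      = (q₁₁ - a) * ζ ^ 2 + q₁₂ * (2 * (ζ * ξ)) + (q₂₂ - b) * ξ ^ 2 := by ring
  have h4 : |2 * (ζ * ξ)| ≤ ζ ^ 2 + ξ ^ 2 :=
    abs_le.2 ⟨by nlinarith [sq_nonneg (ζ + ξ)], by nlinarith [sq_nonneg (ζ - ξ)]⟩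
  rw [e]
  refine (abs_add_three _ _ _).trans ?_
  rw [abs_mul, abs_mul q₁₂, abs_mul (q₂₂ - b), abs_of_nonneg (sq_nonneg ζ),
    abs_of_nonneg (sq_nonneg ξ)]
  have := mul_le_mul_of_nonneg_right h₁ (sq_nonneg ζ)
  have := mul_le_mul_of_nonneg_right h₃ (sq_nonneg ξ)
  have := mul_le_mul h₂ h4 (abs_nonneg _) hδ
  linarith

theorem midpoint_bound (hS : S.Elliptic) (hD : S.ValidData D) {K : ℝ} (hK : 0 ≤ K) :
    ∃ M ≥ 0, ∀ μ, 0 < μ → μ ≤ 1 → ∀ s, ∀ y₁ y₂ : ℝ → ℝ × ℝ, y₁ s ∈ S.tube K μ s →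
      y₂ s ∈ S.tube K μ s → |S.midX D μ y₁ y₂ s| ≤ M ∧ |S.midW D μ y₁ y₂ s| ≤ M := by
  obtain ⟨C, hC, hb⟩ := exists_common_bound hS hD
  refine ⟨K + C, by positivity, fun μ hμ hμ1 s y₁ y₂ ht₁ ht₂ => ?_⟩
  obtain ⟨-, -, -, -, bu, -, bv, -⟩ := hb s (S.slow μ s)
  have hx := abs_midpoint_le ht₁.2 ht₂.2
  have hz := abs_midpoint_le (c := 0) (by simpa using ht₁.1) (by simpa using ht₂.1)
  rw [sub_zero] at hz
  constructor
  · rw [midX, abs_div, abs_of_pos hμ, div_le_iff₀ hμ]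
    refine (abs_sub _ _).trans ?_
    rw [abs_mul, abs_of_nonneg (sq_nonneg μ)]
    have h2 : μ ^ 2 * |D.v s (S.slow μ s)| ≤ μ * 1 * C := by rw [sq]; gcongr
    linarith
  · refine (abs_sub _ _).trans (add_le_add ?_ bu)
    rw [← div_div, abs_div, abs_of_pos hμ, div_le_iff₀ hμ]
    exact hz

theorem continuousOn_energy (hS : S.Elliptic) (hD : S.ValidData D) {μ : ℝ} {y₁ y₂ : ℝ → ℝ × ℝ}
    {I : Set ℝ} (h₁ : ContinuousOn y₁ I) (h₂ : ContinuousOn y₂ I) :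
    ContinuousOn (fun s => S.energy D μ s (S.midX D μ y₁ y₂ s) (S.midW D μ y₁ y₂ s)
      ((y₁ s).1 - (y₂ s).1) ((y₁ s).2 - (y₂ s).2)) I := by
  have hw := hD.weight
  have hf := hD.frame
  have sl : ∀ {f : ℝ → ℝ}, IsSlow S.Ts f → ContinuousOn (fun s => f (S.slow μ s)) I := fun h =>
    (h.smooth.continuous.comp (by unfold slow; fun_prop)).continuousOn
  have c₁ := sl hw.hρ
  have c₂ := sl hw.hα
  have c₃ := sl hw.hk
  have c₄ := sl hw.hp
  have c₅ := sl hS.hη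
  have c₆ := (hf.hu.cont μ).continuousOn (s := I)
  have c₇ := (hf.hv.cont μ).continuousOn (s := I)
  have c₈ := (hf.hU.cont μ).continuousOn (s := I)
  have c₉ := (hf.hV.cont μ).continuousOn (s := I)
  have c₁₀ := (hf.hUB.cont μ).continuousOn (s := I)
  have c₁₁ := (hf.hU₂.cont μ).continuousOn (s := I)
  have c₁₂ := (hf.hUE.cont μ).continuousOn (s := I)
  have f₁ := continuous_fst.comp_continuousOn h₁
  have f₂ := continuous_fst.comp_continuousOn h₂
  have s₁ := continuous_snd.comp_continuousOn h₁
  have s₂ := continuous_snd.comp_continuousOn h₂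
  simp only [Function.comp_def] at f₁ f₂ s₁ s₂
  have cX : ContinuousOn (S.midX D μ y₁ y₂) I := by unfold midX; fun_prop
  have cW : ContinuousOn (S.midW D μ y₁ y₂) I := by unfold midW; fun_prop
  unfold energy q₁₁ q₁₂ q₂₂
  fun_prop

/-- Young's inequality, weighted so that the part quadratic in N can be absorbed by damping of
strength μ². The price is (G/μ)², which becomes (G/μ²)² after integration against that damping. -/
theorem young_bound {M₀ N G κ μ : ℝ} (hκ : 0 < κ) (hμ : 0 < μ) :
    8 * M₀ * N * G ≤ μ ^ 2 * κ * N ^ 2 + 16 * M₀ ^ 2 / κ * (G / μ) ^ 2 := by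
  have h := sq_nonneg (κ * (μ * N) - 4 * M₀ * (G / μ))
  have e : μ * N * (G / μ) = N * G := by field_simp
  have e2 : μ ^ 2 * κ * N ^ 2 + 16 * M₀ ^ 2 / κ * (G / μ) ^ 2 - 8 * M₀ * (μ * N * (G / μ))
      = (κ * (μ * N) - 4 * M₀ * (G / μ)) ^ 2 / κ := by
    field_simp
    ring
  have := div_nonneg h hκ.le
  rw [e] at e2
  linarith

theorem cross_bound {q₁₁ q₁₂ q₂₂ ζ ξ e₁ e₂ M₀ N e : ℝ} (h₁ : |q₁₁| ≤ M₀) (h₂ : |q₁₂| ≤ M₀)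
    (h₃ : |q₂₂| ≤ M₀) (hζ : |ζ| ≤ N) (hξ : |ξ| ≤ N) (he₁ : |e₁| ≤ e) (he₂ : |e₂| ≤ e) :
    |2 * (q₁₁ * ζ + q₁₂ * ξ) * e₁ + 2 * (q₁₂ * ζ + q₂₂ * ξ) * e₂| ≤ 8 * M₀ * N * e := by
  have hM : 0 ≤ M₀ := (abs_nonneg _).trans h₁
  have hN : 0 ≤ N := (abs_nonneg _).trans hζ
  have b : ∀ {a x : ℝ}, |a| ≤ M₀ → |x| ≤ N → |a * x| ≤ M₀ * N := fun ha hx => by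
    rw [abs_mul]; exact mul_le_mul ha hx (abs_nonneg _) hM
  have b2 : ∀ {a b x y e' : ℝ}, |a| ≤ M₀ → |b| ≤ M₀ → |x| ≤ N → |y| ≤ N → |e'| ≤ e →
      |2 * (a * x + b * y) * e'| ≤ 4 * M₀ * N * e := fun {a b' x y e'} ha hb hx hy he => by
    have h := (abs_add_le (a * x) (b' * y)).trans (add_le_add (b ha hx) (b hb hy))
    rw [abs_mul, abs_mul, abs_two]
    calc _ ≤ 2 * (M₀ * N + M₀ * N) * e :=
          mul_le_mul (mul_le_mul_of_nonneg_left h two_pos.le) he (abs_nonneg _) (by positivity)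
      _ = _ := by ring
  refine (abs_add_le _ _).trans ((add_le_add (b2 h₁ h₂ hζ hξ he₁) (b2 h₂ h₃ hζ hξ he₂)).trans_eq ?_)
  ring

set_option maxHeartbeats 1000000 in
/-- A quadratic Lyapunov function for differences of approximate solutions. -/
theorem exists_lyapunov (hS : S.Elliptic) (hr : S.rate ≠ 0) :
    ∃ m > 0, ∃ M₀ > 0, ∃ C > 0, ∀ K ≥ 0, ∃ μ₀ > 0, μ₀ ≤ 1 ∧ ∀ μ, 0 < μ → μ < μ₀ →
      ∀ y₁ y₂ : ℝ → ℝ × ℝ, ∃ Q : ℝ → ℝ,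
        (∀ I : Set ℝ, ContinuousOn y₁ I → ContinuousOn y₂ I → ContinuousOn Q I) ∧
        ∀ s, y₁ s ∈ S.tube K μ s → y₂ s ∈ S.tube K μ s →
          m * ‖y₁ s - y₂ s‖ ^ 2 ≤ Q s ∧ Q s ≤ M₀ * ‖y₁ s - y₂ s‖ ^ 2 ∧
          ∀ (g₁ g₂ : ℝ × ℝ) (G : ℝ), s ∉ jumpSet → ‖g₁‖ ≤ K * μ ^ 3 → ‖g₂‖ ≤ K * μ ^ 3 →
            ‖g₁ - g₂‖ ≤ G → HasDerivAt y₁ (S.V μ s (y₁ s) + g₁) s →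
            HasDerivAt y₂ (S.V μ s (y₂ s) + g₂) s →
            ∃ r, HasDerivAt Q r s ∧
              |r - μ ^ 2 * S.rate * Q s| ≤ μ ^ 2 * (|S.rate| / 2) * Q s + C * (G / μ) ^ 2 := by
  obtain ⟨D, hD⟩ := hS.exists_validData
  have hw := hD.weight
  obtain ⟨r₁, hr₁, hr₁'⟩ := hw.hρ.exists_lower_bound hS.Ts_pos hw.ρ_pos
  obtain ⟨r₂, hr₂, hr₂'⟩ := (hw.hρ.mul hw.hα).exists_lower_bound hS.Ts_pos
    fun σ => mul_pos (hw.ρ_pos σ) (hw.α_pos σ)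
  obtain ⟨R₁, hR₁⟩ := hw.hρ.bounded hS.Ts_pos
  obtain ⟨R₂, hR₂⟩ := (hw.hρ.mul hw.hα).bounded hS.Ts_pos
  have hR₁0 : 0 ≤ R₁ := (abs_nonneg _).trans (hR₁ 0)
  have hR₂0 : 0 ≤ R₂ := (abs_nonneg _).trans (hR₂ 0)
  set m := min r₁ r₂ / 2 with hm
  have hm0 : 0 < m := by positivity
  have hm1 : 2 * m ≤ r₁ := by rw [hm]; linarith [min_le_left r₁ r₂]
  have hm2 : 2 * m ≤ r₂ := by rw [hm]; linarith [min_le_right r₁ r₂]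
  set M₀ := R₁ + R₂ + m with hM₀
  have hβ : 0 < |S.rate| := abs_pos.2 hr
  -- Half of the damping, μ²|rate|/2 times the form, may be lost. It is split into two parts of size
  -- μ²κN²: one for the third order terms, one for Young's inequality.
  set κ := |S.rate| * m / 4 with hκ
  have hκ0 : 0 < κ := by positivity
  -- These constants are fixed before the tube radius K; only the threshold for μ depends on K.
  -- `exists_tubeSolution` relies on this when it chooses K in terms of C.
  refine ⟨m, hm0, 2 * M₀, by positivity, 16 * M₀ ^ 2 / κ, by positivity, fun K hK => ?_⟩
  obtain ⟨M₁, hM₁, μ₁, hμ₁, hμ₁', hde⟩ := difference_equations hS hD hK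
  obtain ⟨M₂, hM₂, hmid⟩ := midpoint_bound hS hD hK
  set M := max M₁ M₂ with hMdef
  have hM : 0 ≤ M := hM₁.trans (le_max_left _ _)
  obtain ⟨C₁, hC₁, hen⟩ := energy_deriv hS hD M
  obtain ⟨C₂, hC₂, hq⟩ := energy_coeff_bound hS hD M
  -- Third order losses: the remainder in the energy rate, the replacement of the diagonal form by
  -- the full one, and the Lipschitz part of the errors.
  set C₃ := C₁ * 2 + 2 * |S.rate| * C₂ * 2 + 8 * M₀ * M with hC₃
  have hC₃0 : 0 < C₃ := by positivity
  refine ⟨min μ₁ (min (m / (2 * C₂)) (κ / C₃)), by positivity, (min_le_left _ _).trans hμ₁',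
    fun μ hμ hμ' y₁ y₂ => ?_⟩
  have hμ1 : μ ≤ 1 := hμ'.le.trans ((min_le_left _ _).trans hμ₁')
  have hμ2 : C₂ * μ ≤ m / 2 := by
    have := (hμ'.trans_le ((min_le_right _ _).trans (min_le_left _ _))).le
    rw [le_div_iff₀ (by positivity)] at this
    linarith
  have hμ3 : C₃ * μ ≤ κ := by
    have := (hμ'.trans_le ((min_le_right _ _).trans (min_le_right _ _))).le
    rw [le_div_iff₀ (by positivity)] at this
    linarith
  refine ⟨fun s => S.energy D μ s (S.midX D μ y₁ y₂ s) (S.midW D μ y₁ y₂ s)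
      ((y₁ s).1 - (y₂ s).1) ((y₁ s).2 - (y₂ s).2),
    fun I h₁ h₂ => continuousOn_energy hS hD h₁ h₂, fun s ht₁ ht₂ => ?_⟩
  set X := S.midX D μ y₁ y₂ s with hX
  set W := S.midW D μ y₁ y₂ s with hW
  set ζ := (y₁ s).1 - (y₂ s).1 with hζ
  set ξ := (y₁ s).2 - (y₂ s).2 with hξ
  set N := ‖y₁ s - y₂ s‖ with hN
  have hN0 : 0 ≤ N := norm_nonneg _
  obtain ⟨bX, bW⟩ := hmid μ hμ hμ1 s y₁ y₂ ht₁ ht₂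
  have bX' : |X| ≤ M := bX.trans (le_max_right _ _)
  have bW' : |W| ≤ M := bW.trans (le_max_right _ _)
  obtain ⟨q₁, q₂, q₃⟩ := hq μ hμ hμ1 s X W bX' bW'
  have hn1 : N ^ 2 ≤ ζ ^ 2 + ξ ^ 2 := sq_norm_le_add (y₁ s - y₂ s)
  have hn2 : ζ ^ 2 + ξ ^ 2 ≤ 2 * N ^ 2 := add_le_two_sq_norm (y₁ s - y₂ s)
  have hζN : |ζ| ≤ N := norm_fst_le (y₁ s - y₂ s)
  have hξN : |ξ| ≤ N := norm_snd_le (y₁ s - y₂ s)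
  have hsub := quadratic_sub_bound (ζ := ζ) (ξ := ξ) q₁ q₂ q₃
  change |S.energy D μ s X W ζ ξ - _| ≤ _ at hsub
  set Q := S.energy D μ s X W ζ ξ with hQ
  set ρ := D.ρ (S.slow μ s) with hρ
  set α := D.α (S.slow μ s) with hα
  have ρ1 : r₁ ≤ ρ := hr₁' _
  have ρ2 : |ρ| ≤ R₁ := hR₁ _
  have α1 : r₂ ≤ ρ * α := hr₂' _
  have α2 : |ρ * α| ≤ R₂ := hR₂ _
  have hlow : 2 * m * (ζ ^ 2 + ξ ^ 2) ≤ ρ * ζ ^ 2 + ρ * α * ξ ^ 2 := by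
    have := mul_le_mul_of_nonneg_right (hm1.trans ρ1) (sq_nonneg ζ)
    have := mul_le_mul_of_nonneg_right (hm2.trans α1) (sq_nonneg ξ)
    linarith only [this, ‹2 * m * ζ ^ 2 ≤ ρ * ζ ^ 2›]
  have hup : ρ * ζ ^ 2 + ρ * α * ξ ^ 2 ≤ (R₁ + R₂) * (ζ ^ 2 + ξ ^ 2) := by
    have h1 := mul_le_mul_of_nonneg_right ((le_abs_self _).trans ρ2) (sq_nonneg ζ)
    have h2 := mul_le_mul_of_nonneg_right ((le_abs_self _).trans α2) (sq_nonneg ξ)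
    have h3 := mul_nonneg hR₁0 (sq_nonneg ξ)
    have h4 := mul_nonneg hR₂0 (sq_nonneg ζ)
    linarith only [h1, h2, h3, h4]
  have hsmall : 2 * (C₂ * μ) * (ζ ^ 2 + ξ ^ 2) ≤ m * (ζ ^ 2 + ξ ^ 2) := by
    have : 0 ≤ ζ ^ 2 + ξ ^ 2 := by positivity
    have := mul_le_mul_of_nonneg_right hμ2 this
    linarith only [this]
  have hQlow : m * N ^ 2 ≤ Q := by
    have h1 := (abs_le.1 hsub).1
    have h2 := mul_le_mul_of_nonneg_left hn1 hm0.le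
    linarith only [h1, h2, hlow, hsmall]
  refine ⟨hQlow, ?_, ?_⟩
  · have h1 := (abs_le.1 hsub).2
    have h2 := mul_le_mul_of_nonneg_left hn2 (by positivity : 0 ≤ R₁ + R₂ + m)
    rw [hM₀]
    linarith only [h1, h2, hup, hsmall]
  intro g₁ g₂ G hs hg₁ hg₂ hG d₁ d₂
  obtain ⟨e₁, e₂, x₁, w₁, -, -, hx₁, hw₁, he₁, he₂, dζ, dξ, dX, dW⟩ :=
    hde μ hμ (hμ'.trans_le (min_le_left _ _)) s hs y₁ y₂ g₁ g₂ ht₁ ht₂ hg₁ hg₂ d₁ d₂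
  obtain ⟨r, hr', hrb⟩ := hen μ hμ hμ1 s hs (fun s => (y₁ s).1 - (y₂ s).1)
    (fun s => (y₁ s).2 - (y₂ s).2) _ _ e₁ e₂ x₁ w₁ bX' bW'
    (hx₁.trans (le_max_left _ _)) (hw₁.trans (le_max_left _ _)) dζ dξ dX dW
  refine ⟨r, hr', ?_⟩
  have hee : ∀ {e' : ℝ}, |e'| ≤ M₁ * μ ^ 3 * N + ‖g₁ - g₂‖ → |e'| ≤ M * μ ^ 3 * N + G := fun h =>
    h.trans (add_le_add (mul_le_mul_of_nonneg_right (mul_le_mul_of_nonneg_right (le_max_left _ _)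
      (by positivity)) hN0) hG)
  have t₁ : |S.q₁₁ D μ s X| ≤ M₀ := by
    have := abs_le.1 q₁
    have := abs_le.1 ρ2
    exact abs_le.2 ⟨by linarith, by linarith⟩
  have t₂ : |S.q₁₂ D μ s X W| ≤ M₀ := q₂.trans (by linarith)
  have t₃ : |S.q₂₂ D μ s X W| ≤ M₀ := by
    have := abs_le.1 q₃
    have := abs_le.1 α2
    exact abs_le.2 ⟨by linarith, by linarith⟩
  have hcross := cross_bound t₁ t₂ t₃ hζN hξN (hee he₁) (hee he₂)
  have hy := young_bound (M₀ := M₀) (N := N) (G := G) hκ0 hμ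
  have h1 := hrb.trans (add_le_add le_rfl hcross)
  have h2 : |μ ^ 2 * S.rate * (Q - (ρ * ζ ^ 2 + ρ * α * ξ ^ 2))|
      ≤ μ ^ 2 * |S.rate| * (2 * (C₂ * μ) * (ζ ^ 2 + ξ ^ 2)) := by
    rw [abs_mul, abs_mul, abs_of_nonneg (sq_nonneg μ)]
    exact mul_le_mul_of_nonneg_left hsub (by positivity)
  have h3 := abs_sub (r - μ ^ 2 * S.rate * (ρ * ζ ^ 2 + ρ * α * ξ ^ 2))
    (μ ^ 2 * S.rate * (Q - (ρ * ζ ^ 2 + ρ * α * ξ ^ 2)))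
  rw [show r - μ ^ 2 * S.rate * (ρ * ζ ^ 2 + ρ * α * ξ ^ 2)
    - μ ^ 2 * S.rate * (Q - (ρ * ζ ^ 2 + ρ * α * ξ ^ 2)) = r - μ ^ 2 * S.rate * Q by ring] at h3
  have h4 : C₁ * μ ^ 3 * (ζ ^ 2 + ξ ^ 2) ≤ C₁ * μ ^ 3 * (2 * N ^ 2) :=
    mul_le_mul_of_nonneg_left hn2 (by positivity)
  have h5 : μ ^ 2 * |S.rate| * (2 * (C₂ * μ) * (ζ ^ 2 + ξ ^ 2))
      ≤ μ ^ 2 * |S.rate| * (2 * (C₂ * μ) * (2 * N ^ 2)) := by gcongr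
  have h6 : μ ^ 2 * N ^ 2 * (C₃ * μ) ≤ μ ^ 2 * N ^ 2 * κ :=
    mul_le_mul_of_nonneg_left hμ3 (by positivity)
  have h7 : μ ^ 2 * (|S.rate| / 2) * (m * N ^ 2) ≤ μ ^ 2 * (|S.rate| / 2) * Q :=
    mul_le_mul_of_nonneg_left hQlow (by positivity)
  have h8 : μ ^ 2 * (|S.rate| / 2) * (m * N ^ 2) = 2 * (μ ^ 2 * N ^ 2 * κ) := by rw [hκ]; ring
  have h9 : C₁ * μ ^ 3 * (2 * N ^ 2) + 8 * M₀ * N * (M * μ ^ 3 * N + G)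
      + μ ^ 2 * |S.rate| * (2 * (C₂ * μ) * (2 * N ^ 2))
      = μ ^ 2 * N ^ 2 * (C₃ * μ) + 8 * M₀ * N * G := by rw [hC₃]; ring
  linarith only [h1, h2, h3, h4, h5, h6, h7, h8, h9, hy]

set_option maxHeartbeats 1000000 in
/-- Contraction (forward in time if the rate is negative, backward if it is positive) of differences
of approximate solutions. -/
theorem energy_estimate (hS : S.Elliptic) (hr : S.rate ≠ 0) :
    ∃ C > 0, ∃ l > 0, ∀ K ≥ 0, ∃ μ₀ > 0, μ₀ ≤ 1 ∧ ∀ μ, 0 < μ → μ < μ₀ →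
      ∀ (y₁ y₂ g₁ g₂ : ℝ → ℝ × ℝ) (a b G : ℝ), a ≤ b → ContinuousOn y₁ (Set.Icc a b) →
        ContinuousOn y₂ (Set.Icc a b) →
        (∀ s ∈ Set.Icc a b, y₁ s ∈ S.tube K μ s) → (∀ s ∈ Set.Icc a b, y₂ s ∈ S.tube K μ s) →
        (∀ s ∈ Set.Ioo a b, s ∉ jumpSet → HasDerivAt y₁ (S.V μ s (y₁ s) + g₁ s) s ∧
          HasDerivAt y₂ (S.V μ s (y₂ s) + g₂ s) s ∧ ‖g₁ s‖ ≤ K * μ ^ 3 ∧ ‖g₂ s‖ ≤ K * μ ^ 3 ∧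
          ‖g₁ s - g₂ s‖ ≤ G) →
        (S.rate < 0 → ‖y₁ b - y₂ b‖ ^ 2
          ≤ C * (exp (-(l * μ ^ 2 * (b - a))) * ‖y₁ a - y₂ a‖ ^ 2 + (G / μ ^ 2) ^ 2)) ∧
        (0 < S.rate → ‖y₁ a - y₂ a‖ ^ 2
          ≤ C * (exp (-(l * μ ^ 2 * (b - a))) * ‖y₁ b - y₂ b‖ ^ 2 + (G / μ ^ 2) ^ 2)) := by
  obtain ⟨m, hm, M₀, hM₀, C, hC, H⟩ := exists_lyapunov hS hr
  have hβ : 0 < |S.rate| := abs_pos.2 hr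
  set l := |S.rate| / 2 with hl
  have hl0 : 0 < l := by positivity
  refine ⟨(M₀ + C / l) / m, by positivity, l, hl0, fun K hK => ?_⟩
  obtain ⟨μ₀, hμ₀, hμ₀1, H⟩ := H K hK
  refine ⟨μ₀, hμ₀, hμ₀1, fun μ hμ hμ' y₁ y₂ g₁ g₂ a b G hab c₁ c₂ t₁ t₂ hd => ?_⟩
  obtain ⟨Q, hQc, hQ⟩ := H μ hμ hμ' y₁ y₂
  have cQ := hQc _ c₁ c₂
  -- The level at which the remaining damping lμ² balances the defect. Above it, Q decays in the
  -- stable direction, so exp(±lμ²s)(Q − k) is monotone.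
  set k := C / l * (G / μ ^ 2) ^ 2 with hk
  have hk0 : 0 ≤ k := by positivity
  have hkl : l * μ ^ 2 * k = C * (G / μ) ^ 2 := by
    rw [hk]; field_simp
  have hder : ∀ s ∈ Set.Ioo a b, s ∉ jumpSet → ∃ r, HasDerivAt Q r s ∧
      |r - μ ^ 2 * S.rate * Q s| ≤ μ ^ 2 * l * Q s + C * (G / μ) ^ 2 := fun s hs hsN => by
    have hsI := Set.Ioo_subset_Icc_self hs
    obtain ⟨d₁, d₂, hg₁, hg₂, hG⟩ := hd s hs hsN
    exact (hQ s (t₁ s hsI) (t₂ s hsI)).2.2 (g₁ s) (g₂ s) G hsN hg₁ hg₂ hG d₁ d₂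
  have hQ' : ∀ s ∈ Set.Ioo a b, s ∉ jumpSet → HasDerivAt Q (deriv Q s) s ∧
      |deriv Q s - μ ^ 2 * S.rate * Q s| ≤ μ ^ 2 * l * Q s + C * (G / μ) ^ 2 := fun s hs hsN => by
    obtain ⟨r, h1, h2⟩ := hder s hs hsN
    rw [h1.deriv]
    exact ⟨h1, h2⟩
  have hexp : ∀ (κ s : ℝ), HasDerivAt (fun s => exp (κ * s)) (κ * exp (κ * s)) s := fun κ s => by
    have := ((hasDerivAt_id s).const_mul κ).exp
    simpa [mul_comm] using this
  have hcE : ∀ κ : ℝ, ContinuousOn (fun s => exp (κ * s) * (Q s - k)) (Set.Icc a b) := fun κ =>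
    ContinuousOn.mul (by fun_prop) (cQ.sub continuousOn_const)
  have fin : ∀ {x y E : ℝ}, 0 ≤ E → m * x ^ 2 - k ≤ E * (M₀ * y ^ 2) →
      x ^ 2 ≤ (M₀ + C / l) / m * (E * y ^ 2 + (G / μ ^ 2) ^ 2) := fun {x y E} hE h => by
    rw [div_mul_eq_mul_div, le_div_iff₀ hm]
    have h1 : 0 ≤ C / l * (E * y ^ 2) := by positivity
    have h2 : 0 ≤ M₀ * (G / μ ^ 2) ^ 2 := by positivity
    rw [hk] at h
    linarith only [h, h1, h2]
  have hsgn : ∀ κ : ℝ, exp (κ * a) * exp (-(κ * b)) = exp (-(κ * (b - a))) := fun κ => by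
    rw [← exp_add]; ring_nf
  obtain ⟨lowa, upa, -⟩ := hQ a (t₁ a (Set.left_mem_Icc.2 hab)) (t₂ a (Set.left_mem_Icc.2 hab))
  obtain ⟨lowb, upb, -⟩ := hQ b (t₁ b (Set.right_mem_Icc.2 hab)) (t₂ b (Set.right_mem_Icc.2 hab))
  constructor
  · intro hneg
    have hβl : S.rate = -(2 * l) := by rw [hl, abs_of_neg hneg]; ring
    have key := le_of_hasDerivAt_nonpos_off_jumpSet hab (hcE (l * μ ^ 2))
      (f' := fun s => l * μ ^ 2 * exp (l * μ ^ 2 * s) * (Q s - k) + exp (l * μ ^ 2 * s) * deriv Q s)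
      (fun s hs hsN => (hexp _ s).fun_mul ((hQ' s hs hsN).1.sub_const k)) (fun s hs hsN => by
        have h := (abs_le.1 (hQ' s hs hsN).2).2
        rw [hβl] at h
        have e : l * μ ^ 2 * exp (l * μ ^ 2 * s) * (Q s - k) + exp (l * μ ^ 2 * s) * deriv Q s
          = exp (l * μ ^ 2 * s) * (l * μ ^ 2 * Q s - l * μ ^ 2 * k + deriv Q s) := by ring
        rw [e]
        exact mul_nonpos_of_nonneg_of_nonpos (exp_pos _).le (by rw [hkl]; linarith))
    refine fin (exp_pos _).le ?_
    have h1 := mul_le_mul_of_nonneg_left key (exp_pos (-(l * μ ^ 2 * b))).le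
    rw [← mul_assoc, ← exp_add, neg_add_cancel, exp_zero, one_mul, ← mul_assoc,
      mul_comm (exp (-(l * μ ^ 2 * b))), hsgn] at h1
    have h2 := mul_le_mul_of_nonneg_left upa (exp_pos (-(l * μ ^ 2 * (b - a)))).le
    have h3 : 0 ≤ exp (-(l * μ ^ 2 * (b - a))) * k := by positivity
    linarith only [h1, h2, h3, lowb]
  · intro hpos
    have hβl : S.rate = 2 * l := by rw [hl, abs_of_pos hpos]; ring
    -- For a positive rate the same argument runs backward: Q grows at least like exp(lμ²s), up to
    -- the level k.
    have key := le_of_hasDerivAt_nonpos_off_jumpSet hab (hcE (-(l * μ ^ 2))).neg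
      (f' := fun s => -(-(l * μ ^ 2) * exp (-(l * μ ^ 2) * s) * (Q s - k)
        + exp (-(l * μ ^ 2) * s) * deriv Q s))
      (fun s hs hsN => ((hexp _ s).fun_mul ((hQ' s hs hsN).1.sub_const k)).fun_neg)
      (fun s hs hsN => by
        have h := (abs_le.1 (hQ' s hs hsN).2).1
        rw [hβl] at h
        have e : -(-(l * μ ^ 2) * exp (-(l * μ ^ 2) * s) * (Q s - k)
            + exp (-(l * μ ^ 2) * s) * deriv Q s)
          = exp (-(l * μ ^ 2) * s) * (l * μ ^ 2 * Q s - l * μ ^ 2 * k - deriv Q s) := by ring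
        rw [e]
        exact mul_nonpos_of_nonneg_of_nonpos (exp_pos _).le (by rw [hkl]; linarith))
    refine fin (exp_pos _).le ?_
    have h1 := mul_le_mul_of_nonneg_left (neg_le_neg_iff.1 key) (exp_pos (l * μ ^ 2 * a)).le
    rw [← mul_assoc, ← exp_add, neg_mul, add_neg_cancel, exp_zero, one_mul, ← mul_assoc, neg_mul,
      hsgn] at h1
    have h2 := mul_le_mul_of_nonneg_left upb (exp_pos (-(l * μ ^ 2 * (b - a)))).le
    have h3 : 0 ≤ exp (-(l * μ ^ 2 * (b - a))) * k := by positivity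
    linarith only [h1, h2, h3, lowa]

end PhaseSystem

namespace PhaseSystem

variable {S : PhaseSystem} {D : EnergyData}

/-- Contraction of differences of approximate solutions in the stable direction of time. -/
theorem contraction (hS : S.Elliptic) (hr : S.rate ≠ 0) :
    ∃ C > 0, ∃ l > 0, ∀ K ≥ 0, ∃ μ₀ > 0, μ₀ ≤ 1 ∧ ∀ μ, 0 < μ → μ < μ₀ →
      ∀ (y₁ y₂ g₁ g₂ : ℝ → ℝ × ℝ) (a b G : ℝ), S.rate * (b - a) ≤ 0 →
        ContinuousOn y₁ (Set.uIcc a b) → ContinuousOn y₂ (Set.uIcc a b) →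
        (∀ s ∈ Set.uIcc a b, y₁ s ∈ S.tube K μ s) → (∀ s ∈ Set.uIcc a b, y₂ s ∈ S.tube K μ s) →
        (∀ s ∈ Set.uIoo a b, s ∉ jumpSet → HasDerivAt y₁ (S.V μ s (y₁ s) + g₁ s) s ∧
          HasDerivAt y₂ (S.V μ s (y₂ s) + g₂ s) s ∧ ‖g₁ s‖ ≤ K * μ ^ 3 ∧ ‖g₂ s‖ ≤ K * μ ^ 3 ∧
          ‖g₁ s - g₂ s‖ ≤ G) →
        ‖y₁ b - y₂ b‖ ^ 2
          ≤ C * (exp (-(l * μ ^ 2 * |b - a|)) * ‖y₁ a - y₂ a‖ ^ 2 + (G / μ ^ 2) ^ 2) := by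
  obtain ⟨C, hC, l, hl, H⟩ := energy_estimate hS hr
  refine ⟨C, hC, l, hl, fun K hK => ?_⟩
  obtain ⟨μ₀, hμ₀, hμ₀1, H⟩ := H K hK
  refine ⟨μ₀, hμ₀, hμ₀1, fun μ hμ hμ' y₁ y₂ g₁ g₂ a b G hab c₁ c₂ t₁ t₂ hd => ?_⟩
  rcases lt_or_gt_of_ne hr with hr | hr
  · have hab' : a ≤ b := by
      by_contra h
      push Not at h
      nlinarith [mul_pos_of_neg_of_neg hr (sub_neg.2 h)]
    rw [Set.uIcc_of_le hab'] at *
    rw [Set.uIoo_of_le hab'] at hd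
    rw [abs_of_nonneg (sub_nonneg.2 hab')]
    exact (H μ hμ hμ' y₁ y₂ g₁ g₂ a b G hab' c₁ c₂ t₁ t₂ hd).1 hr
  · have hab' : b ≤ a := by
      by_contra h
      push Not at h
      nlinarith [mul_pos hr (sub_pos.2 h)]
    rw [Set.uIcc_of_ge hab'] at *
    rw [Set.uIoo_of_ge hab'] at hd
    rw [abs_of_nonpos (sub_nonpos.2 hab'), neg_sub]
    exact (H μ hμ hμ' y₁ y₂ g₁ g₂ b a G hab' c₁ c₂ t₁ t₂ hd).2 hr

theorem LO.fst_V (hS : S.Regular) {K : ℝ} (hK : 0 ≤ K) : S.LO K 1 1 fun μ s y => (S.V μ s y).1 := by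
  have h1 := (LO.V_fst hS hK).mono (m := 1) (n := 1) (by simp) (by simp)
  have dd : S.LO K 1 0 fun μ s y => (y.2 - S.η (S.slow μ s)) * (y.2 - S.η (S.slow μ s)) :=
    (LO.dev hK).mul (LO.dev hK) (by simp) (by simp) (by simp)
  have q1 : S.LO K 0 0 fun μ s y => S.A' s (S.slow μ s) * (y.2 - S.η (S.slow μ s)) :=
    (LO.of_isSep hS hS.isSep_A' 0).mul (LO.dev hK) (by simp) (by simp) (by simp)
  have q2 : S.LO K 0 0 fun μ s y => S.A'' s (S.slow μ s)
      * ((y.2 - S.η (S.slow μ s)) * (y.2 - S.η (S.slow μ s))) :=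
    (LO.of_isSep hS hS.isSep_A'' 0).mul dd (by simp) (by simp) (by simp)
  have q3 : S.LO K 0 0 fun μ s y => S.B s (S.slow μ s) * (μ * y.1) :=
    (LO.of_isSep hS hS.isSep_B 0).mul (m₂ := 0) (n₂ := 0) ((LO.mu 0).mul (LO.fst hK) (by simp)
      (by simp) (by simp)) (by simp) (by simp) (by simp)
  have q4 := (((LO.of_isSep hS hS.isSep_A₀ 0).add q1).add
    (q2.mul (m := 0) (n := 0) (LO.const (1 / 2) 0) (by simp) (by simp) (by simp))).add q3
  have h2 := (LO.mu 1).mul (m := 1) (n := 1) q4 (by simp) (by simp) (by simp)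
  exact (h1.add h2).congr fun μ s y => by ring

theorem LO.snd_V (hS : S.Regular) {K : ℝ} (hK : 0 ≤ K) : S.LO K 2 1 fun μ s y => (S.V μ s y).2 := by
  have h1 := (LO.V_snd hS hK).mono (m := 2) (n := 1) (by simp) (by simp)
  have q1 : S.LO K 0 0 fun μ s y => S.E s (S.slow μ s) * (y.2 - S.η (S.slow μ s)) :=
    (LO.of_isSep hS hS.isSep_E 0).mul (LO.dev hK) (by simp) (by simp) (by simp)
  have q2 := (LO.mu_sq 1).mul (m := 2) (n := 1) ((LO.of_isSep hS hS.isSep_G₀ 0).add q1) (by simp)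
    (by simp) (by simp)
  have q3 : S.LO K 2 1 fun μ s y => S.d * (μ * y.1) :=
    (LO.const S.d 1).mul (m₂ := 2) (n₂ := 1) ((LO.mu 1).mul (LO.fst hK) (by simp)
      (by simp) (by simp)) (by simp) (by simp) (by simp)
  exact (h1.add (q3.add q2)).congr fun μ s y => by ring

/-- Smallness of the right-hand side on tubes. -/
theorem exists_V_bound (hS : S.Regular) {K : ℝ} (hK : 0 ≤ K) :
    ∃ C > 0, ∃ μ₀ > 0, μ₀ ≤ 1 ∧ ∀ μ s, 0 < μ → μ < μ₀ →
      (∀ y ∈ S.tube K μ s, ‖S.V μ s y‖ ≤ C * μ ∧ |(S.V μ s y).2| ≤ C * μ ^ 2) ∧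
      ∀ y₁ ∈ S.tube K μ s, ∀ y₂ ∈ S.tube K μ s, ‖S.V μ s y₁ - S.V μ s y₂‖ ≤ C * μ * ‖y₁ - y₂‖ := by
  obtain ⟨C₁, hC₁, μ₁, hμ₁, hμ₁', H₁⟩ := LO.fst_V hS hK
  obtain ⟨C₂, hC₂, μ₂, hμ₂, hμ₂', H₂⟩ := LO.snd_V hS hK
  refine ⟨C₁ + C₂, by positivity, min μ₁ μ₂, lt_min hμ₁ hμ₂, (min_le_left _ _).trans hμ₁',
    fun μ s hμ hμ' => ?_⟩
  have hμ1 : μ ≤ 1 := hμ'.le.trans ((min_le_left _ _).trans hμ₁')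
  obtain ⟨a₁, b₁⟩ := H₁ μ s hμ (hμ'.trans_le (min_le_left _ _))
  obtain ⟨a₂, b₂⟩ := H₂ μ s hμ (hμ'.trans_le (min_le_right _ _))
  simp only [pow_one] at a₁ b₁ b₂
  refine ⟨fun y hy => ⟨?_, (a₂ y hy).trans ?_⟩, fun y₁ h₁ y₂ h₂ => ?_⟩
  · rw [Prod.norm_def]
    refine max_le ((a₁ y hy).trans ?_) ((a₂ y hy).trans ?_)
    · nlinarith
    · have : μ ^ 2 ≤ μ := by nlinarith
      nlinarith
  · nlinarith [sq_nonneg μ]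
  · have hn : 0 ≤ μ * ‖y₁ - y₂‖ := by positivity
    rw [Prod.norm_def]
    refine max_le ((b₁ y₁ h₁ y₂ h₂).trans ?_) ((b₂ y₁ h₁ y₂ h₂).trans ?_)
    · nlinarith
    · nlinarith

/-- An approximate solution with a defect of third order. -/
theorem exists_center (hS : S.Elliptic) :
    ∃ K ≥ 0, ∃ μ₀ > 0, μ₀ ≤ 1 ∧ ∀ μ, 0 < μ → μ < μ₀ → ∃ y g : ℝ → ℝ × ℝ, Continuous y ∧
      (∀ s, y s ∈ S.tube K μ s) ∧
      ∀ s ∉ jumpSet, HasDerivAt y (S.V μ s (y s) + g s) s ∧ ‖g s‖ ≤ K * μ ^ 3 := by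
  obtain ⟨D, hD⟩ := hS.exists_validData
  have hf := hD.frame
  obtain ⟨C, hC, hb⟩ := exists_common_bound hS hD
  have hL₁ : S.LO C 3 3 S.err₁ := LO.V_fst hS.toRegular hC
  have hL₂ : S.LO C 3 3 S.err₂ := LO.V_snd hS.toRegular hC
  obtain ⟨C₁, hC₁, μ₁, hμ₁, hμ₁', H₁⟩ := hL₁
  obtain ⟨C₂, hC₂, μ₂, hμ₂, hμ₂', H₂⟩ := hL₂
  refine ⟨C + C ^ 2 + C ^ 2 + C ^ 3 + C₁ + C₂, by positivity, min μ₁ μ₂, lt_min hμ₁ hμ₂,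
    (min_le_left _ _).trans hμ₁', fun μ hμ hμ' => ?_⟩
  have hμ1 : μ ≤ 1 := hμ'.le.trans ((min_le_left _ _).trans hμ₁')
  -- The first terms of a formal expansion: u solves the first equation at order μ, and v the second
  -- at order μ². The first neglected terms are of third order.
  set y : ℝ → ℝ × ℝ := fun s =>
    (μ * D.u s (S.slow μ s), S.η (S.slow μ s) + μ ^ 2 * D.v s (S.slow μ s)) with hy
  have ht : ∀ s, y s ∈ S.tube C μ s := fun s => by
    obtain ⟨-, -, -, -, bu, -, bv, -⟩ := hb s (S.slow μ s)
    refine ⟨?_, ?_⟩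
    · rw [abs_mul, abs_of_pos hμ, mul_comm]
      exact mul_le_mul_of_nonneg_right bu hμ.le
    · rw [add_sub_cancel_left, abs_mul, abs_of_nonneg (sq_nonneg μ)]
      calc μ ^ 2 * |D.v s (S.slow μ s)| ≤ μ ^ 2 * C := by gcongr
        _ = C * μ * μ := by ring
        _ ≤ C * μ * 1 := by gcongr
        _ = C * μ := mul_one _
  refine ⟨y, fun s =>
    (μ ^ 3 * D.u' s (S.slow μ s) - (μ ^ 3 * (S.A' s (S.slow μ s) * D.v s (S.slow μ s))
      + μ ^ 5 * (S.A'' s (S.slow μ s) * D.v s (S.slow μ s) ^ 2 / 2)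
      + μ ^ 3 * (S.B s (S.slow μ s) * D.u s (S.slow μ s))) - S.err₁ μ s (y s),
     μ ^ 4 * D.v' s (S.slow μ s) - μ ^ 4 * (S.E s (S.slow μ s) * D.v s (S.slow μ s))
      - S.err₂ μ s (y s)), ?_, ?_, fun s hs => ⟨?_, ?_⟩⟩
  · refine Continuous.prodMk (continuous_const.mul (hf.hu.cont μ)) (Continuous.add ?_
      (continuous_const.mul (hf.hv.cont μ)))
    exact hS.hη.smooth.continuous.comp (by unfold slow; fun_prop)
  · intro s
    have h := ht s
    have hle : C * μ ≤ (C + C ^ 2 + C ^ 2 + C ^ 3 + C₁ + C₂) * μ := by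
      have : 0 ≤ C ^ 2 + C ^ 2 + C ^ 3 + C₁ + C₂ := by positivity
      nlinarith
    exact ⟨h.1.trans hle, h.2.trans hle⟩
  · have h1 := ((hf.hu.hasDerivAt μ s hs).const_mul μ).prodMk
      ((hasDerivAt_slow hS.hη μ s).fun_add ((hf.hv.hasDerivAt μ s hs).const_mul (μ ^ 2)))
    refine HasDerivAt.congr_deriv h1 (Prod.ext ?_ ?_)
    · simp only [err₁, Prod.fst_add, hy]
      ring
    · simp only [err₂, Prod.snd_add, hy]
      ring
  · obtain ⟨bA', bA'', bB, bE, bu, bu', bv, bv'⟩ := hb s (S.slow μ s)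
    have t₁ := (H₁ μ s hμ (hμ'.trans_le (min_le_left _ _))).1 _ (ht s)
    have t₂ := (H₂ μ s hμ (hμ'.trans_le (min_le_right _ _))).1 _ (ht s)
    have p3 : 0 ≤ μ ^ 3 := by positivity
    have p4 : μ ^ 4 ≤ μ ^ 3 := pow_le_pow_of_le_one hμ.le hμ1 (by norm_num)
    have p5 : μ ^ 5 ≤ μ ^ 3 := pow_le_pow_of_le_one hμ.le hμ1 (by norm_num)
    have sc : ∀ {x c e : ℝ}, |x| ≤ c → 0 ≤ e → e ≤ μ ^ 3 → |e * x| ≤ c * μ ^ 3 := fun {x c e} h h0 h' => by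
      rw [abs_mul, abs_of_nonneg h0, mul_comm]
      exact mul_le_mul h h' h0 ((abs_nonneg _).trans h)
    have pr : ∀ {x y : ℝ}, |x| ≤ C → |y| ≤ C → |x * y| ≤ C ^ 2 := fun h h' => by
      rw [abs_mul, sq]; exact mul_le_mul h h' (abs_nonneg _) hC
    have k1 := sc bu' p3 le_rfl
    have k2 := sc (pr bA' bv) p3 le_rfl
    have k3 : |μ ^ 5 * (S.A'' s (S.slow μ s) * D.v s (S.slow μ s) ^ 2 / 2)| ≤ C ^ 3 * μ ^ 3 := by
      refine sc ?_ (by positivity) p5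
      have := mul_le_mul bA'' (pr bv bv) (abs_nonneg _) hC
      rw [← abs_mul] at this
      rw [abs_div, abs_two, sq]
      have h0 : 0 ≤ C ^ 3 := by positivity
      nlinarith
    have k4 := sc (pr bB bu) p3 le_rfl
    have k5 := sc bv' (by positivity) p4
    have k6 := sc (pr bE bv) (by positivity) p4
    have n1 : 0 ≤ C * μ ^ 3 := by positivity
    have n2 : 0 ≤ C ^ 2 * μ ^ 3 := by positivity
    have n3 : 0 ≤ C ^ 3 * μ ^ 3 := by positivity
    have n4 : 0 ≤ C₁ * μ ^ 3 := by positivity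
    have n5 : 0 ≤ C₂ * μ ^ 3 := by positivity
    rw [abs_le] at k1 k2 k3 k4 k5 k6 t₁ t₂
    rw [Prod.norm_def]
    refine max_le (abs_le.2 ⟨?_, ?_⟩) (abs_le.2 ⟨?_, ?_⟩)
    · linarith only [k1.1, k2.2, k3.2, k4.2, t₁.2, n5]
    · linarith only [k1.2, k2.1, k3.1, k4.1, t₁.1, n5]
    · linarith only [k5.1, k6.2, t₂.2, n2, n3, n4]
    · linarith only [k5.2, k6.1, t₂.1, n2, n3, n4]

end PhaseSystem

/-! ### Global existence, continuation, inversion and limits -/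

section Existence

variable {E : Type*} [NormedAddCommGroup E]

theorem intervalIntegrable_of_bounded_off_countable {N : Set ℝ} (hN : IsClosed N) (hNc : N.Countable)
    {e : ℝ → E} (hc : ContinuousOn e Nᶜ) {C : ℝ} (hC : ∀ s, ‖e s‖ ≤ C) (a b : ℝ) :
    IntervalIntegrable e volume a b := by
  have hm : AEStronglyMeasurable e volume := by
    have h1 := hc.aestronglyMeasurable (μ := volume) hN.isOpen_compl.measurableSet
    have h2 : (volume : Measure ℝ).restrict Nᶜ = volume := by
      rw [Measure.restrict_eq_self_of_ae_mem]
      exact hNc.ae_notMem volume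
    rwa [h2] at h1
  refine (intervalIntegrable_const (c := C)).mono_fun hm.restrict ?_
  filter_upwards with s
  exact (hC s).trans (le_abs_self C)

theorem abs_sinh_le_cosh (x : ℝ) : |sinh x| ≤ cosh x := by
  rw [abs_le]
  constructor
  · have := sinh_lt_cosh (x := -x)
    rw [sinh_neg, cosh_neg] at this
    linarith
  · exact (sinh_lt_cosh (x := x)).le

theorem abs_le_cosh (x : ℝ) : |x| ≤ cosh x := by
  have h1 := self_le_sinh_iff.2 (abs_nonneg x)
  have h2 := (sinh_lt_cosh (x := |x|)).le
  rw [cosh_abs] at h2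
  exact h1.trans h2

/-- A right-hand side that is continuous in time off a countable closed set and Lipschitz in the
state is continuous along continuous curves. -/
theorem continuousOn_along {f : ℝ → E → E} {L : ℝ} {N : Set ℝ}
    (hL : ∀ s y₁ y₂, ‖f s y₁ - f s y₂‖ ≤ L * ‖y₁ - y₂‖)
    (hc : ∀ y, ContinuousOn (fun s => f s y) Nᶜ) {y : ℝ → E} (hy : Continuous y) :
    ContinuousOn (fun s => f s (y s)) Nᶜ := by
  intro s hs
  have h1 : Tendsto (fun r => L * ‖y r - y s‖ + ‖f r (y s) - f s (y s)‖) (𝓝[Nᶜ] s) (𝓝 0) := by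
    have a1 : Tendsto (fun r => L * ‖y r - y s‖) (𝓝[Nᶜ] s) (𝓝 (L * ‖y s - y s‖)) :=
      (((hy.sub continuous_const).norm.const_mul L).tendsto s).mono_left nhdsWithin_le_nhds
    have a2 : Tendsto (fun r => ‖f r (y s) - f s (y s)‖) (𝓝[Nᶜ] s) (𝓝 ‖f s (y s) - f s (y s)‖) :=
      ((hc (y s) s hs).sub tendsto_const_nhds).norm
    simpa using a1.add a2
  refine tendsto_iff_norm_sub_tendsto_zero.2 (squeeze_zero (fun _ => norm_nonneg _) (fun r => ?_) h1)
  have e : f r (y r) - f s (y s) = (f r (y r) - f r (y s)) + (f r (y s) - f s (y s)) := by abel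
  rw [e]
  exact (norm_add_le _ _).trans (add_le_add (hL _ _ _) le_rfl)

/-- Global solutions of bounded Lipschitz systems with jumps in time. -/
theorem exists_global_solution [NormedSpace ℝ E] [CompleteSpace E] {f : ℝ → E → E} {L C : ℝ} {N : Set ℝ}
    (hN : IsClosed N) (hNc : N.Countable) (hL0 : 0 < L)
    (hL : ∀ s y₁ y₂, ‖f s y₁ - f s y₂‖ ≤ L * ‖y₁ - y₂‖) (hC : ∀ s y, ‖f s y‖ ≤ C)
    (hc : ∀ y, ContinuousOn (fun s => f s y) Nᶜ) (a : ℝ) (v : E) :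
    ∃ y : ℝ → E, Continuous y ∧ y a = v ∧ ∀ s ∉ N, HasDerivAt y (f s (y s)) s := by
  have hC0 : 0 ≤ C := (norm_nonneg _).trans (hC 0 0)
  have hcont : ∀ {y : ℝ → E}, Continuous y → ContinuousOn (fun s => f s (y s)) Nᶜ := fun hy =>
    continuousOn_along hL hc hy
  have intble : ∀ {y : ℝ → E}, Continuous y → ∀ b c, IntervalIntegrable (fun s => f s (y s)) volume b c :=
    fun hy b c => intervalIntegrable_of_bounded_off_countable hN hNc (hcont hy) (fun s => hC s _) b c
  -- A weight growing in both directions of time. Its integral from a is sinh(2L(s − a))/(2L), at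
  -- most w/(2L) in absolute value, so the Picard map contracts by 1/2 on the whole line at once.
  set w : ℝ → ℝ := fun s => cosh (2 * L * (s - a)) with hw
  have hwpos : ∀ s, 0 < w s := fun s => cosh_pos _
  have hwc : Continuous w := by unfold w; fun_prop
  have curve : ∀ u : ℝ →ᵇ E, Continuous fun s => v + w s • u s := fun u => by
    have := u.continuous
    fun_prop
  have prim : ∀ u : ℝ →ᵇ E, Continuous fun s => ∫ r in a..s, f r (v + w r • u r) := fun u =>
    intervalIntegral.continuous_primitive (fun b c => intble (curve u) b c) a
  have hb : ∀ (u : ℝ →ᵇ E) (s : ℝ), ‖(w s)⁻¹ • ∫ r in a..s, f r (v + w r • u r)‖ ≤ C / (2 * L) := by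
    intro u s
    rw [norm_smul, norm_inv, norm_of_nonneg (hwpos s).le, inv_mul_le_iff₀ (hwpos s)]
    have h1 := intervalIntegral.norm_integral_le_of_norm_le_const (a := a) (b := s)
      (f := fun r => f r (v + w r • u r)) (C := C) fun r _ => hC _ _
    refine h1.trans ?_
    have h2 := abs_le_cosh (2 * L * (s - a))
    rw [abs_mul, abs_of_pos (by positivity)] at h2
    rw [mul_div_assoc', le_div_iff₀ (by positivity)]
    nlinarith [mul_le_mul_of_nonneg_left h2 hC0]
  set T : (ℝ →ᵇ E) → (ℝ →ᵇ E) := fun u => BoundedContinuousFunction.ofNormedAddCommGroup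
    (fun s => (w s)⁻¹ • ∫ r in a..s, f r (v + w r • u r))
    ((hwc.inv₀ fun s => (hwpos s).ne').smul (prim u)) (C / (2 * L)) (hb u) with hT
  have hTapp : ∀ u s, T u s = (w s)⁻¹ • ∫ r in a..s, f r (v + w r • u r) := fun u s => rfl
  have hcontr : ContractingWith (1 / 2) T := by
    refine ⟨by norm_num, LipschitzWith.of_dist_le_mul fun u₁ u₂ => ?_⟩
    rw [BoundedContinuousFunction.dist_le (by positivity)]
    intro s
    rw [hTapp, hTapp, dist_eq_norm, ← smul_sub, norm_smul, norm_inv, norm_of_nonneg (hwpos s).le,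
      inv_mul_le_iff₀ (hwpos s), ← intervalIntegral.integral_sub (intble (curve u₁) _ _)
        (intble (curve u₂) _ _)]
    have hI : ∫ r in a..s, L * dist u₁ u₂ * w r = sinh (2 * L * (s - a)) * (dist u₁ u₂ / 2) := by
      have hd : ∀ r ∈ Set.uIcc a s, HasDerivAt (fun r => sinh (2 * L * (r - a)) * (dist u₁ u₂ / 2))
          (L * dist u₁ u₂ * w r) r := fun r _ => by
        have := ((((hasDerivAt_id r).sub_const a).const_mul (2 * L)).sinh).mul_const (dist u₁ u₂ / 2)
        refine this.congr_deriv ?_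
        simp only [hw, id]
        ring
      rw [intervalIntegral.integral_eq_sub_of_hasDerivAt hd ((by fun_prop : Continuous fun r =>
        L * dist u₁ u₂ * w r).intervalIntegrable _ _)]
      simp
    have h1 := intervalIntegral.norm_integral_le_abs_of_norm_le (a := a) (b := s) (μ := volume)
      (f := fun r => f r (v + w r • u₁ r) - f r (v + w r • u₂ r))
      (g := fun r => L * dist u₁ u₂ * w r) (Eventually.of_forall fun r => by
        refine (hL _ _ _).trans ?_
        rw [add_sub_add_left_eq_sub, ← smul_sub, norm_smul, norm_of_nonneg (hwpos r).le,
          ← dist_eq_norm]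
        have := BoundedContinuousFunction.dist_coe_le_dist (f := u₁) (g := u₂) r
        have h3 := mul_le_mul_of_nonneg_left this (hwpos r).le
        have h4 := mul_le_mul_of_nonneg_left h3 hL0.le
        linarith) ((by fun_prop : Continuous fun r => L * dist u₁ u₂ * w r).intervalIntegrable _ _)
    refine h1.trans ?_
    rw [hI, abs_mul, abs_of_nonneg (by positivity : 0 ≤ dist u₁ u₂ / 2)]
    have := mul_le_mul_of_nonneg_right (abs_sinh_le_cosh (2 * L * (s - a)))
      (by positivity : 0 ≤ dist u₁ u₂ / 2)
    refine this.trans (le_of_eq ?_)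
    simp only [hw]
    push_cast
    ring
  set u := ContractingWith.fixedPoint T hcontr
  have hu : T u = u := hcontr.fixedPoint_isFixedPt
  have hy : ∀ s, v + w s • u s = v + ∫ r in a..s, f r (v + w r • u r) := fun s => by
    conv_lhs => rw [← hu, hTapp, smul_smul, mul_inv_cancel₀ (hwpos s).ne', one_smul]
  refine ⟨fun s => v + w s • u s, curve u, ?_, fun s hs => ?_⟩
  · simp only [hy a, intervalIntegral.integral_same, add_zero]
  · have hca : ContinuousAt (fun r => f r (v + w r • u r)) s :=
      (hcont (curve u)).continuousAt (hN.isOpen_compl.mem_nhds hs)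
    have h1 : HasDerivAt (fun s => ∫ r in a..s, f r (v + w r • u r)) (f s (v + w s • u s)) s := by
      refine intervalIntegral.integral_hasDerivAt_right (intble (curve u) _ _) ?_ hca
      exact ContinuousOn.stronglyMeasurableAtFilter hN.isOpen_compl (hcont (curve u)) s hs
    refine (h1.const_add v).congr_of_eventuallyEq (Eventually.of_forall hy)

end Existence

/-- A bound that improves itself along an interval holds on the interval. -/
theorem bootstrap {h : ℝ → ℝ} {a b r R : ℝ} (hr : r < R) (hc : ContinuousOn h (Set.uIcc a b))
    (h0 : h a ≤ R) (step : ∀ s ∈ Set.uIcc a b, (∀ t ∈ Set.uIcc a s, h t ≤ R) → h s ≤ r) :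
    ∀ s ∈ Set.uIcc a b, h s ≤ r := by
  -- Parametrizing from a to b treats both directions of time together. On [0, 1], the set where the
  -- bound R holds is closed, and it extends to the right because `step` improves R to r < R.
  set γ : ℝ → ℝ := fun θ => a + θ * (b - a) with hγ
  have hmem : ∀ θ ∈ Set.Icc (0 : ℝ) 1, γ θ ∈ Set.uIcc a b := fun θ hθ => by
    rw [← segment_eq_uIcc, segment_eq_image']
    exact ⟨θ, hθ, by simp [hγ]⟩
  have hsub : ∀ θ ∈ Set.Icc (0 : ℝ) 1, ∀ t ∈ Set.uIcc a (γ θ), ∃ θ' ∈ Set.Icc 0 θ, t = γ θ' := by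
    intro θ hθ t ht
    rw [← segment_eq_uIcc, segment_eq_image'] at ht
    obtain ⟨κ, hκ, rfl⟩ := ht
    exact ⟨κ * θ, ⟨mul_nonneg hκ.1 hθ.1, by nlinarith [hκ.1, hκ.2, hθ.1]⟩, by simp [hγ]; ring⟩
  have hcγ : ContinuousOn (fun θ => h (γ θ)) (Set.Icc 0 1) :=
    hc.comp (by unfold γ; fun_prop) hmem
  have hcl : IsClosed ({θ | h (γ θ) ≤ R} ∩ Set.Icc (0 : ℝ) 1) := by
    rw [Set.inter_comm]
    exact hcγ.preimage_isClosed_of_isClosed isClosed_Icc isClosed_Iic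
  have all : Set.Icc (0 : ℝ) 1 ⊆ {θ | h (γ θ) ≤ R} := by
    refine hcl.Icc_subset_of_forall_mem_nhdsGT_of_Icc_subset (by simpa [hγ] using h0) ?_
    intro θ hθ hsubset
    have hθ' : θ ∈ Set.Icc (0 : ℝ) 1 := ⟨hθ.1, hθ.2.le⟩
    have h1 : h (γ θ) < R := by
      refine (step _ (hmem θ hθ') fun t ht => ?_).trans_lt hr
      obtain ⟨θ', hθ1, rfl⟩ := hsub θ hθ' t ht
      exact hsubset hθ1
    have h2 : ∀ᶠ x in 𝓝[Set.Icc 0 1] θ, h (γ x) < R := (hcγ θ hθ').eventually (gt_mem_nhds h1)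
    have h3 : 𝓝[>] θ ≤ 𝓝[Set.Icc 0 1] θ := by
      rw [nhdsWithin, nhdsWithin]
      refine le_inf inf_le_left ?_
      rw [le_principal_iff]
      have : Set.Ioo θ 1 ∈ 𝓝[>] θ := Ioo_mem_nhdsGT hθ.2
      exact mem_of_superset this fun x hx => ⟨hθ.1.trans hx.1.le, hx.2.le⟩
    exact Eventually.mono (h2.filter_mono h3) fun x hx => le_of_lt hx
  intro s hs
  rw [← segment_eq_uIcc, segment_eq_image'] at hs
  obtain ⟨θ, hθ, rfl⟩ := hs
  have e : a + θ • (b - a) = γ θ := by simp [hγ]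
  simp only [e]
  refine step _ (hmem θ hθ) fun t ht => ?_
  obtain ⟨θ', hθ1, rfl⟩ := hsub θ hθ t ht
  exact all ⟨hθ1.1, hθ1.2.trans hθ.2⟩

/-- A continuous function of the line that grows at least linearly has a continuous inverse. -/
theorem exists_inverse {h : ℝ → ℝ} {m : ℝ} (hm : 0 < m) (hc : Continuous h)
    (hg : ∀ a b, a ≤ b → m * (b - a) ≤ h b - h a) :
    ∃ k : ℝ → ℝ, Continuous k ∧ StrictMono k ∧ (∀ x, k (h x) = x) ∧ (∀ x, h (k x) = x) ∧
      ∀ s h', h' ≠ 0 → HasDerivAt h h' (k s) → HasDerivAt k h'⁻¹ s := by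
  have hmono : StrictMono h := fun a b hab => by
    have := hg a b hab.le
    have := mul_pos hm (sub_pos.2 hab)
    linarith
  have hsurj : Function.Surjective h := by
    refine hc.surjective ?_ ?_
    · refine tendsto_atTop_mono' atTop (f₁ := fun x => m * x + h 0) ?_ ?_
      · filter_upwards [eventually_ge_atTop 0] with x hx
        have := hg 0 x hx
        linarith
      · exact tendsto_atTop_add_const_right _ _ (tendsto_id.const_mul_atTop hm)
    · refine tendsto_atBot_mono' atBot (f₁ := fun x => m * x + h 0) ?_ ?_
      · filter_upwards [eventually_le_atBot 0] with x hx
        have := hg x 0 hx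
        linarith
      · exact tendsto_atBot_add_const_right _ _ (tendsto_id.const_mul_atBot hm)
  set e := hmono.orderIsoOfSurjective h hsurj with he
  have e1 : ∀ x, e x = h x := fun x => rfl
  have hk : ∀ x, h (e.symm x) = x := fun x => by rw [← e1]; exact e.apply_symm_apply x
  refine ⟨e.symm, e.symm.continuous, e.symm.strictMono, fun x => ?_, hk, fun s h' hh hd => ?_⟩
  · rw [← e1]; exact e.symm_apply_apply x
  · exact hd.of_local_left_inverse e.symm.continuous.continuousAt hh (Eventually.of_forall hk)

/-- The Lipschitz condition passes uniform convergence of the curves on to their derivatives, so no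
compactness argument is needed. -/
theorem hasDerivAt_of_tendstoUniformlyOn_solutions {E : Type*} [NormedAddCommGroup E]
    [NormedSpace ℝ E] {f : ℝ → E → E}
    {L : ℝ} (hL : ∀ s y₁ y₂, ‖f s y₁ - f s y₂‖ ≤ L * ‖y₁ - y₂‖) {Y : ℕ → ℝ → E} {y : ℝ → E}
    {U : Set ℝ} (hU : IsOpen U) (hY : TendstoUniformlyOn Y y atTop U)
    (hd : ∀ n, ∀ s ∈ U, HasDerivAt (Y n) (f s (Y n s)) s) {x : ℝ} (hx : x ∈ U) :
    HasDerivAt y (f x (y x)) x := by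
  refine hasDerivAt_of_tendstoLocallyUniformlyOn (f := Y) (f' := fun n s => f s (Y n s))
    (g' := fun s => f s (y s)) hU (TendstoUniformlyOn.tendstoLocallyUniformlyOn ?_)
    (Eventually.of_forall hd) (fun s hs => hY.tendsto_at hs) hx
  rw [Metric.tendstoUniformlyOn_iff] at hY ⊢
  intro ε hε
  filter_upwards [hY (ε / (|L| + 1)) (by positivity)] with n hn s hs
  have h1 := hn s hs
  rw [lt_div_iff₀ (by positivity)] at h1
  rw [dist_eq_norm] at h1 ⊢
  refine (hL _ _ _).trans_lt (lt_of_le_of_lt ?_ h1)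
  rw [mul_comm]
  exact mul_le_mul_of_nonneg_left (by linarith [le_abs_self L]) (norm_nonneg _)

/-- The bound does not involve m, so letting m tend to infinity gives an exponential rate of
convergence, uniform on compact sets. -/
theorem exists_limit {E : Type*} [NormedAddCommGroup E] [CompleteSpace E] {Y : ℕ → ℝ → E} {B k : ℝ}
    (hk : 0 < k)
    (h : ∀ n m : ℕ, ∀ b : ℝ, |b| ≤ n → n ≤ m → ‖Y n b - Y m b‖ ≤ B * exp (-(k * (n - |b|)))) :
    ∃ y : ℝ → E, ∀ R, TendstoUniformlyOn Y y atTop (Set.Icc (-R) R) := by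
  have hB : 0 ≤ B := by
    have := (norm_nonneg _).trans (h 0 0 0 (by simp) le_rfl)
    simpa using this
  have hlim : ∀ R : ℝ, Tendsto (fun n : ℕ => B * exp (-(k * (n - R)))) atTop (𝓝 0) := fun R => by
    have h1 : Tendsto (fun n : ℕ => k * ((n : ℝ) - R)) atTop atTop :=
      (tendsto_atTop_add_const_right _ (-R) tendsto_natCast_atTop_atTop).const_mul_atTop hk
    have := (tendsto_exp_neg_atTop_nhds_zero.comp h1).const_mul B
    simpa using this
  have hconv : ∀ b, ∃ l, Tendsto (fun n => Y n b) atTop (𝓝 l) := fun b => by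
    refine cauchySeq_tendsto_of_complete (Metric.cauchySeq_iff'.2 fun ε hε => ?_)
    obtain ⟨N, hN⟩ := (((hlim |b|).eventually (gt_mem_nhds hε)).and
      (tendsto_natCast_atTop_atTop.eventually (eventually_ge_atTop |b|))).exists
    refine ⟨N, fun n hn => ?_⟩
    rw [dist_comm, dist_eq_norm]
    exact (h N n b hN.2 hn).trans_lt hN.1
  choose y hy using hconv
  refine ⟨y, fun R => Metric.tendstoUniformlyOn_iff.2 fun ε hε => ?_⟩
  filter_upwards [(hlim R).eventually (gt_mem_nhds hε),
    tendsto_natCast_atTop_atTop.eventually (eventually_ge_atTop R)] with n h1 h2 b hb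
  have hbR : |b| ≤ R := abs_le.2 hb
  rw [dist_comm, dist_eq_norm]
  refine lt_of_le_of_lt ?_ h1
  have h3 : Tendsto (fun m => ‖Y n b - Y m b‖) atTop (𝓝 ‖Y n b - y b‖) :=
    (tendsto_const_nhds.sub (hy b)).norm
  refine le_of_tendsto h3 ?_
  filter_upwards [eventually_ge_atTop n] with m hm
  refine (h n m b (hbR.trans h2) hm).trans (mul_le_mul_of_nonneg_left (exp_le_exp.2 ?_) hB)
  nlinarith

/-! ### Clamped systems, and the solution in a tube -/

namespace PhaseSystem

variable {S : PhaseSystem}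

/-- Contraction of differences of approximate solutions, in terms of norms. -/
theorem norm_contraction (hS : S.Elliptic) (hr : S.rate ≠ 0) :
    ∃ C > 0, ∃ l > 0, ∀ K ≥ 0, ∃ μ₀ > 0, μ₀ ≤ 1 ∧ ∀ μ, 0 < μ → μ < μ₀ →
      ∀ (y₁ y₂ g₁ g₂ : ℝ → ℝ × ℝ) (a b G : ℝ), S.rate * (b - a) ≤ 0 → 0 ≤ G →
        ContinuousOn y₁ (Set.uIcc a b) → ContinuousOn y₂ (Set.uIcc a b) →
        (∀ s ∈ Set.uIcc a b, y₁ s ∈ S.tube K μ s) → (∀ s ∈ Set.uIcc a b, y₂ s ∈ S.tube K μ s) →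
        (∀ s ∈ Set.uIoo a b, s ∉ jumpSet → HasDerivAt y₁ (S.V μ s (y₁ s) + g₁ s) s ∧
          HasDerivAt y₂ (S.V μ s (y₂ s) + g₂ s) s ∧ ‖g₁ s‖ ≤ K * μ ^ 3 ∧ ‖g₂ s‖ ≤ K * μ ^ 3 ∧
          ‖g₁ s - g₂ s‖ ≤ G) →
        ‖y₁ b - y₂ b‖ ≤ C * (exp (-(l * μ ^ 2 * |b - a|)) * ‖y₁ a - y₂ a‖ + G / μ ^ 2) := by
  obtain ⟨C, hC, l, hl, H⟩ := contraction hS hr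
  refine ⟨√C, by positivity, l / 2, by positivity, fun K hK => ?_⟩
  obtain ⟨μ₀, hμ₀, hμ₀1, H⟩ := H K hK
  refine ⟨μ₀, hμ₀, hμ₀1, fun μ hμ hμ' y₁ y₂ g₁ g₂ a b G hab hG c₁ c₂ t₁ t₂ hd => ?_⟩
  have h := H μ hμ hμ' y₁ y₂ g₁ g₂ a b G hab c₁ c₂ t₁ t₂ hd
  refine abs_le_of_sq_le_sq' ?_ (by positivity) |>.2
  refine h.trans ?_
  have e : exp (-(l * μ ^ 2 * |b - a|)) = exp (-(l / 2 * μ ^ 2 * |b - a|)) ^ 2 := by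
    rw [← exp_nat_mul]; ring_nf
  have hE := exp_pos (-(l / 2 * μ ^ 2 * |b - a|))
  rw [mul_pow, sq_sqrt hC.le, e]
  have : 0 ≤ exp (-(l / 2 * μ ^ 2 * |b - a|)) * ‖y₁ a - y₂ a‖ * (G / μ ^ 2) := by positivity
  refine mul_le_mul_of_nonneg_left ?_ hC.le
  nlinarith

theorem tube_mono {K K' μ s : ℝ} (hμ : 0 ≤ μ) (h : K ≤ K') : S.tube K μ s ⊆ S.tube K' μ s :=
  fun _ hy => ⟨hy.1.trans (mul_le_mul_of_nonneg_right h hμ), hy.2.trans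
    (mul_le_mul_of_nonneg_right h hμ)⟩

theorem mem_tube_of_norm_sub_le {K r μ s : ℝ} {y y' : ℝ × ℝ} (hy : y ∈ S.tube K μ s)
    (h : ‖y' - y‖ ≤ r * μ) : y' ∈ S.tube (K + r) μ s := by
  have h1 : |y'.1 - y.1| ≤ r * μ := (norm_fst_le (y' - y)).trans h
  have h2 : |y'.2 - y.2| ≤ r * μ := (norm_snd_le (y' - y)).trans h
  constructor
  · have := abs_add_le (y'.1 - y.1) y.1
    rw [sub_add_cancel] at this
    linarith [hy.1]
  · have := abs_add_le (y'.2 - y.2) (y.2 - S.η (S.slow μ s))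
    rw [sub_add_sub_cancel] at this
    linarith [hy.2]

theorem norm_sub_le_of_mem_tube {K μ s : ℝ} {y y' : ℝ × ℝ} (hy : y ∈ S.tube K μ s)
    (hy' : y' ∈ S.tube K μ s) : ‖y - y'‖ ≤ 2 * K * μ := by
  rw [Prod.norm_def]
  refine max_le (abs_le.2 ?_) (abs_le.2 ?_)
  · have h1 := abs_le.1 hy.1
    have h2 := abs_le.1 hy'.1
    constructor <;> simp only [Prod.fst_sub] <;> linarith [h1.1, h1.2, h2.1, h2.2]
  · have h1 := abs_le.1 hy.2
    have h2 := abs_le.1 hy'.2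
    constructor <;> simp only [Prod.snd_sub] <;> linarith [h1.1, h1.2, h2.1, h2.2]

variable (S) in
/-- The nearest point of the tube. -/
def clamp (K μ s : ℝ) (y : ℝ × ℝ) : ℝ × ℝ :=
  (max (-(K * μ)) (min (K * μ) y.1),
    S.η (S.slow μ s) + max (-(K * μ)) (min (K * μ) (y.2 - S.η (S.slow μ s))))

theorem clamp_mem {K μ s : ℝ} (h : 0 ≤ K * μ) (y : ℝ × ℝ) : S.clamp K μ s y ∈ S.tube K μ s := by
  have key : ∀ x : ℝ, |max (-(K * μ)) (min (K * μ) x)| ≤ K * μ := fun x =>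
    abs_le.2 ⟨le_max_left _ _, max_le (by linarith) (min_le_left _ _)⟩
  exact ⟨key _, by simpa [clamp] using key _⟩

theorem clamp_eq {K μ s : ℝ} {y : ℝ × ℝ} (hy : y ∈ S.tube K μ s) : S.clamp K μ s y = y := by
  have key : ∀ x : ℝ, |x| ≤ K * μ → max (-(K * μ)) (min (K * μ) x) = x := fun x hx => by
    rw [min_eq_right (abs_le.1 hx).2, max_eq_right (abs_le.1 hx).1]
  unfold clamp
  rw [key _ hy.1, key _ hy.2]
  ext <;> simp

theorem norm_clamp_sub_le (K μ s : ℝ) (y y' : ℝ × ℝ) :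
    ‖S.clamp K μ s y - S.clamp K μ s y'‖ ≤ ‖y - y'‖ := by
  have key : ∀ x x' : ℝ, |max (-(K * μ)) (min (K * μ) x) - max (-(K * μ)) (min (K * μ) x')|
      ≤ |x - x'| := fun x x' => by
    refine (abs_max_sub_max_le_max _ _ _ _).trans ?_
    rw [sub_self, abs_zero]
    refine max_le (abs_nonneg _) ((abs_min_sub_min_le_max _ _ _ _).trans ?_)
    rw [sub_self, abs_zero]
    exact max_le (abs_nonneg _) le_rfl
  rw [Prod.norm_def]
  refine max_le ((key _ _).trans (norm_fst_le (y - y'))) ?_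
  have h := key (y.2 - S.η (S.slow μ s)) (y'.2 - S.η (S.slow μ s))
  rw [sub_sub_sub_cancel_right] at h
  simp only [clamp, Prod.snd_sub, add_sub_add_left_eq_sub, norm_eq_abs]
  exact h.trans (norm_snd_le (y - y'))

theorem continuousAt_coeff {H : ℝ → ℝ → ℝ}
    (h : ContDiffOn ℝ ∞ (Function.uncurry H) impulseDomain) {μ : ℝ} {p : ℝ × ℝ × ℝ}
    (hp : p.1 ∉ jumpSet) (hJ : 0 < S.Jr + μ * p.2.1) :
    ContinuousAt (fun p : ℝ × ℝ × ℝ => H (saw p.1) (S.Jr + μ * p.2.1)) p := by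
  have h1 : ContinuousAt (Function.uncurry H) (saw p.1, S.Jr + μ * p.2.1) :=
    h.continuousOn.continuousAt (isOpen_impulseDomain.mem_nhds ⟨Set.mem_univ _, hJ⟩)
  have h2 : ContinuousAt saw p.1 := continuousOn_saw.continuousAt (isOpen_compl_jumpSet.mem_nhds hp)
  have h3 : ContinuousAt (fun p : ℝ × ℝ × ℝ => saw p.1) p :=
    ContinuousAt.comp' (f := fun p : ℝ × ℝ × ℝ => p.1) h2 continuousAt_fst
  exact ContinuousAt.comp' (f := fun p : ℝ × ℝ × ℝ => (saw p.1, S.Jr + μ * p.2.1)) h1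
    (h3.prodMk (by fun_prop))

theorem continuous_u (hS : S.Regular) (μ : ℝ) : Continuous fun p : ℝ × ℝ × ℝ => S.u μ p.1 p.2 := by
  have h1 := hS.hP.smooth.continuous
  have h2 := hS.hQ.smooth.continuous
  have h3 := hS.hR.smooth.continuous
  unfold u force
  fun_prop

theorem continuousAt_A (hS : S.Regular) {μ : ℝ} {p : ℝ × ℝ × ℝ} (hp : p.1 ∉ jumpSet)
    (hJ : 0 < S.Jr + μ * p.2.1) : ContinuousAt (fun p : ℝ × ℝ × ℝ => S.A μ p.1 p.2) p :=
  ((continuousAt_coeff hS.hH₁ hp hJ).mul (continuous_u hS μ).continuousAt).add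
    (continuousAt_coeff hS.hH₀ hp hJ)

theorem continuousAt_G (hS : S.Regular) {μ : ℝ} {p : ℝ × ℝ × ℝ} (hp : p.1 ∉ jumpSet)
    (hJ : 0 < S.Jr + μ * p.2.1) : ContinuousAt (fun p : ℝ × ℝ × ℝ => S.G μ p.1 p.2) p :=
  ((continuousAt_coeff hS.hM₁ hp hJ).mul (continuous_u hS μ).continuousAt).add
    (continuousAt_coeff hS.hM₀ hp hJ)

theorem continuousAt_V (hS : S.Regular) {μ : ℝ} {p : ℝ × ℝ × ℝ} (hp : p.1 ∉ jumpSet)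
    (hJ : 0 < S.Jr + μ * p.2.1) (hG : 1 + μ ^ 2 * S.G μ p.1 p.2 ≠ 0) :
    ContinuousAt (fun p : ℝ × ℝ × ℝ => S.V μ p.1 p.2) p := by
  have hden : ContinuousAt (fun p : ℝ × ℝ × ℝ => 1 + μ ^ 2 * S.G μ p.1 p.2) p :=
    continuousAt_const.add (continuousAt_const.mul (continuousAt_G hS hp hJ))
  refine ContinuousAt.prodMk (continuousAt_const.mul ((continuousAt_A hS hp hJ).div hden hG)) ?_
  exact continuousAt_const.sub ((continuousAt_const.sub (continuousAt_coeff hS.hΘ hp hJ)).div hden hG)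

/-- Bounds in tubes, and solutions of the system modified outside of a tube. -/
theorem exists_clamped_solution (hS : S.Regular) {K : ℝ} (hK : 0 ≤ K) :
    ∃ μ₀ > 0, μ₀ ≤ 1 ∧ ∀ μ, 0 < μ → μ < μ₀ →
      (∀ s, ∀ y ∈ S.tube K μ s, S.Jr / 2 ≤ S.Jr + μ * y.1 ∧ 1 / 2 ≤ 1 + μ ^ 2 * S.G μ s y ∧
        ‖S.V μ s y‖ ≤ 1 / 2) ∧
      (∀ s y y', ‖S.V μ s (S.clamp K μ s y) - S.V μ s (S.clamp K μ s y')‖ ≤ 1 * ‖y - y'‖) ∧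
      ∀ (a : ℝ) (v : ℝ × ℝ), ∃ y : ℝ → ℝ × ℝ, Continuous y ∧ y a = v ∧
        ∀ s ∉ jumpSet, HasDerivAt y (S.V μ s (S.clamp K μ s (y s))) s := by
  obtain ⟨C, hC, μ₁, hμ₁, hμ₁', H⟩ := exists_V_bound hS hK
  obtain ⟨μ₂, hμ₂, hμ₂', H₂⟩ := LO.exists_half (LO.G_bounded hS hK)
  have hJ := hS.Jr_pos
  refine ⟨min (min μ₁ μ₂) (min (1 / (2 * C)) (S.Jr / (2 * (K + 1)))), by positivity,
    ((min_le_left _ _).trans (min_le_left _ _)).trans hμ₁', fun μ hμ hμ' => ?_⟩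
  have m₁ : μ < μ₁ := hμ'.trans_le ((min_le_left _ _).trans (min_le_left _ _))
  have m₂ : μ < μ₂ := hμ'.trans_le ((min_le_left _ _).trans (min_le_right _ _))
  have m₃ : C * μ ≤ 1 / 2 := by
    have := (hμ'.trans_le ((min_le_right _ _).trans (min_le_left _ _))).le
    rw [le_div_iff₀ (by positivity)] at this
    linarith
  have m₄ : (K + 1) * μ ≤ S.Jr / 2 := by
    have := (hμ'.trans_le ((min_le_right _ _).trans (min_le_right _ _))).le
    rw [le_div_iff₀ (by positivity)] at this
    linarith
  have hμ1 : μ ≤ 1 := m₁.le.trans hμ₁'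
  have hKμ : 0 ≤ K * μ := by positivity
  have hbd : ∀ s, ∀ y ∈ S.tube K μ s, S.Jr / 2 ≤ S.Jr + μ * y.1 ∧ 1 / 2 ≤ 1 + μ ^ 2 * S.G μ s y ∧
        ‖S.V μ s y‖ ≤ 1 / 2 := fun s y hy => by
    refine ⟨?_, H₂ μ s hμ m₂ y hy, (((H μ s hμ m₁).1 y hy).1).trans m₃⟩
    have h1 := (abs_le.1 hy.1).1
    have h2 := mul_le_mul_of_nonneg_left h1 hμ.le
    nlinarith
  have hLip : ∀ s y y', ‖S.V μ s (S.clamp K μ s y) - S.V μ s (S.clamp K μ s y')‖ ≤ 1 * ‖y - y'‖ :=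
    fun s y y' => by
      refine ((H μ s hμ m₁).2 _ (clamp_mem hKμ y) _ (clamp_mem hKμ y')).trans ?_
      exact mul_le_mul (by linarith) (norm_clamp_sub_le _ _ _ _ _) (norm_nonneg _) one_pos.le
  refine ⟨hbd, hLip, exists_global_solution isClosed_jumpSet countable_jumpSet one_pos hLip
    (C := 1 / 2) (fun s y => (hbd s _ (clamp_mem hKμ y)).2.2) fun y s hs => ?_⟩
  obtain ⟨b₁, b₂, -⟩ := hbd s _ (clamp_mem (S := S) (s := s) hKμ y)
  have hcl : ContinuousAt (fun s => (s, S.clamp K μ s y)) s := by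
    have := hS.hη.smooth.continuous
    refine Continuous.continuousAt ?_
    unfold clamp slow
    fun_prop
  refine ContinuousAt.continuousWithinAt ?_
  exact ContinuousAt.comp' (f := fun s => (s, S.clamp K μ s y))
    (continuousAt_V hS (p := (s, S.clamp K μ s y)) hs (by linarith) (by linarith)) hcl

end PhaseSystem

namespace PhaseSystem

variable {S : PhaseSystem}

variable (S) in
/-- Solutions, in the phase variable, that stay in a tube. -/
structure TubeSolution (K μ : ℝ) (y : ℝ → ℝ × ℝ) : Prop where
  cont : Continuous y
  mem : ∀ s, y s ∈ S.tube K μ s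
  hasDerivAt : ∀ s ∉ jumpSet, HasDerivAt y (S.V μ s (y s)) s

/-- Start on the approximate solution far upstream of the stable direction and follow the clamped
system. The defect O(μ³) moves the solution by at most O(μ³/μ²) = O(μ), so the clamp is inactive.
Solutions with different starting points approach each other exponentially, and the limit is a
solution on the whole line. -/
theorem exists_tubeSolution (hS : S.Elliptic) (hr : S.rate ≠ 0) :
    ∃ K > 0, ∃ μ₀ > 0, μ₀ ≤ 1 ∧ ∀ μ, 0 < μ → μ < μ₀ → ∃ y, S.TubeSolution K μ y := by
  obtain ⟨Kc, hKc, μ₁, hμ₁, hμ₁', Hc⟩ := exists_center hS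
  obtain ⟨C, hC, l, hl, H⟩ := norm_contraction hS hr
  -- The approximate solution lies in the tube of radius Kcμ, the contraction keeps the exact ones
  -- within C·Kc·μ of it, and the extra 1 is the margin for `bootstrap`.
  set K := Kc + (C * Kc + 1) with hK
  have hK0 : 0 < K := by positivity
  obtain ⟨μ₂, hμ₂, hμ₂', H⟩ := H K hK0.le
  obtain ⟨μ₃, hμ₃, hμ₃', H₃⟩ := exists_clamped_solution hS.toRegular hK0.le
  refine ⟨K, hK0, min μ₁ (min μ₂ μ₃), by positivity, (min_le_left _ _).trans hμ₁',
    fun μ hμ hμ' => ?_⟩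
  have m₂ : μ < μ₂ := hμ'.trans_le ((min_le_right _ _).trans (min_le_left _ _))
  obtain ⟨yc, gc, yc_cont, yc_mem, yc_d⟩ := Hc μ hμ (hμ'.trans_le (min_le_left _ _))
  obtain ⟨hbd, hLip, hex⟩ := H₃ μ hμ (hμ'.trans_le ((min_le_right _ _).trans (min_le_right _ _)))
  have HH := H μ hμ m₂
  have hr0 : 0 < |S.rate| := abs_pos.2 hr
  -- The sign of the rate: starting points tend to −∞ if contraction is forward, and to +∞ if it is
  -- backward.
  set κ := S.rate / |S.rate| with hκ
  have hκr : S.rate * κ = |S.rate| := by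
    rw [hκ, mul_div_assoc', div_eq_iff hr0.ne', ← abs_mul_abs_self]
  choose Y Yc Y0 Yd using fun n : ℕ => hex (κ * n) (yc (κ * n))
  have yc_mem' : ∀ s, yc s ∈ S.tube K μ s := fun s =>
    tube_mono hμ.le (by rw [hK]; nlinarith) (yc_mem s)
  have Yd' : ∀ n s, s ∉ jumpSet → Y n s ∈ S.tube K μ s → HasDerivAt (Y n) (S.V μ s (Y n s) + 0) s := by
    intro n s hs hm
    have := Yd n s hs
    rwa [clamp_eq hm, ← add_zero (S.V μ s (Y n s))] at this
  have near : ∀ (n : ℕ) b, S.rate * (b - κ * n) ≤ 0 → ‖Y n b - yc b‖ ≤ C * Kc * μ := by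
    intro n b hb
    have hdir : ∀ s ∈ Set.uIcc (κ * n) b, S.rate * (s - κ * n) ≤ 0 := fun s hs => by
      rw [← segment_eq_uIcc, segment_eq_image'] at hs
      obtain ⟨θ, hθ, rfl⟩ := hs
      simp only [smul_eq_mul, add_sub_cancel_left]
      nlinarith [hθ.1]
    refine bootstrap (h := fun s => ‖Y n s - yc s‖) (a := κ * n) (R := (C * Kc + 1) * μ) (by linarith)
      (((Yc n).sub yc_cont).norm.continuousOn) ?_ ?_ b Set.right_mem_uIcc
    · rw [Y0, sub_self, norm_zero]; positivity
    · intro s hs hle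
      have hm : ∀ t ∈ Set.uIcc (κ * n) s, Y n t ∈ S.tube K μ t := fun t ht =>
        mem_tube_of_norm_sub_le (yc_mem t) (hle t ht)
      have h := HH (Y n) yc (fun _ => 0) gc (κ * n) s (Kc * μ ^ 3) (hdir s hs) (by positivity)
        (Yc n).continuousOn yc_cont.continuousOn hm (fun t _ => yc_mem' t) fun t ht htN => by
          have htm := hm t (Set.uIoo_subset_uIcc_self ht)
          have hg := (yc_d t htN).2
          refine ⟨Yd' n t htN htm, (yc_d t htN).1, by simp; positivity, hg.trans ?_, by simpa using hg⟩
          exact mul_le_mul_of_nonneg_right (by rw [hK]; nlinarith) (by positivity)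
      rw [Y0, sub_self, norm_zero, mul_zero, zero_add] at h
      refine h.trans_eq ?_
      field_simp
  have hmem : ∀ (n : ℕ) b, S.rate * (b - κ * n) ≤ 0 → Y n b ∈ S.tube K μ b := fun n b hb =>
    mem_tube_of_norm_sub_le (yc_mem b) ((near n b hb).trans (by nlinarith))
  have hdir : ∀ (n : ℕ) (b : ℝ), |b| ≤ n → S.rate * (b - κ * n) ≤ 0 := fun n b hb => by
    have h1 : S.rate * b ≤ |S.rate| * |b| := by rw [← abs_mul]; exact le_abs_self _
    have h2 : S.rate * (b - κ * n) = S.rate * b - |S.rate| * n := by rw [← hκr]; ring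
    nlinarith
  have hκ1 : |κ| = 1 := by rw [hκ, abs_div, abs_abs, div_self hr0.ne']
  -- At the starting point of the n-th solution, the m-th one is already in the tube; from there to
  -- b the distance is contracted over a length of at least n − |b|.
  have cauchy : ∀ n m : ℕ, ∀ b : ℝ, |b| ≤ n → n ≤ m →
      ‖Y n b - Y m b‖ ≤ C * (2 * K * μ) * exp (-(l * μ ^ 2 * (n - |b|))) := by
    intro n m b hb hnm
    have hnm' : (n : ℝ) ≤ m := by exact_mod_cast hnm
    have hn : |κ * n| = n := by rw [abs_mul, hκ1, one_mul, Nat.abs_cast]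
    have hrange : ∀ s ∈ Set.uIcc (κ * n) b, |s| ≤ n := fun s hs => by
      rw [← segment_eq_uIcc] at hs
      have hconv := (convex_Icc (-(n : ℝ)) n).segment_subset
        (show κ * n ∈ Set.Icc (-(n : ℝ)) n from abs_le.1 hn.le) (abs_le.1 hb) hs
      exact abs_le.2 hconv
    have dn : ∀ s ∈ Set.uIcc (κ * n) b, Y n s ∈ S.tube K μ s := fun s hs =>
      hmem n s (hdir n s (hrange s hs))
    have dm : ∀ s ∈ Set.uIcc (κ * n) b, Y m s ∈ S.tube K μ s := fun s hs =>
      hmem m s (hdir m s ((hrange s hs).trans hnm'))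
    have h := HH (Y n) (Y m) (fun _ => 0) (fun _ => 0) (κ * n) b 0 (hdir n b hb) le_rfl
      (Yc n).continuousOn (Yc m).continuousOn dn dm fun t ht htN =>
        ⟨Yd' n t htN (dn t (Set.uIoo_subset_uIcc_self ht)),
          Yd' m t htN (dm t (Set.uIoo_subset_uIcc_self ht)), by simp; positivity,
          by simp; positivity, by simp⟩
    have h0 := norm_sub_le_of_mem_tube (dn _ Set.left_mem_uIcc) (dm _ Set.left_mem_uIcc)
    rw [zero_div, add_zero] at h
    have h2 : (n : ℝ) - |b| ≤ |b - κ * n| := by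
      have := abs_sub_abs_le_abs_sub (κ * n) b
      rw [hn, abs_sub_comm] at this
      exact this
    have h3 : exp (-(l * μ ^ 2 * |b - κ * n|)) ≤ exp (-(l * μ ^ 2 * (n - |b|))) :=
      exp_le_exp.2 (neg_le_neg (mul_le_mul_of_nonneg_left h2 (by positivity)))
    calc _ ≤ C * (exp (-(l * μ ^ 2 * |b - κ * n|)) * ‖Y n (κ * n) - Y m (κ * n)‖) := h
      _ ≤ C * (exp (-(l * μ ^ 2 * (n - |b|))) * (2 * K * μ)) := by gcongr
      _ = _ := by ring
  obtain ⟨y, hy⟩ := exists_limit (by positivity) cauchy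
  have ymem : ∀ s, y s ∈ S.tube K μ s := fun s => by
    have ht := (hy |s|).tendsto_at (show s ∈ Set.Icc (-|s|) |s| from abs_le.1 le_rfl)
    have hcl : IsClosed (S.tube K μ s) := by
      have h1 : IsClosed {y : ℝ × ℝ | |y.1| ≤ K * μ} := isClosed_le (by fun_prop) continuous_const
      have h2 : IsClosed {y : ℝ × ℝ | |y.2 - S.η (S.slow μ s)| ≤ K * μ} :=
        isClosed_le (by fun_prop) continuous_const
      exact h1.inter h2
    refine hcl.mem_of_tendsto ht ?_
    filter_upwards [tendsto_natCast_atTop_atTop.eventually (eventually_ge_atTop |s|)] with n hn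
    exact hmem n s (hdir n s hn)
  refine ⟨y, ?_, ymem, fun s hs => ?_⟩
  · have : TendstoLocallyUniformly Y y atTop := by
      rw [tendstoLocallyUniformly_iff_forall_isCompact]
      intro T hT
      obtain ⟨R, hR⟩ := hT.isBounded.subset_closedBall 0
      refine (hy R).mono (hR.trans_eq ?_)
      rw [Real.closedBall_eq_Icc, zero_sub, zero_add]
    exact this.continuous (Frequently.of_forall Yc)
  · have hU : IsOpen (jumpSetᶜ ∩ Set.Ioo (-(|s| + 1)) (|s| + 1)) :=
      isOpen_compl_jumpSet.inter isOpen_Ioo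
    have h1 : TendstoUniformlyOn Y y atTop (jumpSetᶜ ∩ Set.Ioo (-(|s| + 1)) (|s| + 1)) :=
      (hy (|s| + 1)).mono fun x hx => Set.Ioo_subset_Icc_self hx.2
    have h2 := hasDerivAt_of_tendstoUniformlyOn_solutions
      (f := fun s y => S.V μ s (S.clamp K μ s y)) hLip hU h1 (fun n t ht => Yd n t ht.1)
      (x := s) ⟨hs, by constructor <;> linarith [neg_abs_le s, le_abs_self s]⟩
    rwa [clamp_eq (ymem s)] at h2

/-- Two curves whose distance is contracted from arbitrarily far in the past or the future are
close. -/
theorem norm_sub_le_of_tube (hS : S.Elliptic) (hr : S.rate ≠ 0) :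
    ∃ C > 0, ∀ K ≥ 0, ∃ μ₀ > 0, μ₀ ≤ 1 ∧ ∀ μ, 0 < μ → μ < μ₀ →
      ∀ (y₁ y₂ g₁ g₂ : ℝ → ℝ × ℝ) (G : ℝ), 0 ≤ G → Continuous y₁ → Continuous y₂ →
        (∀ s, y₁ s ∈ S.tube K μ s) → (∀ s, y₂ s ∈ S.tube K μ s) →
        (∀ s ∉ jumpSet, HasDerivAt y₁ (S.V μ s (y₁ s) + g₁ s) s ∧
          HasDerivAt y₂ (S.V μ s (y₂ s) + g₂ s) s ∧ ‖g₁ s‖ ≤ K * μ ^ 3 ∧ ‖g₂ s‖ ≤ K * μ ^ 3 ∧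
          ‖g₁ s - g₂ s‖ ≤ G) →
        ∀ b, ‖y₁ b - y₂ b‖ ≤ C * (G / μ ^ 2) := by
  obtain ⟨C, hC, l, hl, H⟩ := norm_contraction hS hr
  refine ⟨C, hC, fun K hK => ?_⟩
  obtain ⟨μ₀, hμ₀, hμ₀1, H⟩ := H K hK
  refine ⟨μ₀, hμ₀, hμ₀1, fun μ hμ hμ' y₁ y₂ g₁ g₂ G hG c₁ c₂ t₁ t₂ hd b => ?_⟩
  have hr0 : 0 < |S.rate| := abs_pos.2 hr
  have hlim : Tendsto (fun n : ℕ => C * (exp (-(l * μ ^ 2 * |S.rate| * n)) * (2 * K * μ) + G / μ ^ 2))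
      atTop (𝓝 (C * (0 * (2 * K * μ) + G / μ ^ 2))) := by
    refine (Tendsto.add_const _ (Tendsto.mul_const _ ?_)).const_mul C
    exact tendsto_exp_neg_atTop_nhds_zero.comp
      (tendsto_natCast_atTop_atTop.const_mul_atTop (by positivity))
  rw [zero_mul, zero_add] at hlim
  refine ge_of_tendsto' hlim fun n => ?_
  -- The point b + rate·n lies upstream of b for either sign of the rate. The initial distance is at
  -- most the width of the tube, so its contribution vanishes as n grows.
  have h := H μ hμ hμ' y₁ y₂ g₁ g₂ (b + S.rate * n) b G (by
      have := mul_nonneg (mul_self_nonneg S.rate) n.cast_nonneg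
      nlinarith) hG c₁.continuousOn
    c₂.continuousOn (fun s _ => t₁ s) (fun s _ => t₂ s) fun s _ hs => hd s hs
  rw [show b - (b + S.rate * n) = -(S.rate * n) by ring, abs_neg, abs_mul, Nat.abs_cast,
    ← mul_assoc] at h
  refine h.trans (mul_le_mul_of_nonneg_left (add_le_add ?_ le_rfl) hC.le)
  exact mul_le_mul_of_nonneg_left (norm_sub_le_of_mem_tube (t₁ _) (t₂ _)) (exp_pos _).le

theorem tubeSolution_unique (hS : S.Elliptic) (hr : S.rate ≠ 0) {K : ℝ} (hK : 0 ≤ K) :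
    ∃ μ₀ > 0, ∀ μ, 0 < μ → μ < μ₀ → ∀ y₁ y₂, S.TubeSolution K μ y₁ → S.TubeSolution K μ y₂ →
      y₁ = y₂ := by
  obtain ⟨C, hC, H⟩ := norm_sub_le_of_tube hS hr
  obtain ⟨μ₀, hμ₀, -, H⟩ := H K hK
  refine ⟨μ₀, hμ₀, fun μ hμ hμ' y₁ y₂ h₁ h₂ => funext fun b => ?_⟩
  have h := H μ hμ hμ' y₁ y₂ (fun _ => 0) (fun _ => 0) 0 le_rfl h₁.cont h₂.cont h₁.mem h₂.mem
    (fun s hs => ⟨by simpa using h₁.hasDerivAt s hs, by simpa using h₂.hasDerivAt s hs,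
      by simp; positivity, by simp; positivity, by simp⟩) b
  rw [zero_div, mul_zero] at h
  exact sub_eq_zero.1 (norm_le_zero_iff.1 h)

end PhaseSystem

/-! ### Almost periodicity in the phase variable -/

theorem abs_sub_le_of_deriv_off_jumpSet {f f' : ℝ → ℝ} {a b C : ℝ} (hab : a ≤ b)
    (hc : ContinuousOn f (Set.Icc a b))
    (hd : ∀ s ∈ Set.Ioo a b, s ∉ jumpSet → HasDerivAt f (f' s) s)
    (hn : ∀ s ∈ Set.Ioo a b, s ∉ jumpSet → |f' s| ≤ C) : |f b - f a| ≤ C * (b - a) := by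
  have lin : ∀ s, HasDerivAt (fun s => C * s) C s := fun s => by
    simpa using (hasDerivAt_id s).const_mul C
  have h1 := le_of_hasDerivAt_nonpos_off_jumpSet (f := fun s => f s - C * s)
    (f' := fun s => f' s - C) hab (hc.sub (by fun_prop)) (fun s hs hN => (hd s hs hN).fun_sub (lin s))
    (fun s hs hN => by linarith [(abs_le.1 (hn s hs hN)).2])
  have h2 := le_of_hasDerivAt_nonpos_off_jumpSet (f := fun s => -f s - C * s)
    (f' := fun s => -f' s - C) hab (hc.neg.sub (by fun_prop))
    (fun s hs hN => (hd s hs hN).fun_neg.fun_sub (lin s))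
    (fun s hs hN => by linarith [(abs_le.1 (hn s hs hN)).1])
  exact abs_le.2 ⟨by linarith, by linarith⟩

theorem abs_div_sub_div_le {a a' b b' : ℝ} (hb : 1 / 2 ≤ b) (hb' : 1 / 2 ≤ b') :
    |a / b - a' / b'| ≤ 2 * |a - a'| + 4 * |a'| * |b - b'| := by
  have h1 : 0 < b := by linarith
  have h2 : 0 < b' := by linarith
  have i1 : |b⁻¹| ≤ 2 := by
    rw [abs_of_pos (inv_pos.2 h1), inv_le_comm₀ h1 two_pos]; linarith
  have i2 : |b'⁻¹| ≤ 2 := by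
    rw [abs_of_pos (inv_pos.2 h2), inv_le_comm₀ h2 two_pos]; linarith
  have e : a / b - a' / b' = b⁻¹ * (a - a') + b⁻¹ * b'⁻¹ * (a' * (b' - b)) := by
    field_simp; ring
  rw [e]
  refine (abs_add_le _ _).trans ?_
  rw [abs_mul, abs_mul, abs_mul, abs_mul, abs_sub_comm b']
  have j := mul_le_mul i1 i2 (abs_nonneg _) two_pos.le
  have k1 := mul_le_mul_of_nonneg_right i1 (abs_nonneg (a - a'))
  have k2 := mul_le_mul_of_nonneg_right j (by positivity : 0 ≤ |a'| * |b - b'|)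
  linarith

/-- Integers whose multiples of a given number are almost integral are relatively dense. -/
theorem exists_relatively_dense (β : ℝ) {θ : ℝ} (hθ : 0 < θ) :
    ∃ L > 0, ∀ x : ℝ, ∃ j i : ℤ, x ≤ j ∧ (j : ℝ) ≤ x + L ∧ |j * β - i| ≤ θ := by
  obtain ⟨n, hn⟩ := exists_nat_gt (1 / θ)
  have hn0 : 0 < n := by
    have : (0 : ℝ) < n := (by positivity : 0 < 1 / θ).trans hn
    exact_mod_cast this
  -- Dirichlet: kβ differs from an integer by some α with |α| ≤ θ. Multiples of k then change jβ
  -- modulo 1 in steps of α, so integers are approximated at bounded gaps.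
  obtain ⟨i₀, k, hk, -, hki⟩ := Real.exists_int_int_abs_mul_sub_le β hn0
  set α := k * β - i₀ with hα
  have hαθ : |α| ≤ θ := by
    refine hki.trans ?_
    rw [div_le_iff₀ (by positivity)]
    rw [div_lt_iff₀ hθ] at hn
    nlinarith
  have hk' : (0 : ℝ) < k := by exact_mod_cast hk
  by_cases h0 : α = 0
  · refine ⟨k, hk', fun x => ⟨k * ⌈x / k⌉, i₀ * ⌈x / k⌉, ?_, ?_, ?_⟩⟩
    · push_cast
      have := Int.le_ceil (x / k)
      rw [div_le_iff₀ hk'] at this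
      linarith
    · push_cast
      have := Int.ceil_lt_add_one (x / k)
      have h2 := mul_lt_mul_of_pos_left this hk'
      rw [mul_add, mul_div_cancel₀ _ hk'.ne', mul_one] at h2
      exact h2.le
    · have : ((k * ⌈x / k⌉ : ℤ) : ℝ) * β - (i₀ * ⌈x / k⌉ : ℤ) = α * ⌈x / k⌉ := by
        push_cast; rw [hα]; ring
      rw [this, h0, zero_mul, abs_zero]
      exact hθ.le
  · have hα0 : 0 < |α| := abs_pos.2 h0
    refine ⟨k * (1 / |α| + 2), by positivity, fun x => ?_⟩
    set m₀ : ℤ := ⌈x / k⌉ with hm₀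
    -- N is the next integer to be hit and m the first multiple with m|α| ≥ N, so m overshoots m₀ by
    -- less than 1/|α| + 1.
    set N : ℤ := ⌈m₀ * |α|⌉ with hN
    set m : ℤ := ⌈N / |α|⌉ with hm
    have a1 : x ≤ k * m₀ := by
      have := Int.le_ceil (x / k)
      rw [div_le_iff₀ hk'] at this
      linarith
    have a2 : k * (m₀ : ℝ) < x + k := by
      have := mul_lt_mul_of_pos_left (Int.ceil_lt_add_one (x / k)) hk'
      rwa [mul_add, mul_div_cancel₀ _ hk'.ne', mul_one] at this
    have b1 : m₀ * |α| ≤ N := Int.le_ceil _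
    have b2 : (N : ℝ) < m₀ * |α| + 1 := Int.ceil_lt_add_one _
    have c1 : N / |α| ≤ m := Int.le_ceil _
    have c2 : (m : ℝ) < N / |α| + 1 := Int.ceil_lt_add_one _
    have d1 : (m₀ : ℝ) ≤ N / |α| := by rwa [le_div_iff₀ hα0]
    have d2 : N / |α| < m₀ + 1 / |α| := by
      rw [div_lt_iff₀ hα0, add_mul, div_mul_cancel₀ _ hα0.ne']; exact b2
    have e1 : (N : ℝ) ≤ m * |α| := by rwa [div_le_iff₀ hα0] at c1
    have e2 : m * |α| < N + |α| := by
      have := mul_lt_mul_of_pos_right c2 hα0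
      rwa [add_mul, div_mul_cancel₀ _ hα0.ne', one_mul] at this
    have key : ∃ i : ℤ, |m * α - i| ≤ |α| := by
      rcases abs_cases α with ⟨h, -⟩ | ⟨h, -⟩
      · refine ⟨N, ?_⟩
        rw [h] at e1 e2 ⊢
        exact abs_le.2 ⟨by linarith, by linarith⟩
      · refine ⟨-N, ?_⟩
        rw [h] at e1 e2 ⊢
        push_cast
        exact abs_le.2 ⟨by linarith, by linarith⟩
    obtain ⟨i, hi⟩ := key
    refine ⟨k * m, i + m * i₀, ?_, ?_, ?_⟩
    · push_cast
      nlinarith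
    · push_cast
      have : (m : ℝ) ≤ m₀ + 1 / |α| + 1 := by linarith
      nlinarith [mul_le_mul_of_nonneg_left this hk'.le]
    · refine le_of_eq_of_le (congrArg abs ?_) (hi.trans hαθ)
      push_cast
      rw [hα]; ring

namespace PhaseSystem

variable {S : PhaseSystem}

theorem exists_force_bound (hS : S.Regular) :
    ∃ C > 0, (∀ s τ φ, |S.force s τ φ| ≤ C) ∧
      ∀ s τ τ' φ, |S.force s τ φ - S.force s τ' φ| ≤ C * |τ - τ'| := by
  obtain ⟨p, hp⟩ := hS.hP.bounded hS.Ts_pos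
  obtain ⟨q, hq⟩ := hS.hQ.bounded hS.Ts_pos
  obtain ⟨r, hr⟩ := hS.hR.bounded hS.Ts_pos
  obtain ⟨p', hp0, hp'⟩ := hS.hP.lipschitz hS.Ts_pos
  obtain ⟨q', hq0, hq'⟩ := hS.hQ.lipschitz hS.Ts_pos
  obtain ⟨r', hr0, hr'⟩ := hS.hR.lipschitz hS.Ts_pos
  have b1 : ∀ {x y M : ℝ}, |x| ≤ M → |y| ≤ 1 → |x * y| ≤ M := fun hx hy => by
    rw [abs_mul]
    exact (mul_le_mul hx hy (abs_nonneg _) ((abs_nonneg _).trans hx)).trans_eq (mul_one _)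
  have n1 := (abs_nonneg _).trans (hp 0)
  have n2 := (abs_nonneg _).trans (hq 0)
  have n3 := (abs_nonneg _).trans (hr 0)
  refine ⟨p + q + r + (p' + q' + r'), by positivity, fun s τ φ => ?_, fun s τ τ' φ => ?_⟩
  · refine (abs_add_three _ _ _).trans ?_
    have h1 := b1 (hp τ) (abs_sin_le_one (S.lam * (s - φ)))
    have h2 := b1 (hq τ) (abs_cos_le_one (S.lam * (s - φ)))
    linarith [hr τ]
  · have e : S.force s τ φ - S.force s τ' φ = (S.P τ - S.P τ') * sin (S.lam * (s - φ))
        + (S.Q τ - S.Q τ') * cos (S.lam * (s - φ)) + (S.R τ - S.R τ') := by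
      unfold force; ring
    rw [e]
    refine (abs_add_three _ _ _).trans ?_
    have h1 := b1 (hp' τ τ') (abs_sin_le_one (S.lam * (s - φ)))
    have h2 := b1 (hq' τ τ') (abs_cos_le_one (S.lam * (s - φ)))
    have h3 := hr' τ τ'
    have h4 : 0 ≤ (p + q + r) * |τ - τ'| := by positivity
    linarith

/-- Unlike `LO`, these bounds restrict the impulse only. They serve where the phase shift is not yet
known to be near η. -/
structure StripBound (S : PhaseSystem) (C : ℝ) : Prop where
  pos : 0 < C
  H₁ : ∀ s J, |J - S.Jr| ≤ S.Jr / 2 → |S.H₁ (saw s) J| ≤ C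
  H₀ : ∀ s J, |J - S.Jr| ≤ S.Jr / 2 → |S.H₀ (saw s) J| ≤ C
  M₁ : ∀ s J, |J - S.Jr| ≤ S.Jr / 2 → |S.M₁ (saw s) J| ≤ C
  M₀ : ∀ s J, |J - S.Jr| ≤ S.Jr / 2 → |S.M₀ (saw s) J| ≤ C
  lip₁ : ∀ s J, |J - S.Jr| ≤ S.Jr / 2 → |S.H₁ (saw s) J - S.H₁ (saw s) S.Jr| ≤ C * |J - S.Jr|
  lip₀ : ∀ s J, |J - S.Jr| ≤ S.Jr / 2 → |S.H₀ (saw s) J - S.H₀ (saw s) S.Jr| ≤ C * |J - S.Jr|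
  Θ : ∀ J, |J - S.Jr| ≤ S.Jr / 2 → |S.Θ J| ≤ C * |J - S.Jr|
  force : ∀ s τ φ, |S.force s τ φ| ≤ C
  force_sub : ∀ s τ τ' φ, |S.force s τ φ - S.force s τ' φ| ≤ C * |τ - τ'|

theorem exists_stripBound (hS : S.Regular) : ∃ C, S.StripBound C := by
  obtain ⟨C₁, h₁⟩ := hasExpansion_of_contDiffOn hS.Jr_pos hS.hH₁
  obtain ⟨C₂, h₂⟩ := hasExpansion_of_contDiffOn hS.Jr_pos hS.hH₀
  obtain ⟨C₃, h₃⟩ := hasExpansion_of_contDiffOn hS.Jr_pos hS.hM₁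
  obtain ⟨C₄, h₄⟩ := hasExpansion_of_contDiffOn hS.Jr_pos hS.hM₀
  obtain ⟨C₅, h₅⟩ := hasExpansion_of_contDiffOn hS.Jr_pos hS.hΘ
  obtain ⟨C₆, hC₆, hf, hf'⟩ := exists_force_bound hS
  have p₁ := h₁.pos
  have p₂ := h₂.pos
  have p₃ := h₃.pos
  have p₄ := h₄.pos
  have p₅ := h₅.pos
  have self : |S.Jr - S.Jr| ≤ S.Jr / 2 := by
    rw [sub_self, abs_zero]; linarith [hS.Jr_pos]
  have up : ∀ {x c y : ℝ}, x ≤ c * |y| → c ≤ C₁ + C₂ + C₃ + C₄ + C₅ + C₆ →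
      x ≤ (C₁ + C₂ + C₃ + C₄ + C₅ + C₆) * |y| := fun h hc =>
    h.trans (mul_le_mul_of_nonneg_right hc (abs_nonneg _))
  refine ⟨C₁ + C₂ + C₃ + C₄ + C₅ + C₆, by positivity, fun s J h => (h₁.bound s J h).trans ?_,
    fun s J h => (h₂.bound s J h).trans ?_, fun s J h => (h₃.bound s J h).trans ?_,
    fun s J h => (h₄.bound s J h).trans ?_, fun s J h => up (h₁.lip s J S.Jr h self) ?_,
    fun s J h => up (h₂.lip s J S.Jr h self) ?_, fun J h => ?_, fun s τ φ => (hf s τ φ).trans ?_,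
    fun s τ τ' φ => up (hf' s τ τ' φ) ?_⟩
  · linarith
  · linarith
  · linarith
  · linarith
  · linarith
  · linarith
  · have := h₅.lip 0 J S.Jr h self
    simp only [hS.Θ_Jr, sub_zero] at this
    exact up this (by linarith)
  · linarith
  · linarith

/-- Dependence of the right-hand side on the force. -/
theorem StripBound.norm_V_sub_le {C μ s s' : ℝ} (h : S.StripBound C) (hμ : 0 < μ) (hμ1 : μ ≤ 1)
    (hs : saw s' = saw s) {y : ℝ × ℝ} (hJ : |μ * y.1| ≤ S.Jr / 2)
    (hG : 1 / 2 ≤ 1 + μ ^ 2 * S.G μ s y) (hG' : 1 / 2 ≤ 1 + μ ^ 2 * S.G μ s' y) :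
    ‖S.V μ s' y - S.V μ s y‖
      ≤ (2 * C + 4 * (C * C + C) * C + 4 * (1 + C * S.Jr) * C) * |S.u μ s' y - S.u μ s y| := by
  have hC := h.pos
  have hJ' : |S.Jr + μ * y.1 - S.Jr| ≤ S.Jr / 2 := by rwa [add_sub_cancel_left]
  set d := |S.u μ s' y - S.u μ s y| with hd
  have hd0 : 0 ≤ d := abs_nonneg _
  have hJ0 : 0 ≤ S.Jr := by linarith [(abs_nonneg _).trans hJ]
  have eA : S.A μ s' y - S.A μ s y = S.H₁ (saw s) (S.Jr + μ * y.1) * (S.u μ s' y - S.u μ s y) := by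
    unfold A; rw [hs]; ring
  have eG : S.G μ s' y - S.G μ s y = S.M₁ (saw s) (S.Jr + μ * y.1) * (S.u μ s' y - S.u μ s y) := by
    unfold G; rw [hs]; ring
  have bA : |S.A μ s' y - S.A μ s y| ≤ C * d := by
    rw [eA, abs_mul]; exact mul_le_mul_of_nonneg_right (h.H₁ s _ hJ') hd0
  have bG : |(1 + μ ^ 2 * S.G μ s' y) - (1 + μ ^ 2 * S.G μ s y)| ≤ C * d := by
    rw [add_sub_add_left_eq_sub, ← mul_sub, eG, abs_mul, abs_mul, abs_of_nonneg (sq_nonneg μ)]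
    have h1 : μ ^ 2 ≤ 1 := pow_le_one₀ hμ.le hμ1
    have h2 := mul_le_mul_of_nonneg_right (h.M₁ s _ hJ') hd0
    have h3 := mul_le_mul h1 h2 (by positivity) one_pos.le
    rwa [one_mul] at h3
  have cA : |S.A μ s y| ≤ C * C + C := by
    refine (abs_add_le _ _).trans (add_le_add ?_ (h.H₀ s _ hJ'))
    rw [abs_mul]
    exact mul_le_mul (h.H₁ s _ hJ') (h.force _ _ _) (abs_nonneg _) hC.le
  have cΘ : |1 - S.Θ (S.Jr + μ * y.1)| ≤ 1 + C * S.Jr := by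
    refine (abs_sub _ _).trans ?_
    rw [abs_one]
    have := (h.Θ _ hJ').trans (mul_le_mul_of_nonneg_left hJ' hC.le)
    have : C * (S.Jr / 2) ≤ C * S.Jr := by nlinarith
    linarith
  rw [Prod.norm_def]
  refine max_le ?_ ?_
  · simp only [V, Prod.fst_sub, norm_eq_abs, ← mul_sub]
    rw [abs_mul, abs_of_pos hμ]
    have h1 := abs_div_sub_div_le (a := S.A μ s' y) (a' := S.A μ s y) hG' hG
    have h2 : 4 * |S.A μ s y| * |(1 + μ ^ 2 * S.G μ s' y) - (1 + μ ^ 2 * S.G μ s y)|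
        ≤ 4 * (C * C + C) * (C * d) := by gcongr
    have h3 : 0 ≤ 4 * (1 + C * S.Jr) * C * d := by positivity
    calc _ ≤ 1 * |S.A μ s' y / (1 + μ ^ 2 * S.G μ s' y) - S.A μ s y / (1 + μ ^ 2 * S.G μ s y)| := by
          gcongr
      _ ≤ _ := by linarith
  · simp only [V, Prod.snd_sub, norm_eq_abs]
    rw [sub_sub_sub_cancel_left, abs_sub_comm]
    have h1 := abs_div_sub_div_le (a := 1 - S.Θ (S.Jr + μ * y.1))
      (a' := 1 - S.Θ (S.Jr + μ * y.1)) hG' hG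
    rw [sub_self, abs_zero, mul_zero, zero_add] at h1
    have h2 : 4 * |1 - S.Θ (S.Jr + μ * y.1)|
        * |(1 + μ ^ 2 * S.G μ s' y) - (1 + μ ^ 2 * S.G μ s y)| ≤ 4 * (1 + C * S.Jr) * (C * d) := by
      gcongr
    have h3 : 0 ≤ (2 * C + 4 * (C * C + C) * C) * d := by positivity
    linarith

/-- Shifting by j common fast periods changes only the slow time, and i slow periods may be
subtracted from that change. -/
theorem StripBound.u_shift {C μ s : ℝ} (h : S.StripBound C) (hS : S.Regular) (i j : ℤ)
    (y : ℝ × ℝ) : saw (s + S.Tf * j) = saw s ∧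
      |S.u μ (s + S.Tf * j) y - S.u μ s y| ≤ C * |μ ^ 2 * S.c * (S.Tf * j) - S.Ts * i| := by
  obtain ⟨n, m, hn, hTf, hm⟩ := hS.fast
  have e1 : S.Tf * j = 2 * π * ((n * j : ℤ) : ℝ) := by rw [hTf]; push_cast; ring
  refine ⟨by rw [e1, saw_add_period], ?_⟩
  have e2 : S.lam * (s + S.Tf * j - y.2) = S.lam * (s - y.2) + ((m * j : ℤ) : ℝ) * (2 * π) := by
    push_cast; linear_combination (j : ℝ) * hm
  have e3 : S.u μ (s + S.Tf * j) y
      = S.force s (μ ^ 2 * S.c * (s - y.2) + (μ ^ 2 * S.c * (S.Tf * j) - S.Ts * i)) y.2 := by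
    have per : ∀ {α : ℝ → ℝ}, IsSlow S.Ts α → α (μ ^ 2 * S.c * (s + S.Tf * j - y.2))
        = α (μ ^ 2 * S.c * (s - y.2) + (μ ^ 2 * S.c * (S.Tf * j) - S.Ts * i)) := fun {α} hα => by
      have := (hα.periodic.int_mul i)
        (μ ^ 2 * S.c * (s - y.2) + (μ ^ 2 * S.c * (S.Tf * j) - S.Ts * i))
      rw [← this]
      congr 1
      ring
    unfold PhaseSystem.u PhaseSystem.force
    rw [e2, sin_add_int_mul_two_pi, cos_add_int_mul_two_pi, per hS.hP, per hS.hQ, per hS.hR]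
  rw [e3]
  refine (h.force_sub _ _ _ _).trans_eq ?_
  rw [add_sub_cancel_left]

/-- The translated solution satisfies the original system with a defect proportional to the mismatch
θ of the slow periods. Contraction from infinity bounds its distance to the solution itself by a
multiple of θ/μ². -/
theorem tubeSolution_almost_periodic (hS : S.Elliptic) (hr : S.rate ≠ 0) {K : ℝ} (hK : 0 ≤ K) :
    ∃ μ₀ > 0, ∀ μ, 0 < μ → μ < μ₀ → ∀ y, S.TubeSolution K μ y → ∀ δ > 0, ∃ θ > 0, ∀ i j : ℤ,
      |μ ^ 2 * S.c * (S.Tf * j) - S.Ts * i| ≤ θ → ∀ s, ‖y (s + S.Tf * j) - y s‖ ≤ δ := by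
  obtain ⟨C, hC, H⟩ := norm_sub_le_of_tube hS hr
  have hK1 : 0 ≤ K + 1 := by linarith
  obtain ⟨μ₁, hμ₁, hμ₁', H⟩ := H (K + 1) hK1
  obtain ⟨μ₂, hμ₂, -, H₂⟩ := exists_clamped_solution hS.toRegular hK1
  obtain ⟨B, hB⟩ := exists_stripBound hS.toRegular
  obtain ⟨L, hL, hη⟩ := hS.hη.lipschitz hS.Ts_pos
  have hB0 := hB.pos
  have hJ := hS.Jr_pos
  set B' := (2 * B + 4 * (B * B + B) * B + 4 * (1 + B * S.Jr) * B) * B with hB'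
  have hB'0 : 0 < B' := by positivity
  refine ⟨min μ₁ (min μ₂ (S.Jr / (2 * (K + 1)))), by positivity, fun μ hμ hμ' y hy δ hδ => ?_⟩
  have m₁ : μ < μ₁ := hμ'.trans_le (min_le_left _ _)
  have hμ1 : μ ≤ 1 := m₁.le.trans hμ₁'
  have m₃ : (K + 1) * μ ≤ S.Jr / 2 := by
    have := (hμ'.trans_le ((min_le_right _ _).trans (min_le_right _ _))).le
    rw [le_div_iff₀ (by positivity)] at this
    linarith
  obtain ⟨hbd, -, -⟩ := H₂ μ hμ (hμ'.trans_le ((min_le_right _ _).trans (min_le_left _ _)))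
  -- In order: the translate stays in the tube of radius K + 1, its defect is admissible for the
  -- contraction, and the final distance is at most δ.
  refine ⟨min (μ / L) (min ((K + 1) * μ ^ 3 / B') (δ * μ ^ 2 / (C * B'))), by positivity,
    fun i j hij s => ?_⟩
  set θ := |μ ^ 2 * S.c * (S.Tf * j) - S.Ts * i| with hθ
  have θ₁ : L * θ ≤ μ := by
    have := hij.trans (min_le_left _ _)
    rw [le_div_iff₀ hL] at this
    linarith
  have θ₂ : B' * θ ≤ (K + 1) * μ ^ 3 := by
    have := hij.trans ((min_le_right _ _).trans (min_le_left _ _))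
    rw [le_div_iff₀ hB'0] at this
    linarith
  have θ₃ : C * (B' * θ / μ ^ 2) ≤ δ := by
    have := hij.trans ((min_le_right _ _).trans (min_le_right _ _))
    rw [le_div_iff₀ (by positivity)] at this
    rw [mul_div_assoc', div_le_iff₀ (by positivity)]
    linarith
  have hmem' : ∀ s, y (s + S.Tf * j) ∈ S.tube (K + 1) μ s := fun s => by
    have h1 := hy.mem (s + S.Tf * j)
    have h2 : |S.η (S.slow μ (s + S.Tf * j)) - S.η (S.slow μ s)| ≤ L * θ := by
      have e : S.η (S.slow μ (s + S.Tf * j))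
          = S.η (S.slow μ s + (μ ^ 2 * S.c * (S.Tf * j) - S.Ts * i)) := by
        rw [← (hS.hη.periodic.int_mul i) (S.slow μ s + (μ ^ 2 * S.c * (S.Tf * j) - S.Ts * i))]
        congr 1
        unfold slow
        ring
      rw [e]
      refine (hη _ _).trans_eq ?_
      rw [add_sub_cancel_left]
    refine ⟨h1.1.trans (by nlinarith), ?_⟩
    have h3 := abs_add_le ((y (s + S.Tf * j)).2 - S.η (S.slow μ (s + S.Tf * j)))
      (S.η (S.slow μ (s + S.Tf * j)) - S.η (S.slow μ s))
    rw [sub_add_sub_cancel] at h3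
    linarith [h1.2]
  have hmem : ∀ s, y s ∈ S.tube (K + 1) μ s := fun s => tube_mono hμ.le (by linarith) (hy.mem s)
  have hN : ∀ s ∉ jumpSet, s + S.Tf * j ∉ jumpSet := fun s hs => by
    obtain ⟨n, m, hn, hTf, hm⟩ := hS.fast
    have := add_period_notMem_jumpSet (n * j) hs
    push_cast at this
    rwa [hTf, mul_assoc]
  refine (H μ hμ m₁ (fun s => y (s + S.Tf * j)) y
    (fun s => S.V μ (s + S.Tf * j) (y (s + S.Tf * j)) - S.V μ s (y (s + S.Tf * j))) (fun _ => 0)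
    (B' * θ) (by positivity) (hy.cont.comp (by fun_prop)) hy.cont hmem' hmem (fun s hs => ?_) s).trans θ₃
  obtain ⟨u1, u2⟩ := hB.u_shift (μ := μ) (s := s) hS.toRegular i j (y (s + S.Tf * j))
  have hb1 := hbd s _ (hmem' s)
  have hb2 := hbd (s + S.Tf * j) _ (hmem (s + S.Tf * j))
  have hJ' : |μ * (y (s + S.Tf * j)).1| ≤ S.Jr / 2 := by
    rw [abs_mul, abs_of_pos hμ]
    have := mul_le_mul hμ1 (hmem' s).1 (abs_nonneg _) one_pos.le
    linarith
  have hV := (hB.norm_V_sub_le hμ hμ1 u1 hJ' hb1.2.1 hb2.2.1).trans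
    (mul_le_mul_of_nonneg_left u2 (by positivity))
  rw [← mul_assoc] at hV
  refine ⟨?_, by simpa using hy.hasDerivAt s hs, hV.trans θ₂, by simp; positivity, by simpa using hV⟩
  rw [add_sub_cancel]
  exact (hy.hasDerivAt _ (hN s hs)).comp_add_const s (S.Tf * j)

end PhaseSystem

/-! ### The averaged force and localization of the phase -/

namespace PhaseSystem

variable (S : PhaseSystem)

/-- The averaged force, for a frozen slow time and phase shift. -/
def avg (σ φ : ℝ) : ℝ := fastMean S.Tf fun s => S.H₁ (saw s) S.Jr * S.force s σ φ + S.H₀ (saw s) S.Jr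

/-- `sinCoeff` and `cosCoeff` are the coefficients of sin(lam·s) and cos(lam·s) in the force. They
separate s from (σ, φ), so averages depend on φ explicitly. -/
def sinCoeff (σ φ : ℝ) : ℝ := S.P σ * cos (S.lam * φ) + S.Q σ * sin (S.lam * φ)

def cosCoeff (σ φ : ℝ) : ℝ := S.Q σ * cos (S.lam * φ) - S.P σ * sin (S.lam * φ)

variable {S}

theorem force_eq (s σ φ : ℝ) : S.force s σ φ
    = sin (S.lam * s) * S.sinCoeff σ φ + cos (S.lam * s) * S.cosCoeff σ φ + S.R σ := by
  unfold force sinCoeff cosCoeff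
  rw [mul_sub, sin_sub, cos_sub]
  ring

theorem fastMean_sin_cos (hS : S.Regular) {H : ℝ → ℝ} (hH : IsFast S.Tf H) (a b : ℝ) :
    fastMean S.Tf (fun s => H s * (sin (S.lam * s) * a + cos (S.lam * s) * b))
      = fastMean S.Tf (fun s => H s * sin (S.lam * s)) * a
        + fastMean S.Tf (fun s => H s * cos (S.lam * s)) * b := by
  have h1 : IsFast S.Tf fun s => a * (H s * sin (S.lam * s)) :=
    (IsFast.const a).mul (hH.mul hS.isFast_sin)
  have h2 : IsFast S.Tf fun s => b * (H s * cos (S.lam * s)) :=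
    (IsFast.const b).mul (hH.mul hS.isFast_cos)
  have e : (fun s => H s * (sin (S.lam * s) * a + cos (S.lam * s) * b))
      = fun s => a * (H s * sin (S.lam * s)) + b * (H s * cos (S.lam * s)) := by
    funext s; ring
  rw [e, fastMean_add h1 h2, fastMean_const_mul, fastMean_const_mul]
  ring

theorem avg_eq (hS : S.Regular) (σ φ : ℝ) : S.avg σ φ
    = fastMean S.Tf (fun s => S.H₁ (saw s) S.Jr * sin (S.lam * s)) * S.sinCoeff σ φ
      + fastMean S.Tf (fun s => S.H₁ (saw s) S.Jr * cos (S.lam * s)) * S.cosCoeff σ φ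
      + fastMean S.Tf (fun s => S.H₁ (saw s) S.Jr) * S.R σ
      + fastMean S.Tf (fun s => S.H₀ (saw s) S.Jr) := by
  have f1 := hS.isFast hS.hH₁
  have f0 := hS.isFast hS.hH₀
  have f2 : IsFast S.Tf fun s => S.H₁ (saw s) S.Jr
      * (sin (S.lam * s) * S.sinCoeff σ φ + cos (S.lam * s) * S.cosCoeff σ φ) :=
    f1.mul ((hS.isFast_sin.mul (IsFast.const _)).add (hS.isFast_cos.mul (IsFast.const _)))
  have f3 : IsFast S.Tf fun s => S.R σ * S.H₁ (saw s) S.Jr := (IsFast.const _).mul f1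
  have e : (fun s => S.H₁ (saw s) S.Jr * S.force s σ φ + S.H₀ (saw s) S.Jr)
      = fun s => S.H₁ (saw s) S.Jr
        * (sin (S.lam * s) * S.sinCoeff σ φ + cos (S.lam * s) * S.cosCoeff σ φ)
        + S.R σ * S.H₁ (saw s) S.Jr + S.H₀ (saw s) S.Jr := by
    funext s; rw [force_eq]; ring
  rw [avg, e, fastMean_add (f2.add f3) f0, fastMean_add f2 f3, fastMean_const_mul,
    fastMean_sin_cos hS f1]
  ring

theorem mean_A'_eq (hS : S.Regular) (σ : ℝ) : S.mean S.A' σ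
    = S.lam * (fastMean S.Tf (fun s => S.H₁ (saw s) S.Jr * sin (S.lam * s)) * S.cosCoeff σ (S.η σ)
      - fastMean S.Tf (fun s => S.H₁ (saw s) S.Jr * cos (S.lam * s)) * S.sinCoeff σ (S.η σ)) := by
  have e : (fun s => S.A' s σ) = fun s => S.H₁ (saw s) S.Jr * (sin (S.lam * s)
      * (S.lam * S.cosCoeff σ (S.η σ)) + cos (S.lam * s) * (-(S.lam * S.sinCoeff σ (S.η σ)))) := by
    funext s
    unfold A' u₀' sinCoeff cosCoeff
    rw [mul_sub S.lam s, sin_sub, cos_sub]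
    ring
  rw [mean, e, fastMean_sin_cos hS (hS.isFast hS.hH₁)]
  ring

theorem sinCoeff_add (σ φ x : ℝ) : S.sinCoeff σ (φ + x)
    = S.sinCoeff σ φ * cos (S.lam * x) + S.cosCoeff σ φ * sin (S.lam * x) := by
  unfold sinCoeff cosCoeff
  rw [mul_add, cos_add, sin_add]
  ring

theorem cosCoeff_add (σ φ x : ℝ) : S.cosCoeff σ (φ + x)
    = S.cosCoeff σ φ * cos (S.lam * x) - S.sinCoeff σ φ * sin (S.lam * x) := by
  unfold sinCoeff cosCoeff
  rw [mul_add, cos_add, sin_add]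
  ring

theorem exists_slow_coeff_bound (hS : S.Regular) :
    ∃ C > 0, ∀ σ, |S.P σ| ≤ C ∧ |S.Q σ| ≤ C ∧ |S.R σ| ≤ C ∧ |deriv S.P σ| ≤ C ∧
      |deriv S.Q σ| ≤ C ∧ |deriv S.R σ| ≤ C ∧ |S.η σ| ≤ C ∧ |deriv S.η σ| ≤ C := by
  have hT := hS.Ts_pos
  obtain ⟨C₁, h₁⟩ := hS.hP.bounded hT
  obtain ⟨C₂, h₂⟩ := hS.hQ.bounded hT
  obtain ⟨C₃, h₃⟩ := hS.hR.bounded hT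
  obtain ⟨C₄, h₄⟩ := hS.hP.deriv.bounded hT
  obtain ⟨C₅, h₅⟩ := hS.hQ.deriv.bounded hT
  obtain ⟨C₆, h₆⟩ := hS.hR.deriv.bounded hT
  obtain ⟨C₇, h₇⟩ := hS.hη.bounded hT
  obtain ⟨C₈, h₈⟩ := hS.hη.deriv.bounded hT
  have p₁ := (abs_nonneg _).trans (h₁ 0)
  have p₂ := (abs_nonneg _).trans (h₂ 0)
  have p₃ := (abs_nonneg _).trans (h₃ 0)
  have p₄ := (abs_nonneg _).trans (h₄ 0)
  have p₅ := (abs_nonneg _).trans (h₅ 0)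
  have p₆ := (abs_nonneg _).trans (h₆ 0)
  have p₇ := (abs_nonneg _).trans (h₇ 0)
  have p₈ := (abs_nonneg _).trans (h₈ 0)
  refine ⟨C₁ + C₂ + C₃ + C₄ + C₅ + C₆ + C₇ + C₈ + 1, by positivity, fun σ => ?_⟩
  refine ⟨(h₁ σ).trans ?_, (h₂ σ).trans ?_, (h₃ σ).trans ?_, (h₄ σ).trans ?_,
    (h₅ σ).trans ?_, (h₆ σ).trans ?_, (h₇ σ).trans ?_, (h₈ σ).trans ?_⟩ <;> linarith

theorem abs_mul_add_mul_le {a b x y C : ℝ} (ha : |a| ≤ C) (hb : |b| ≤ C) (hx : |x| ≤ 1)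
    (hy : |y| ≤ 1) : |a * x + b * y| ≤ 2 * C := by
  refine (abs_add_le _ _).trans ?_
  rw [abs_mul, abs_mul]
  have h1 := mul_le_mul ha hx (abs_nonneg _) ((abs_nonneg _).trans ha)
  have h2 := mul_le_mul hb hy (abs_nonneg _) ((abs_nonneg _).trans hb)
  linarith

/-- The averaged force restores the phase. -/
theorem exists_restoring (hS : S.Elliptic) :
    ∃ δ > 0, ∃ a > 0, ∀ σ x, |x| ≤ δ → a * x ^ 2 ≤ -S.d * S.avg σ (S.η σ + x) * x := by
  obtain ⟨C, hC, hb⟩ := exists_slow_coeff_bound hS.toRegular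
  have hA' : IsSlow S.Ts fun σ => S.mean S.A' σ * (-S.d) :=
    (hS.isSep_A'.fastMean_isSlow : IsSlow S.Ts (S.mean S.A')).mul (IsSlow.const _)
  obtain ⟨a, ha, hlow⟩ := hA'.exists_lower_bound hS.Ts_pos fun σ => by linarith [hS.ell σ]
  set m₁ := fastMean S.Tf (fun s => S.H₁ (saw s) S.Jr * sin (S.lam * s)) with hm₁
  set m₂ := fastMean S.Tf (fun s => S.H₁ (saw s) S.Jr * cos (S.lam * s)) with hm₂
  set c₁ := (|m₁| + |m₂|) * (2 * C) with hc₁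
  have hc₁0 : 0 ≤ c₁ := by positivity
  set c₂ := c₁ * |S.lam| ^ 2 + c₁ * |S.lam| ^ 3 with hc₂
  have hc₂0 : 0 ≤ c₂ := by positivity
  -- The averaged force vanishes at η, and its slope times −d is at least a. For |x| ≤ δ the
  -- quadratic remainder uses up at most half of that.
  refine ⟨min 1 (a / (2 * (|S.d| * c₂ + 1))), by positivity, a / 2, by positivity, fun σ x hx => ?_⟩
  have hx1 : |x| ≤ 1 := hx.trans (min_le_left _ _)
  have hx2 : |x| * (|S.d| * c₂ + 1) ≤ a / 2 := by
    have := hx.trans (min_le_right _ _)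
    rw [le_div_iff₀ (by positivity)] at this
    linarith
  set β₁ := S.sinCoeff σ (S.η σ) with hβ₁
  set β₂ := S.cosCoeff σ (S.η σ) with hβ₂
  obtain ⟨bP, bQ, -⟩ := hb σ
  have b₁ : |β₁| ≤ 2 * C := abs_mul_add_mul_le bP bQ (abs_cos_le_one _) (abs_sin_le_one _)
  have b₂ : |β₂| ≤ 2 * C := by
    have := abs_mul_add_mul_le bQ (b := -S.P σ) (by rwa [abs_neg]) (abs_cos_le_one (S.lam * S.η σ))
      (abs_sin_le_one (S.lam * S.η σ))
    refine le_of_eq_of_le (congrArg abs ?_) this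
    rw [hβ₂, cosCoeff]; ring
  have k₁ : |m₁ * β₁ + m₂ * β₂| ≤ c₁ := by
    refine (abs_add_le _ _).trans ?_
    rw [abs_mul, abs_mul]
    have := mul_le_mul_of_nonneg_left b₁ (abs_nonneg m₁)
    have := mul_le_mul_of_nonneg_left b₂ (abs_nonneg m₂)
    linarith
  have k₂ : |m₁ * β₂ - m₂ * β₁| ≤ c₁ := by
    refine (abs_sub _ _).trans ?_
    rw [abs_mul, abs_mul]
    have := mul_le_mul_of_nonneg_left b₂ (abs_nonneg m₁)
    have := mul_le_mul_of_nonneg_left b₁ (abs_nonneg m₂)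
    linarith
  have hcos : |cos (S.lam * x) - 1| ≤ |S.lam| ^ 2 * |x| ^ 2 := by
    have h1 := one_sub_sq_div_two_le_cos (x := S.lam * x)
    have h2 := cos_le_one (S.lam * x)
    rw [sq_abs, sq_abs, ← mul_pow]
    exact abs_le.2 ⟨by nlinarith [sq_nonneg (S.lam * x)], by nlinarith [sq_nonneg (S.lam * x)]⟩
  have hsin : |sin (S.lam * x) - S.lam * x| ≤ |S.lam| ^ 3 * |x| ^ 2 := by
    have h := sin_taylor_remainder 0 S.lam (r := |x|) (x₁ := x) (x₂ := 0) le_rfl (by simp)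
    simp only [zero_sub, sin_neg, sin_zero, cos_zero, mul_one, mul_zero, sub_zero, add_zero,
      sub_self] at h
    rw [neg_add_eq_sub, abs_sub_comm] at h
    refine h.trans ?_
    have : |x| ^ 2 * |x| ≤ |x| ^ 2 * 1 := mul_le_mul_of_nonneg_left hx1 (by positivity)
    calc |S.lam| ^ 3 * |x| ^ 2 * |x| = |S.lam| ^ 3 * (|x| ^ 2 * |x|) := by ring
      _ ≤ |S.lam| ^ 3 * (|x| ^ 2 * 1) := by gcongr
      _ = _ := by ring
  have h0 : S.avg σ (S.η σ) = 0 := hS.mean_A₀ σ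
  have e : S.avg σ (S.η σ + x) = S.mean S.A' σ * x + ((m₁ * β₁ + m₂ * β₂) * (cos (S.lam * x) - 1)
      + (m₁ * β₂ - m₂ * β₁) * (sin (S.lam * x) - S.lam * x)) := by
    rw [avg_eq hS.toRegular] at h0 ⊢
    rw [mean_A'_eq hS.toRegular, sinCoeff_add, cosCoeff_add, ← hm₁, ← hm₂, ← hβ₁, ← hβ₂]
    rw [← hm₁, ← hm₂, ← hβ₁, ← hβ₂] at h0
    linear_combination h0
  have hrem : |(m₁ * β₁ + m₂ * β₂) * (cos (S.lam * x) - 1)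
      + (m₁ * β₂ - m₂ * β₁) * (sin (S.lam * x) - S.lam * x)| ≤ c₂ * |x| ^ 2 := by
    refine (abs_add_le _ _).trans ?_
    rw [abs_mul, abs_mul]
    have := mul_le_mul k₁ hcos (abs_nonneg _) hc₁0
    have := mul_le_mul k₂ hsin (abs_nonneg _) hc₁0
    rw [hc₂]
    linarith
  set r := (m₁ * β₁ + m₂ * β₂) * (cos (S.lam * x) - 1)
      + (m₁ * β₂ - m₂ * β₁) * (sin (S.lam * x) - S.lam * x) with hr
  have h1 : |S.d * r * x| ≤ (|x| * (|S.d| * c₂ + 1)) * x ^ 2 := by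
    rw [abs_mul, abs_mul]
    calc |S.d| * |r| * |x| ≤ |S.d| * (c₂ * |x| ^ 2) * |x| := by gcongr
      _ = (|x| * (|S.d| * c₂)) * x ^ 2 := by rw [sq_abs]; ring
      _ ≤ _ := by
        refine mul_le_mul_of_nonneg_right (mul_le_mul_of_nonneg_left ?_ (abs_nonneg _)) (sq_nonneg _)
        linarith
  have h2 := mul_le_mul_of_nonneg_right hx2 (sq_nonneg x)
  have h3 := mul_le_mul_of_nonneg_right (hlow σ) (sq_nonneg x)
  have h4 := (abs_le.1 h1).2
  rw [e]
  linarith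

/-- Only z is assumed to be O(μ); the phase shift is merely bounded. So the first coefficient is
compared with its value at the actual φ instead of being expanded at η. The second equation is slow,
of order μ². -/
theorem StripBound.V_approx {C μ s K M : ℝ} (h : S.StripBound C) (hS : S.Regular) (hμ : 0 < μ)
    (hK : 0 ≤ K) {y : ℝ × ℝ} (hy : |y.1| ≤ K * μ) (hφ : |y.2| ≤ M) (hJ : K * μ ^ 2 ≤ S.Jr / 2)
    (hG : μ ^ 2 * (C * C + C) ≤ 1 / 2) :
    |(S.V μ s y).1 / μ - (S.H₁ (saw s) S.Jr * S.force s (S.slow μ s) y.2 + S.H₀ (saw s) S.Jr)|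
      ≤ (2 * (C * K * C + C * (C * (S.c * M)) + C * K) + 4 * (C * C + C) * (C * C + C)) * μ ^ 2 ∧
    |(S.V μ s y).2| ≤ (2 * (C * K) + 4 * (C * C + C)) * μ ^ 2 := by
  have hC := h.pos
  have hz : |S.Jr + μ * y.1 - S.Jr| ≤ K * μ ^ 2 := by
    rw [add_sub_cancel_left, abs_mul, abs_of_pos hμ]
    have := mul_le_mul_of_nonneg_left hy hμ.le
    linarith
  have hJ' := hz.trans hJ
  have self : |S.Jr - S.Jr| ≤ S.Jr / 2 := by rw [sub_self, abs_zero]; linarith [hS.Jr_pos]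
  set J := S.Jr + μ * y.1 with hJdef
  have bG : |S.G μ s y| ≤ C * C + C := by
    refine (abs_add_le _ _).trans (add_le_add ?_ (h.M₀ s _ hJ'))
    rw [abs_mul]
    exact mul_le_mul (h.M₁ s _ hJ') (h.force _ _ _) (abs_nonneg _) hC.le
  have bG' : |μ ^ 2 * S.G μ s y| ≤ μ ^ 2 * (C * C + C) := by
    rw [abs_mul, abs_of_nonneg (sq_nonneg μ)]
    exact mul_le_mul_of_nonneg_left bG (sq_nonneg μ)
  have hden : 1 / 2 ≤ 1 + μ ^ 2 * S.G μ s y := by linarith [(abs_le.1 (bG'.trans hG)).1]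
  have hsub : |(1 + μ ^ 2 * S.G μ s y) - 1| ≤ μ ^ 2 * (C * C + C) := by
    rwa [add_sub_cancel_left]
  constructor
  · have e : (S.V μ s y).1 / μ = S.A μ s y / (1 + μ ^ 2 * S.G μ s y) := by
      simp only [PhaseSystem.V]; field_simp
    set A₁ := S.H₁ (saw s) S.Jr * S.force s (S.slow μ s) y.2 + S.H₀ (saw s) S.Jr with hA₁
    have bA₁ : |A₁| ≤ C * C + C := by
      refine (abs_add_le _ _).trans (add_le_add ?_ (h.H₀ s _ self))
      rw [abs_mul]
      exact mul_le_mul (h.H₁ s _ self) (h.force _ _ _) (abs_nonneg _) hC.le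
    have bA : |S.A μ s y - A₁| ≤ (C * K * C + C * (C * (S.c * M)) + C * K) * μ ^ 2 := by
      have e2 : S.A μ s y - A₁ = (S.H₁ (saw s) J - S.H₁ (saw s) S.Jr) * S.u μ s y
          + S.H₁ (saw s) S.Jr * (S.u μ s y - S.force s (S.slow μ s) y.2)
          + (S.H₀ (saw s) J - S.H₀ (saw s) S.Jr) := by
        rw [hA₁]; unfold A; rw [← hJdef]; ring
      rw [e2]
      refine (abs_add_three _ _ _).trans ?_
      rw [abs_mul, abs_mul]
      have t1 := mul_le_mul ((h.lip₁ s _ hJ').trans (mul_le_mul_of_nonneg_left hz hC.le))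
        (h.force s (μ ^ 2 * S.c * (s - y.2)) y.2) (abs_nonneg _) (by positivity)
      have t2 : |S.u μ s y - S.force s (S.slow μ s) y.2| ≤ C * (μ ^ 2 * (S.c * M)) := by
        refine (h.force_sub _ _ _ _).trans (mul_le_mul_of_nonneg_left ?_ hC.le)
        have e3 : μ ^ 2 * S.c * (s - y.2) - S.slow μ s = -(μ ^ 2 * (S.c * y.2)) := by
          unfold slow; ring
        rw [e3, abs_neg, abs_mul, abs_mul, abs_of_nonneg (sq_nonneg μ), abs_of_pos hS.c_pos]
        have := hS.c_pos
        gcongr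
      have t3 := mul_le_mul (h.H₁ s _ self) t2 (abs_nonneg _) hC.le
      have t4 := (h.lip₀ s _ hJ').trans (mul_le_mul_of_nonneg_left hz hC.le)
      have t1' : |S.H₁ (saw s) J - S.H₁ (saw s) S.Jr| * |S.u μ s y| ≤ C * (K * μ ^ 2) * C := t1
      linarith
    rw [e]
    have key := abs_div_sub_div_le (a := S.A μ s y) (a' := A₁) (b' := 1) hden (by norm_num)
    rw [div_one] at key
    have k2 : 4 * |A₁| * |(1 + μ ^ 2 * S.G μ s y) - 1| ≤ 4 * (C * C + C) * (μ ^ 2 * (C * C + C)) := by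
      gcongr
    linarith
  · have key := abs_div_sub_div_le (a := 1 - S.Θ J) (a' := 1) (b' := 1) hden (by norm_num)
    rw [div_one, abs_one] at key
    have e : (S.V μ s y).2 = -((1 - S.Θ J) / (1 + μ ^ 2 * S.G μ s y) - 1) := by
      simp only [PhaseSystem.V]; ring
    rw [e, abs_neg]
    have hΘ := (h.Θ _ hJ').trans (mul_le_mul_of_nonneg_left hz hC.le)
    rw [show 1 - S.Θ J - 1 = -S.Θ J by ring, abs_neg] at key
    linarith

end PhaseSystem

namespace PhaseSystem

variable {S : PhaseSystem}

theorem hasDerivAt_sinCoeff (hS : S.Regular) {μ s φ' : ℝ} {φ : ℝ → ℝ} (hφ : HasDerivAt φ φ' s) :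
    HasDerivAt (fun s => S.sinCoeff (S.slow μ s) (φ s))
      (μ ^ 2 * S.c * (deriv S.P (S.slow μ s) * cos (S.lam * φ s)
        + deriv S.Q (S.slow μ s) * sin (S.lam * φ s))
        + S.lam * φ' * S.cosCoeff (S.slow μ s) (φ s)) s := by
  have dP := hasDerivAt_slow hS.hP μ s
  have dQ := hasDerivAt_slow hS.hQ μ s
  refine ((dP.fun_mul (hφ.const_mul S.lam).cos).fun_add
    (dQ.fun_mul (hφ.const_mul S.lam).sin)).congr_deriv ?_
  unfold cosCoeff
  ring

theorem hasDerivAt_cosCoeff (hS : S.Regular) {μ s φ' : ℝ} {φ : ℝ → ℝ} (hφ : HasDerivAt φ φ' s) :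
    HasDerivAt (fun s => S.cosCoeff (S.slow μ s) (φ s))
      (μ ^ 2 * S.c * (deriv S.Q (S.slow μ s) * cos (S.lam * φ s)
        + -deriv S.P (S.slow μ s) * sin (S.lam * φ s))
        - S.lam * φ' * S.sinCoeff (S.slow μ s) (φ s)) s := by
  have dP := hasDerivAt_slow hS.hP μ s
  have dQ := hasDerivAt_slow hS.hQ μ s
  refine ((dQ.fun_mul (hφ.const_mul S.lam).cos).fun_sub
    (dP.fun_mul (hφ.const_mul S.lam).sin)).congr_deriv ?_
  unfold sinCoeff
  ring

/-- Averaging of the first equation along curves with a slowly varying phase shift. -/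
theorem exists_averaged (hS : S.Regular) (B : ℝ) :
    ∃ C > 0, ∃ N : ℝ → ℝ → ℝ → ℝ, (∀ s σ φ, |N s σ φ| ≤ C) ∧
      ∀ μ, 0 < μ → ∀ φ : ℝ → ℝ, (Continuous φ → Continuous fun s => N s (S.slow μ s) (φ s)) ∧
      ∀ s ∉ jumpSet, ∀ φ', HasDerivAt φ φ' s → |φ'| ≤ B * μ ^ 2 →
      ∃ r, HasDerivAt (fun s => N s (S.slow μ s) (φ s))
        (S.H₁ (saw s) S.Jr * S.force s (S.slow μ s) (φ s) + S.H₀ (saw s) S.Jr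
          - S.avg (S.slow μ s) (φ s) + r) s ∧ |r| ≤ C * μ ^ 2 := by
  have hT := hS.Tf_pos
  have f1 := hS.isFast hS.hH₁
  obtain ⟨E₁, c₁, F₁, -, d₁⟩ := (f1.mul hS.isFast_sin).exists_primitive hT
  obtain ⟨E₂, c₂, F₂, -, d₂⟩ := (f1.mul hS.isFast_cos).exists_primitive hT
  obtain ⟨E₃, c₃, F₃, -, d₃⟩ := f1.exists_primitive hT
  obtain ⟨E₄, c₄, F₄, -, d₄⟩ := (hS.isFast hS.hH₀).exists_primitive hT
  obtain ⟨C₁, b₁⟩ := F₁.bounded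
  obtain ⟨C₂, b₂⟩ := F₂.bounded
  obtain ⟨C₃, b₃⟩ := F₃.bounded
  obtain ⟨C₄, b₄⟩ := F₄.bounded
  have n₁ := (abs_nonneg _).trans (b₁ 0)
  have n₂ := (abs_nonneg _).trans (b₂ 0)
  have n₃ := (abs_nonneg _).trans (b₃ 0)
  have n₄ := (abs_nonneg _).trans (b₄ 0)
  obtain ⟨M, hM, hb⟩ := exists_slow_coeff_bound hS
  have hc := hS.c_pos
  have bs : ∀ σ φ, |S.sinCoeff σ φ| ≤ 2 * M := fun σ φ => by
    obtain ⟨bP, bQ, -⟩ := hb σ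
    exact abs_mul_add_mul_le bP bQ (abs_cos_le_one _) (abs_sin_le_one _)
  have bc : ∀ σ φ, |S.cosCoeff σ φ| ≤ 2 * M := fun σ φ => by
    obtain ⟨bP, bQ, -⟩ := hb σ
    have := abs_mul_add_mul_le bQ (b := -S.P σ) (by rwa [abs_neg]) (abs_cos_le_one (S.lam * φ))
      (abs_sin_le_one (S.lam * φ))
    refine le_of_eq_of_le (congrArg abs ?_) this
    rw [cosCoeff]; ring
  set D := S.c * (2 * M) + |S.lam| * |B| * (2 * M) with hD
  have hD0 : 0 ≤ D := by positivity
  refine ⟨(C₁ + C₂) * (2 * M) + C₃ * M + C₄ + (C₁ + C₂) * D + C₃ * (S.c * M) + 1, by positivity,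
    fun s σ φ => E₁ s * S.sinCoeff σ φ + E₂ s * S.cosCoeff σ φ + E₃ s * S.R σ + E₄ s, ?_, ?_⟩
  · intro s σ φ
    have t₁ : |E₁ s * S.sinCoeff σ φ| ≤ C₁ * (2 * M) := by
      rw [abs_mul]; exact mul_le_mul (b₁ s) (bs σ φ) (abs_nonneg _) n₁
    have t₂ : |E₂ s * S.cosCoeff σ φ| ≤ C₂ * (2 * M) := by
      rw [abs_mul]; exact mul_le_mul (b₂ s) (bc σ φ) (abs_nonneg _) n₂
    have t₃ : |E₃ s * S.R σ| ≤ C₃ * M := by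
      rw [abs_mul]; exact mul_le_mul (b₃ s) (hb σ).2.2.1 (abs_nonneg _) n₃
    have t₄ := b₄ s
    have p : 0 ≤ (C₁ + C₂) * D + C₃ * (S.c * M) + 1 := by positivity
    refine (abs_add_le _ _).trans ?_
    have := abs_add_three (E₁ s * S.sinCoeff σ φ) (E₂ s * S.cosCoeff σ φ) (E₃ s * S.R σ)
    linarith
  · intro μ hμ φ
    refine ⟨fun hφ => ?_, fun s hs φ' hφ hφ' => ?_⟩
    · have h1 := hS.hP.smooth.continuous
      have h2 := hS.hQ.smooth.continuous
      have h3 := hS.hR.smooth.continuous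
      unfold sinCoeff cosCoeff slow
      fun_prop
    · have ds := hasDerivAt_sinCoeff (μ := μ) hS hφ
      have dc := hasDerivAt_cosCoeff (μ := μ) hS hφ
      have dR := hasDerivAt_slow hS.hR μ s
      set σ := S.slow μ s with hσ
      obtain ⟨-, -, -, bP', bQ', bR', -⟩ := hb σ
      set ss := μ ^ 2 * S.c * (deriv S.P σ * cos (S.lam * φ s) + deriv S.Q σ * sin (S.lam * φ s))
        + S.lam * φ' * S.cosCoeff σ (φ s) with hss
      set cc := μ ^ 2 * S.c * (deriv S.Q σ * cos (S.lam * φ s) + -deriv S.P σ * sin (S.lam * φ s))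
        - S.lam * φ' * S.sinCoeff σ (φ s) with hcc
      have hφ'' : |φ'| ≤ |B| * μ ^ 2 :=
        hφ'.trans (mul_le_mul_of_nonneg_right (le_abs_self B) (sq_nonneg μ))
      have hl : ∀ {x : ℝ}, |x| ≤ 2 * M → |S.lam * φ' * x| ≤ |S.lam| * |B| * (2 * M) * μ ^ 2 :=
        fun {x} hx => by
          rw [abs_mul, abs_mul]
          calc |S.lam| * |φ'| * |x| ≤ |S.lam| * (|B| * μ ^ 2) * (2 * M) := by gcongr
            _ = _ := by ring
      have hm : ∀ {x : ℝ}, |x| ≤ 2 * M → |μ ^ 2 * S.c * x| ≤ S.c * (2 * M) * μ ^ 2 := fun {x} hx => by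
        rw [abs_mul, abs_of_pos (by positivity : 0 < μ ^ 2 * S.c)]
        calc μ ^ 2 * S.c * |x| ≤ μ ^ 2 * S.c * (2 * M) := by gcongr
          _ = _ := by ring
      have hss' : |ss| ≤ D * μ ^ 2 := by
        refine (abs_add_le _ _).trans ?_
        have t1 := hm (abs_mul_add_mul_le bP' bQ' (abs_cos_le_one (S.lam * φ s))
          (abs_sin_le_one (S.lam * φ s)))
        have t2 := hl (bc σ (φ s))
        rw [hD]; linarith
      have hcc' : |cc| ≤ D * μ ^ 2 := by
        refine (abs_sub _ _).trans ?_
        have t1 := hm (abs_mul_add_mul_le bQ' (b := -deriv S.P σ) (by rwa [abs_neg])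
          (abs_cos_le_one (S.lam * φ s)) (abs_sin_le_one (S.lam * φ s)))
        have t2 := hl (bs σ (φ s))
        rw [hD]; linarith
      refine ⟨E₁ s * ss + E₂ s * cc + E₃ s * (μ ^ 2 * (S.c * deriv S.R σ)), ?_, ?_⟩
      · refine (((((d₁ s hs).fun_mul ds).fun_add ((d₂ s hs).fun_mul dc)).fun_add
          ((d₃ s hs).fun_mul dR)).fun_add (d₄ s hs)).congr_deriv ?_
        rw [avg_eq hS, force_eq]
        ring
      · have t₁ : |E₁ s * ss| ≤ C₁ * (D * μ ^ 2) := by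
          rw [abs_mul]; exact mul_le_mul (b₁ s) hss' (abs_nonneg _) n₁
        have t₂ : |E₂ s * cc| ≤ C₂ * (D * μ ^ 2) := by
          rw [abs_mul]; exact mul_le_mul (b₂ s) hcc' (abs_nonneg _) n₂
        have t₃ : |E₃ s * (μ ^ 2 * (S.c * deriv S.R σ))| ≤ C₃ * (μ ^ 2 * (S.c * M)) := by
          rw [abs_mul, abs_mul, abs_mul, abs_of_nonneg (sq_nonneg μ), abs_of_pos hc]
          have := b₃ s
          gcongr
        have p : 0 ≤ ((C₁ + C₂) * (2 * M) + C₃ * M + C₄ + 1) * μ ^ 2 := by positivity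
        have := abs_add_three (E₁ s * ss) (E₂ s * cc) (E₃ s * (μ ^ 2 * (S.c * deriv S.R σ)))
        linarith

/-- Solutions with a phase near the resonance phase are in a tube of radius proportional to `μ`. -/
theorem localization (hS : S.Elliptic) :
    ∃ δ > 0, ∀ K ≥ 0, ∃ K' ≥ 0, ∃ μ₀ > 0, ∀ μ, 0 < μ → μ < μ₀ → ∀ y : ℝ → ℝ × ℝ, Continuous y →
      (∀ s, |(y s).1| ≤ K * μ ∧ |(y s).2 - S.η (S.slow μ s)| ≤ δ) →
      (∀ s ∉ jumpSet, HasDerivAt y (S.V μ s (y s)) s) → S.TubeSolution K' μ y := by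
  obtain ⟨δ, hδ, a, ha, hres⟩ := exists_restoring hS
  refine ⟨δ, hδ, fun K hK => ?_⟩
  obtain ⟨C, hC⟩ := exists_stripBound hS.toRegular
  obtain ⟨M, hM, hb⟩ := exists_slow_coeff_bound hS.toRegular
  have hC0 := hC.pos
  have hc := hS.c_pos
  have hJ := hS.Jr_pos
  set B₁ := 2 * (C * K * C + C * (C * (S.c * (M + δ))) + C * K) + 4 * (C * C + C) * (C * C + C)
    with hB₁
  set B₂ := 2 * (C * K) + 4 * (C * C + C) with hB₂
  have hB₁0 : 0 ≤ B₁ := by positivity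
  have hB₂0 : 0 ≤ B₂ := by positivity
  obtain ⟨N₀, hN₀, N, hN, hNd⟩ := exists_averaged hS.toRegular B₂
  set X₀ := B₂ + S.c * M with hX₀
  have hX₀0 : 0 < X₀ := by positivity
  set K' := K + 2 * X₀ + 2 / a * (2 * (|S.d| * (K + N₀)) + |S.d| * (B₁ + N₀)) with hK'
  have hpart : 0 ≤ 2 / a * (2 * (|S.d| * (K + N₀)) + |S.d| * (B₁ + N₀)) := by positivity
  have hμ₀ : 0 < min 1 (min (S.Jr / (2 * (K + 1))) (1 / (2 * (C * C + C)))) := by positivity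
  refine ⟨K', by positivity, _, hμ₀, fun μ hμ hμ' y yc ynear yd => ⟨yc, fun s₁ => ?_, yd⟩⟩
  have hμ1 : μ ≤ 1 := (hμ'.trans_le (min_le_left _ _)).le
  have hμμ : μ ^ 2 ≤ μ := by nlinarith
  have hJ' : K * μ ^ 2 ≤ S.Jr / 2 := by
    have := (hμ'.trans_le ((min_le_right _ _).trans (min_le_left _ _))).le
    rw [le_div_iff₀ (by positivity)] at this
    nlinarith
  have hG' : μ ^ 2 * (C * C + C) ≤ 1 / 2 := by
    have := (hμ'.trans_le ((min_le_right _ _).trans (min_le_right _ _))).le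
    rw [le_div_iff₀ (by positivity)] at this
    nlinarith [(by positivity : 0 < C * C + C)]
  have hφM : ∀ s, |(y s).2| ≤ M + δ := fun s => by
    have h1 := abs_add_le ((y s).2 - S.η (S.slow μ s)) (S.η (S.slow μ s))
    rw [sub_add_cancel] at h1
    linarith [(ynear s).2, (hb (S.slow μ s)).2.2.2.2.2.2.1]
  have hV : ∀ s, _ := fun s => hC.V_approx (s := s) hS.toRegular hμ hK (ynear s).1 (hφM s) hJ' hG'
  set x : ℝ → ℝ := fun s => (y s).2 - S.η (S.slow μ s) with hx
  have xc : Continuous x := (continuous_snd.comp yc).sub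
    (hS.hη.smooth.continuous.comp (by unfold slow; fun_prop))
  have xd : ∀ s ∉ jumpSet, HasDerivAt x
      ((S.V μ s (y s)).2 - μ ^ 2 * (S.c * deriv S.η (S.slow μ s))) s := fun s hs =>
    (hasDerivAt_snd (yd s hs)).fun_sub (hasDerivAt_slow hS.hη μ s)
  have xd' : ∀ s, |(S.V μ s (y s)).2 - μ ^ 2 * (S.c * deriv S.η (S.slow μ s))| ≤ X₀ * μ ^ 2 := by
    intro s
    refine (abs_sub _ _).trans ?_
    rw [abs_mul, abs_mul, abs_of_nonneg (sq_nonneg μ), abs_of_pos hc]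
    have h1 := (hV s).2
    have h2 := (hb (S.slow μ s)).2.2.2.2.2.2.2
    have h3 : μ ^ 2 * (S.c * |deriv S.η (S.slow μ s)|) ≤ μ ^ 2 * (S.c * M) := by gcongr
    rw [hX₀]; linarith
  refine ⟨(ynear s₁).1.trans (mul_le_mul_of_nonneg_right (by linarith) hμ.le), ?_⟩
  change |x s₁| ≤ _
  rcases le_or_gt |x s₁| (2 * X₀ * μ) with hle | hgt
  · refine hle.trans (mul_le_mul_of_nonneg_right (by linarith) hμ.le)
  set e : ℝ := x s₁ / |x s₁| with he
  have hx0 : x s₁ ≠ 0 := fun h => by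
    rw [h, abs_zero] at hgt
    exact absurd hgt (not_lt.2 (by positivity))
  have he1 : |e| = 1 := by
    rw [he, abs_div, abs_abs, div_self (abs_ne_zero.2 hx0)]
  have hee : e * e = 1 := by rw [← abs_mul_abs_self, he1, one_mul]
  have hex : e * x s₁ = |x s₁| := by
    rw [he, div_mul_eq_mul_div, ← abs_mul_abs_self, mul_div_cancel_right₀ _ (abs_ne_zero.2 hx0)]
  -- Over a length 1/μ the deviation x changes by at most X₀μ, so it keeps its sign and at least
  -- half of its initial size. Meanwhile the averaged force acts long enough to change z/μ by a
  -- multiple of |x|/μ.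
  set b := s₁ + 1 / μ with hbdef
  have hs₁b : s₁ ≤ b := by rw [hbdef]; linarith [(by positivity : 0 ≤ 1 / μ)]
  have hfar : ∀ s ∈ Set.Icc s₁ b, |x s₁| / 2 ≤ e * x s := fun s hs => by
    have h1 := abs_sub_le_of_deriv_off_jumpSet (f := x) hs.1 xc.continuousOn
      (fun t _ htN => xd t htN) (fun t _ _ => xd' t)
    have h2 : X₀ * μ ^ 2 * (s - s₁) ≤ X₀ * μ := by
      have h3 : μ * (s - s₁) ≤ 1 := by
        have := mul_le_mul_of_nonneg_left (sub_le_sub_right hs.2 s₁) hμ.le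
        rwa [hbdef, add_sub_cancel_left, mul_one_div_cancel hμ.ne'] at this
      calc X₀ * μ ^ 2 * (s - s₁) = X₀ * μ * (μ * (s - s₁)) := by ring
        _ ≤ X₀ * μ * 1 := by gcongr
        _ = _ := mul_one _
    have h4 : |e * (x s - x s₁)| ≤ X₀ * μ := by
      rw [abs_mul, he1, one_mul]; exact h1.trans h2
    have h5 := (abs_le.1 h4).1
    rw [mul_sub, hex] at h5
    linarith
  -- z/μ with its fast oscillation removed: bounded by K + N₀, with derivative equal to the averaged
  -- force up to O(μ²).
  set Wf : ℝ → ℝ := fun s => (y s).1 / μ - N s (S.slow μ s) ((y s).2) with hWf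
  have hφc : Continuous fun s => (y s).2 := continuous_snd.comp yc
  obtain ⟨Nc, Nd⟩ := hNd μ hμ fun s => (y s).2
  have Wc : Continuous Wf := ((continuous_fst.comp yc).div_const μ).sub (Nc hφc)
  have Wb : ∀ s, |Wf s| ≤ K + N₀ := fun s => by
    refine (abs_sub _ _).trans (add_le_add ?_ (hN _ _ _))
    rw [abs_div, abs_of_pos hμ, div_le_iff₀ hμ]
    exact (ynear s).1
  have Wd : ∀ s ∉ jumpSet, ∃ ρ, HasDerivAt Wf (S.avg (S.slow μ s) ((y s).2) + ρ) s ∧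
      |ρ| ≤ (B₁ + N₀) * μ ^ 2 := fun s hs => by
    obtain ⟨r, hr1, hr2⟩ := Nd s hs _ (hasDerivAt_snd (yd s hs)) (hV s).2
    refine ⟨((S.V μ s (y s)).1 / μ - (S.H₁ (saw s) S.Jr * S.force s (S.slow μ s) (y s).2
      + S.H₀ (saw s) S.Jr)) - r,
      (((hasDerivAt_fst (yd s hs)).div_const μ).fun_sub hr1).congr_deriv (by ring), ?_⟩
    refine (abs_sub _ _).trans ?_
    have := (hV s).1
    linarith
  have Wd' : ∀ s ∉ jumpSet, HasDerivAt Wf (deriv Wf s) s ∧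
      |deriv Wf s - S.avg (S.slow μ s) ((y s).2)| ≤ (B₁ + N₀) * μ ^ 2 := fun s hs => by
    obtain ⟨ρ, h1, h2⟩ := Wd s hs
    rw [h1.deriv, add_sub_cancel_left]
    exact ⟨h1, h2⟩
  -- A lower bound for the growth rate of e(−d)·Wf. Boundedness of Wf over the length 1/μ forces g =
  -- O(μ), hence x(s₁) = O(μ).
  set g := a * |x s₁| / 2 - |S.d| * ((B₁ + N₀) * μ ^ 2) with hg
  have key := le_of_hasDerivAt_nonpos_off_jumpSet (f := fun s => g * s - e * (-S.d) * Wf s)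
    (f' := fun s => g - e * (-S.d) * deriv Wf s) hs₁b (by fun_prop)
    (fun s _ hsN => by
      have h1 := ((hasDerivAt_id s).const_mul g).fun_sub ((Wd' s hsN).1.const_mul (e * (-S.d)))
      simpa using h1)
    (fun s hs hsN => by
      have hs' := Set.Ioo_subset_Icc_self hs
      have h1 := hres (S.slow μ s) (x s) (ynear s).2
      have hadd : S.η (S.slow μ s) + x s = (y s).2 := by simp only [hx]; ring
      rw [hadd] at h1
      have h2 := hfar s hs'
      have hpos : 0 < |x s₁| / 2 := half_pos (abs_pos.2 hx0)
      have h3 : a * (e * x s) ≤ e * (-S.d) * S.avg (S.slow μ s) (y s).2 := by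
        have h4 : a * (e * x s) * (e * x s)
            ≤ e * (-S.d) * S.avg (S.slow μ s) (y s).2 * (e * x s) := by
          have e1 : a * (e * x s) * (e * x s) = a * x s ^ 2 := by linear_combination a * x s ^ 2 * hee
          have e2 : e * (-S.d) * S.avg (S.slow μ s) (y s).2 * (e * x s)
              = -S.d * S.avg (S.slow μ s) (y s).2 * x s := by
            linear_combination (-S.d * S.avg (S.slow μ s) (y s).2 * x s) * hee
          rw [e1, e2]; exact h1
        exact le_of_mul_le_mul_right h4 (by linarith)
      have h5 : |e * (-S.d) * (deriv Wf s - S.avg (S.slow μ s) (y s).2)|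
          ≤ |S.d| * ((B₁ + N₀) * μ ^ 2) := by
        rw [abs_mul, abs_mul, he1, one_mul, abs_neg]
        exact mul_le_mul_of_nonneg_left (Wd' s hsN).2 (abs_nonneg _)
      have h6 := (abs_le.1 h5).1
      have h7 := mul_le_mul_of_nonneg_left h2 ha.le
      rw [hg]
      linarith)
  have hW2 : |e * (-S.d) * (Wf b - Wf s₁)| ≤ |S.d| * (2 * (K + N₀)) := by
    rw [abs_mul, abs_mul, he1, one_mul, abs_neg]
    refine mul_le_mul_of_nonneg_left ((abs_sub _ _).trans ?_) (abs_nonneg _)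
    linarith [Wb b, Wb s₁]
  have hgb : g * (b - s₁) ≤ |S.d| * (2 * (K + N₀)) := by
    have := (abs_le.1 hW2).2
    linarith
  have hb' : b - s₁ = 1 / μ := by rw [hbdef]; ring
  rw [hb', mul_one_div, div_le_iff₀ hμ, hg] at hgb
  have h8 : a * |x s₁| / 2 ≤ (2 * (|S.d| * (K + N₀)) + |S.d| * (B₁ + N₀)) * μ := by
    have : |S.d| * ((B₁ + N₀) * μ ^ 2) ≤ |S.d| * ((B₁ + N₀) * μ) := by gcongr
    linarith
  have h9 : |x s₁| ≤ 2 / a * (2 * (|S.d| * (K + N₀)) + |S.d| * (B₁ + N₀)) * μ := by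
    have := mul_le_mul_of_nonneg_left h8 (by positivity : 0 ≤ 2 / a)
    have e1 : 2 / a * (a * |x s₁| / 2) = |x s₁| := by field_simp
    rw [e1, ← mul_assoc] at this
    exact this
  exact h9.trans (mul_le_mul_of_nonneg_right (by linarith) hμ.le)

end PhaseSystem

/-! ### Passing between time and phase -/

namespace PhaseSystem

variable {S : PhaseSystem}

variable (S) in
/-- The phase at time `t`. -/
def ph (t : ℝ) (w : ℝ × ℝ) : ℝ := w.2 + t / S.c

variable (S) in
/-- A vector field depending on time whose solutions, parametrized by the phase, solve the
system of `S`, as long as the impulse stays in a strip. -/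
structure TimeField (K μ : ℝ) (f : ℝ → ℝ × ℝ → ℝ × ℝ) : Prop where
  eq : ∀ t w, |w.1| ≤ K * μ → S.ph t w ∉ jumpSet →
    f t w = (S.c * (1 - (S.V μ (S.ph t w) w).2))⁻¹ • S.V μ (S.ph t w) w
  lower : ∀ t w, |w.1| ≤ K * μ → (2 * S.c)⁻¹ ≤ S.c⁻¹ + (f t w).2

variable (S) in
/-- Nondegeneracy of the system in a strip. -/
structure StripRegular (K μ : ℝ) : Prop where
  J_pos : ∀ w : ℝ × ℝ, |w.1| ≤ K * μ → 0 < S.Jr + μ * w.1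
  G_ne : ∀ s (w : ℝ × ℝ), |w.1| ≤ K * μ → 1 + μ ^ 2 * S.G μ s w ≠ 0
  V_le : ∀ s (w : ℝ × ℝ), |w.1| ≤ K * μ → 1 / 2 ≤ 1 - (S.V μ s w).2

/-- Holds for every phase shift, so it applies to solutions that are not known to lie in a tube. -/
theorem exists_stripRegular (hS : S.Regular) {K : ℝ} (hK : 0 ≤ K) :
    ∃ μ₀ > 0, ∀ μ, 0 < μ → μ < μ₀ → S.StripRegular K μ := by
  obtain ⟨C, hC⟩ := exists_stripBound hS
  have hC0 := hC.pos
  have hJ := hS.Jr_pos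
  refine ⟨min 1 (min (S.Jr / (2 * (K + 1))) (min (1 / (2 * (C * C + C))) (1 / (4 * (C * K + 1))))),
    by positivity, fun μ hμ hμ' => ?_⟩
  have hμ1 : μ ≤ 1 := (hμ'.trans_le (min_le_left _ _)).le
  have hμμ : μ ^ 2 ≤ μ := by nlinarith
  have hr := hμ'.trans_le (min_le_right _ _)
  have hJ' : K * μ ^ 2 ≤ S.Jr / 2 := by
    have := (hr.trans_le (min_le_left _ _)).le
    rw [le_div_iff₀ (by positivity)] at this
    nlinarith
  have hr := hr.trans_le (min_le_right _ _)
  have hG' : μ ^ 2 * (C * C + C) ≤ 1 / 2 := by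
    have := (hr.trans_le (min_le_left _ _)).le
    rw [le_div_iff₀ (by positivity)] at this
    nlinarith [(by positivity : 0 < C * C + C)]
  have hΘ' : C * (K * μ ^ 2) ≤ 1 / 4 := by
    have := (hr.trans_le (min_le_right _ _)).le
    rw [le_div_iff₀ (by positivity)] at this
    nlinarith [mul_nonneg hC0.le hK]
  have hdist : ∀ w : ℝ × ℝ, |w.1| ≤ K * μ → |S.Jr + μ * w.1 - S.Jr| ≤ K * μ ^ 2 := fun w hw => by
    rw [add_sub_cancel_left, abs_mul, abs_of_pos hμ]
    nlinarith
  have hG : ∀ s (w : ℝ × ℝ), |w.1| ≤ K * μ → |μ ^ 2 * S.G μ s w| ≤ 1 / 2 := fun s w hw => by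
    have hd := (hdist w hw).trans hJ'
    refine le_trans ?_ hG'
    rw [abs_mul, abs_of_nonneg (sq_nonneg μ)]
    refine mul_le_mul_of_nonneg_left ((abs_add_le _ _).trans (add_le_add ?_ (hC.M₀ _ _ hd)))
      (sq_nonneg μ)
    rw [abs_mul]
    exact mul_le_mul (hC.M₁ _ _ hd) (hC.force _ _ _) (abs_nonneg _) hC0.le
  refine ⟨fun w hw => ?_, fun s w hw => ?_, fun s w hw => ?_⟩
  · have := (abs_le.1 ((hdist w hw).trans hJ')).1
    linarith
  · have := (abs_le.1 (hG s w hw)).1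
    intro h
    linarith
  · have hd := hdist w hw
    have h1 := abs_le.1 (((hC.Θ _ (hd.trans hJ')).trans (mul_le_mul_of_nonneg_left hd hC0.le)).trans hΘ')
    have h2 := abs_le.1 (hG s w hw)
    simp only [V, sub_sub_cancel]
    rw [le_div_iff₀ (by linarith [h2.1])]
    linarith [h1.2, h2.2]

theorem continuousOn_of_isSolutionOn {f : ℝ → ℝ × ℝ → ℝ × ℝ} {w : ℝ → ℝ × ℝ} {a b : ℝ}
    (hab : a ≤ b) (h : IsSolutionOn f w (Set.Icc a b)) : ContinuousOn w (Set.Icc a b) := by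
  have ha := Set.left_mem_Icc.2 hab
  have h1 := intervalIntegral.continuousOn_primitive_interval'
    (h a ha b (Set.right_mem_Icc.2 hab)).1 (Set.left_mem_uIcc)
  rw [Set.uIcc_of_le hab] at h1
  refine (h1.const_add (w a)).congr fun t ht => ?_
  simp only [← (h a ha t ht).2, add_sub_cancel]

/-- `TimeField.lower` holds at the jump phases too, so the integral equation alone gives growth of
the phase, with no prior knowledge that jump times are negligible. -/
theorem ph_growth {K μ : ℝ} {f : ℝ → ℝ × ℝ → ℝ × ℝ} (hf : S.TimeField K μ f) {w : ℝ → ℝ × ℝ}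
    {I : Set ℝ} (hI : I.OrdConnected) (h : IsSolutionOn f w I) (hK : ∀ t ∈ I, |(w t).1| ≤ K * μ)
    {a b : ℝ} (ha : a ∈ I) (hb : b ∈ I) (hab : a ≤ b) :
    (2 * S.c)⁻¹ * (b - a) ≤ S.ph b (w b) - S.ph a (w a) := by
  obtain ⟨hi, he⟩ := h a ha b hb
  have h2 := congrArg Prod.snd he
  have hcomm := ContinuousLinearMap.intervalIntegral_comp_comm (ContinuousLinearMap.snd ℝ ℝ ℝ) hi
  simp only [ContinuousLinearMap.coe_snd'] at hcomm
  rw [← hcomm, Prod.snd_sub] at h2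
  have hi2 : IntervalIntegrable (fun r => (f r (w r)).2) volume a b := by
    rw [intervalIntegrable_iff] at hi ⊢
    exact hi.snd
  have h3 : ∫ r in a..b, ((2 * S.c)⁻¹ - S.c⁻¹) ≤ ∫ r in a..b, (f r (w r)).2 :=
    intervalIntegral.integral_mono_on hab intervalIntegrable_const hi2 fun r hr => by
      linarith [hf.lower r (w r) (hK r (hI.out ha hb hr))]
  rw [intervalIntegral.integral_const, smul_eq_mul, ← h2] at h3
  unfold ph
  have e1 : b / S.c - a / S.c = (b - a) * S.c⁻¹ := by rw [← sub_div, div_eq_mul_inv]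
  linarith

/-- Away from jump phases the field is continuous along the solution, so the integral equation can
be differentiated there. -/
theorem hasDerivAt_of_isSolutionOn (hS : S.Regular) {K μ : ℝ} {f : ℝ → ℝ × ℝ → ℝ × ℝ}
    (hf : S.TimeField K μ f) (hr : S.StripRegular K μ) {w : ℝ → ℝ × ℝ} {a b : ℝ}
    (h : IsSolutionOn f w (Set.Icc a b)) (hK : ∀ t ∈ Set.Icc a b, |(w t).1| ≤ K * μ) {t : ℝ}
    (ht : t ∈ Set.Ioo a b) (htN : S.ph t (w t) ∉ jumpSet) :
    HasDerivAt w ((S.c * (1 - (S.V μ (S.ph t (w t)) (w t)).2))⁻¹ • S.V μ (S.ph t (w t)) (w t)) t := by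
  have hab := (ht.1.trans ht.2).le
  have ha := Set.left_mem_Icc.2 hab
  have htI := Set.Ioo_subset_Icc_self ht
  have hc := hS.c_pos
  have hwc : ContinuousAt w t :=
    (continuousOn_of_isSolutionOn hab h).continuousAt (Icc_mem_nhds ht.1 ht.2)
  have hphc : ContinuousAt (fun r => S.ph r (w r)) t :=
    (continuous_snd.continuousAt.comp hwc).add (continuousAt_id.div_const _)
  have hev : (fun r => f r (w r)) =ᶠ[𝓝 t]
      fun r => (S.c * (1 - (S.V μ (S.ph r (w r)) (w r)).2))⁻¹ • S.V μ (S.ph r (w r)) (w r) := by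
    filter_upwards [Icc_mem_nhds ht.1 ht.2,
      hphc.eventually_mem (isOpen_compl_jumpSet.mem_nhds htN)] with r hr1 hr2
    exact hf.eq r (w r) (hK r hr1) hr2
  have hVc : ContinuousAt (fun r => S.V μ (S.ph r (w r)) (w r)) t :=
    ContinuousAt.comp (f := fun r => (S.ph r (w r), w r))
      (g := fun p : ℝ × ℝ × ℝ => S.V μ p.1 p.2)
      (continuousAt_V hS htN (hr.J_pos _ (hK t htI)) (hr.G_ne _ _ (hK t htI)))
      (hphc.prodMk hwc)
  have hne : S.c * (1 - (S.V μ (S.ph t (w t)) (w t)).2) ≠ 0 := by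
    have := hr.V_le (S.ph t (w t)) _ (hK t htI)
    have : 0 < 1 - (S.V μ (S.ph t (w t)) (w t)).2 := by linarith
    positivity
  have hfc : ContinuousAt (fun r => f r (w r)) t := by
    rw [continuousAt_congr hev]
    have h1 : ContinuousAt (fun r => S.c * (1 - (S.V μ (S.ph r (w r)) (w r)).2)) t :=
      continuousAt_const.mul (continuousAt_const.sub hVc.snd)
    exact (h1.inv₀ hne).smul hVc
  rw [← hev.eq_of_nhds]
  have hmeas : StronglyMeasurableAtFilter (fun r => f r (w r)) (𝓝 t) := by
    have hi := (h a ha b (Set.right_mem_Icc.2 hab)).1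
    rw [intervalIntegrable_iff_integrableOn_Ioc_of_le hab] at hi
    exact ⟨Set.Ioc a b, Ioc_mem_nhds ht.1 ht.2, hi.aestronglyMeasurable⟩
  have hd := (intervalIntegral.integral_hasDerivAt_right (h a ha t htI).1 hmeas hfc).const_add (w a)
  refine hd.congr_of_eventuallyEq ?_
  filter_upwards [Icc_mem_nhds ht.1 ht.2] with r hr1
  rw [← (h a ha r hr1).2, add_sub_cancel]

/-- Change of the independent variable from time to phase. -/
theorem exists_phase_parametrization (hc : 0 < S.c) {μ : ℝ} {w : ℝ → ℝ × ℝ} (wc : Continuous w)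
    (hg : ∀ a b, a ≤ b → (2 * S.c)⁻¹ * (b - a) ≤ S.ph b (w b) - S.ph a (w a)) :
    ∃ Y : ℝ → ℝ × ℝ, Continuous Y ∧ (∀ t, Y (S.ph t (w t)) = w t) ∧
      (∀ s, ∃ t, S.ph t (w t) = s) ∧
      ∀ t, 1 / 2 ≤ 1 - (S.V μ (S.ph t (w t)) (w t)).2 →
        HasDerivAt w ((S.c * (1 - (S.V μ (S.ph t (w t)) (w t)).2))⁻¹ •
          S.V μ (S.ph t (w t)) (w t)) t →
        HasDerivAt Y (S.V μ (S.ph t (w t)) (w t)) (S.ph t (w t)) := by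
  have hphc : Continuous fun t => S.ph t (w t) :=
    (continuous_snd.comp wc).add (continuous_id.div_const _)
  obtain ⟨k, kc, -, hk1, hk2, hkd⟩ := exists_inverse (by positivity : 0 < (2 * S.c)⁻¹) hphc hg
  refine ⟨fun s => w (k s), wc.comp kc, fun t => by simp only [hk1], fun s => ⟨k s, hk2 s⟩,
    fun t hV hw => ?_⟩
  set v := S.V μ (S.ph t (w t)) (w t) with hv
  have hpos : 0 < 1 - v.2 := by linarith
  have hne : S.c * (1 - v.2) ≠ 0 := by positivity
  have h1 : HasDerivAt (fun t => S.ph t (w t)) (S.c * (1 - v.2))⁻¹ t := by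
    refine ((hasDerivAt_snd hw).add ((hasDerivAt_id t).div_const S.c)).congr_deriv ?_
    simp only [Prod.smul_snd, smul_eq_mul]
    field_simp
    ring
  have h2 : HasDerivAt k (S.c * (1 - v.2)) (S.ph t (w t)) := by
    have := hkd (S.ph t (w t)) _ (inv_ne_zero hne) (by simpa only [hk1 t] using h1)
    rwa [inv_inv] at this
  have h3 : HasDerivAt w ((S.c * (1 - v.2))⁻¹ • v) (k (S.ph t (w t))) := by
    simpa only [hk1 t] using hw
  refine (h3.scomp _ h2).congr_deriv ?_
  rw [smul_smul, mul_inv_cancel₀ hne, one_smul]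

theorem exists_phase_solution_univ (hS : S.Regular) {K μ : ℝ} {f : ℝ → ℝ × ℝ → ℝ × ℝ}
    (hf : S.TimeField K μ f) (hr : S.StripRegular K μ) {w : ℝ → ℝ × ℝ}
    (h : IsSolutionOn f w Set.univ) (hK : ∀ t, |(w t).1| ≤ K * μ) :
    ∃ Y : ℝ → ℝ × ℝ, Continuous Y ∧ (∀ t, Y (S.ph t (w t)) = w t) ∧
      (∀ s, ∃ t, S.ph t (w t) = s) ∧ ∀ s ∉ jumpSet, HasDerivAt Y (S.V μ s (Y s)) s := by
  have hI : ∀ a b, IsSolutionOn f w (Set.Icc a b) := fun a b s _ t _ =>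
    h s (Set.mem_univ _) t (Set.mem_univ _)
  have wc : Continuous w := continuous_iff_continuousAt.2 fun t =>
    (continuousOn_of_isSolutionOn (by linarith) (hI (t - 1) (t + 1))).continuousAt
      (Icc_mem_nhds (by linarith) (by linarith))
  obtain ⟨Y, Yc, Yw, hs, Yd⟩ := exists_phase_parametrization (μ := μ) hS.c_pos wc fun a b hab =>
    ph_growth hf Set.ordConnected_univ h (fun t _ => hK t) (Set.mem_univ _) (Set.mem_univ _) hab
  refine ⟨Y, Yc, Yw, hs, fun s hsN => ?_⟩
  obtain ⟨t, rfl⟩ := hs s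
  rw [Yw]
  exact Yd t (hr.V_le _ _ (hK t)) (hasDerivAt_of_isSolutionOn hS hf hr (hI (t - 1) (t + 1))
    (fun r _ => hK r) ⟨by linarith, by linarith⟩ hsN)

theorem exists_phase_solution_Icc (hS : S.Regular) {K μ : ℝ} {f : ℝ → ℝ × ℝ → ℝ × ℝ}
    (hf : S.TimeField K μ f) (hr : S.StripRegular K μ) {w : ℝ → ℝ × ℝ} {a b : ℝ} (hab : a ≤ b)
    (h : IsSolutionOn f w (Set.Icc a b)) (hK : ∀ t ∈ Set.Icc a b, |(w t).1| ≤ K * μ) :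
    ∃ Y : ℝ → ℝ × ℝ, Continuous Y ∧ (∀ t ∈ Set.Icc a b, Y (S.ph t (w t)) = w t) ∧
      (∀ s ∈ Set.Icc (S.ph a (w a)) (S.ph b (w b)), ∃ t ∈ Set.Icc a b, S.ph t (w t) = s) ∧
      ∀ s ∈ Set.Ioo (S.ph a (w a)) (S.ph b (w b)), s ∉ jumpSet →
        HasDerivAt Y (S.V μ s (Y s)) s := by
  have hc := hS.c_pos
  have wc := continuousOn_of_isSolutionOn hab h
  -- Constant continuation outside [a, b]. There the phase grows at rate 1/c, so the growth bound
  -- persists and the global change of variable applies.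
  set w' : ℝ → ℝ × ℝ := fun t => w (max a (min b t)) with hw'
  have hmem : ∀ t, max a (min b t) ∈ Set.Icc a b := fun t =>
    ⟨le_max_left _ _, max_le hab (min_le_left _ _)⟩
  have hid : ∀ t ∈ Set.Icc a b, w' t = w t := fun t ht => by
    simp only [hw', min_eq_right ht.2, max_eq_right ht.1]
  have wc' : Continuous w' := wc.comp_continuous (by fun_prop) hmem
  have hg : ∀ x y, x ≤ y → (2 * S.c)⁻¹ * (y - x) ≤ S.ph y (w' y) - S.ph x (w' x) := by
    intro x y hxy
    set x' := max a (min b x)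
    set y' := max a (min b y)
    have hxy' : x' ≤ y' := max_le_max le_rfl (min_le_min le_rfl hxy)
    have hlip : y' - x' ≤ y - x := by
      have h1 : |y' - x'| ≤ |y - x| := by
        refine (abs_max_sub_max_le_max _ _ _ _).trans ?_
        rw [sub_self, abs_zero]
        refine max_le (abs_nonneg _) ((abs_min_sub_min_le_max _ _ _ _).trans ?_)
        rw [sub_self, abs_zero]
        exact max_le (abs_nonneg _) le_rfl
      rwa [abs_of_nonneg (by linarith), abs_of_nonneg (by linarith)] at h1
    have h2 := ph_growth hf Set.ordConnected_Icc h hK (hmem x) (hmem y) hxy'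
    have e1 : S.ph y (w' y) - S.ph x (w' x)
        = S.ph y' (w y') - S.ph x' (w x') + S.c⁻¹ * ((y - x) - (y' - x')) := by
      simp only [ph, hw', x', y']; ring
    rw [e1]
    have h3 : (2 * S.c)⁻¹ ≤ S.c⁻¹ := inv_anti₀ hc (by linarith)
    have h4 := mul_le_mul_of_nonneg_right h3 (by linarith : 0 ≤ (y - x) - (y' - x'))
    linarith
  obtain ⟨Y, Yc, Yw, hs, Yd⟩ := exists_phase_parametrization (μ := μ) hc wc' hg
  have hmono : ∀ x y, S.ph x (w' x) ≤ S.ph y (w' y) → x ≤ y := fun x y hxy => by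
    by_contra! hlt
    have := hg y x hlt.le
    have : 0 < (2 * S.c)⁻¹ * (x - y) := mul_pos (by positivity) (sub_pos.2 hlt)
    linarith
  have hsm : ∀ s ∈ Set.Icc (S.ph a (w a)) (S.ph b (w b)), ∃ t ∈ Set.Icc a b, S.ph t (w t) = s := by
    intro s hsI
    obtain ⟨t, rfl⟩ := hs s
    rw [← hid a (Set.left_mem_Icc.2 hab), ← hid b (Set.right_mem_Icc.2 hab)] at hsI
    have ht : t ∈ Set.Icc a b := ⟨hmono _ _ hsI.1, hmono _ _ hsI.2⟩
    exact ⟨t, ht, by rw [hid t ht]⟩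
  refine ⟨Y, Yc, fun t ht => by rw [← hid t ht, Yw], hsm, fun s hsI hsN => ?_⟩
  obtain ⟨t, ht, rfl⟩ := hsm s (Set.Ioo_subset_Icc_self hsI)
  have ht' : t ∈ Set.Ioo a b := by
    refine ⟨lt_of_le_of_ne ht.1 ?_, lt_of_le_of_ne ht.2 ?_⟩
    · rintro rfl; exact lt_irrefl _ hsI.1
    · rintro rfl; exact lt_irrefl _ hsI.2
  have hd := hasDerivAt_of_isSolutionOn hS hf hr h hK ht' hsN
  have hev : w' =ᶠ[𝓝 t] w := by
    filter_upwards [Icc_mem_nhds ht'.1 ht'.2] with r hr1 using hid r hr1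
  have := Yd t (by rw [hid t ht]; exact hr.V_le _ _ (hK t ht))
    (by rw [hid t ht]; exact hd.congr_of_eventuallyEq hev)
  rw [hid t ht] at this
  rwa [← hid t ht, Yw, hid t ht]

end PhaseSystem

namespace PhaseSystem

variable {S : PhaseSystem}

variable (S) in
/-- Bounds in a tube. -/
def TubeBound (K μ : ℝ) : Prop := ∀ s, ∀ y ∈ S.tube K μ s,
  S.Jr / 2 ≤ S.Jr + μ * y.1 ∧ 1 / 2 ≤ 1 + μ ^ 2 * S.G μ s y ∧ ‖S.V μ s y‖ ≤ 1 / 2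

theorem continuous_clamp (hS : S.Regular) (K μ : ℝ) :
    Continuous fun p : ℝ × ℝ × ℝ => S.clamp K μ p.1 p.2 := by
  have hη := hS.hη.smooth.continuous
  unfold clamp slow
  fun_prop

variable (S) in
/-- Solutions, in the phase variable, of the system modified outside of a tube. -/
structure ClampedSolution (K μ : ℝ) (Y : ℝ → ℝ × ℝ) : Prop where
  cont : Continuous Y
  hasDerivAt : ∀ s ∉ jumpSet, HasDerivAt Y (S.V μ s (S.clamp K μ s (Y s))) s

theorem TubeSolution.clampedSolution {K μ : ℝ} {Y : ℝ → ℝ × ℝ} (h : S.TubeSolution K μ Y) :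
    S.ClampedSolution K μ Y :=
  ⟨h.cont, fun s hs => by rw [clamp_eq (h.mem s)]; exact h.hasDerivAt s hs⟩

/-- A constant below 1 is what matters: it makes s − φ(s) increasing, so phase can be converted to
time, and it makes comparisons at equal phase and at equal time equivalent. -/
theorem ClampedSolution.lipschitz {K μ : ℝ} (hKμ : 0 ≤ K * μ) (hb : S.TubeBound K μ)
    {Y : ℝ → ℝ × ℝ} (hY : S.ClampedSolution K μ Y) (s s' : ℝ) :
    ‖Y s' - Y s‖ ≤ 1 / 2 * |s' - s| := by
  wlog h : s ≤ s' generalizing s s'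
  · rw [norm_sub_rev, abs_sub_comm]
    exact this s' s (le_of_not_ge h)
  rw [abs_of_nonneg (sub_nonneg.2 h), Prod.norm_def]
  have hV : ∀ r, ‖S.V μ r (S.clamp K μ r (Y r))‖ ≤ 1 / 2 := fun r =>
    (hb r _ (clamp_mem hKμ _)).2.2
  refine max_le ?_ ?_
  · exact abs_sub_le_of_deriv_off_jumpSet h (continuous_fst.comp hY.cont).continuousOn
      (fun r _ hr => hasDerivAt_fst (hY.hasDerivAt r hr)) fun r _ _ => (norm_fst_le _).trans (hV r)
  · exact abs_sub_le_of_deriv_off_jumpSet h (continuous_snd.comp hY.cont).continuousOn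
      (fun r _ hr => hasDerivAt_snd (hY.hasDerivAt r hr)) fun r _ _ => (norm_snd_le _).trans (hV r)

/-- Change of the independent variable from phase to time. -/
theorem ClampedSolution.exists_time_solution (hS : S.Regular) {K μ : ℝ} (hKμ : 0 ≤ K * μ)
    (hb : S.TubeBound K μ) {f : ℝ → ℝ × ℝ → ℝ × ℝ} (hf : S.TimeField K μ f) {Y : ℝ → ℝ × ℝ}
    (hY : S.ClampedSolution K μ Y) :
    ∃ y : ℝ → ℝ × ℝ, Continuous y ∧ (∀ t, Y (S.ph t (y t)) = y t) ∧
      (∀ s, y (S.c * (s - (Y s).2)) = Y s ∧ S.ph (S.c * (s - (Y s).2)) (Y s) = s) ∧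
      (StrictMono fun t => S.ph t (y t)) ∧
      ∀ I : Set ℝ, I.OrdConnected → (∀ t ∈ I, y t ∈ S.tube K μ (S.ph t (y t))) →
        IsSolutionOn f y I := by
  have hc := hS.c_pos
  -- Time as a function of the phase; its inverse k gives the phase at a given time.
  have hhc : Continuous fun s => S.c * (s - (Y s).2) :=
    continuous_const.mul (continuous_id.sub (continuous_snd.comp hY.cont))
  have hgrow : ∀ a b, a ≤ b → S.c / 2 * (b - a) ≤ S.c * (b - (Y b).2) - S.c * (a - (Y a).2) := by
    intro a b hab
    have h1 := (norm_snd_le _).trans (hY.lipschitz hKμ hb a b)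
    rw [abs_of_nonneg (sub_nonneg.2 hab)] at h1
    have h2 := (abs_le.1 h1).2
    rw [Prod.snd_sub] at h2
    nlinarith
  obtain ⟨k, kc, kmono, hk1, hk2, hkd⟩ := exists_inverse (half_pos hc) hhc hgrow
  have hph : ∀ t, S.ph t (Y (k t)) = k t := fun t => by
    have := hk2 t
    unfold ph
    rw [← eq_sub_iff_add_eq', div_eq_iff hc.ne', mul_comm, ← this, this]
    exact this.symm
  set v : ℝ → ℝ × ℝ := fun t => S.V μ (k t) (S.clamp K μ (k t) (Y (k t))) with hv
  have hvb : ∀ t, ‖v t‖ ≤ 1 / 2 := fun t => (hb _ _ (clamp_mem hKμ _)).2.2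
  have hv2 : ∀ t, 1 / 2 ≤ 1 - (v t).2 := fun t => by
    have := (abs_le.1 ((norm_snd_le (v t)).trans (hvb t))).2
    linarith
  have hpos : ∀ t, S.c / 2 ≤ S.c * (1 - (v t).2) := fun t => by nlinarith [hv2 t]
  have hne : ∀ t, S.c * (1 - (v t).2) ≠ 0 := fun t =>
    ((half_pos hc).trans_le (hpos t)).ne'
  set g : ℝ → ℝ × ℝ := fun t => (S.c * (1 - (v t).2))⁻¹ • v t with hg
  set N := k ⁻¹' jumpSet with hN
  have hNc : IsClosed N := isClosed_jumpSet.preimage kc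
  have hNcount : N.Countable := countable_jumpSet.preimage_of_injOn kmono.injective.injOn
  have hyd : ∀ t ∉ N, HasDerivAt (fun t => Y (k t)) (g t) t := fun t ht => by
    have h1 := hY.hasDerivAt (k t) ht
    have h2 : HasDerivAt (fun s => S.c * (s - (Y s).2)) (S.c * (1 - (v t).2)) (k t) :=
      ((hasDerivAt_id _).fun_sub (hasDerivAt_snd h1)).const_mul S.c
    exact h1.scomp t (hkd t _ (hne t) h2)
  have hvc : ContinuousOn v Nᶜ := fun t ht => by
    have hm : S.clamp K μ (k t) (Y (k t)) ∈ S.tube K μ (k t) := clamp_mem hKμ _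
    have hJ := hS.Jr_pos
    have hcl : Continuous fun t => S.clamp K μ (k t) (Y (k t)) :=
      (continuous_clamp hS K μ).comp (kc.prodMk (hY.cont.comp kc))
    exact (ContinuousAt.comp (f := fun t => (k t, S.clamp K μ (k t) (Y (k t))))
      (g := fun p : ℝ × ℝ × ℝ => S.V μ p.1 p.2)
      (continuousAt_V hS ht (by linarith [(hb _ _ hm).1]) (by linarith [(hb _ _ hm).2.1] : _ < _).ne')
      (kc.prodMk hcl).continuousAt).continuousWithinAt
  have hgc : ContinuousOn g Nᶜ := by
    have h1 : ContinuousOn (fun t => S.c * (1 - (v t).2)) Nᶜ :=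
      continuousOn_const.mul (continuousOn_const.sub hvc.snd)
    exact (h1.inv₀ fun t _ => hne t).smul hvc
  have hgb : ∀ t, ‖g t‖ ≤ (S.c / 2)⁻¹ * (1 / 2) := fun t => by
    rw [hg, norm_smul, norm_inv, norm_eq_abs, abs_of_pos ((half_pos hc).trans_le (hpos t))]
    exact mul_le_mul (inv_anti₀ (half_pos hc) (hpos t)) (hvb t) (norm_nonneg _) (by positivity)
  have hgi := intervalIntegrable_of_bounded_off_countable hNc hNcount hgc hgb
  refine ⟨fun t => Y (k t), hY.cont.comp kc, fun t => by simp only [hph], fun s => ⟨by simp only [hk1], ?_⟩,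
    ?_, fun I hI hm a ha b hb' => ?_⟩
  · have := hph (S.c * (s - (Y s).2))
    simpa only [hk1] using this
  · simpa only [hph] using kmono
  have heq : ∀ t ∈ I, t ∉ N → g t = f t (Y (k t)) := fun t ht htN => by
    have hmt := hm t ht
    simp only [hph] at hmt
    have h1 := hf.eq t (Y (k t)) hmt.1 (by rw [hph]; exact htN)
    rw [hph] at h1
    rw [h1, hg, hv]
    simp only [clamp_eq hmt]
  have hsub : Set.uIoc a b ⊆ I := Set.uIoc_subset_uIcc.trans (hI.uIcc_subset ha hb')
  have hae : ∀ᵐ t, t ∈ Set.uIoc a b → g t = f t (Y (k t)) := by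
    filter_upwards [hNcount.ae_notMem volume] with t ht hmem using heq t (hsub hmem) ht
  refine ⟨(hgi a b).congr_ae ((ae_restrict_iff' measurableSet_uIoc).2 hae), ?_⟩
  rw [← intervalIntegral.integral_congr_ae hae]
  exact (integral_eq_of_hasDerivAt_off_countable _ g hNcount (hY.cont.comp kc).continuousOn
    (fun t ht => hyd t ht.2) (hgi a b)).symm

/-- At the same time the phases of two states differ by no more than the states themselves, and W
moves at most half as fast as the phase. So distance at equal time and distance at equal phase are
equivalent. -/
theorem norm_sub_comparison {W : ℝ → ℝ × ℝ} (hW : ∀ s s', ‖W s' - W s‖ ≤ 1 / 2 * |s' - s|) {t : ℝ}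
    {w : ℝ × ℝ} (hw : W (S.ph t w) = w) (y : ℝ × ℝ) :
    ‖y - W (S.ph t y)‖ ≤ 3 / 2 * ‖y - w‖ ∧ ‖y - w‖ ≤ 2 * ‖y - W (S.ph t y)‖ := by
  have h1 := hW (S.ph t y) (S.ph t w)
  have h2 : |S.ph t w - S.ph t y| ≤ ‖y - w‖ := by
    rw [norm_sub_rev]
    unfold ph
    rw [add_sub_add_right_eq_sub]
    exact norm_snd_le (w - y)
  rw [hw] at h1
  have h3 := norm_add_le (y - w) (w - W (S.ph t y))
  have h4 := norm_add_le (y - W (S.ph t y)) (-(w - W (S.ph t y)))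
  rw [norm_neg] at h4
  rw [sub_add_sub_cancel] at h3
  rw [show y - W (S.ph t y) + -(w - W (S.ph t y)) = y - w by abel] at h4
  constructor <;> linarith

theorem isAlmostPeriodic_time (hS : S.Elliptic) (hr : S.rate ≠ 0) {K : ℝ} (hK : 0 ≤ K) :
    ∃ μ₀ > 0, ∀ μ, 0 < μ → μ < μ₀ → ∀ W, S.TubeSolution K μ W → S.TubeBound K μ →
      ∀ w : ℝ → ℝ × ℝ, Continuous w → (∀ t, W (S.ph t (w t)) = w t) → IsAlmostPeriodic w := by
  obtain ⟨μ₀, hμ₀, H⟩ := tubeSolution_almost_periodic hS hr hK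
  refine ⟨μ₀, hμ₀, fun μ hμ hμ' W hW hb w wc hw => ⟨wc, fun δ hδ => ?_⟩⟩
  have hc := hS.c_pos
  have hTs := hS.Ts_pos
  have hTf := hS.Tf_pos
  have hlip := hW.clampedSolution.lipschitz (by positivity) hb
  -- A phase translation by Tf·j corresponds to a time translation by c·Tf·j. The residual phase
  -- difference is absorbed with factor 1/2, so δ/4 becomes δ/2 < δ.
  obtain ⟨θ, hθ, hθ'⟩ := H μ hμ hμ' W hW (δ / 4) (by positivity)
  obtain ⟨L, hL, hd⟩ := exists_relatively_dense (μ ^ 2 * S.c * S.Tf / S.Ts) (div_pos hθ hTs)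
  have hcT : 0 < S.c * S.Tf := by positivity
  refine ⟨S.c * S.Tf * L, by positivity, fun x => ?_⟩
  obtain ⟨j, i, h1, h2, h3⟩ := hd (x / (S.c * S.Tf))
  refine ⟨S.c * (S.Tf * j), ⟨?_, ?_⟩, fun t => ?_⟩
  · rw [div_le_iff₀ hcT] at h1; linarith
  · have := mul_le_mul_of_nonneg_left h2 hcT.le
    rw [mul_add, mul_div_cancel₀ _ hcT.ne'] at this
    linarith
  have hij : |μ ^ 2 * S.c * (S.Tf * j) - S.Ts * i| ≤ θ := by
    have e1 : μ ^ 2 * S.c * (S.Tf * j) - S.Ts * i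
        = S.Ts * (j * (μ ^ 2 * S.c * S.Tf / S.Ts) - i) := by field_simp
    rw [e1, abs_mul, abs_of_pos hTs]
    calc S.Ts * _ ≤ S.Ts * (θ / S.Ts) := mul_le_mul_of_nonneg_left h3 hTs.le
      _ = θ := by field_simp
  have h4 := hθ' i j hij (S.ph t (w t))
  rw [hw] at h4
  have h5 := hlip (S.ph t (w t) + S.Tf * j) (S.ph (t + S.c * (S.Tf * j)) (w (t + S.c * (S.Tf * j))))
  rw [hw] at h5
  set w' := w (t + S.c * (S.Tf * j))
  have h6 : S.ph (t + S.c * (S.Tf * j)) w' - (S.ph t (w t) + S.Tf * j) = w'.2 - (w t).2 := by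
    unfold ph; field_simp; ring
  rw [h6] at h5
  have h7 : |w'.2 - (w t).2| ≤ ‖w' - w t‖ := norm_snd_le (w' - w t)
  have h8 := norm_add_le (w' - W (S.ph t (w t) + S.Tf * j)) (W (S.ph t (w t) + S.Tf * j) - w t)
  rw [sub_add_sub_cancel] at h8
  rw [dist_eq_norm]
  linarith

end PhaseSystem

/-! ### Stability and instability -/

namespace PhaseSystem

variable {S : PhaseSystem}

variable (S) in
/-- A solution `w` in time whose phase parametrization `W` stays in a tube, together with a
contraction estimate in a larger tube. -/
structure TubeFrame (K μ C l : ℝ) (f : ℝ → ℝ × ℝ → ℝ × ℝ) (W w : ℝ → ℝ × ℝ) : Prop where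
  reg : S.Regular
  K_pos : 0 ≤ K
  μ_pos : 0 < μ
  C_pos : 0 < C
  l_pos : 0 < l
  field : S.TimeField (K + 1) μ f
  strip : S.StripRegular (K + 1) μ
  bound : S.TubeBound (K + 1) μ
  exists_clamped : ∀ a v, ∃ Y, S.ClampedSolution (K + 1) μ Y ∧ Y a = v
  sol : S.TubeSolution K μ W
  cont : Continuous w
  ph_eq : ∀ t, W (S.ph t (w t)) = w t
  contraction : ∀ (Y₁ Y₂ : ℝ → ℝ × ℝ) (a b : ℝ), S.rate * (b - a) ≤ 0 → Continuous Y₁ →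
    Continuous Y₂ → (∀ s ∈ Set.uIcc a b, Y₁ s ∈ S.tube (K + 1) μ s) →
    (∀ s ∈ Set.uIcc a b, Y₂ s ∈ S.tube (K + 1) μ s) →
    (∀ s ∈ Set.uIoo a b, s ∉ jumpSet → HasDerivAt Y₁ (S.V μ s (Y₁ s)) s) →
    (∀ s ∈ Set.uIoo a b, s ∉ jumpSet → HasDerivAt Y₂ (S.V μ s (Y₂ s)) s) →
    ‖Y₁ b - Y₂ b‖ ≤ C * (exp (-(l * μ ^ 2 * |b - a|)) * ‖Y₁ a - Y₂ a‖)

namespace TubeFrame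

variable {K μ C l : ℝ} {f : ℝ → ℝ × ℝ → ℝ × ℝ} {W w : ℝ → ℝ × ℝ}

theorem lipschitz (h : S.TubeFrame K μ C l f W w) (s s' : ℝ) : ‖W s' - W s‖ ≤ 1 / 2 * |s' - s| := by
  have h1 : S.TubeSolution (K + 1) μ W :=
    ⟨h.sol.cont, fun s => tube_mono h.μ_pos.le (by linarith) (h.sol.mem s), h.sol.hasDerivAt⟩
  exact h1.clampedSolution.lipschitz (mul_nonneg (by linarith [h.K_pos]) h.μ_pos.le) h.bound s s'

theorem mem_tube (h : S.TubeFrame K μ C l f W w) (s : ℝ) : W s ∈ S.tube (K + 1) μ s :=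
  tube_mono h.μ_pos.le (by linarith) (h.sol.mem s)

/-- The radius 2μ/3 at equal time becomes μ at equal phase, exactly the margin between the tubes K
and K + 1. -/
theorem mem_tube_of_near (h : S.TubeFrame K μ C l f W w) {t : ℝ} {y : ℝ × ℝ}
    (hy : ‖y - w t‖ ≤ 2 / 3 * μ) : y ∈ S.tube (K + 1) μ (S.ph t y) :=
  mem_tube_of_norm_sub_le (h.sol.mem _)
    (by linarith [(norm_sub_comparison h.lipschitz (h.ph_eq t) y).1])

theorem estimate_of_near (h : S.TubeFrame K μ C l f W w) (hr : S.rate < 0) {a b : ℝ} (hab : a ≤ b)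
    {y : ℝ → ℝ × ℝ} (hy : IsSolutionOn f y (Set.Icc a b))
    (hnear : ∀ t ∈ Set.Icc a b, ‖y t - w t‖ ≤ 2 / 3 * μ) :
    ‖y b - w b‖ ≤ 3 * C * (exp (-(l * μ ^ 2 * ((2 * S.c)⁻¹ * (b - a)))) * ‖y a - w a‖) := by
  have hm := fun t ht => h.mem_tube_of_near (hnear t ht)
  have hK : ∀ t ∈ Set.Icc a b, |(y t).1| ≤ (K + 1) * μ := fun t ht => (hm t ht).1
  have haI := Set.left_mem_Icc.2 hab
  have hbI := Set.right_mem_Icc.2 hab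
  obtain ⟨Y, Yc, Yy, hs, Yd⟩ := exists_phase_solution_Icc h.reg h.field h.strip hab hy hK
  have hg := ph_growth h.field Set.ordConnected_Icc hy hK haI hbI hab
  have hc := h.reg.c_pos
  have hC := h.C_pos
  have hl := h.l_pos
  have hμ := h.μ_pos
  have hle : S.ph a (y a) ≤ S.ph b (y b) := by
    have : 0 ≤ (2 * S.c)⁻¹ * (b - a) := mul_nonneg (by positivity) (by linarith)
    linarith
  have key := h.contraction Y W (S.ph a (y a)) (S.ph b (y b))
    (mul_nonpos_of_nonpos_of_nonneg hr.le (sub_nonneg.2 hle)) Yc h.sol.cont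
    (fun s hsI => by
      rw [Set.uIcc_of_le hle] at hsI
      obtain ⟨t, ht, rfl⟩ := hs s hsI
      rw [Yy t ht]
      exact hm t ht)
    (fun s _ => h.mem_tube s)
    (fun s hsI hsN => Yd s (by rwa [Set.uIoo_of_le hle] at hsI) hsN)
    (fun s _ hsN => h.sol.hasDerivAt s hsN)
  rw [Yy a haI, Yy b hbI, abs_of_nonneg (sub_nonneg.2 hle)] at key
  have c1 := (norm_sub_comparison h.lipschitz (h.ph_eq a) (y a)).1
  have c2 := (norm_sub_comparison h.lipschitz (h.ph_eq b) (y b)).2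
  have hexp : exp (-(l * μ ^ 2 * (S.ph b (y b) - S.ph a (y a))))
      ≤ exp (-(l * μ ^ 2 * ((2 * S.c)⁻¹ * (b - a)))) :=
    exp_le_exp.2 (neg_le_neg (mul_le_mul_of_nonneg_left hg (by positivity)))
  calc ‖y b - w b‖ ≤ 2 * _ := c2
    _ ≤ 2 * (C * (exp (-(l * μ ^ 2 * ((2 * S.c)⁻¹ * (b - a)))) * (3 / 2 * ‖y a - w a‖))) := by
        refine mul_le_mul_of_nonneg_left (key.trans ?_) zero_le_two
        gcongr
    _ = _ := by ring

/-- `bootstrap` removes the nearness assumption of `estimate_of_near`: while the distance is at most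
2μ/3, contraction already gives μ/2. -/
theorem stability_estimate (h : S.TubeFrame K μ C l f W w) (hr : S.rate < 0) {a b : ℝ} (hab : a ≤ b)
    {y : ℝ → ℝ × ℝ} (hy : IsSolutionOn f y (Set.Icc a b))
    (h1 : ‖y a - w a‖ ≤ 1 / 2 * μ) (h2 : 3 * C * ‖y a - w a‖ ≤ 1 / 2 * μ) :
    ‖y b - w b‖ ≤ 3 * C * (exp (-(l * μ ^ 2 * ((2 * S.c)⁻¹ * (b - a)))) * ‖y a - w a‖) := by
  have hμ := h.μ_pos
  have hC := h.C_pos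
  have hl := h.l_pos
  have hc := h.reg.c_pos
  refine h.estimate_of_near hr hab hy ?_
  have hsub : ∀ t ∈ Set.Icc a b, IsSolutionOn f y (Set.Icc a t) := fun t ht r hr' s hs =>
    hy r ⟨hr'.1, hr'.2.trans ht.2⟩ s ⟨hs.1, hs.2.trans ht.2⟩
  have hboot := bootstrap (h := fun t => ‖y t - w t‖) (a := a) (b := b) (r := 1 / 2 * μ)
    (R := 2 / 3 * μ) (by linarith)
    (by
      rw [Set.uIcc_of_le hab]
      exact ((continuousOn_of_isSolutionOn hab hy).sub h.cont.continuousOn).norm)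
    (by linarith)
    (fun t ht hle => by
      rw [Set.uIcc_of_le hab] at ht
      rw [Set.uIcc_of_le ht.1] at hle
      refine (h.estimate_of_near hr ht.1 (hsub t ht) hle).trans (le_trans ?_ h2)
      have hexp : exp (-(l * μ ^ 2 * ((2 * S.c)⁻¹ * (t - a)))) ≤ 1 := by
        refine exp_le_one_iff.2 (neg_nonpos.2 (mul_nonneg (by positivity) ?_))
        exact mul_nonneg (by positivity) (sub_nonneg.2 ht.1)
      refine mul_le_mul_of_nonneg_left ?_ (by positivity)
      exact mul_le_of_le_one_left (norm_nonneg _) hexp)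
  rw [Set.uIcc_of_le hab] at hboot
  exact fun t ht => (hboot t ht).trans (by linarith)

/-- Initial values for which `stability_estimate` applies. -/
theorem exists_radius (h : S.TubeFrame K μ C l f W w) {r : ℝ} (hr : 0 < r) :
    ∃ δ > 0, ∀ x : ℝ, 0 ≤ x → x < δ → x ≤ 1 / 2 * μ ∧ 3 * C * x ≤ 1 / 2 * μ ∧ 3 * C * x < r := by
  have hμ := h.μ_pos
  have hC := h.C_pos
  refine ⟨min (1 / 2 * μ) (min (1 / 2 * μ / (3 * C)) (r / (3 * C))), by positivity,
    fun x _ hx' => ⟨(hx'.trans_le (min_le_left _ _)).le, ?_, ?_⟩⟩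
  · have := (hx'.trans_le ((min_le_right _ _).trans (min_le_left _ _))).le
    rw [le_div_iff₀ (by positivity)] at this
    linarith
  · have := hx'.trans_le ((min_le_right _ _).trans (min_le_right _ _))
    rw [lt_div_iff₀ (by positivity)] at this
    linarith

theorem isLyapunovStable (h : S.TubeFrame K μ C l f W w) (hr : S.rate < 0) :
    IsLyapunovStable f w := by
  intro t₀ r hr0
  obtain ⟨δ, hδ, hδ'⟩ := h.exists_radius hr0
  have hμ := h.μ_pos
  have hC := h.C_pos
  have hl := h.l_pos
  have hc := h.reg.c_pos
  refine ⟨δ, hδ, fun t₁ _ y hy hd t ht => ?_⟩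
  rw [dist_eq_norm] at hd ⊢
  obtain ⟨a1, a2, a3⟩ := hδ' _ (norm_nonneg _) hd
  have hy' : IsSolutionOn f y (Set.Icc t₀ t) := fun r hr' s hs =>
    hy r ⟨hr'.1, hr'.2.trans ht.2⟩ s ⟨hs.1, hs.2.trans ht.2⟩
  refine (h.stability_estimate hr ht.1 hy' a1 a2).trans_lt (lt_of_le_of_lt ?_ a3)
  refine mul_le_mul_of_nonneg_left (mul_le_of_le_one_left (norm_nonneg _) ?_) (by positivity)
  refine exp_le_one_iff.2 (neg_nonpos.2 (mul_nonneg (by positivity) ?_))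
  exact mul_nonneg (by positivity) (sub_nonneg.2 ht.1)

theorem exists_solution_Ici (h : S.TubeFrame K μ C l f W w) {t₀ : ℝ} {v : ℝ × ℝ} {Y : ℝ → ℝ × ℝ}
    (hY : S.ClampedSolution (K + 1) μ Y) (hv : Y (S.ph t₀ v) = v)
    (hm : ∀ s ≥ S.ph t₀ v, Y s ∈ S.tube (K + 1) μ s) :
    ∃ y : ℝ → ℝ × ℝ, IsSolutionOn f y (Set.Ici t₀) ∧ y t₀ = v := by
  have hc := h.reg.c_pos
  obtain ⟨y, -, hyY, hYy, hmono, hsol⟩ := hY.exists_time_solution h.reg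
    (mul_nonneg (by linarith [h.K_pos]) h.μ_pos.le) h.bound h.field
  have ht₀ : S.c * (S.ph t₀ v - v.2) = t₀ := by unfold ph; field_simp; ring
  have hy0 : y t₀ = v := by
    have := (hYy (S.ph t₀ v)).1
    rwa [hv, ht₀] at this
  refine ⟨y, hsol _ Set.ordConnected_Ici fun t ht => ?_, hy0⟩
  have h1 := hmono.monotone ht
  simp only [hy0] at h1
  have h2 := hm _ h1
  rwa [hyY] at h2

theorem isAsymptoticallyStable (h : S.TubeFrame K μ C l f W w) (hr : S.rate < 0) :
    IsAsymptoticallyStable f w := by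
  refine ⟨h.isLyapunovStable hr, fun t₀ => ?_⟩
  obtain ⟨δ, hδ, hδ'⟩ := h.exists_radius one_pos
  have hμ := h.μ_pos
  have hC := h.C_pos
  have hl := h.l_pos
  have hc := h.reg.c_pos
  refine ⟨δ, hδ, fun v hv => ⟨?_, fun y hy hy0 => ?_⟩⟩
  · rw [dist_eq_norm] at hv
    obtain ⟨a1, a2, -⟩ := hδ' _ (norm_nonneg _) hv
    obtain ⟨Y, hY, hYv⟩ := h.exists_clamped (S.ph t₀ v) v
    have hcmp := (norm_sub_comparison h.lipschitz (h.ph_eq t₀) v).1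
    -- Existence comes from the clamped system, which has global solutions; contraction keeps this
    -- one inside the tube, where the clamp does nothing.
    refine h.exists_solution_Ici hY hYv fun b hb => ?_
    have hboot := bootstrap (h := fun s => ‖Y s - W s‖) (a := S.ph t₀ v) (b := b) (r := 1 / 2 * μ)
      (R := 1 * μ) (by linarith) (hY.cont.sub h.sol.cont).norm.continuousOn
      (by
        simp only [hYv]
        linarith)
      (fun s hs hle => by
        rw [Set.uIcc_of_le hb] at hs
        have hmem : ∀ r ∈ Set.uIcc (S.ph t₀ v) s, Y r ∈ S.tube (K + 1) μ r := fun r hr' =>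
          mem_tube_of_norm_sub_le (h.sol.mem r) (hle r hr')
        have key := h.contraction Y W (S.ph t₀ v) s
          (mul_nonpos_of_nonpos_of_nonneg hr.le (sub_nonneg.2 hs.1)) hY.cont h.sol.cont hmem
          (fun r _ => h.mem_tube r)
          (fun r hr' hrN => by
            have := hY.hasDerivAt r hrN
            rwa [clamp_eq (hmem r (Set.uIoo_subset_uIcc_self hr'))] at this)
          (fun r _ hrN => h.sol.hasDerivAt r hrN)
        rw [hYv] at key
        have hexp : exp (-(l * μ ^ 2 * |s - S.ph t₀ v|)) ≤ 1 :=
          exp_le_one_iff.2 (neg_nonpos.2 (by positivity))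
        have h3 : C * (exp (-(l * μ ^ 2 * |s - S.ph t₀ v|)) * ‖v - W (S.ph t₀ v)‖)
            ≤ C * (1 * (3 / 2 * ‖v - w t₀‖)) := by gcongr
        have h4 : 0 ≤ C * ‖v - w t₀‖ := by positivity
        linarith)
    have := hboot b Set.right_mem_uIcc
    exact mem_tube_of_norm_sub_le (h.sol.mem b) (by linarith)
  · rw [dist_eq_norm, ← hy0] at hv
    obtain ⟨a1, a2, -⟩ := hδ' _ (norm_nonneg _) hv
    have hlim : Tendsto (fun t => 3 * C * (exp (-(l * μ ^ 2 * ((2 * S.c)⁻¹ * (t - t₀))))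
        * ‖y t₀ - w t₀‖)) atTop (𝓝 0) := by
      have h1 : Tendsto (fun t => l * μ ^ 2 * ((2 * S.c)⁻¹ * (t - t₀))) atTop atTop :=
        ((tendsto_atTop_add_const_right _ (-t₀) tendsto_id).const_mul_atTop
          (by positivity)).const_mul_atTop (by positivity)
      have h2 := ((tendsto_exp_neg_atTop_nhds_zero.comp h1).mul_const ‖y t₀ - w t₀‖).const_mul (3 * C)
      simpa using h2
    refine squeeze_zero' (Eventually.of_forall fun t => dist_nonneg) ?_ hlim
    filter_upwards [eventually_ge_atTop t₀] with t ht
    rw [dist_eq_norm]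
    exact h.stability_estimate hr ht (fun r hr' s hs => hy r hr'.1 s hs.1) a1 a2

/-- If w were stable, a solution through a slightly displaced point would stay in the tube for all
later phases. Backward contraction from arbitrarily late phases would then force its initial
displacement to vanish. -/
theorem not_isLyapunovStable (h : S.TubeFrame K μ C l f W w) (hr : 0 < S.rate) :
    ¬ IsLyapunovStable f w := by
  intro hst
  have hμ := h.μ_pos
  have hC := h.C_pos
  have hl := h.l_pos
  have hc := h.reg.c_pos
  obtain ⟨δ, hδ, hδ'⟩ := hst 0 (1 / 2 * μ) (by positivity)
  set ρ := min (δ / 2) (1 / 2 * μ) with hρ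
  have hρ0 : 0 < ρ := by positivity
  -- Displace z alone, so that the phase at time 0 is unchanged.
  set v : ℝ × ℝ := w 0 + (ρ, 0) with hv
  have hvw : ‖v - w 0‖ = ρ := by
    rw [hv, add_sub_cancel_left, Prod.norm_def]
    simp [abs_of_pos hρ0, hρ0.le]
  obtain ⟨Y, hY, hYv⟩ := h.exists_clamped (S.ph 0 v) v
  obtain ⟨y, yc, hyY, hYy, hmono, hsol⟩ := hY.exists_time_solution h.reg
    (mul_nonneg (by linarith [h.K_pos]) h.μ_pos.le) h.bound h.field
  have ht₀ : S.c * (S.ph 0 v - v.2) = 0 := by unfold ph; simp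
  have hy0 : y 0 = v := by
    have := (hYy (S.ph 0 v)).1
    rwa [hYv, ht₀] at this
  have hnear : ∀ b ≥ 0, ‖y b - w b‖ ≤ 1 / 2 * μ := fun b hb => by
    refine bootstrap (h := fun t => ‖y t - w t‖) (a := 0) (b := b) (r := 1 / 2 * μ)
      (R := 2 / 3 * μ) (by linarith) (yc.sub h.cont).norm.continuousOn ?_ ?_ b Set.right_mem_uIcc
    · simp only [hy0, hvw]
      linarith [min_le_right (δ / 2) (1 / 2 * μ)]
    · intro t ht hle
      rw [Set.uIcc_of_le hb] at ht
      rw [Set.uIcc_of_le ht.1] at hle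
      have hs := hsol (Set.Icc 0 t) Set.ordConnected_Icc fun r hr' => h.mem_tube_of_near (hle r hr')
      have := hδ' t ht.1 y hs (by
        rw [hy0, dist_eq_norm, hvw]
        linarith [min_le_left (δ / 2) (1 / 2 * μ)]) t ⟨ht.1, le_rfl⟩
      rw [dist_eq_norm] at this
      exact this.le
  have hm : ∀ s ≥ S.ph 0 v, Y s ∈ S.tube (K + 1) μ s := fun s hs => by
    obtain ⟨h1, h2⟩ := hYy s
    have h3 : 0 ≤ S.c * (s - (Y s).2) := by
      by_contra! hlt
      have := hmono hlt
      simp only [hy0, h1, h2] at this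
      linarith
    have h5 := hnear _ h3
    rw [h1] at h5
    have h4 := h.mem_tube_of_near (h5.trans (by linarith))
    rwa [h2] at h4
  have hzero : ‖v - W (S.ph 0 v)‖ ≤ 0 := by
    have hlim : Tendsto (fun x : ℝ => C * (exp (-(l * μ ^ 2 * x)) * (2 * (K + 1) * μ))) atTop (𝓝 0) := by
      have h1 : Tendsto (fun x : ℝ => l * μ ^ 2 * x) atTop atTop :=
        tendsto_id.const_mul_atTop (by positivity)
      have h2 := ((tendsto_exp_neg_atTop_nhds_zero.comp h1).mul_const (2 * (K + 1) * μ)).const_mul C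
      simpa using h2
    refine ge_of_tendsto hlim ?_
    filter_upwards [eventually_ge_atTop 0] with x hx
    have hle : S.ph 0 v ≤ S.ph 0 v + x := by linarith
    have hmem : ∀ r ∈ Set.uIcc (S.ph 0 v + x) (S.ph 0 v), Y r ∈ S.tube (K + 1) μ r := fun r hr' => by
      rw [Set.uIcc_of_ge hle] at hr'
      exact hm r hr'.1
    have key := h.contraction Y W (S.ph 0 v + x) (S.ph 0 v) (by nlinarith) hY.cont h.sol.cont hmem
      (fun r _ => h.mem_tube r)
      (fun r hr' hrN => by
        have := hY.hasDerivAt r hrN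
        rwa [clamp_eq (hmem r (Set.uIoo_subset_uIcc_self hr'))] at this)
      (fun r _ hrN => h.sol.hasDerivAt r hrN)
    rw [hYv, sub_add_cancel_left, abs_neg, abs_of_nonneg hx] at key
    refine key.trans ?_
    gcongr
    exact norm_sub_le_of_mem_tube (hm _ hle) (h.mem_tube _)
  have := (norm_sub_comparison h.lipschitz (h.ph_eq 0) v).2
  linarith

end TubeFrame

end PhaseSystem

/-! ### Assembly for phase systems -/

namespace PhaseSystem

variable {S : PhaseSystem}

theorem exists_eta_bound (hS : S.Regular) :
    ∃ M > 0, (∀ σ, |S.η σ| ≤ M) ∧ ∀ σ σ', |S.η σ - S.η σ'| ≤ M * |σ - σ'| := by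
  obtain ⟨M, hM, hb⟩ := exists_slow_coeff_bound hS
  refine ⟨M, hM, fun σ => (hb σ).2.2.2.2.2.2.1, fun σ σ' => ?_⟩
  exact Convex.norm_image_sub_le_of_norm_deriv_le
    (fun x _ => (hS.hη.hasDerivAt x).differentiableAt) (fun x _ => (hb x).2.2.2.2.2.2.2)
    convex_univ (Set.mem_univ σ') (Set.mem_univ σ)

theorem slow_ph (hc : S.c ≠ 0) (μ t : ℝ) (w : ℝ × ℝ) :
    S.slow μ (S.ph t w) = μ ^ 2 * t + μ ^ 2 * S.c * w.2 := by
  unfold slow ph; field_simp; ring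

/-- The almost periodic solution, its uniqueness and its stability, for a family of vector fields
represented by a phase system. -/
theorem exists_almostPeriodic_solution (hS : S.Elliptic) (hr : S.rate ≠ 0)
    {F : ℝ → ℝ → ℝ × ℝ → ℝ × ℝ}
    (hF : ∀ K ≥ 0, ∃ μ₀ > 0, ∀ μ, 0 < μ → μ < μ₀ → S.TimeField K μ (F μ)) :
    ∃ δ > 0, ∃ K₀ > 0, ∀ K ≥ K₀, ∃ μ₀ > 0, ∀ μ, 0 < μ → μ < μ₀ → ∃ w : ℝ → ℝ × ℝ,
      (IsSolutionOn (F μ) w Set.univ ∧ IsAlmostPeriodic w ∧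
        (∀ t, |(w t).1| ≤ K₀ * μ ∧ |(w t).2 - S.η (μ ^ 2 * t)| ≤ K₀ * μ) ∧ K₀ * μ ≤ δ) ∧
      (∀ y : ℝ → ℝ × ℝ, IsSolutionOn (F μ) y Set.univ →
        (∀ t, |(y t).1| ≤ K * μ ∧ |(y t).2 - S.η (μ ^ 2 * t)| ≤ δ) → y = w) ∧
      (S.rate < 0 → IsAsymptoticallyStable (F μ) w) ∧ (0 < S.rate → ¬ IsLyapunovStable (F μ) w) := by
  have hc := hS.c_pos
  obtain ⟨M, hM, hη, hη'⟩ := exists_eta_bound hS.toRegular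
  obtain ⟨δ, hδ, hloc⟩ := localization hS
  obtain ⟨K₁, hK₁, μ₁, hμ₁, hμ₁', hex⟩ := exists_tubeSolution hS hr
  obtain ⟨C, hC, l, hl, hcontr⟩ := norm_contraction hS hr
  -- Tubes follow η at slow time μ²cs, which exceeds εt by μ²cφ. The second summand pays for this
  -- shift of the argument of η.
  set K₀ := K₁ + M * (S.c * (M + K₁)) with hK₀
  have hK₀0 : 0 < K₀ := by positivity
  -- The other half of δ is reserved for the same shift of slow time in the uniqueness part.
  refine ⟨δ / 2, half_pos hδ, K₀, hK₀0, fun K hK => ?_⟩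
  have hK0 : 0 ≤ K := hK₀0.le.trans hK
  have hK₁1 : 0 ≤ K₁ + 1 := by positivity
  obtain ⟨K', hK', μ₂, hμ₂, hloc⟩ := hloc K hK0
  obtain ⟨μ₃, hμ₃, huniq⟩ := tubeSolution_unique hS hr (hK'.trans (le_max_right K₁ K'))
  obtain ⟨μ₄, hμ₄, -, hcontr⟩ := hcontr (K₁ + 1) hK₁1
  obtain ⟨μ₅, hμ₅, -, hcl⟩ := exists_clamped_solution hS.toRegular hK₁1
  obtain ⟨μ₆, hμ₆, hap⟩ := isAlmostPeriodic_time hS hr hK₁.le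
  obtain ⟨μ₇, hμ₇, hF₁⟩ := hF (K₁ + 1) hK₁1
  obtain ⟨μ₈, hμ₈, hF₂⟩ := hF K hK0
  obtain ⟨μ₉, hμ₉, hst₁⟩ := exists_stripRegular hS.toRegular hK₁1
  obtain ⟨μ₀, hμ₀, hst₂⟩ := exists_stripRegular hS.toRegular hK0
  set m := min (min (min μ₁ μ₂) (min μ₃ μ₄)) (min (min μ₅ μ₆) (min (min μ₇ μ₈) (min μ₉ μ₀))) with hm
  set m' := min (δ / 2 / K₀) (δ / 2 / (M * (S.c * (M + δ)))) with hm'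
  have hm0 : 0 < min m m' := by positivity
  refine ⟨min m m', hm0, fun μ hμ hμ' => ?_⟩
  simp only [hm, hm', lt_min_iff] at hμ'
  obtain ⟨⟨⟨⟨l₁, l₂⟩, l₃, l₄⟩, ⟨l₅, l₆⟩, ⟨l₇, l₈⟩, l₉, l₀⟩, l₁₀, l₁₁⟩ := hμ'
  have hμ1 : μ ≤ 1 := l₁.le.trans hμ₁'
  have hμμ : μ ^ 2 ≤ μ := by nlinarith
  rw [lt_div_iff₀ (by positivity)] at l₁₀ l₁₁
  obtain ⟨W, hW⟩ := hex μ hμ l₁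
  obtain ⟨hb, -, hcl⟩ := hcl μ hμ l₅
  have hb₁ : S.TubeBound K₁ μ := fun s y hy => hb s y (tube_mono hμ.le (by linarith) hy)
  have hf := hF₁ μ hμ l₇
  have hf₁ : S.TimeField K₁ μ (F μ) :=
    ⟨fun t w hw => hf.eq t w (hw.trans (by nlinarith)), fun t w hw => hf.lower t w (hw.trans (by nlinarith))⟩
  obtain ⟨w, wc, hWw, -, -, hsol⟩ := hW.clampedSolution.exists_time_solution hS.toRegular
    (by positivity) hb₁ hf₁
  have hmem : ∀ t, w t ∈ S.tube K₁ μ (S.ph t (w t)) := fun t => by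
    have := hW.mem (S.ph t (w t))
    rwa [hWw] at this
  have hframe : S.TubeFrame K₁ μ C l (F μ) W w :=
    { reg := hS.toRegular
      K_pos := hK₁.le
      μ_pos := hμ
      C_pos := hC
      l_pos := hl
      field := hf
      strip := hst₁ μ hμ l₉
      bound := hb
      exists_clamped := fun a v => by
        obtain ⟨Y, h1, h2, h3⟩ := hcl a v
        exact ⟨Y, ⟨h1, h3⟩, h2⟩
      sol := hW
      cont := wc
      ph_eq := hWw
      contraction := fun Y₁ Y₂ a b hab c₁ c₂ t₁ t₂ d₁ d₂ => by
        have := hcontr μ hμ l₄ Y₁ Y₂ (fun _ => 0) (fun _ => 0) a b 0 hab le_rfl c₁.continuousOn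
          c₂.continuousOn t₁ t₂ fun s hs hsN => ⟨by simpa using d₁ s hs hsN, by simpa using d₂ s hs hsN,
            by simp; positivity, by simp; positivity, by simp⟩
        simpa using this }
  refine ⟨w, ⟨hsol _ Set.ordConnected_univ fun t _ => hmem t, hap μ hμ l₆ W hW hb₁ w wc hWw,
    fun t => ⟨(hmem t).1.trans ?_, ?_⟩, by linarith⟩, fun y hy hnear => ?_,
    hframe.isAsymptoticallyStable, hframe.not_isLyapunovStable⟩
  · exact mul_le_mul_of_nonneg_right (by rw [hK₀]; linarith [(by positivity : 0 ≤ M * (S.c * (M + K₁)))]) hμ.le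
  · have h1 := (hmem t).2
    have h2 := hη' (S.slow μ (S.ph t (w t))) (μ ^ 2 * t)
    rw [slow_ph hc.ne'] at h1 h2
    rw [add_sub_cancel_left, abs_mul, abs_mul, abs_of_pos hc, abs_of_nonneg (sq_nonneg μ)] at h2
    have h3 : |(w t).2| ≤ M + K₁ := by
      have h4 := abs_add_le ((w t).2 - S.η (μ ^ 2 * t + μ ^ 2 * S.c * (w t).2))
        (S.η (μ ^ 2 * t + μ ^ 2 * S.c * (w t).2))
      rw [sub_add_cancel] at h4
      have h5 := hη (μ ^ 2 * t + μ ^ 2 * S.c * (w t).2)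
      nlinarith
    have h6 := abs_add_le ((w t).2 - S.η (μ ^ 2 * t + μ ^ 2 * S.c * (w t).2))
      (S.η (μ ^ 2 * t + μ ^ 2 * S.c * (w t).2) - S.η (μ ^ 2 * t))
    rw [sub_add_sub_cancel] at h6
    have h7 : M * (μ ^ 2 * S.c * |(w t).2|) ≤ M * (μ * S.c * (M + K₁)) := by gcongr
    rw [hK₀]
    linarith
  · obtain ⟨Y, Yc, Yy, hs, Yd⟩ := exists_phase_solution_univ hS.toRegular (hF₂ μ hμ l₈) (hst₂ μ hμ l₀) hy
      fun t => (hnear t).1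
    have hY := hloc μ hμ l₂ Y Yc (fun s => by
      obtain ⟨t, rfl⟩ := hs s
      rw [Yy]
      refine ⟨(hnear t).1, ?_⟩
      have h1 := (hnear t).2
      have h2 := hη' (μ ^ 2 * t) (S.slow μ (S.ph t (y t)))
      rw [slow_ph hc.ne'] at h2 ⊢
      rw [sub_add_cancel_left, abs_neg, abs_mul, abs_mul, abs_of_pos hc, abs_of_nonneg (sq_nonneg μ)] at h2
      have h3 : |(y t).2| ≤ M + δ := by
        have h4 := abs_add_le ((y t).2 - S.η (μ ^ 2 * t)) (S.η (μ ^ 2 * t))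
        rw [sub_add_cancel] at h4
        linarith [hη (μ ^ 2 * t)]
      have h6 := abs_add_le ((y t).2 - S.η (μ ^ 2 * t))
        (S.η (μ ^ 2 * t) - S.η (μ ^ 2 * t + μ ^ 2 * S.c * (y t).2))
      rw [sub_add_sub_cancel] at h6
      have h7 : M * (μ ^ 2 * S.c * |(y t).2|) ≤ M * (μ * S.c * (M + δ)) := by gcongr
      linarith) Yd
    -- Localization puts both curves in tubes, and uniqueness is applied in the larger one. No
    -- almost periodicity of y is needed.
    have hWY : Y = W := huniq μ hμ l₃ Y W
      ⟨hY.cont, fun s => tube_mono hμ.le (le_max_right _ _) (hY.mem s), hY.hasDerivAt⟩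
      ⟨hW.cont, fun s => tube_mono hμ.le (le_max_left _ _) (hW.mem s), hW.hasDerivAt⟩
    funext t
    have h1 := (norm_sub_comparison hframe.lipschitz (hWw t) (y t)).2
    rw [← hWY, Yy, sub_self, norm_zero, mul_zero] at h1
    exact sub_eq_zero.1 (norm_le_zero_iff.1 h1)

end PhaseSystem

/-! ### Smoothness of the root, and harmonic coefficients of the force -/

/-- By continuity η stays in the neighbourhood where the implicit function gives the only solution,
so it coincides locally with that smooth function. -/
theorem contDiff_of_root {g : ℝ × ℝ → ℝ} (hg : ContDiff ℝ ∞ g) {η : ℝ → ℝ} (hη : Continuous η)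
    (h0 : ∀ σ, g (σ, η σ) = 0) {g' : ℝ → ℝ}
    (hd : ∀ σ, HasDerivAt (fun φ => g (σ, φ)) (g' σ) (η σ)) (hne : ∀ σ, g' σ ≠ 0) :
    ContDiff ℝ ∞ η := by
  refine contDiff_iff_contDiffAt.2 fun σ => ?_
  have hgat : ContDiffAt ℝ ∞ g (σ, η σ) := hg.contDiffAt
  set L := fderiv ℝ g (σ, η σ) ∘L ContinuousLinearMap.inr ℝ ℝ ℝ with hL
  have hL1 : L 1 = g' σ := by
    have h1 : HasDerivAt (fun φ : ℝ => (σ, φ)) ((0 : ℝ), (1 : ℝ)) (η σ) :=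
      (hasDerivAt_const _ _).prodMk (hasDerivAt_id _)
    have h2 := (hg.differentiable (by simp) (σ, η σ)).hasFDerivAt.comp_hasDerivAt _ h1
    exact h2.unique (hd σ)
  have hinv : L.IsInvertible := by
    refine ⟨ContinuousLinearEquiv.unitsEquivAut ℝ (Units.mk0 (g' σ) (hne σ)), ?_⟩
    refine ContinuousLinearMap.ext_ring ?_
    rw [hL1]
    simp
  have hn : (∞ : WithTop ℕ∞) ≠ 0 := by simp
  refine (hgat.contDiffAt_implicitFunction hn hinv).congr_of_eventuallyEq ?_
  have hc : Tendsto (fun r => (r, η r)) (𝓝 σ) (𝓝 (σ, η σ)) :=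
    (continuous_id.prodMk hη).tendsto σ
  filter_upwards [hc.eventually (hgat.eventually_apply_eq_iff_implicitFunction hn hinv)] with r hr
  exact (hr.1 (by rw [h0, h0])).symm

theorem IsBiharmonic.exists_coeff {ν Γ : ℝ} (hΓ : 0 < Γ) {f : ℝ → ℝ → ℝ} (hf : IsBiharmonic ν Γ f) :
    ∃ P Q R : ℝ → ℝ, IsSlow (2 * π / Γ) P ∧ IsSlow (2 * π / Γ) Q ∧ IsSlow (2 * π / Γ) R ∧
      ∀ t τ, f t τ = P τ * sin (ν * t) + Q τ * cos (ν * t) + R τ := by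
  have hper : ∀ τ, Γ * (τ + 2 * π / Γ) = Γ * τ + 2 * π := fun τ => by field_simp
  have hsin : IsSlow (2 * π / Γ) fun τ => sin (Γ * τ) :=
    ⟨by fun_prop, fun τ => by simp only [hper, sin_add_two_pi]⟩
  have hcos : IsSlow (2 * π / Γ) fun τ => cos (Γ * τ) :=
    ⟨by fun_prop, fun τ => by simp only [hper, cos_add_two_pi]⟩
  cases hf with
  | close a₁ a₂ h₁ h₂ hne =>
    refine ⟨_, _, _, (IsSlow.const a₁).add ((IsSlow.const a₂).mul hcos), (IsSlow.const a₂).mul hsin,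
      IsSlow.const 0, fun t τ => ?_⟩
    simp only [sin_add]; ring
  | distant A B θ =>
    refine ⟨_, _, _, IsSlow.const (A * cos θ), IsSlow.const (A * sin θ), (IsSlow.const B).mul hsin,
      fun t τ => ?_⟩
    simp only [sin_add]; ring

namespace PhaseSystem

variable {S : PhaseSystem}

theorem hasDerivAt_avg (hS : S.Regular) (σ : ℝ) :
    HasDerivAt (fun φ => S.avg σ φ) (S.mean S.A' σ) (S.η σ) := by
  have e : (fun φ => S.avg σ φ) = fun φ => _ := funext fun φ => avg_eq hS σ φ
  rw [e, mean_A'_eq hS]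
  have hl : HasDerivAt (fun φ => S.lam * φ) S.lam (S.η σ) := by
    simpa using (hasDerivAt_id (S.η σ)).const_mul S.lam
  have h1 : HasDerivAt (fun φ => S.sinCoeff σ φ) (S.lam * S.cosCoeff σ (S.η σ)) (S.η σ) := by
    refine ((hl.cos.const_mul (S.P σ)).fun_add (hl.sin.const_mul (S.Q σ))).congr_deriv ?_
    unfold cosCoeff; ring
  have h2 : HasDerivAt (fun φ => S.cosCoeff σ φ) (-(S.lam * S.sinCoeff σ (S.η σ))) (S.η σ) := by
    refine ((hl.cos.const_mul (S.Q σ)).fun_sub (hl.sin.const_mul (S.P σ))).congr_deriv ?_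
    unfold sinCoeff; ring
  refine ((((h1.const_mul _).fun_add (h2.const_mul _)).add_const _).add_const _).congr_deriv ?_
  ring

theorem contDiff_avg (hS : S.Regular) : ContDiff ℝ ∞ fun p : ℝ × ℝ => S.avg p.1 p.2 := by
  simp only [avg_eq hS]
  have hP := hS.hP.smooth
  have hQ := hS.hQ.smooth
  have hR := hS.hR.smooth
  unfold sinCoeff cosCoeff
  fun_prop

end PhaseSystem

/-! ### The Green function of the impact oscillator -/

theorem saw_neg {s : ℝ} (hs : s ∉ jumpSet) : saw (-s) = 2 * π - saw s := by
  have h := mem_Ioo_floor_of_notMem_jumpSet hs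
  set k := ⌊s / (2 * π)⌋
  rw [saw_eq_of_mem (k := k) ⟨h.1.le, h.2⟩, saw_eq_of_mem (k := -(k + 1))
    ⟨by push_cast; linarith [h.2], by push_cast; linarith [h.1]⟩]
  push_cast
  ring

theorem neg_mem_jumpSet {s : ℝ} (hs : s ∈ jumpSet) : -s ∈ jumpSet := by
  obtain ⟨k, rfl⟩ := hs
  exact ⟨-k, by push_cast; ring⟩

theorem saw_of_mem_jumpSet {s : ℝ} (hs : s ∈ jumpSet) : saw s = 0 := by
  obtain ⟨k, rfl⟩ := hs
  have hp := pi_pos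
  simp only
  rw [saw_eq_of_mem (k := k) ⟨le_rfl, by linarith⟩, sub_self]

namespace ImpactOscillator

variable (S : ImpactOscillator)

/-- The frequency ratio `Ω / ω₀(J)`. -/
def ratio (J : ℝ) : ℝ :=
  if 0 < S.Δ then 1 - arctan (J / (2 * S.Ω * S.Δ)) / π
  else if S.Δ < 0 then -arctan (J / (2 * S.Ω * S.Δ)) / π
  else 1 / 2

/-- The Green function on one period. -/
def green (x J : ℝ) : ℝ := cos (S.ratio J * (x - π)) / (2 * S.Ω * sin (π * S.ratio J))

def greenX (x J : ℝ) : ℝ :=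
  -(S.ratio J * sin (S.ratio J * (x - π))) / (2 * S.Ω * sin (π * S.ratio J))

def greenJ : ℝ → ℝ → ℝ := partialJ fun x J => J * S.green x J

variable {S}

theorem omega_eq (J : ℝ) : S.omega J = S.Ω / S.ratio J := by
  have hp := pi_ne_zero
  unfold omega ratio
  split_ifs
  · rw [one_sub_div hp, div_div_eq_mul_div]; ring
  · rw [div_div_eq_mul_div, div_neg, neg_div, mul_comm]
  · ring

theorem ratio_eq (hΩ : 0 < S.Ω) (J : ℝ) : S.Ω / S.omega J = S.ratio J := by
  rw [omega_eq, div_div_cancel₀ hΩ.ne']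

theorem contDiff_ratio : ContDiff ℝ ∞ S.ratio := by
  unfold ratio
  split_ifs
  · exact contDiff_const.sub ((contDiff_arctan.comp (contDiff_id.div_const _)).div_const _)
  · exact ((contDiff_arctan.comp (contDiff_id.div_const _)).neg).div_const _
  · exact contDiff_const

/-- This keeps sin(π·ratio) positive, so the Green function has no pole for J > 0. -/
theorem ratio_mem (hΩ : 0 < S.Ω) {J : ℝ} (hJ : 0 < J) : 0 < S.ratio J ∧ S.ratio J < 1 := by
  have hp := pi_pos
  unfold ratio
  split_ifs with h1 h2
  · have h3 := arctan_pos.2 (by positivity : 0 < J / (2 * S.Ω * S.Δ))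
    have h4 := arctan_lt_pi_div_two (J / (2 * S.Ω * S.Δ))
    refine ⟨?_, by linarith [div_pos h3 hp]⟩
    rw [sub_pos, div_lt_one hp]; linarith
  · have h3 := arctan_lt_zero.2 (div_neg_of_pos_of_neg hJ (mul_neg_of_pos_of_neg (by positivity) h2) :
      J / (2 * S.Ω * S.Δ) < 0)
    have h4 := neg_pi_div_two_lt_arctan (J / (2 * S.Ω * S.Δ))
    refine ⟨div_pos (by linarith) hp, ?_⟩
    rw [div_lt_one hp]; linarith
  · norm_num

theorem omega_pos (hΩ : 0 < S.Ω) {J : ℝ} (hJ : 0 < J) : 0 < S.omega J := by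
  rw [omega_eq]
  exact div_pos hΩ (ratio_mem hΩ hJ).1

theorem sin_ratio_pos (hΩ : 0 < S.Ω) {J : ℝ} (hJ : 0 < J) : 0 < sin (π * S.ratio J) := by
  have h := ratio_mem hΩ hJ
  exact sin_pos_of_pos_of_lt_pi (mul_pos pi_pos h.1) (by nlinarith [pi_pos])

theorem contDiffOn_ratio : ContDiffOn ℝ ∞ (fun p : ℝ × ℝ => S.ratio p.2) impulseDomain :=
  (contDiff_ratio.comp contDiff_snd).contDiffOn

theorem contDiffOn_omega (hΩ : 0 < S.Ω) :
    ContDiffOn ℝ ∞ (fun p : ℝ × ℝ => S.omega p.2) impulseDomain := by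
  simp only [omega_eq]
  exact contDiffOn_const.div contDiffOn_ratio fun p hp => (ratio_mem hΩ hp.2).1.ne'

theorem contDiffOn_green (hΩ : 0 < S.Ω) :
    ContDiffOn ℝ ∞ (Function.uncurry S.green) impulseDomain := by
  have h := contDiffOn_ratio (S := S)
  refine ContDiffOn.div (f := fun p : ℝ × ℝ => cos (S.ratio p.2 * (p.1 - π)))
    (g := fun p : ℝ × ℝ => 2 * S.Ω * sin (π * S.ratio p.2)) (by fun_prop) (by fun_prop) fun p hp => ?_
  have := sin_ratio_pos hΩ hp.2
  positivity

theorem contDiffOn_greenX (hΩ : 0 < S.Ω) :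
    ContDiffOn ℝ ∞ (Function.uncurry S.greenX) impulseDomain := by
  have h := contDiffOn_ratio (S := S)
  refine ContDiffOn.div (f := fun p : ℝ × ℝ => -(S.ratio p.2 * sin (S.ratio p.2 * (p.1 - π))))
    (g := fun p : ℝ × ℝ => 2 * S.Ω * sin (π * S.ratio p.2)) (by fun_prop) (by fun_prop) fun p hp => ?_
  have := sin_ratio_pos hΩ hp.2
  positivity

theorem contDiffOn_mul_green (hΩ : 0 < S.Ω) :
    ContDiffOn ℝ ∞ (Function.uncurry fun x J => J * S.green x J) impulseDomain :=
  contDiffOn_snd.mul (contDiffOn_green hΩ)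

theorem contDiffOn_greenJ (hΩ : 0 < S.Ω) :
    ContDiffOn ℝ ∞ (Function.uncurry S.greenJ) impulseDomain :=
  contDiffOn_partialJ (contDiffOn_mul_green hΩ)

theorem kappa_eq (hΩ : 0 < S.Ω) (ψ J : ℝ) : S.kappa ψ J = S.green (saw ψ) J := by
  unfold kappa green
  rw [ratio_eq hΩ]
  rfl

theorem kappaPsi_eq (hΩ : 0 < S.Ω) {ψ : ℝ} (hψ : ψ ∉ jumpSet) (J : ℝ) :
    S.kappaPsi ψ J = S.greenX (saw ψ) J := by
  have h := mem_Ioo_floor_of_notMem_jumpSet hψ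
  set k := ⌊ψ / (2 * π)⌋
  have he : (fun s => S.kappa s J) =ᶠ[𝓝 ψ] fun s => S.green (s - 2 * π * k) J := by
    filter_upwards [Ioo_mem_nhds h.1 h.2] with r hr
    rw [kappa_eq hΩ, saw_eq_of_mem ⟨hr.1.le, hr.2⟩]
  unfold kappaPsi
  rw [he.deriv_eq, saw_eq_of_mem (k := k) ⟨h.1.le, h.2⟩]
  have h1 : HasDerivAt (fun s => S.ratio J * (s - 2 * π * k - π)) (S.ratio J) ψ := by
    simpa using (((hasDerivAt_id ψ).sub_const (2 * π * k)).sub_const π).const_mul (S.ratio J)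
  refine (HasDerivAt.congr_deriv (h1.cos.div_const _) ?_).deriv
  unfold greenX
  ring

theorem kappa_neg (hΩ : 0 < S.Ω) (ψ J : ℝ) : S.kappa (-ψ) J = S.kappa ψ J := by
  rw [kappa_eq hΩ, kappa_eq hΩ]
  by_cases h : ψ ∈ jumpSet
  · rw [saw_of_mem_jumpSet h, saw_of_mem_jumpSet (neg_mem_jumpSet h)]
  · rw [saw_neg h]
    unfold green
    rw [← cos_neg]
    congr 2
    ring

/-- κ is even about each jump point, so `deriv` equals its own negative there, whether or not κ is
differentiable. The value is used only to bound the field at jump phases. -/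
theorem kappaPsi_of_mem_jumpSet (hΩ : 0 < S.Ω) {ψ : ℝ} (hψ : ψ ∈ jumpSet) (J : ℝ) :
    S.kappaPsi ψ J = 0 := by
  obtain ⟨k, rfl⟩ := hψ
  have he : (fun s => S.kappa s J) = fun s => S.kappa (2 * π * ((2 * k : ℤ) : ℝ) - s) J := by
    funext s
    rw [← kappa_neg hΩ, kappa_eq hΩ, kappa_eq hΩ, sub_eq_neg_add, saw_add_period]
  have h1 : S.kappaPsi (2 * π * (k : ℝ)) J = -S.kappaPsi (2 * π * (k : ℝ)) J := by
    have h2 := deriv_comp_const_sub (fun s => S.kappa s J) (2 * π * ((2 * k : ℤ) : ℝ)) (2 * π * (k : ℝ))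
    rw [← he, show 2 * π * ((2 * k : ℤ) : ℝ) - 2 * π * (k : ℝ) = 2 * π * (k : ℝ) by
      push_cast; ring] at h2
    exact h2
  simp only
  linarith

theorem deriv_mul_kappa (hΩ : 0 < S.Ω) (ψ : ℝ) {J : ℝ} (hJ : 0 < J) :
    deriv (fun I => -I * S.kappa ψ I) J = -S.greenJ (saw ψ) J := by
  have e : (fun I => -I * S.kappa ψ I) = fun I => -(I * S.green (saw ψ) I) := by
    funext I; rw [kappa_eq hΩ]; ring
  rw [e]
  exact (hasDerivAt_partialJ (contDiffOn_mul_green hΩ) (saw ψ) hJ).fun_neg.deriv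

end ImpactOscillator

namespace PhaseSystem

/-- The system whose averaged force is the averaged phase shift of the given one. -/
def phaseShift (S : PhaseSystem) : PhaseSystem := { S with H₁ := S.M₁, H₀ := S.M₀ }

theorem Regular.phaseShift {S : PhaseSystem} (h : S.Regular) : S.phaseShift.Regular :=
  ⟨h.c_pos, h.Jr_pos, h.Ts_pos, h.fast, h.hP, h.hQ, h.hR, h.hη, h.hM₁, h.hM₀, h.hM₁, h.hM₀, h.hΘ,
    h.Θ_Jr⟩

end PhaseSystem

/-! ### The impulse-phase equations as a phase system -/

namespace ImpactOscillator

variable (S : ImpactOscillator)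

/-- A resonance with admissible parameters. -/
structure IsResonant : Prop where
  Ω_pos : 0 < S.Ω
  ν_pos : 0 < S.ν
  p_pos : 0 < S.p
  q_pos : 0 < S.q
  J_pos : 0 < S.Jr
  res : S.omega S.Jr = (S.q : ℝ) / (S.p : ℝ) * S.ν

/-- Coefficients of a harmonic force with slowly varying amplitudes. -/
structure IsForce (T : ℝ) (P Q R : ℝ → ℝ) : Prop where
  T_pos : 0 < T
  hP : IsSlow T P
  hQ : IsSlow T Q
  hR : IsSlow T R
  eq : ∀ t τ, S.f t τ = P τ * sin (S.ν * t) + Q τ * cos (S.ν * t) + R τ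

/-- The resonant frequency. -/
def freq : ℝ := (S.q : ℝ) / (S.p : ℝ) * S.ν

/-- The impulse-phase equations with the phase as independent variable. -/
def system (T : ℝ) (P Q R η : ℝ → ℝ) : PhaseSystem where
  c := S.freq⁻¹
  lam := (S.p : ℝ) / (S.q : ℝ)
  Jr := S.Jr
  Tf := 2 * π * (S.q : ℤ)
  Ts := T
  P := P
  Q := Q
  R := R
  η := η
  H₁ x J := -4 * S.greenX x J
  H₀ x J := -4 * S.γ * (J * S.omega J * S.greenX x J ^ 2)
  M₁ x J := 4 * (J⁻¹ * S.greenJ x J)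
  M₀ x J := 4 * S.γ * (S.omega J * S.greenX x J * S.greenJ x J)
  Θ J := 1 - S.freq / S.omega J

variable {S} {T : ℝ} {P Q R η : ℝ → ℝ}

theorem IsResonant.freq_pos (h : S.IsResonant) : 0 < S.freq := by
  have h1 : (0 : ℝ) < S.p := by exact_mod_cast h.p_pos
  have h2 : (0 : ℝ) < S.q := by exact_mod_cast h.q_pos
  have h3 := h.ν_pos
  unfold freq
  positivity

theorem IsResonant.system_regular (h : S.IsResonant) (hf : S.IsForce T P Q R) (hη : IsSlow T η) :
    (S.system T P Q R η).Regular where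
  c_pos := inv_pos.2 h.freq_pos
  Jr_pos := h.J_pos
  Ts_pos := hf.T_pos
  fast := by
    have h2 : (0 : ℝ) < S.q := by exact_mod_cast h.q_pos
    refine ⟨S.q, S.p, by exact_mod_cast h.q_pos, rfl, ?_⟩
    simp only [system, Int.cast_natCast]
    field_simp
  hP := hf.hP
  hQ := hf.hQ
  hR := hf.hR
  hη := hη
  hH₁ := contDiffOn_const.mul (contDiffOn_greenX h.Ω_pos)
  hH₀ := contDiffOn_const.mul ((contDiffOn_snd.mul (contDiffOn_omega h.Ω_pos)).mul
    ((contDiffOn_greenX h.Ω_pos).pow 2))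
  hM₁ := contDiffOn_const.mul ((contDiffOn_snd.inv fun _ hp => (ne_of_gt hp.2)).mul
    (contDiffOn_greenJ h.Ω_pos))
  hM₀ := contDiffOn_const.mul (((contDiffOn_omega h.Ω_pos).mul (contDiffOn_greenX h.Ω_pos)).mul
    (contDiffOn_greenJ h.Ω_pos))
  hΘ := contDiffOn_const.sub (contDiffOn_const.div (contDiffOn_omega h.Ω_pos)
    fun _ hp => (omega_pos h.Ω_pos hp.2).ne')
  Θ_Jr := by
    have h1 := h.freq_pos.ne'
    simp only [system]
    rw [h.res, ← freq, div_self h1, sub_self]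

theorem phase_eq (t φ : ℝ) : S.phase t φ = φ + S.freq * t := rfl

/-- Resonance turns νt into (p/q)(ψ − φ). -/
theorem IsForce.force_eq (h : S.IsResonant) (hf : S.IsForce T P Q R) (t τ φ : ℝ) :
    (S.system T P Q R η).force (S.phase t φ) τ φ = S.f t τ := by
  have h1 : (S.p : ℝ) ≠ 0 := by exact_mod_cast h.p_pos.ne'
  have h2 : (S.q : ℝ) ≠ 0 := by exact_mod_cast h.q_pos.ne'
  have e : (S.p : ℝ) / S.q * (S.phase t φ - φ) = S.ν * t := by
    unfold phase; field_simp; ring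
  rw [hf.eq]
  simp only [PhaseSystem.force, system, e]

theorem IsForce.F_eq (h : S.IsResonant) (hf : S.IsForce T P Q R) {t τ φ : ℝ}
    (hs : S.phase t φ ∉ jumpSet) (J : ℝ) :
    S.F t τ φ J = S.omega J * ((S.system T P Q R η).H₁ (saw (S.phase t φ)) J
      * (S.system T P Q R η).force (S.phase t φ) τ φ
      + (S.system T P Q R η).H₀ (saw (S.phase t φ)) J) := by
  rw [hf.force_eq h, F, force, kappaPsi_eq h.Ω_pos hs]
  simp only [system]
  ring

theorem IsForce.G_eq (h : S.IsResonant) (hf : S.IsForce T P Q R) {t τ φ : ℝ}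
    (hs : S.phase t φ ∉ jumpSet) {J : ℝ} (hJ : 0 < J) :
    S.G t τ φ J = S.omega J * ((S.system T P Q R η).M₁ (saw (S.phase t φ)) J
      * (S.system T P Q R η).force (S.phase t φ) τ φ
      + (S.system T P Q R η).M₀ (saw (S.phase t φ)) J) := by
  rw [hf.force_eq h, G, force, kappaPsi_eq h.Ω_pos hs, deriv_mul_kappa h.Ω_pos _ hJ]
  simp only [system]
  field_simp

theorem IsForce.G_eq_of_mem_jumpSet (h : S.IsResonant) (hf : S.IsForce T P Q R) {t τ φ : ℝ}
    (hs : S.phase t φ ∈ jumpSet) {J : ℝ} (hJ : 0 < J) :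
    S.G t τ φ J = S.omega J * ((S.system T P Q R η).M₁ (saw (S.phase t φ)) J
      * (S.system T P Q R η).force (S.phase t φ) τ φ) := by
  rw [hf.force_eq h, G, force, kappaPsi_of_mem_jumpSet h.Ω_pos hs, deriv_mul_kappa h.Ω_pos _ hJ]
  simp only [system]
  ring

theorem system_ph (t : ℝ) (w : ℝ × ℝ) : (S.system T P Q R η).ph t w = S.phase t w.2 := by
  rw [phase_eq]
  simp only [PhaseSystem.ph, system, div_inv_eq_mul]
  ring

theorem IsResonant.system_u (h : S.IsResonant) (μ t : ℝ) (w : ℝ × ℝ) :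
    (S.system T P Q R η).u μ (S.phase t w.2) w
      = (S.system T P Q R η).force (S.phase t w.2) (μ ^ 2 * t) w.2 := by
  have h1 := h.freq_pos.ne'
  have e : μ ^ 2 * S.freq⁻¹ * (S.phase t w.2 - w.2) = μ ^ 2 * t := by
    rw [phase_eq]; field_simp; ring
  unfold PhaseSystem.u
  rw [show (S.system T P Q R η).c = S.freq⁻¹ from rfl, e]

/-- The impulse-phase equations are represented by the system in the phase variable. -/
theorem IsForce.exists_timeField (h : S.IsResonant) (hf : S.IsForce T P Q R) (hη : IsSlow T η)
    {K : ℝ} (hK : 0 ≤ K) : ∃ μ₀ > 0, ∀ μ, 0 < μ → μ < μ₀ →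
      (S.system T P Q R η).TimeField K μ (S.field (μ ^ 2)) := by
  have hreg := h.system_regular hf hη
  set Y := S.system T P Q R η with hY
  obtain ⟨μ₁, hμ₁, hstrip⟩ := PhaseSystem.exists_stripRegular hreg hK
  obtain ⟨C, hC⟩ := PhaseSystem.exists_stripBound hreg
  have hC0 := hC.pos
  have hJ := h.J_pos
  have hω := h.freq_pos
  refine ⟨min (min 1 μ₁) (min (S.Jr / (2 * (K + 1))) (min (1 / (4 * (C * C + C)))
    (1 / (4 * (C * K + 1))))), by positivity, fun μ hμ hμ' => ?_⟩
  simp only [lt_min_iff] at hμ'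
  obtain ⟨⟨l₁, l₂⟩, l₃, l₄, l₅⟩ := hμ'
  have hμμ : μ ^ 2 ≤ μ := by nlinarith
  rw [lt_div_iff₀ (by positivity)] at l₃ l₄ l₅
  have hJ' : K * μ ^ 2 ≤ S.Jr / 2 := by nlinarith
  have hG' : μ ^ 2 * (C * C + C) ≤ 1 / 4 := by nlinarith [(by positivity : 0 < C * C + C)]
  have hΘ' : C * (K * μ ^ 2) ≤ 1 / 4 := by nlinarith [mul_nonneg hC0.le hK]
  have hst := hstrip μ hμ l₂
  have hsq : √(μ ^ 2) = μ := sqrt_sq hμ.le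
  refine ⟨fun t w hw hs => ?_, fun t w hw => ?_⟩
  · rw [system_ph] at hs ⊢
    have hJp : 0 < S.Jr + μ * w.1 := hst.J_pos w hw
    have hG := hst.G_ne (S.phase t w.2) w hw
    have hωJ := omega_pos h.Ω_pos hJp
    have hFA : S.F t (μ ^ 2 * t) w.2 (S.Jr + μ * w.1)
        = S.omega (S.Jr + μ * w.1) * Y.A μ (S.phase t w.2) w := by
      rw [hf.F_eq h hs (η := η), PhaseSystem.A, h.system_u]; rfl
    have hGG : S.G t (μ ^ 2 * t) w.2 (S.Jr + μ * w.1)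
        = S.omega (S.Jr + μ * w.1) * Y.G μ (S.phase t w.2) w := by
      rw [hf.G_eq h hs hJp (η := η), PhaseSystem.G, h.system_u]; rfl
    have hV1 : 1 - (Y.V μ (S.phase t w.2) w).2 = S.freq / S.omega (S.Jr + μ * w.1)
        / (1 + μ ^ 2 * Y.G μ (S.phase t w.2) w) := by
      simp only [PhaseSystem.V, sub_sub_cancel]
      simp [hY, system]
    -- This is dψ/dt; multiplying by it converts derivatives in the phase into derivatives in time.
    have hcV : (Y.c * (1 - (Y.V μ (S.phase t w.2) w).2))⁻¹
        = S.omega (S.Jr + μ * w.1) * (1 + μ ^ 2 * Y.G μ (S.phase t w.2) w) := by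
      rw [hV1, show Y.c = S.freq⁻¹ from rfl]
      field_simp
    rw [hcV]
    unfold field
    rw [hsq, hFA, hGG]
    refine Prod.ext ?_ ?_
    · simp only [PhaseSystem.V, Prod.smul_fst, smul_eq_mul]
      field_simp
    · have h2 : (Y.V μ (S.phase t w.2) w).2 = 1 - S.freq / S.omega (S.Jr + μ * w.1)
        / (1 + μ ^ 2 * Y.G μ (S.phase t w.2) w) := by linarith
      simp only [Prod.smul_snd, smul_eq_mul]
      rw [h2, ← freq]
      field_simp
      ring
  · have hd : |S.Jr + μ * w.1 - S.Jr| ≤ K * μ ^ 2 := by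
      rw [add_sub_cancel_left, abs_mul, abs_of_pos hμ]
      nlinarith
    have hd' := hd.trans hJ'
    have hJp : 0 < S.Jr + μ * w.1 := hst.J_pos w hw
    have hωJ := omega_pos h.Ω_pos hJp
    have h1 := abs_le.1 (((hC.Θ _ hd').trans (mul_le_mul_of_nonneg_left hd hC0.le)).trans hΘ')
    -- With 1 + μ²g ≥ 3/4 below, dψ/dt is at least 3/5 of the resonant frequency, more than the half
    -- required.
    have h2 : 4 / 5 * S.freq ≤ S.omega (S.Jr + μ * w.1) := by
      have h3 : -(1 / 4) ≤ 1 - S.freq / S.omega (S.Jr + μ * w.1) := h1.1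
      have h4 : S.freq / S.omega (S.Jr + μ * w.1) ≤ 5 / 4 := by linarith
      rw [div_le_iff₀ hωJ] at h4
      linarith
    have hM : ∀ s, |Y.M₁ (saw s) (S.Jr + μ * w.1) * Y.force s (μ ^ 2 * t) w.2| ≤ C * C := fun s => by
      rw [abs_mul]
      exact mul_le_mul (hC.M₁ _ _ hd') (hC.force _ _ _) (abs_nonneg _) hC0.le
    have hb : ∃ g, S.G t (μ ^ 2 * t) w.2 (S.Jr + μ * w.1) = S.omega (S.Jr + μ * w.1) * g ∧
        |g| ≤ C * C + C := by
      by_cases hs : S.phase t w.2 ∈ jumpSet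
      · exact ⟨_, hf.G_eq_of_mem_jumpSet h hs hJp (η := η), (hM _).trans (by linarith)⟩
      · exact ⟨_, hf.G_eq h hs hJp (η := η),
          (abs_add_le _ _).trans (add_le_add (hM _) (hC.M₀ _ _ hd'))⟩
    obtain ⟨g, hg, hgb⟩ := hb
    have h5 : |μ ^ 2 * g| ≤ 1 / 4 := by
      rw [abs_mul, abs_of_nonneg (sq_nonneg μ)]
      exact (mul_le_mul_of_nonneg_left hgb (sq_nonneg μ)).trans hG'
    have h6 := (abs_le.1 h5).1
    rw [show Y.c = S.freq⁻¹ from rfl, inv_inv, mul_inv, inv_inv]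
    have h7 := mul_le_mul_of_nonneg_left h6 hωJ.le
    simp only [field, hsq, hg]
    rw [← freq]
    linarith

end ImpactOscillator

/-! ### Identification of the averaged quantities -/

theorem PhaseSystem.isFast_force {S : PhaseSystem} (hS : S.Regular) (σ φ : ℝ) :
    IsFast S.Tf fun s => S.force s σ φ := by
  simp only [PhaseSystem.force_eq]
  exact ((hS.isFast_sin.mul (IsFast.const _)).add (hS.isFast_cos.mul (IsFast.const _))).add
    (IsFast.const _)

namespace ImpactOscillator

variable {S : ImpactOscillator} {T : ℝ} {P Q R η : ℝ → ℝ}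

/-- The substitution ψ = φ + (q/p)νt maps the time period 2πp/ν to q full turns of the phase. The
jump times form a null set, and periodicity removes the offset φ. -/
theorem IsResonant.meanT_eq (h : S.IsResonant) {φ : ℝ} {g e : ℝ → ℝ}
    (he : Function.Periodic e (2 * π * (S.q : ℤ)))
    (heq : ∀ t, S.phase t φ ∉ jumpSet → g t = e (S.phase t φ)) :
    S.meanT g = fastMean (2 * π * (S.q : ℤ)) e := by
  have h1 : (0 : ℝ) < S.p := by exact_mod_cast h.p_pos
  have h2 : (0 : ℝ) < S.q := by exact_mod_cast h.q_pos
  have h3 := h.ν_pos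
  have hω := h.freq_pos
  have hinj : Function.Injective fun t => S.phase t φ := fun a b hab => by
    simp only [phase_eq, add_right_inj] at hab
    exact mul_left_cancel₀ hω.ne' hab
  have hae : ∀ᵐ t, t ∈ Set.uIoc 0 (2 * π * S.p / S.ν) → g t = e (φ + S.freq * t) := by
    filter_upwards [(countable_jumpSet.preimage_of_injOn hinj.injOn).ae_notMem volume] with t ht _
    exact heq t ht
  have hend : φ + S.freq * (2 * π * S.p / S.ν) = φ + 2 * π * (S.q : ℤ) := by
    unfold freq
    push_cast
    field_simp
  unfold meanT fastMean
  rw [intervalIntegral.integral_congr_ae hae, intervalIntegral.integral_comp_add_mul e hω.ne', hend,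
    mul_zero, add_zero, he.intervalIntegral_add_eq φ 0, zero_add, smul_eq_mul, ← mul_assoc]
  congr 1
  unfold freq
  push_cast
  field_simp

theorem IsForce.f₀_eq (h : S.IsResonant) (hf : S.IsForce T P Q R) (hη : IsSlow T η) (φ σ : ℝ) :
    S.f₀ φ σ = S.freq * (S.system T P Q R η).avg σ φ := by
  have hreg := h.system_regular hf hη
  have hfast := (IsFast.const S.freq).mul (((hreg.isFast hreg.hH₁).mul
    (PhaseSystem.isFast_force hreg σ φ)).add (hreg.isFast hreg.hH₀))
  rw [PhaseSystem.avg, ← fastMean_const_mul]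
  refine h.meanT_eq (φ := φ) hfast.periodic fun t ht => ?_
  rw [F₀, hf.F_eq h ht (η := η), h.res]
  rfl

theorem IsForce.g₀_eq (h : S.IsResonant) (hf : S.IsForce T P Q R) (hη : IsSlow T η) (φ σ : ℝ) :
    S.g₀ φ σ = S.freq * (S.system T P Q R η).phaseShift.avg σ φ := by
  have hreg := h.system_regular hf hη
  have hfast := (IsFast.const S.freq).mul (((hreg.isFast hreg.hM₁).mul
    (PhaseSystem.isFast_force hreg σ φ)).add (hreg.isFast hreg.hM₀))
  rw [PhaseSystem.avg, ← fastMean_const_mul]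
  refine h.meanT_eq (φ := φ) hfast.periodic fun t ht => ?_
  rw [G₀, hf.G_eq h ht h.J_pos (η := η), h.res]
  rfl

theorem hasDerivAt_omega (h : S.IsResonant) : HasDerivAt S.omega S.d S.Jr := by
  have h1 := hasDerivAt_partialJ (H := fun _ J => S.omega J) (contDiffOn_omega h.Ω_pos) 0 h.J_pos
  exact h1.differentiableAt.hasDerivAt

/-- F is ω(J) times a coefficient of the phase system, so the product rule adds ω' times the
averaged force. That term vanishes at a root of f₀. -/
theorem IsForce.f₁_eq (h : S.IsResonant) (hf : S.IsForce T P Q R) (hη : IsSlow T η) (σ : ℝ) :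
    S.f₁ (η σ) σ = S.d * (S.system T P Q R η).avg σ (η σ)
      + S.freq * (S.system T P Q R η).mean (S.system T P Q R η).B σ := by
  have hreg := h.system_regular hf hη
  set Y := S.system T P Q R η with hY
  have hforce := PhaseSystem.isFast_force hreg σ (η σ)
  have hA := (IsFast.const S.d).mul (((hreg.isFast hreg.hH₁).mul hforce).add (hreg.isFast hreg.hH₀))
  have hB := (IsFast.const S.freq).mul (((hreg.isFast (contDiffOn_partialJ hreg.hH₁)).mul hforce).add
    (hreg.isFast (contDiffOn_partialJ hreg.hH₀)))
  rw [PhaseSystem.avg, PhaseSystem.mean, ← fastMean_const_mul, ← fastMean_const_mul]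
  refine Eq.trans ?_ (fastMean_add hA hB)
  refine h.meanT_eq (φ := η σ) (hA.add hB).periodic fun t ht => ?_
  have e : (fun J => S.F t σ (η σ) J) = fun J => S.omega J * (Y.H₁ (saw (S.phase t (η σ))) J
      * Y.force (S.phase t (η σ)) σ (η σ) + Y.H₀ (saw (S.phase t (η σ))) J) :=
    funext fun J => hf.F_eq h ht J
  rw [F₁, e]
  have d₁ := hasDerivAt_partialJ hreg.hH₁ (saw (S.phase t (η σ))) h.J_pos
  have d₀ := hasDerivAt_partialJ hreg.hH₀ (saw (S.phase t (η σ))) h.J_pos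
  refine (((hasDerivAt_omega h).fun_mul ((d₁.mul_const _).fun_add d₀)).congr_deriv ?_).deriv
  rw [h.res]
  rfl

theorem IsForce.hasDerivAt_f₀ (h : S.IsResonant) (hf : S.IsForce T P Q R) (hη : IsSlow T η) (σ : ℝ) :
    HasDerivAt (fun φ => S.f₀ φ σ)
      (S.freq * (S.system T P Q R η).mean (S.system T P Q R η).A' σ) (η σ) := by
  simp only [hf.f₀_eq h hη]
  exact (PhaseSystem.hasDerivAt_avg (h.system_regular hf hη) σ).const_mul _

theorem IsForce.a_eq (h : S.IsResonant) (hf : S.IsForce T P Q R) (hη : IsSlow T η) (σ : ℝ) :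
    S.a η σ = S.freq * (S.system T P Q R η).mean (S.system T P Q R η).A' σ :=
  (hf.hasDerivAt_f₀ h hη σ).deriv

/-- The formula for the φ-derivative of `avg` is applied to `phaseShift`, whose `A'` is the `E` of
the original system. -/
theorem IsForce.e_eq (h : S.IsResonant) (hf : S.IsForce T P Q R) (hη : IsSlow T η) (σ : ℝ) :
    S.e η σ = S.freq * (S.system T P Q R η).mean (S.system T P Q R η).E σ := by
  unfold e
  simp only [hf.g₀_eq h hη]
  exact ((PhaseSystem.hasDerivAt_avg (h.system_regular hf hη).phaseShift σ).const_mul _).deriv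

theorem IsForce.d_eq (h : S.IsResonant) (hf : S.IsForce T P Q R) (hη : IsSlow T η) :
    (S.system T P Q R η).d = S.d / S.freq := by
  have hreg := h.system_regular hf hη
  have h1 := hasDerivAt_partialJ hreg.hΘ 0 h.J_pos
  have hω : S.omega S.Jr ≠ 0 := (omega_pos h.Ω_pos h.J_pos).ne'
  have h2 : HasDerivAt (fun J => 1 - S.freq / S.omega J) (S.d / S.freq) S.Jr := by
    refine (((hasDerivAt_const S.Jr S.freq).fun_div (hasDerivAt_omega h) hω).const_sub 1).congr_deriv ?_
    have hfreq := h.freq_pos.ne'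
    rw [h.res, ← freq]
    field_simp
    ring
  exact h1.unique h2

/-- A continuous root of the averaged equation is smooth. -/
theorem IsForce.isSlow_root (h : S.IsResonant) (hf : S.IsForce T P Q R) (hc : Continuous η)
    (hper : Function.Periodic η T) (hzero : ∀ σ, S.f₀ (η σ) σ = 0) (hne : ∀ σ, S.a η σ ≠ 0) :
    IsSlow T η := by
  have hω := h.freq_pos
  refine ⟨?_, hper⟩
  have hg : ContDiff ℝ ∞ fun p : ℝ × ℝ => S.f₀ p.2 p.1 := by
    -- The averaged force does not involve the field η of the system, so a constant may fill it
    -- while smoothness of the root is still unknown.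
    simp only [hf.f₀_eq h (IsSlow.const 0)]
    exact contDiff_const.mul (PhaseSystem.contDiff_avg (h.system_regular hf (IsSlow.const 0)))
  refine contDiff_of_root hg hc hzero (g' := fun σ => S.a η σ) (fun σ => ?_) hne
  exact (hf.hasDerivAt_f₀ h (IsSlow.const (η σ)) σ).differentiableAt.hasDerivAt

theorem IsForce.system_elliptic (h : S.IsResonant) (hf : S.IsForce T P Q R) (hη : IsSlow T η)
    (hzero : ∀ σ, S.f₀ (η σ) σ = 0) (hell : ∀ σ, S.a η σ * S.d < 0) :
    (S.system T P Q R η).Elliptic where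
  toRegular := h.system_regular hf hη
  mean_A₀ := fun σ => by
    have := hzero σ
    rw [hf.f₀_eq h hη] at this
    exact (mul_eq_zero.1 this).resolve_left h.freq_pos.ne'
  ell := fun σ => by
    have h1 := hell σ
    have hω := h.freq_pos
    rw [hf.a_eq h hη] at h1
    rw [hf.d_eq h hη]
    have e : (S.system T P Q R η).mean (S.system T P Q R η).A' σ * (S.d / S.freq)
        = S.freq * (S.system T P Q R η).mean (S.system T P Q R η).A' σ * S.d / S.freq ^ 2 := by
      field_simp
    rw [e]
    exact div_neg_of_neg_of_pos h1 (by positivity)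

/-- The factor is the change of unit from time to phase; in particular the rate has the sign of ⟨b +
e⟩. -/
theorem IsForce.rate_eq (h : S.IsResonant) {Γ : ℝ} (hf : S.IsForce (2 * π / Γ) P Q R)
    (hη : IsSlow (2 * π / Γ) η) (hzero : ∀ σ, S.f₀ (η σ) σ = 0) :
    (S.system (2 * π / Γ) P Q R η).rate
      = S.freq⁻¹ * periodMean Γ fun τ => S.b η τ + S.e η τ := by
  have hω := h.freq_pos.ne'
  have e : (fun τ => S.b η τ + S.e η τ) = fun τ => S.freq *
      ((S.system (2 * π / Γ) P Q R η).mean (S.system (2 * π / Γ) P Q R η).B τ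
        + (S.system (2 * π / Γ) P Q R η).mean (S.system (2 * π / Γ) P Q R η).E τ) := by
    funext τ
    have h0 : (S.system (2 * π / Γ) P Q R η).avg τ (η τ) = 0 := by
      have := hzero τ
      rw [hf.f₀_eq h hη] at this
      exact (mul_eq_zero.1 this).resolve_left hω
    rw [b, hf.f₁_eq h hη, hf.e_eq h hη, h0]
    ring
  rw [e, periodMean, intervalIntegral.integral_const_mul, PhaseSystem.rate, fastMean,
    show (S.system (2 * π / Γ) P Q R η).Ts = 2 * π / Γ from rfl, inv_div]
  field_simp

end ImpactOscillator

end

/-! ### The theorem for the impact oscillator -/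

theorem theorem2 (S : ImpactOscillator) (Γ : ℝ) (η₀ : ℝ → ℝ) (σ₁ : ℝ)
    (hΩ : 0 < S.Ω) (hν : 0 < S.ν) (hΓ : 0 < Γ) (hJ : 0 < S.Jr)
    (hp : 0 < S.p) (hq : 0 < S.q) (hpq : Nat.Coprime S.p S.q)
    (hf : IsBiharmonic S.ν Γ S.f)
    (hres : S.omega S.Jr = (S.q : ℝ) / (S.p : ℝ) * S.ν)
    (hnondeg : deriv S.omega S.Jr ≠ 0)
    (hη_cont : Continuous η₀) (hη_per : Function.Periodic η₀ (2 * Real.pi / Γ))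
    (hη_range : ∀ τ, 0 < η₀ τ ∧ η₀ τ < 2 * Real.pi)
    (hη_zero : ∀ τ, S.f₀ (η₀ τ) τ = 0)
    (hσ : σ₁ < 0) (hell : ∀ τ, S.a η₀ τ * S.d < σ₁)
    (hmean : periodMean Γ (fun τ => S.b η₀ τ + S.e η₀ τ) ≠ 0) :
    ∃ δ > 0, ∃ K₀ > 0, ∀ K ≥ K₀, ∃ ε₀ > 0, ∀ ε : ℝ, 0 < ε → ε < ε₀ →
      ∃ w : ℝ → ℝ × ℝ,
        (IsSolutionOn (S.field ε) w Set.univ ∧ IsAlmostPeriodic w ∧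
          StaysNear η₀ ε (K₀ * ε) (K₀ * √ε) w ∧ K₀ * √ε ≤ δ) ∧
        (∀ y : ℝ → ℝ × ℝ, IsSolutionOn (S.field ε) y Set.univ → IsAlmostPeriodic y →
          StaysNear η₀ ε (K * ε) δ y → y = w) ∧
        (periodMean Γ (fun τ => S.b η₀ τ + S.e η₀ τ) < 0 →
          IsAsymptoticallyStable (S.field ε) w) ∧
        (0 < periodMean Γ (fun τ => S.b η₀ τ + S.e η₀ τ) →
          ¬ IsLyapunovStable (S.field ε) w) := by
  obtain ⟨P, Q, R, hP, hQ, hR, hPQR⟩ := hf.exists_coeff hΓ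
  have hres' : S.IsResonant := ⟨hΩ, hν, hp, hq, hJ, hres⟩
  have hF : S.IsForce (2 * π / Γ) P Q R := ⟨by positivity, hP, hQ, hR, hPQR⟩
  have hell' : ∀ τ, S.a η₀ τ * S.d < 0 := fun τ => (hell τ).trans hσ
  have hη := hF.isSlow_root hres' hη_cont hη_per hη_zero
    fun τ h0 => by simpa [h0] using hell' τ
  have hrate := hF.rate_eq hres' hη hη_zero
  have hω := inv_pos.2 hres'.freq_pos
  obtain ⟨δ, hδ, K₀, hK₀, H⟩ := PhaseSystem.exists_almostPeriodic_solution
    (hF.system_elliptic hres' hη hη_zero hell') (by rw [hrate]; exact mul_ne_zero hω.ne' hmean)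
    (F := fun μ => S.field (μ ^ 2)) fun K hK => hF.exists_timeField hres' hη hK
  refine ⟨δ, hδ, K₀, hK₀, fun K hK => ?_⟩
  obtain ⟨μ₀, hμ₀, H⟩ := H K hK
  refine ⟨μ₀ ^ 2, by positivity, fun ε hε hε' => ?_⟩
  have hμ : 0 < √ε := sqrt_pos.2 hε
  have hsq : √ε ^ 2 = ε := sq_sqrt hε.le
  obtain ⟨w, ⟨h1, h2, h3, h4⟩, h5, h6, h7⟩ := H (√ε) hμ ((sqrt_lt' hμ₀).2 hε')
  simp only [hsq] at h1 h3 h5 h6 h7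
  rw [hrate] at h6 h7
  -- J − Jr = √ε·z, so a bound of order ε on the impulse is a bound of order μ = √ε on z.
  have hfst : ∀ (L z : ℝ), |√ε * z| ≤ L * ε ↔ |z| ≤ L * √ε := fun L z => by
    rw [abs_mul, abs_of_pos hμ, ← mul_le_mul_iff_right₀ hμ (b := |z|),
      show √ε * (L * √ε) = L * √ε ^ 2 by ring, hsq]
  refine ⟨w, ⟨h1, h2, fun t => ⟨(hfst _ _).2 (h3 t).1, (h3 t).2⟩, h4⟩,
    fun y hy _ hnear => h5 y hy fun t => ⟨(hfst _ _).1 (hnear t).1, (hnear t).2⟩,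
    fun h => h6 (mul_neg_of_pos_of_neg hω h), fun h => h7 (mul_pos hω h)⟩
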